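/- Let $k$ be a field of characteristic $0$. Let $X$ and $Y$ be toric varieties over $k$ with fans $\Sigma(X)$, $\Sigma(Y)$ in lattices $N(X)$, $N(Y)$, and let $\tilde f\colon Y\to X$ be a proper toric morphism given by a map of lattices $f_N\colon N(Y)\to N(X)$. For a cone $\delta$ let $N_\delta$ be the sublattice generated by its lattice points, and let $V_X(\delta)\subseteq X$ denote the closed stratum of $\delta$ (the closure of its torus orbit, with the reduced structure). Let $\tau\in\Sigma(Y)$, let $\tau'$ be the smallest cone of $\Sigma(X)$ containing $f_N(\tau)$, let $q\colon N(X)\to N(X)/N_{\tau'}$ be the quotient map, and let $f\colon V_Y(\tau)\to V_X(\tau')$ be the restriction of $\tilde f$. Let $N'$ be the saturation of $q(f_N(N(Y)))$ in $N(X)/N_{\tau'}$. Let $v\in N(X)$ be generic with respect to $(X,Y,V_Y(\tau))$: for every cone $\delta\supseteq\tau'$ of $\Sigma(X)$ whose image $q(\delta)$ has dimension $\operatorname{rk}(N(X)/N_{\tau'})-\operatorname{rk}N'$, the affine space $N'_{\mathbb R}+q(v)$ meets $q(\delta)$ in at most one point, and such a point lies in the relative interior of $q(\delta)$. Let $\Delta^\tau(v)$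 be the set of cones $\delta\in\Sigma(X)$ with $\tau'\subseteq\delta$, $\dim\delta=\operatorname{rk}N(X)-\operatorname{rk}f_N(N(Y))+\operatorname{rk}(f_N(N(Y))\cap N_{\tau'})$ and $(f_N(N(Y))_{\mathbb R}+v)\cap\delta\neq\emptyset$. For $\delta\in\Delta^\tau(v)$ put $m(\delta)=[N(X):f_N(N(Y))+N_\delta]$; this index is finite. (1) Put $l=\operatorname{rk}N(Y)-\dim\tau=\dim V_Y(\tau)$. If $f$ is generically finite onto its image, that is, if $\operatorname{rk}q(f_N(N(Y)))=l$, then in the Chow group $A_l(V_X(\tau'))$ $$f_*[V_Y(\tau)]=\sum_{\delta\in\Delta^\tau(v)}m(\delta)\,[V_X(\delta)].$$ Otherwise $f_*[V_Y(\tau)]=0$. (2) Let $N_Q\subseteq N(Y)$ be a sublattice of rank $r$, and let the torus $T_Q$ with cocharacter lattice $N_Q$ act on $Y$ through $N_Q\subseteq N(Y)$ and on $X$ through $f_N|_{N_Q}$. These actions restrict to actions of $T_Q$ on $V_Y(\tau)$ and $V_X(\tau')$, and $f$ is $T_Q$-equivariant. (3) The index $[N':q(f_N(N(Y)))]$ is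 finite and divides $m(\delta)$ for each $\delta\in\Delta^\tau(v)$. There is a $T_Q$-invariant closed subvariety $K\subseteq V_X(\tau')\times\mathbb P^1$ (with $T_Q$ acting trivially on $\mathbb P^1$), dominating $\mathbb P^1$, whose fibres over two distinct rational points of $\mathbb P^1$ have the cycles $$[f(V_Y(\tau))]\qquad\text{and}\qquad\sum_{\delta\in\Delta^\tau(v)}\frac{m(\delta)}{[N':q(f_N(N(Y)))]}\,[V_X(\delta)].$$ In other words, the closed substack $[K/T_Q]$ of $[V_X(\tau')/T_Q]\times\mathbb P^1$ induces a rational equivalence of $[f(V_Y(\tau))/T_Q]$ and $\sum_{\delta\in\Delta^\tau(v)}\frac{m(\delta)}{[N':q(f_N(N(Y)))]}[V_X(\delta)/T_Q]$. (4) Let $f_Q\colon[V_Y(\tau)/T_Q]\to[V_X(\tau')/T_Q]$ be the morphism of quotient stacks induced by $f$, and put $l_Q=\operatorname{rk}N(Y)-\dim\tau-r$. If $f$ is generically finite onto its image, then in the Chow group $A_{l_Q}([V_X(\tau')/T_Q])$ $$f_{Q*}[V_Y(\tau)/T_Q]=\sum_{\delta\in\Delta^\tau(v)}m(\delta)\,[V_X(\delta)/T_Q].$$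 Otherwise $f_{Q*}[V_Y(\tau)/T_Q]=0$. Here the Chow group $A_{l_Q}([V/T_Q])$ is the Chow group $A_{l_Q+rM}\big((V\times U)/T_Q\big)$ for $U=(\mathbb A^M\setminus 0)^r$ and $M$ large, where $T_Q\cong\mathbb G_m^r$ acts on the $i$-th factor of $U$ by its $i$-th coordinate; the formulas hold for every $M$. -/

import Mathlib

open CategoryTheory Limits MonoidalCategory CartesianMonoidalCategory AlgebraicGeometry
open scoped TensorProduct

universe u

noncomputable section

namespace Toric

section Lattice

variable {N N' : Type u} [AddCommGroup N] [AddCommGroup N']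

/-- The real vector space `N_ℝ = ℝ ⊗ N` of a lattice `N`. -/
abbrev RealSpace (N : Type u) [AddCommGroup N] : Type u := ℝ ⊗[ℤ] N

/-- The canonical map `N → N_ℝ`. -/
def toReal (N : Type u) [AddCommGroup N] : N →ₗ[ℤ] RealSpace N := TensorProduct.mk ℤ ℝ N 1

/-- The real extension `N_ℝ → N'_ℝ` of a map of lattices. -/
def realMap (f : N →ₗ[ℤ] N') : RealSpace N →ₗ[ℝ] RealSpace N' := f.baseChange ℝ

/-- The real extension `N_ℝ → ℝ` of an element of the dual lattice. -/
def pairing (m : Module.Dual ℤ N) : RealSpace N →ₗ[ℝ] ℝ := Module.Dual.baseChange ℝ m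

lemma pairing_add (a b : Module.Dual ℤ N) (x : RealSpace N) :
    pairing (a + b) x = pairing a x + pairing b x := by
  simp [pairing]

/-- `τ` is a face of `σ`: it is cut out of `σ` by an integral functional which is nonnegative
on `σ`. -/
def IsFace (τ σ : PointedCone ℝ (RealSpace N)) : Prop :=
  ∃ m : Module.Dual ℤ N, (∀ x ∈ σ, 0 ≤ pairing m x) ∧ ∀ x, x ∈ τ ↔ x ∈ σ ∧ pairing m x = 0

/-- The monoid `σ^∨ ∩ M`, where `M` is the lattice dual to `N`. -/
def dualMonoid (σ : PointedCone ℝ (RealSpace N)) : AddSubmonoid (Module.Dual ℤ N) where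
  carrier := {m | ∀ x ∈ σ, 0 ≤ pairing m x}
  zero_mem' := by intro x _; simp [pairing]
  add_mem' := by
    intro a b ha hb x hx
    rw [pairing_add]
    exact add_nonneg (ha x hx) (hb x hx)

/-- The sublattice `N_σ` of `N` generated by the lattice points of the cone `σ`. -/
def coneLattice (σ : PointedCone ℝ (RealSpace N)) : Submodule ℤ N :=
  Submodule.span ℤ {n | toReal N n ∈ σ}

/-- The real subspace `L_ℝ ⊆ N_ℝ` spanned by a subgroup `L ⊆ N`. -/
def realSpan (L : Submodule ℤ N) : Submodule ℝ (RealSpace N) :=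
  Submodule.span ℝ (toReal N '' L)

/-- The saturation of a subgroup: all elements of which a nonzero multiple lies in it. -/
def saturation (L : Submodule ℤ N) : Submodule ℤ N :=
  (Submodule.torsion ℤ (N ⧸ L)).comap L.mkQ

/-- The relative interior of a cone: from such a point one can move a little away from any point
of the cone without leaving the cone. -/
def relInterior (σ : PointedCone ℝ (RealSpace N)) : Set (RealSpace N) :=
  {x | x ∈ σ ∧ ∀ y ∈ σ, ∃ ε : ℝ, 0 < ε ∧ x - ε • y ∈ σ}

/-- A fan in a lattice `N`: a finite set of rational polyhedral strongly convex cones, closed under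
taking faces, any two of which meet along a common face. -/
structure Fan (N : Type u) [AddCommGroup N] where
  cones : Set (PointedCone ℝ (RealSpace N))
  finite : cones.Finite
  rational : ∀ σ ∈ cones, ∃ s : Set N, s.Finite ∧ σ = PointedCone.hull ℝ (toReal N '' s)
  stronglyConvex : ∀ σ ∈ cones, ∀ x ∈ σ, -x ∈ σ → x = 0
  face_mem : ∀ σ ∈ cones, ∀ τ, IsFace τ σ → τ ∈ cones
  inf_isFace : ∀ σ ∈ cones, ∀ τ ∈ cones, IsFace (σ ⊓ τ) σ

lemma pairing_neg (a : Module.Dual ℤ N) (x : RealSpace N) :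
    pairing (-a) x = - pairing a x := by
  simp [pairing]

lemma pairing_nsmul (n : ℕ) (a : Module.Dual ℤ N) (x : RealSpace N) :
    pairing (n • a) x = n * pairing a x := by
  induction n with
  | zero => simp [pairing]
  | succ n ih => rw [succ_nsmul, pairing_add, ih]; push_cast; ring

lemma pairing_comp (f : N →ₗ[ℤ] N') (m : Module.Dual ℤ N') (x : RealSpace N) :
    pairing (m ∘ₗ f) x = pairing m (realMap f x) := by
  induction x using TensorProduct.induction_on with
  | zero => simp
  | tmul r n => simp [pairing, realMap]
  | add x y hx hy => rw [map_add, hx, hy, map_add, map_add]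

lemma dualMonoid_anti {τ σ : PointedCone ℝ (RealSpace N)} (h : τ ≤ σ) :
    dualMonoid σ ≤ dualMonoid τ := fun _ hm x hx => hm x (h hx)

/-- If `τ = σ ∩ m^⊥`, then every element of `τ^∨ ∩ M` lies in `σ^∨ ∩ M` after adding a multiple
of `m`. -/
lemma exists_add_nsmul_mem {τ σ : PointedCone ℝ (RealSpace N)}
    (hσ : ∃ s : Set N, s.Finite ∧ σ = PointedCone.hull ℝ (toReal N '' s))
    {m : Module.Dual ℤ N} (hm : ∀ x ∈ σ, 0 ≤ pairing m x)
    (hτ : ∀ x, x ∈ τ ↔ x ∈ σ ∧ pairing m x = 0)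
    {a : Module.Dual ℤ N} (ha : a ∈ dualMonoid τ) : ∃ n : ℕ, a + n • m ∈ dualMonoid σ := by
  obtain ⟨s, hs, rfl⟩ := hσ
  have key : ∀ x ∈ s, ∃ n : ℕ, ∀ k : ℕ, n ≤ k → 0 ≤ pairing (a + k • m) (toReal N x) := by
    intro x hx
    have hxσ : toReal N x ∈ PointedCone.hull ℝ (toReal N '' s) :=
      PointedCone.subset_hull ⟨x, hx, rfl⟩
    rcases (hm _ hxσ).eq_or_lt with h0 | hpos
    · refine ⟨0, fun k _ => ?_⟩
      rw [pairing_add, pairing_nsmul, ← h0, mul_zero, add_zero]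
      exact ha _ ((hτ _).2 ⟨hxσ, h0.symm⟩)
    · obtain ⟨n, hn⟩ := exists_nat_ge (-(pairing a (toReal N x)) / pairing m (toReal N x))
      refine ⟨n, fun k hk => ?_⟩
      rw [pairing_add, pairing_nsmul]
      rw [div_le_iff₀ hpos] at hn
      have : (n : ℝ) * pairing m (toReal N x) ≤ k * pairing m (toReal N x) := by
        gcongr
      linarith
  choose! n hn using key
  obtain ⟨B, hB⟩ := (hs.image n).bddAbove
  refine ⟨B, fun x hx => ?_⟩
  induction hx using Submodule.span_induction with
  | mem y hy =>
    obtain ⟨z, hz, rfl⟩ := hy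
    exact hn z hz B (hB ⟨z, hz, rfl⟩)
  | zero => simp
  | add y z _ _ hy hz => rw [map_add]; exact add_nonneg hy hz
  | smul c y _ hy =>
    have : c • y = (c : ℝ) • y := rfl
    rw [this, map_smul]
    exact smul_nonneg c.2 hy

end Lattice

section Affine

variable {N N' : Type u} [AddCommGroup N] [AddCommGroup N'] (k : Type u) [Field k]

/-- The coordinate ring `k[σ^∨ ∩ M]` of the affine toric variety `U_σ`. -/
abbrev ConeRing (σ : PointedCone ℝ (RealSpace N)) : Type u := AddMonoidAlgebra k (dualMonoid σ)

/-- The restriction map `k[σ^∨ ∩ M] → k[τ^∨ ∩ M]` for `τ ⊆ σ`. -/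
def coneRingMap {τ σ : PointedCone ℝ (RealSpace N)} (h : τ ≤ σ) :
    ConeRing k σ →ₐ[k] ConeRing k τ :=
  AddMonoidAlgebra.mapDomainAlgHom k k (AddSubmonoid.inclusion (dualMonoid_anti h))

lemma coneRingMap_single {τ σ : PointedCone ℝ (RealSpace N)} (h : τ ≤ σ) (a : dualMonoid σ)
    (c : k) : coneRingMap k h (AddMonoidAlgebra.single a c) =
      AddMonoidAlgebra.single (AddSubmonoid.inclusion (dualMonoid_anti h) a) c := by
  simp [coneRingMap]

lemma coneRingMap_injective {τ σ : PointedCone ℝ (RealSpace N)} (h : τ ≤ σ) :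
    Function.Injective (coneRingMap k h) :=
  AddMonoidAlgebra.mapDomain_injective (AddSubmonoid.inclusion_injective _)

lemma isLocalization_coneRingMap {τ σ : PointedCone ℝ (RealSpace N)} (h : τ ≤ σ)
    (hσ : ∃ s : Set N, s.Finite ∧ σ = PointedCone.hull ℝ (toReal N '' s))
    {m : Module.Dual ℤ N} (hm : m ∈ dualMonoid σ)
    (hτ : ∀ x, x ∈ τ ↔ x ∈ σ ∧ pairing m x = 0) :
    @IsLocalization.Away _ _ (AddMonoidAlgebra.single (⟨m, hm⟩ : dualMonoid σ) 1 : ConeRing k σ)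
      (ConeRing k τ) _ (coneRingMap k h).toRingHom.toAlgebra := by
  let := (coneRingMap k h).toRingHom.toAlgebra
  have halg : ∀ x, algebraMap (ConeRing k σ) (ConeRing k τ) x = coneRingMap k h x := fun _ => rfl
  have hneg : -m ∈ dualMonoid τ := by
    intro x hx
    rw [pairing_neg, ((hτ x).1 hx).2, neg_zero]
  have hu : coneRingMap k h (AddMonoidAlgebra.single (⟨m, hm⟩ : dualMonoid σ) 1) *
      (AddMonoidAlgebra.single (⟨-m, hneg⟩ : dualMonoid τ) 1 : ConeRing k τ) = 1 := by
    rw [coneRingMap_single, AddMonoidAlgebra.single_mul_single, AddMonoidAlgebra.one_def]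
    congr 1
    · ext1
      simp
    · simp
  have hpow : ∀ n : ℕ, (AddMonoidAlgebra.single (⟨m, hm⟩ : dualMonoid σ) 1 : ConeRing k σ) ^ n =
      AddMonoidAlgebra.single (n • (⟨m, hm⟩ : dualMonoid σ)) 1 := by
    intro n
    rw [AddMonoidAlgebra.single_pow, one_pow]
  have hsurj : ∀ z : ConeRing k τ, ∃ (n : ℕ) (y : ConeRing k σ), z * coneRingMap k h
      ((AddMonoidAlgebra.single (⟨m, hm⟩ : dualMonoid σ) 1 : ConeRing k σ) ^ n) =
        coneRingMap k h y := by
    intro z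
    induction z using AddMonoidAlgebra.induction_linear with
    | zero => exact ⟨0, 0, by simp⟩
    | add f g hf hg =>
      obtain ⟨n, y, hy⟩ := hf
      obtain ⟨n', y', hy'⟩ := hg
      refine ⟨n + n', y * (AddMonoidAlgebra.single (⟨m, hm⟩ : dualMonoid σ) 1 : ConeRing k σ) ^ n' +
        y' * (AddMonoidAlgebra.single (⟨m, hm⟩ : dualMonoid σ) 1 : ConeRing k σ) ^ n, ?_⟩
      rw [map_add, map_mul, map_mul, ← hy, ← hy', pow_add, map_mul]
      ring
    | single a c =>
      obtain ⟨n, hn⟩ := exists_add_nsmul_mem hσ hm hτ a.2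
      refine ⟨n, AddMonoidAlgebra.single ⟨_, hn⟩ c, ?_⟩
      rw [hpow, coneRingMap_single, coneRingMap_single, AddMonoidAlgebra.single_mul_single, mul_one]
      congr 1
  refine ⟨?_, ?_, ?_⟩
  · rintro ⟨_, n, rfl⟩
    rw [halg, map_pow]
    exact (IsUnit.of_mul_eq_one _ hu).pow n
  · intro z
    obtain ⟨n, y, hy⟩ := hsurj z
    exact ⟨⟨y, ⟨_, n, rfl⟩⟩, hy⟩
  · intro x y hxy
    exact ⟨1, by rw [coneRingMap_injective k h hxy]⟩

end Affine

section Variety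

variable {N : Type u} [AddCommGroup N] (k : Type u) [Field k]

lemma coneRingMap_rfl (σ : PointedCone ℝ (RealSpace N)) (x : ConeRing k σ) :
    coneRingMap k (le_refl σ) x = x := by
  induction x using AddMonoidAlgebra.induction_linear with
  | zero => simp
  | add f g hf hg => rw [map_add, hf, hg]
  | single a c => rw [coneRingMap_single]; rfl

lemma coneRingMap_comp {ρ τ σ : PointedCone ℝ (RealSpace N)} (h : ρ ≤ τ) (h' : τ ≤ σ)
    (x : ConeRing k σ) :
    coneRingMap k h (coneRingMap k h' x) = coneRingMap k (h.trans h') x := by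
  induction x using AddMonoidAlgebra.induction_linear with
  | zero => simp
  | add f g hf hg => rw [map_add, map_add, map_add, hf, hg]
  | single a c => rw [coneRingMap_single, coneRingMap_single, coneRingMap_single]; rfl

/-- The affine toric variety `U_σ = Spec k[σ^∨ ∩ M]`. -/
abbrev affineToric (σ : PointedCone ℝ (RealSpace N)) : Scheme.{u} := Spec (.of (ConeRing k σ))

/-- The morphism `U_τ → U_σ` for `τ ⊆ σ`. -/
def faceMap {τ σ : PointedCone ℝ (RealSpace N)} (h : τ ≤ σ) :
    affineToric k τ ⟶ affineToric k σ :=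
  Spec.map (CommRingCat.ofHom (coneRingMap k h).toRingHom)

lemma faceMap_rfl (σ : PointedCone ℝ (RealSpace N)) : faceMap k (le_refl σ) = 𝟙 _ := by
  rw [faceMap, ← Spec.map_id]
  congr 1
  apply CommRingCat.hom_ext
  exact RingHom.ext (coneRingMap_rfl k σ)

lemma faceMap_comp {ρ τ σ : PointedCone ℝ (RealSpace N)} (h : ρ ≤ τ) (h' : τ ≤ σ) :
    faceMap k h ≫ faceMap k h' = faceMap k (h.trans h') := by
  rw [faceMap, faceMap, faceMap, ← Spec.map_comp]
  congr 1
  apply CommRingCat.hom_ext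
  exact RingHom.ext fun x => coneRingMap_comp k h h' x

/-- The structure morphism of the affine toric variety `U_σ`. -/
abbrev chartHom (σ : PointedCone ℝ (RealSpace N)) : affineToric k σ ⟶ Spec (.of k) :=
  Spec.map (CommRingCat.ofHom (algebraMap k (ConeRing k σ)))

lemma faceMap_chartHom {τ σ : PointedCone ℝ (RealSpace N)} (h : τ ≤ σ) :
    faceMap k h ≫ chartHom k σ = chartHom k τ := by
  rw [faceMap, ← Spec.map_comp]
  congr 1
  apply CommRingCat.hom_ext
  exact (coneRingMap k h).comp_algebraMap

/-- The functor sending a cone `σ` of a fan to the affine toric variety `U_σ`. -/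
def Fan.chart (F : Fan N) : F.cones ⥤ Scheme.{u} where
  obj σ := affineToric k σ.1
  map h := faceMap k (leOfHom h)
  map_id σ := faceMap_rfl k σ.1
  map_comp _ _ := (faceMap_comp k _ _).symm

variable (F : Fan N)

lemma Fan.chart_face {σ τ : F.cones} (h : σ ≤ τ) : IsFace σ.1 τ.1 := by
  have := F.inf_isFace τ.1 τ.2 σ.1 σ.2
  rwa [inf_eq_right.2 (show σ.1 ≤ τ.1 from h)] at this

instance {σ τ : F.cones} (h : σ ⟶ τ) : IsOpenImmersion ((F.chart k).map h) := by
  obtain ⟨m, hm, hσ⟩ := F.chart_face (leOfHom h)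
  have := isLocalization_coneRingMap k (leOfHom h) (F.rational _ τ.2) hm hσ
  let := (coneRingMap k (leOfHom h)).toRingHom.toAlgebra
  exact IsOpenImmersion.of_isLocalization
    (AddMonoidAlgebra.single (⟨m, hm⟩ : dualMonoid τ.1) 1 : ConeRing k τ.1)

lemma Fan.mem_range_chart {σ τ : F.cones} (h : σ ⟶ τ) {m : Module.Dual ℤ N}
    (hm : m ∈ dualMonoid τ.1) (hσ : ∀ x, x ∈ σ.1 ↔ x ∈ τ.1 ∧ pairing m x = 0)
    (y : PrimeSpectrum (ConeRing k τ.1)) :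
    (∃ x, (F.chart k).map h x = y) ↔
      (AddMonoidAlgebra.single (⟨m, hm⟩ : dualMonoid τ.1) 1 : ConeRing k τ.1) ∉ y.asIdeal := by
  have := isLocalization_coneRingMap k (leOfHom h) (F.rational _ τ.2) hm hσ
  let := (coneRingMap k (leOfHom h)).toRingHom.toAlgebra
  have := PrimeSpectrum.localization_away_comap_range (ConeRing k σ.1)
    (AddMonoidAlgebra.single (⟨m, hm⟩ : dualMonoid τ.1) 1 : ConeRing k τ.1)
  exact (Set.ext_iff.1 this y)

instance : (F.chart k ⋙ Scheme.forget).IsLocallyDirected where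
  cond {i j l} fi fj xi xj hij := by
    obtain ⟨mi, hmi, hi⟩ := F.chart_face (leOfHom fi)
    obtain ⟨mj, hmj, hj⟩ := F.chart_face (leOfHom fj)
    have hm : mi + mj ∈ dualMonoid l.1 := add_mem hmi hmj
    have hinf : ∀ x, x ∈ i.1 ⊓ j.1 ↔ x ∈ l.1 ∧ pairing (mi + mj) x = 0 := by
      intro x
      rw [Submodule.mem_inf, hi, hj, pairing_add]
      constructor
      · rintro ⟨⟨h1, h2⟩, -, h3⟩
        exact ⟨h1, by rw [h2, h3, add_zero]⟩
      · rintro ⟨h1, h2⟩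
        have := hmi x h1
        have := hmj x h1
        exact ⟨⟨h1, by linarith⟩, h1, by linarith⟩
    let t : F.cones := ⟨i.1 ⊓ j.1, F.face_mem _ l.2 _ ⟨_, hm, hinf⟩⟩
    let ti : t ⟶ i := homOfLE (show t.1 ≤ i.1 from inf_le_left)
    let tj : t ⟶ j := homOfLE (show t.1 ≤ j.1 from inf_le_right)
    have hij' : (F.chart k).map fi xi = (F.chart k).map fj xj := hij
    have h1 := (F.mem_range_chart k fi hmi hi _).1 ⟨xi, rfl⟩
    have h2 := (F.mem_range_chart k fj hmj hj _).1 ⟨xj, rfl⟩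
    rw [← hij'] at h2
    obtain ⟨x, hx⟩ := (F.mem_range_chart k (ti ≫ fi) hm hinf ((F.chart k).map fi xi)).2 (by
      intro h
      have : (AddMonoidAlgebra.single (⟨mi + mj, hm⟩ : dualMonoid l.1) 1 : ConeRing k l.1) =
        AddMonoidAlgebra.single (⟨mi, hmi⟩ : dualMonoid l.1) 1 *
          AddMonoidAlgebra.single (⟨mj, hmj⟩ : dualMonoid l.1) 1 := by
        rw [AddMonoidAlgebra.single_mul_single, mul_one]
        rfl
      rw [this] at h
      rcases (((F.chart k).map fi xi : PrimeSpectrum (ConeRing k l.1)).2.mem_or_mem h) with h | h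
      · exact h1 h
      · exact h2 h)
    refine ⟨t, ti, tj, x, ?_, ?_⟩
    · apply ((F.chart k).map fi).isOpenEmbedding.injective
      rw [← hx, Functor.map_comp]
      rfl
    · apply ((F.chart k).map fj).isOpenEmbedding.injective
      rw [← hij', ← hx, Subsingleton.elim (ti ≫ fi) (tj ≫ fj), Functor.map_comp]
      rfl

/-- The structure morphisms of the charts, as a cocone. -/
def Fan.structureCocone : Cocone (F.chart k) where
  pt := Spec (.of k)
  ι :=
    { app := fun σ => chartHom k σ.1
      naturality := fun σ τ h => by
        exact (faceMap_chartHom k (leOfHom h)).trans (Category.comp_id _).symm }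

/-- The toric variety of a fan, as a scheme over `k`: the affine toric varieties `U_σ` of its cones,
glued along the open subschemes `U_τ ⊆ U_σ` for the faces `τ` of `σ`. -/
def Fan.variety : Over (Spec (.of k)) :=
  Over.mk (colimit.desc (F.chart k) (F.structureCocone k))

/-- The open immersion `U_σ → X`. -/
def Fan.ι (σ : F.cones) : affineToric k σ.1 ⟶ (F.variety k).left :=
  colimit.ι (F.chart k) σ

instance (σ : F.cones) : IsOpenImmersion (F.ι k σ) :=
  inferInstanceAs (IsOpenImmersion (colimit.ι (F.chart k) σ))


lemma Fan.ι_hom (σ : F.cones) : F.ι k σ ≫ (F.variety k).hom = chartHom k σ.1 :=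
  colimit.ι_desc (F.structureCocone k) σ

lemma Fan.faceMap_ι {σ τ : F.cones} (h : σ.1 ≤ τ.1) :
    faceMap k h ≫ F.ι k τ = F.ι k σ :=
  colimit.w (F.chart k) (homOfLE (show σ ≤ τ from h))

lemma Fan.hom_ext {F : Fan N} {Z : Scheme.{u}} {g h : (F.variety k).left ⟶ Z}
    (e : ∀ σ, F.ι k σ ≫ g = F.ι k σ ≫ h) : g = h :=
  colimit.hom_ext e

/-- The closed subset `V(τ)` of the toric variety `X`: the closure of the orbit `O(τ)`, which is the
closed subset of `U_τ` where all characters in `τ^∨ ∩ M` outside `τ^⊥` vanish. -/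
def Fan.stratum (τ : F.cones) : TopologicalSpace.Closeds (F.variety k).left :=
  TopologicalSpace.Closeds.closure (F.ι k τ '' PrimeSpectrum.zeroLocus
    {z : ConeRing k τ.1 | ∃ m : dualMonoid τ.1, (∃ x ∈ τ.1, pairing m.1 x ≠ 0) ∧
      z = AddMonoidAlgebra.single m 1})

/-- The closed stratum `V(τ)` with its reduced scheme structure. -/
def Fan.closedStratum (τ : F.cones) : Over (Spec (.of k)) :=
  Over.mk ((Scheme.IdealSheafData.vanishingIdeal (F.stratum k τ)).subschemeι ≫ (F.variety k).hom)

/-- The closed immersion `V(τ) → X`. -/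
def Fan.strIncl (τ : F.cones) : F.closedStratum k τ ⟶ F.variety k :=
  Over.homMk (Scheme.IdealSheafData.vanishingIdeal (F.stratum k τ)).subschemeι

instance (τ : F.cones) : IsClosedImmersion (F.strIncl k τ).left :=
  inferInstanceAs (IsClosedImmersion
    (Scheme.IdealSheafData.vanishingIdeal (F.stratum k τ)).subschemeι)

end Variety

section Morphism

variable {N N' : Type u} [AddCommGroup N] [AddCommGroup N'] (k : Type u) [Field k]

/-- `f` is a map of fans: each cone is mapped into a cone. -/
def IsFanMap (F : Fan N) (F' : Fan N') (f : N →ₗ[ℤ] N') : Prop :=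
  ∀ σ ∈ F.cones, ∃ σ' ∈ F'.cones, σ.map (realMap f) ≤ σ'

lemma comp_mem_dualMonoid {f : N →ₗ[ℤ] N'} {σ : PointedCone ℝ (RealSpace N)}
    {σ' : PointedCone ℝ (RealSpace N')} (h : σ.map (realMap f) ≤ σ') {m : Module.Dual ℤ N'}
    (hm : m ∈ dualMonoid σ') : m ∘ₗ f ∈ dualMonoid σ := by
  intro x hx
  rw [pairing_comp]
  exact hm _ (h ⟨x, hx, rfl⟩)

/-- The map `σ'^∨ ∩ M' → σ^∨ ∩ M` dual to a map of lattices sending `σ` into `σ'`. -/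
def dualMonoidMap (f : N →ₗ[ℤ] N') {σ : PointedCone ℝ (RealSpace N)}
    {σ' : PointedCone ℝ (RealSpace N')} (h : σ.map (realMap f) ≤ σ') :
    dualMonoid σ' →+ dualMonoid σ where
  toFun m := ⟨m.1 ∘ₗ f, comp_mem_dualMonoid h m.2⟩
  map_zero' := by ext1; simp
  map_add' a b := by ext1; simp [LinearMap.add_comp]

/-- The map `k[σ'^∨ ∩ M'] → k[σ^∨ ∩ M]`. -/
def coneRingPull (f : N →ₗ[ℤ] N') {σ : PointedCone ℝ (RealSpace N)}
    {σ' : PointedCone ℝ (RealSpace N')} (h : σ.map (realMap f) ≤ σ') :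
    ConeRing k σ' →ₐ[k] ConeRing k σ :=
  AddMonoidAlgebra.mapDomainAlgHom k k (dualMonoidMap f h)

lemma coneRingPull_single (f : N →ₗ[ℤ] N') {σ : PointedCone ℝ (RealSpace N)}
    {σ' : PointedCone ℝ (RealSpace N')} (h : σ.map (realMap f) ≤ σ') (a : dualMonoid σ') (c : k) :
    coneRingPull k f h (AddMonoidAlgebra.single a c) =
      AddMonoidAlgebra.single (dualMonoidMap f h a) c := by
  simp [coneRingPull]

/-- The morphism of affine toric varieties `U_σ → U_σ'`. -/
def affineMap (f : N →ₗ[ℤ] N') {σ : PointedCone ℝ (RealSpace N)}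
    {σ' : PointedCone ℝ (RealSpace N')} (h : σ.map (realMap f) ≤ σ') :
    affineToric k σ ⟶ affineToric k σ' :=
  Spec.map (CommRingCat.ofHom (coneRingPull k f h).toRingHom)

lemma affineMap_chartHom (f : N →ₗ[ℤ] N') {σ : PointedCone ℝ (RealSpace N)}
    {σ' : PointedCone ℝ (RealSpace N')} (h : σ.map (realMap f) ≤ σ') :
    affineMap k f h ≫ chartHom k σ' = chartHom k σ := by
  rw [affineMap, ← Spec.map_comp]
  congr 1
  apply CommRingCat.hom_ext
  exact (coneRingPull k f h).comp_algebraMap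

variable {F : Fan N} {F' : Fan N'}

/-- Compatibility of the local toric morphisms: restricting the source or enlarging the target. -/
lemma faceMap_affineMap (f : N →ₗ[ℤ] N') {ρ σ : PointedCone ℝ (RealSpace N)}
    {ρ' σ' : PointedCone ℝ (RealSpace N')} (i : ρ ≤ σ) (i' : ρ' ≤ σ')
    (h : ρ.map (realMap f) ≤ ρ') (h' : σ.map (realMap f) ≤ σ') :
    faceMap k i ≫ affineMap k f h' = affineMap k f h ≫ faceMap k i' := by
  rw [faceMap, faceMap, affineMap, affineMap, ← Spec.map_comp, ← Spec.map_comp]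
  congr 1
  apply CommRingCat.hom_ext
  refine RingHom.ext fun x => ?_
  change coneRingMap k i (coneRingPull k f h' x) = coneRingPull k f h (coneRingMap k i' x)
  induction x using AddMonoidAlgebra.induction_linear with
  | zero => simp
  | add f g hf hg => simp only [map_add, hf, hg]
  | single a c =>
    rw [coneRingMap_single, coneRingPull_single, coneRingPull_single, coneRingMap_single]
    rfl

/-- Two affine toric morphisms with nested sources agree after composing with the inclusions of the
targets into the toric variety. -/
lemma faceMap_affineMap_ι (f : N →ₗ[ℤ] N') {ρ σ : PointedCone ℝ (RealSpace N)}
    {ρ' σ' : F'.cones} (i : ρ ≤ σ)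
    (h : ρ.map (realMap f) ≤ ρ'.1) (h' : σ.map (realMap f) ≤ σ'.1) :
    faceMap k i ≫ affineMap k f h' ≫ F'.ι k σ' = affineMap k f h ≫ F'.ι k ρ' := by
  let t : F'.cones := ⟨ρ'.1 ⊓ σ'.1, F'.face_mem _ ρ'.2 _ (F'.inf_isFace _ ρ'.2 _ σ'.2)⟩
  have t₁ : t.1 ≤ ρ'.1 := inf_le_left
  have t₂ : t.1 ≤ σ'.1 := inf_le_right
  have ht : ρ.map (realMap f) ≤ t.1 := le_inf h ((Submodule.map_mono i).trans h')
  have e₁ := faceMap_affineMap k f i t₂ ht h'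
  have e₂ := faceMap_affineMap k f (le_refl ρ) t₁ ht h
  rw [faceMap_rfl, Category.id_comp] at e₂
  rw [reassoc_of% e₁, Fan.faceMap_ι, e₂, Category.assoc, Fan.faceMap_ι]

/-- The cocone on the charts of the source which defines a toric morphism. -/
def toricCocone (f : N →ₗ[ℤ] N') (hf : IsFanMap F F' f) : Cocone (F.chart k) where
  pt := (F'.variety k).left
  ι :=
    { app := fun σ => affineMap k f (hf σ.1 σ.2).choose_spec.2 ≫
        F'.ι k ⟨(hf σ.1 σ.2).choose, (hf σ.1 σ.2).choose_spec.1⟩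
      naturality := fun σ τ h => by
        refine Eq.trans ?_ (Category.comp_id _).symm
        exact faceMap_affineMap_ι k f (leOfHom h) (hf σ.1 σ.2).choose_spec.2
          (hf τ.1 τ.2).choose_spec.2
          (ρ' := ⟨(hf σ.1 σ.2).choose, (hf σ.1 σ.2).choose_spec.1⟩)
          (σ' := ⟨(hf τ.1 τ.2).choose, (hf τ.1 τ.2).choose_spec.1⟩) }

/-- The toric morphism of toric varieties associated with a map of fans, as a morphism of schemes:
on `U_σ` it is `U_σ → U_σ'` for any cone `σ'` containing the image of `σ`. -/
def toricMap (f : N →ₗ[ℤ] N') (hf : IsFanMap F F' f) :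
    (F.variety k).left ⟶ (F'.variety k).left :=
  colimit.desc (F.chart k) (toricCocone k f hf)

lemma ι_toricMap (f : N →ₗ[ℤ] N') (hf : IsFanMap F F' f) (σ : F.cones) (σ' : F'.cones)
    (h : σ.1.map (realMap f) ≤ σ'.1) :
    F.ι k σ ≫ toricMap k f hf = affineMap k f h ≫ F'.ι k σ' := by
  rw [← faceMap_affineMap_ι k f (le_refl σ.1) h (hf σ.1 σ.2).choose_spec.2
    (σ' := ⟨(hf σ.1 σ.2).choose, (hf σ.1 σ.2).choose_spec.1⟩), faceMap_rfl, Category.id_comp]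
  exact colimit.ι_desc (toricCocone k f hf) σ

/-- The toric morphism of toric varieties associated with a map of fans, over `k`. -/
def toricMorphism (f : N →ₗ[ℤ] N') (hf : IsFanMap F F' f) : F.variety k ⟶ F'.variety k :=
  Over.homMk (toricMap k f hf) (Fan.hom_ext k fun σ => by
    have h1 := ι_toricMap k f hf σ ⟨(hf σ.1 σ.2).choose, (hf σ.1 σ.2).choose_spec.1⟩
      (hf σ.1 σ.2).choose_spec.2
    rw [reassoc_of% h1, Fan.ι_hom, Fan.ι_hom, affineMap_chartHom])

/-- `τ'` is the smallest cone of the fan `F'` which contains the image of `τ`. -/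
def IsSmallestCone (f : N →ₗ[ℤ] N') (τ : F.cones) (τ' : F'.cones) : Prop :=
  τ.1.map (realMap f) ≤ τ'.1 ∧ ∀ σ' : F'.cones, τ.1.map (realMap f) ≤ σ'.1 → τ'.1 ≤ σ'.1

lemma toricMorphism_stratum (f : N →ₗ[ℤ] N') (hf : IsFanMap F F' f) {τ : F.cones} {τ' : F'.cones}
    (h : IsSmallestCone f τ τ') :
    (toricMorphism k f hf).left '' (F.stratum k τ) ⊆ F'.stratum k τ' := by
  refine (image_closure_subset_closure_image (toricMorphism k f hf).left.continuous).trans ?_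
  refine closure_mono ?_
  rintro _ ⟨_, ⟨y, hy, rfl⟩, rfl⟩
  refine ⟨affineMap k f h.1 y, ?_, ?_⟩
  · rintro _ ⟨m, ⟨x, hx, hmx⟩, rfl⟩
    change coneRingPull k f h.1 (AddMonoidAlgebra.single m 1) ∈ y.asIdeal
    rw [coneRingPull_single]
    refine hy ⟨dualMonoidMap f h.1 m, ?_, rfl⟩
    by_contra! hcon
    let ρ : PointedCone ℝ (RealSpace N') := τ'.1 ⊓ (LinearMap.ker (pairing m.1)).restrictScalars _
    have hρ : ∀ x, x ∈ ρ ↔ x ∈ τ'.1 ∧ pairing m.1 x = 0 := fun x => Iff.rfl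
    have hρm : ρ ∈ F'.cones := F'.face_mem _ τ'.2 _ ⟨m.1, m.2, hρ⟩
    have : τ'.1 ≤ ρ := h.2 ⟨ρ, hρm⟩ (by
      rintro _ ⟨z, hz, rfl⟩
      refine (hρ _).2 ⟨h.1 ⟨z, hz, rfl⟩, ?_⟩
      have := hcon z hz
      change pairing (m.1 ∘ₗ f) z = 0 at this
      rwa [pairing_comp] at this)
    exact hmx ((hρ x).1 (this hx)).2
  · rw [← Scheme.Hom.comp_apply, ← Scheme.Hom.comp_apply]
    exact congrArg (fun g : affineToric k τ.1 ⟶ (F'.variety k).left => g y)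
      (ι_toricMap k f hf τ τ' h.1).symm

lemma vanishingIdeal_stratum_le (f : N →ₗ[ℤ] N') (hf : IsFanMap F F' f) {τ : F.cones}
    {τ' : F'.cones} (h : IsSmallestCone f τ τ') :
    Scheme.IdealSheafData.vanishingIdeal (F'.stratum k τ') ≤
      (Scheme.IdealSheafData.vanishingIdeal (F.stratum k τ)).map (toricMorphism k f hf).left := by
  rw [Scheme.IdealSheafData.map_vanishingIdeal]
  apply Scheme.IdealSheafData.vanishingIdeal_antimono
  rw [TopologicalSpace.Closeds.closure_le]
  exact toricMorphism_stratum k f hf h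

/-- The restriction `V(τ) → V(τ')` of a toric morphism to closed strata, where `τ'` is the smallest
cone containing the image of `τ`. -/
def stratumMap (f : N →ₗ[ℤ] N') (hf : IsFanMap F F' f) {τ : F.cones} {τ' : F'.cones}
    (h : IsSmallestCone f τ τ') : F.closedStratum k τ ⟶ F'.closedStratum k τ' :=
  Over.homMk (Scheme.IdealSheafData.subschemeMap _ _ (toricMorphism k f hf).left
    (vanishingIdeal_stratum_le k f hf h)) (by simp [Fan.closedStratum])

lemma stratumMap_strIncl (f : N →ₗ[ℤ] N') (hf : IsFanMap F F' f) {τ : F.cones} {τ' : F'.cones}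
    (h : IsSmallestCone f τ τ') :
    stratumMap k f hf h ≫ F'.strIncl k τ' = F.strIncl k τ ≫ toricMorphism k f hf := by
  ext1
  exact Scheme.IdealSheafData.subschemeMap_subschemeι _ _ _
    (vanishingIdeal_stratum_le k f hf h)

instance (f : N →ₗ[ℤ] N') (hf : IsFanMap F F' f) {τ : F.cones} {τ' : F'.cones}
    (h : IsSmallestCone f τ τ') [IsProper (toricMorphism k f hf).left] :
    IsProper (stratumMap k f hf h).left := by
  have h1 : (stratumMap k f hf h).left ≫ (F'.strIncl k τ').left =
      (F.strIncl k τ).left ≫ (toricMorphism k f hf).left :=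
    congrArg Over.Hom.left (stratumMap_strIncl k f hf h)
  have : IsProper ((stratumMap k f hf h).left ≫ (F'.strIncl k τ').left) := by
    rw [h1]; infer_instance
  exact IsProper.of_comp _ (F'.strIncl k τ').left

end Morphism

section Action

variable {N Q : Type u} [AddCommGroup N] [AddCommGroup Q] (k : Type u) [Field k]

/-- `Spec A` as a scheme over `k`, for a `k`-algebra `A`. -/
abbrev affineOver (A : Type u) [CommRing A] [Algebra k A] : Over (Spec (.of k)) :=
  Over.mk (Spec.map (CommRingCat.ofHom (algebraMap k A)))

/-- The coordinate ring `k[Q^*]` of the torus with cocharacter lattice `Q`. -/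
abbrev TorusRing (Q : Type u) [AddCommGroup Q] : Type u := AddMonoidAlgebra k (Module.Dual ℤ Q)

/-- The torus `T_Q = Spec k[Q^*]` with cocharacter lattice `Q`. -/
abbrev torus (Q : Type u) [AddCommGroup Q] : Over (Spec (.of k)) := affineOver k (TorusRing k Q)

/-- The morphism `Spec A × Spec B → Spec B` given by a homomorphism `B → A ⊗ B`. -/
def ofCoaction {A B : Type u} [CommRing A] [CommRing B] [Algebra k A] [Algebra k B]
    (c : B →ₐ[k] A ⊗[k] B) : affineOver k A ⊗ affineOver k B ⟶ affineOver k B :=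
  Over.homMk ((pullbackSpecIso k A B).hom ≫ Spec.map (CommRingCat.ofHom c.toRingHom)) (by
    rw [← cancel_epi (pullbackSpecIso k A B).inv]
    have h1 : (pullbackSpecIso k A B).inv ≫ (affineOver k A ⊗ affineOver k B).hom =
        Spec.map (CommRingCat.ofHom (algebraMap k (A ⊗[k] B))) := by
      change (pullbackSpecIso k A B).inv ≫ pullback.fst _ _ ≫ Spec.map _ = _
      rw [pullbackSpecIso_inv_fst_assoc, ← Spec.map_comp]
      rfl
    rw [h1, Category.assoc, Iso.inv_hom_id_assoc]
    change Spec.map _ ≫ Spec.map _ = _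
    rw [← Spec.map_comp]
    congr 1
    apply CommRingCat.hom_ext
    exact c.comp_algebraMap)

/-- For `j : Q → N`, the coaction `k[σ^∨ ∩ M] → k[Q^*] ⊗ k[σ^∨ ∩ M]`, which sends a character
`χ^m` to `χ^(m ∘ j) ⊗ χ^m`. -/
def coneCoaction (j : Q →ₗ[ℤ] N) (σ : PointedCone ℝ (RealSpace N)) :
    ConeRing k σ →ₐ[k] TorusRing k Q ⊗[k] ConeRing k σ :=
  AddMonoidAlgebra.lift k _ _
    { toFun := fun m => AddMonoidAlgebra.single (m.toAdd.1 ∘ₗ j) 1 ⊗ₜ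
        AddMonoidAlgebra.single m.toAdd 1
      map_one' := by
        rw [toAdd_one, ZeroMemClass.coe_zero, LinearMap.zero_comp, ← AddMonoidAlgebra.one_def,
          ← AddMonoidAlgebra.one_def, Algebra.TensorProduct.one_def]
      map_mul' := fun a b => by
        rw [toAdd_mul, AddMemClass.coe_add, LinearMap.add_comp, Algebra.TensorProduct.tmul_mul_tmul,
          AddMonoidAlgebra.single_mul_single, AddMonoidAlgebra.single_mul_single, mul_one] }

lemma coneCoaction_single (j : Q →ₗ[ℤ] N) (σ : PointedCone ℝ (RealSpace N)) (m : dualMonoid σ)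
    (c : k) : coneCoaction k j σ (AddMonoidAlgebra.single m c) =
      c • (AddMonoidAlgebra.single (m.1 ∘ₗ j) 1 ⊗ₜ AddMonoidAlgebra.single m 1) := by
  simp [coneCoaction, AddMonoidAlgebra.lift_single]

/-- The inclusion `U_τ → U_σ` as a morphism over `k`. -/
def faceOver {τ σ : PointedCone ℝ (RealSpace N)} (h : τ ≤ σ) :
    affineOver k (ConeRing k τ) ⟶ affineOver k (ConeRing k σ) :=
  Over.homMk (faceMap k h) (faceMap_chartHom k h)

/-- The action of `T_Q` on `U_σ`. -/
def coneAct (j : Q →ₗ[ℤ] N) (σ : PointedCone ℝ (RealSpace N)) :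
    torus k Q ⊗ affineOver k (ConeRing k σ) ⟶ affineOver k (ConeRing k σ) :=
  ofCoaction k (coneCoaction k j σ)

lemma faceOver_coneAct (j : Q →ₗ[ℤ] N) {τ σ : PointedCone ℝ (RealSpace N)} (h : τ ≤ σ) :
    torus k Q ◁ faceOver k h ≫ coneAct k j σ = coneAct k j τ ≫ faceOver k h := by
  ext1
  rw [← cancel_epi (pullbackSpecIso k (TorusRing k Q) (ConeRing k τ)).inv]
  have h1 : (pullbackSpecIso k (TorusRing k Q) (ConeRing k τ)).inv ≫
      (torus k Q ◁ faceOver k h).left = Spec.map (CommRingCat.ofHom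
        (Algebra.TensorProduct.map (AlgHom.id k (TorusRing k Q)) (coneRingMap k h)).toRingHom) ≫
      (pullbackSpecIso k (TorusRing k Q) (ConeRing k σ)).inv := by
    have hf := pullbackSpecIso_inv_fst k (TorusRing k Q) (ConeRing k σ)
    have hs := pullbackSpecIso_inv_snd k (TorusRing k Q) (ConeRing k σ)
    change _ ≫ pullback.fst (torus k Q).hom (affineOver k (ConeRing k σ)).hom = _ at hf
    change _ ≫ pullback.snd (torus k Q).hom (affineOver k (ConeRing k σ)).hom = _ at hs
    apply pullback.hom_ext
    · rw [Category.assoc, Category.assoc, hf, Over.whiskerLeft_left_fst, ← Spec.map_comp]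
      refine (pullbackSpecIso_inv_fst k (TorusRing k Q) (ConeRing k τ)).trans ?_
      congr 1
      apply CommRingCat.hom_ext
      refine RingHom.ext fun x => ?_
      change x ⊗ₜ[k] (1 : ConeRing k τ) =
        Algebra.TensorProduct.map (AlgHom.id k _) (coneRingMap k h) (x ⊗ₜ[k] (1 : ConeRing k σ))
      rw [Algebra.TensorProduct.map_tmul, map_one]
      exact congrArg (· ⊗ₜ[k] (1 : ConeRing k τ)) (AlgHom.id_apply (R := k) x).symm
    · rw [Category.assoc, Category.assoc, hs, Over.whiskerLeft_left_snd, ← Spec.map_comp]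
      refine (pullbackSpecIso_inv_snd_assoc k (TorusRing k Q) (ConeRing k τ) _).trans ?_
      refine (Spec.map_comp _ _).symm.trans ?_
      congr 1
  have h2 : ∀ ρ : PointedCone ℝ (RealSpace N),
      (pullbackSpecIso k (TorusRing k Q) (ConeRing k ρ)).inv ≫ (coneAct k j ρ).left =
        Spec.map (CommRingCat.ofHom (coneCoaction k j ρ).toRingHom) :=
    fun ρ => Iso.inv_hom_id_assoc _ _
  rw [Over.comp_left, Over.comp_left, reassoc_of% h1, h2, reassoc_of% h2]
  change _ = _ ≫ faceMap k h
  rw [faceMap, ← Spec.map_comp, ← Spec.map_comp]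
  congr 1
  apply CommRingCat.hom_ext
  refine RingHom.ext fun x => ?_
  change Algebra.TensorProduct.map _ _ (coneCoaction k j σ x) =
    coneCoaction k j τ (coneRingMap k h x)
  induction x using AddMonoidAlgebra.induction_linear with
  | zero => simp
  | add f g hf hg => simp only [map_add, hf, hg]
  | single a c =>
    rw [coneRingMap_single, coneCoaction_single, coneCoaction_single, map_smul,
      Algebra.TensorProduct.map_tmul, coneRingMap_single]
    rfl

/-- The multiplication of the torus `T_Q`, given by `χ^m ↦ χ^m ⊗ χ^m`. -/
def torusMul (Q : Type u) [AddCommGroup Q] : torus k Q ⊗ torus k Q ⟶ torus k Q :=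
  ofCoaction k (Bialgebra.comulAlgHom k (TorusRing k Q))

/-- The unit of the torus `T_Q`, given by `χ^m ↦ 1`. -/
def torusOne (Q : Type u) [AddCommGroup Q] : 𝟙_ (Over (Spec (.of k))) ⟶ torus k Q :=
  Over.homMk (Spec.map (CommRingCat.ofHom (Bialgebra.counitAlgHom k (TorusRing k Q)).toRingHom)) (by
    change Spec.map _ ≫ Spec.map _ = 𝟙 _
    rw [← Spec.map_comp, ← Spec.map_id]
    congr 1
    apply CommRingCat.hom_ext
    exact (Bialgebra.counitAlgHom k (TorusRing k Q)).comp_algebraMap)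

variable {k} in
/-- The morphism `T_Q × X → X` is an action of the torus `T_Q`. -/
structure IsAction {X : Over (Spec (.of k))} (act : torus k Q ⊗ X ⟶ X) : Prop where
  one_act : (torusOne k Q ▷ X) ≫ act = snd _ _
  mul_act : (torusMul k Q ▷ X) ≫ act = (α_ _ _ _).hom ≫ (torus k Q ◁ act) ≫ act

variable (F : Fan N)

/-- The open cover of a toric variety by the `U_σ`. -/
def Fan.cover : (F.variety k).left.OpenCover := Scheme.IsLocallyDirected.openCover (F.chart k)

instance : Preorder (F.cover k).I₀ := inferInstanceAs (Preorder F.cones)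

lemma Fan.isOpenImmersion_faceMap {i j : F.cones} (h : i.1 ≤ j.1) :
    IsOpenImmersion (faceMap k h) :=
  inferInstanceAs (IsOpenImmersion ((F.chart k).map (homOfLE h : i ⟶ j)))

lemma Fan.exists_lift_faceMap {i j : F.cones}
    (x : (pullback (F.ι k i) (F.ι k j) : Scheme.{u})) :
    ∃ (l : F.cones) (hi : l.1 ≤ i.1) (hj : l.1 ≤ j.1) (y : affineToric k l.1),
      pullback.lift (faceMap k hi) (faceMap k hj)
        ((F.faceMap_ι k hi).trans (F.faceMap_ι k hj).symm) y = x := by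
  have hx : F.ι k i (pullback.fst (F.ι k i) (F.ι k j) x) =
      F.ι k j (pullback.snd (F.ι k i) (F.ι k j) x) := by
    rw [← Scheme.Hom.comp_apply, ← Scheme.Hom.comp_apply, pullback.condition]
  obtain ⟨l, fi, fj, y, hi, hj⟩ := (Scheme.IsLocallyDirected.ι_eq_ι_iff (F.chart k)).1 hx
  refine ⟨l, leOfHom fi, leOfHom fj, y, ?_⟩
  apply (pullback.fst (F.ι k i) (F.ι k j)).isOpenEmbedding.injective
  refine Eq.trans ?_ hi
  have key := pullback.lift_fst (faceMap k (leOfHom fi)) (faceMap k (leOfHom fj))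
    ((F.faceMap_ι k (leOfHom fi)).trans (F.faceMap_ι k (leOfHom fj)).symm)
  exact congrArg (fun g => g y) key

instance : Scheme.Cover.LocallyDirected (F.cover k) where
  trans {i j} h := faceMap k (show (i : F.cones).1 ≤ (j : F.cones).1 from leOfHom h)
  trans_id i := faceMap_rfl k (i : F.cones).1
  trans_comp f g := (faceMap_comp k (leOfHom f) (leOfHom g)).symm
  w {i j} h := F.faceMap_ι k (leOfHom h)
  directed {i j} x := by
    obtain ⟨l, hi, hj, y, h⟩ := F.exists_lift_faceMap k (i := i) (j := j) x
    exact ⟨l, homOfLE hi, homOfLE hj, y, h⟩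
  property_trans {i j} h := F.isOpenImmersion_faceMap k (i := i) (j := j) (leOfHom h)

/-- The open immersion `U_σ → X` as a morphism over `k`. -/
def Fan.ιOver (σ : F.cones) : affineOver k (ConeRing k σ.1) ⟶ F.variety k :=
  Over.homMk (F.ι k σ) (F.ι_hom k σ)

lemma Fan.faceOver_ιOver {σ τ : F.cones} (h : σ.1 ≤ τ.1) :
    faceOver k h ≫ F.ιOver k τ = F.ιOver k σ := by
  ext1
  exact F.faceMap_ι k h

/-- The isomorphism (used as a morphism) from the preimage of `U_σ` in `T × X` to `T × U_σ`. -/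
def Fan.preimageChart (T : Over (Spec (.of k))) (σ : F.cones) :
    pullback (snd T (F.variety k)).left (F.ι k σ) ⟶ (T ⊗ affineOver k (ConeRing k σ.1)).left :=
  pullback.lift (pullback.fst _ _ ≫ (fst T (F.variety k)).left) (pullback.snd _ _) (by
    have h1 : (fst T (F.variety k)).left ≫ T.hom = (T ⊗ F.variety k).hom := Over.w _
    have h2 : (snd T (F.variety k)).left ≫ (F.variety k).hom = (T ⊗ F.variety k).hom := Over.w _
    rw [Category.assoc, h1, ← h2, pullback.condition_assoc, Fan.ι_hom]
    rfl)

lemma Fan.preimageChart_fst (T : Over (Spec (.of k))) (σ : F.cones) :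
    F.preimageChart k T σ ≫ pullback.fst T.hom (affineOver k (ConeRing k σ.1)).hom =
      pullback.fst _ _ ≫ (fst T (F.variety k)).left :=
  pullback.lift_fst _ _ _

lemma Fan.preimageChart_snd (T : Over (Spec (.of k))) (σ : F.cones) :
    F.preimageChart k T σ ≫ pullback.snd T.hom (affineOver k (ConeRing k σ.1)).hom =
      pullback.snd _ _ :=
  pullback.lift_snd _ _ _

lemma Fan.preimageChart_comp (T : Over (Spec (.of k))) {σ τ : F.cones} (h : σ.1 ≤ τ.1) :
    pullback.map (snd T (F.variety k)).left (F.ι k σ) (snd T (F.variety k)).left (F.ι k τ)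
      (𝟙 _) (faceMap k h) (𝟙 _) (by simp) (by rw [Category.comp_id, Fan.faceMap_ι]) ≫
      F.preimageChart k T τ = F.preimageChart k T σ ≫ (T ◁ faceOver k h).left := by
  apply pullback.hom_ext
  · rw [Category.assoc, Category.assoc, Over.whiskerLeft_left_fst, Fan.preimageChart_fst,
      Fan.preimageChart_fst, pullback.map, pullback.lift_fst_assoc, Category.comp_id]
  · rw [Category.assoc, Category.assoc, Over.whiskerLeft_left_snd, Fan.preimageChart_snd,
      ← Category.assoc, Fan.preimageChart_snd, pullback.map, pullback.lift_snd]
    rfl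

/-- The action of `T_Q` on `X`, restricted to the preimage of `U_σ` in `T_Q × X`. -/
def Fan.chartAct (j : Q →ₗ[ℤ] N) (σ : F.cones) :
    pullback (snd (torus k Q) (F.variety k)).left (F.ι k σ) ⟶ (F.variety k).left :=
  F.preimageChart k (torus k Q) σ ≫ (coneAct k j σ.1 ≫ F.ιOver k σ).left

lemma Fan.chartAct_comp (j : Q →ₗ[ℤ] N) {σ τ : F.cones} (h : σ.1 ≤ τ.1) :
    pullback.map (snd (torus k Q) (F.variety k)).left (F.ι k σ) (snd (torus k Q) (F.variety k)).left
      (F.ι k τ) (𝟙 _) (faceMap k h) (𝟙 _) (by simp) (by rw [Category.comp_id, Fan.faceMap_ι]) ≫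
      F.chartAct k j τ = F.chartAct k j σ := by
  rw [chartAct, ← Category.assoc, preimageChart_comp, Category.assoc, ← Over.comp_left,
    ← Category.assoc, faceOver_coneAct, Category.assoc, Fan.faceOver_ιOver]
  rfl

lemma Fan.chartAct_hom (j : Q →ₗ[ℤ] N) (σ : F.cones) :
    F.chartAct k j σ ≫ (F.variety k).hom =
      pullback.fst _ _ ≫ (torus k Q ⊗ F.variety k).hom := by
  have h1 : pullback.fst (torus k Q).hom (affineOver k (ConeRing k σ.1)).hom ≫ (torus k Q).hom =
    (torus k Q ⊗ affineOver k (ConeRing k σ.1)).hom := rfl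
  rw [chartAct, Category.assoc, Over.w, ← h1, ← Category.assoc, preimageChart_fst, Category.assoc,
    Over.w]

/-- The action of the torus `T_Q` on the toric variety `X` given by a map of lattices `j : Q → N`,
glued from the actions of `T_Q` on the `U_σ`. -/
def Fan.torusAct (j : Q →ₗ[ℤ] N) : torus k Q ⊗ F.variety k ⟶ F.variety k :=
  Scheme.OpenCover.glueMorphismsOverOfLocallyDirected
    ((F.cover k).pullback₁ (snd (torus k Q) (F.variety k)).left)
    (fun σ => F.chartAct k j σ)
    (fun {σ τ} h => F.chartAct_comp k j (σ := σ) (τ := τ) (leOfHom h))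
    (fun σ => F.chartAct_hom k j σ)

lemma Fan.torusAct_ιOver (j : Q →ₗ[ℤ] N) (σ : F.cones) :
    torus k Q ◁ F.ιOver k σ ≫ F.torusAct k j = coneAct k j σ.1 ≫ F.ιOver k σ := by
  let s : (torus k Q ⊗ affineOver k (ConeRing k σ.1)).left ⟶
      pullback (snd (torus k Q) (F.variety k)).left (F.ι k σ) :=
    pullback.lift (torus k Q ◁ F.ιOver k σ).left
      (pullback.snd (torus k Q).hom (affineOver k (ConeRing k σ.1)).hom)
      (Over.whiskerLeft_left_snd (F.ιOver k σ))
  have hs₁ : s ≫ pullback.fst _ _ = (torus k Q ◁ F.ιOver k σ).left := pullback.lift_fst _ _ _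
  have hs₂ : s ≫ pullback.snd _ _ =
    pullback.snd (torus k Q).hom (affineOver k (ConeRing k σ.1)).hom := pullback.lift_snd _ _ _
  have h1 : s ≫ F.preimageChart k (torus k Q) σ = 𝟙 _ := by
    apply pullback.hom_ext
    · rw [Category.assoc, preimageChart_fst, ← Category.assoc, hs₁, Category.id_comp]
      exact Over.whiskerLeft_left_fst (F.ιOver k σ)
    · rw [Category.assoc, preimageChart_snd, hs₂, Category.id_comp]
  have h2 : pullback.fst (snd (torus k Q) (F.variety k)).left (F.ι k σ) ≫
      (F.torusAct k j).left = F.chartAct k j σ :=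
    Scheme.OpenCover.map_glueMorphismsOverOfLocallyDirected_left
      ((F.cover k).pullback₁ (snd (torus k Q) (F.variety k)).left)
      (fun σ => F.chartAct k j σ)
      (fun {σ τ} h => F.chartAct_comp k j (σ := σ) (τ := τ) (leOfHom h))
      (fun σ => F.chartAct_hom k j σ) σ
  ext1
  rw [Over.comp_left, ← hs₁, Category.assoc, h2, chartAct]
  exact (Category.assoc _ _ _).symm.trans ((congrArg (· ≫ _) h1).trans (Category.id_comp _))

end Action

section Cycles

variable (k : Type u) [Field k]

attribute [local instance] MvPolynomial.gradedAlgebra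

/-- The projective line over `k`, as the `Proj` of the polynomial ring in two variables. -/
def projLine : Over (Spec (.of k)) :=
  Over.mk (Proj.toSpecZero (MvPolynomial.homogeneousSubmodule (Fin 2) k) ≫
    Spec.map (CommRingCat.ofHom
      (algebraMap k (MvPolynomial.homogeneousSubmodule (Fin 2) k 0))))

open Classical in
/-- The cycle `[Z]` of an irreducible closed subset `Z`, taken with its reduced structure: it has
coefficient one at the generic point of `Z` and zero elsewhere. -/
def primeCycle {X : Scheme.{u}} (Z : Set X) : AlgebraicCycle X ℤ where
  toFun x := if IsGenericPoint x Z then 1 else 0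
  supportWithinDomain' := fun _ _ => Set.mem_univ _
  supportLocallyFiniteWithinDomain' := by
    intro z _
    refine ⟨Set.univ, Filter.univ_mem, Set.Subsingleton.finite ?_⟩
    intro x hx y hy
    have h1 : IsGenericPoint x Z := by
      by_contra h
      exact hx.2 (if_neg h)
    have h2 : IsGenericPoint y Z := by
      by_contra h
      exact hy.2 (if_neg h)
    exact h1.eq h2

open Classical in
/-- The proper pushforward of cycles: the cycle `[Z]` goes to `deg(Z / f(Z)) [f(Z)]` if
`dim f(Z) = dim Z`, and to zero otherwise. (The height of a point is the dimension of its
closure.) -/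
def pushforward {X Y : Scheme.{u}} (f : X ⟶ Y) [IsProper f] (c : AlgebraicCycle X ℤ) :
    AlgebraicCycle Y ℤ :=
  AlgebraicCycle.map f Order.height Order.height c

variable {k}

/-- The scheme-theoretic fibre `K_a` of `K → V × ℙ¹ → ℙ¹` over a rational point `a`. -/
abbrev fiberAt {K V : Over (Spec (.of k))} (i : K ⟶ V ⊗ projLine k)
    (a : 𝟙_ (Over (Spec (.of k))) ⟶ projLine k) : Scheme.{u} :=
  pullback (i ≫ snd V (projLine k)).left a.left

/-- The morphism `K_a → V` from the fibre of `K → V × ℙ¹ → ℙ¹` over a rational point `a`. -/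
def fiberMap {K V : Over (Spec (.of k))} (i : K ⟶ V ⊗ projLine k)
    (a : 𝟙_ (Over (Spec (.of k))) ⟶ projLine k) : fiberAt i a ⟶ V.left :=
  pullback.fst _ _ ≫ (i ≫ fst V (projLine k)).left

/-- The multiplicity of a point of `V` in the cycle of the fibre `K_a ⊆ V` of a closed subscheme
`K ⊆ V × ℙ¹`: at the generic point of an irreducible component it is the length of the local ring
of `K_a`, and at other points it is zero (the local ring has infinite length there). -/
def fiberMultiplicity {K V : Over (Spec (.of k))} (i : K ⟶ V ⊗ projLine k)
    (a : 𝟙_ (Over (Spec (.of k))) ⟶ projLine k) (x : V.left) : ℤ :=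
  ∑ᶠ z : {z : fiberAt i a // fiberMap i a z = x},
    ((Module.length ((fiberAt i a).presheaf.stalk z.1)
      ((fiberAt i a).presheaf.stalk z.1)).toNat : ℤ)

/-- The closed subvariety `K ⊆ V × ℙ¹`, dominating `ℙ¹`, induces a rational equivalence of the cycles
`c` and `c'`: they are the cycles of its fibres over two distinct rational points of `ℙ¹`. -/
structure InducesRationalEquivalence {K V : Over (Spec (.of k))} (i : K ⟶ V ⊗ projLine k)
    (c c' : AlgebraicCycle V.left ℤ) : Prop where
  isIntegral : IsIntegral K.left
  isClosedImmersion : IsClosedImmersion i.left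
  isDominant : IsDominant (i ≫ snd V (projLine k)).left
  exists_fibers : ∃ a b : 𝟙_ (Over (Spec (.of k))) ⟶ projLine k, a ≠ b ∧
    (∀ x, c x = fiberMultiplicity i a x) ∧ (∀ x, c' x = fiberMultiplicity i b x)

/-- A scheme has dimension `l`, for an integer `l`. -/
def HasDim (X : Scheme.{u}) (l : ℤ) : Prop := ∃ n : ℕ, topologicalKrullDim X = n ∧ (n : ℤ) = l

/-- The closure of the point `x` has dimension `l`, for an integer `l`. -/
def PointHasDim {X : Scheme.{u}} (x : X) (l : ℤ) : Prop :=
  ∃ n : ℕ, Order.height x = n ∧ (n : ℤ) = l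

variable (V : Over (Spec (.of k)))

/-- The group of `l`-dimensional cycles. -/
def cycles (l : ℤ) : AddSubgroup (AlgebraicCycle V.left ℤ) where
  carrier := {c | ∀ x, c x ≠ 0 → PointHasDim x l}
  zero_mem' := fun _ h => absurd rfl h
  add_mem' := by
    intro a b ha hb x hx
    by_cases h : a x = 0
    · refine hb x fun h' => hx ?_
      change a x + b x = 0
      rw [h, h', add_zero]
    · exact ha x h
  neg_mem' := by
    intro a ha x hx
    refine ha x fun h => hx ?_
    change - a x = 0
    rw [h, neg_zero]

/-- The group of `l`-dimensional cycles rationally equivalent to zero: it is generated by the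
differences of the fibres of `(l+1)`-dimensional subvarieties of `V × ℙ¹` dominating `ℙ¹`. -/
def ratCycles (l : ℤ) : AddSubgroup (AlgebraicCycle V.left ℤ) :=
  AddSubgroup.closure {d | ∃ (K : Over (Spec (.of k))) (i : K ⟶ V ⊗ projLine k)
    (c c' : AlgebraicCycle V.left ℤ), HasDim K.left (l + 1) ∧
      InducesRationalEquivalence i c c' ∧ d = c - c'}

/-- The Chow group `A_l(V)`. -/
abbrev Chow (l : ℤ) : Type u := cycles V l ⧸ (ratCycles V l).addSubgroupOf (cycles V l)

/-- The cycles `c` and `c'` are `l`-dimensional and have the same class in `A_l(V)`. -/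
def EqInChow (l : ℤ) (c c' : AlgebraicCycle V.left ℤ) : Prop :=
  ∃ (h : c ∈ cycles V l) (h' : c' ∈ cycles V l),
    (QuotientAddGroup.mk ⟨c, h⟩ : Chow V l) = QuotientAddGroup.mk ⟨c', h'⟩

end Cycles

section Equivariant

variable {k : Type u} [Field k] {Q : Type u} [AddCommGroup Q] {T X B : Over (Spec (.of k))}

/-- The diagonal action of `T` on `X × B`. -/
def diagAct (a : T ⊗ X ⟶ X) (b : T ⊗ B ⟶ B) : T ⊗ (X ⊗ B) ⟶ X ⊗ B :=
  lift ((T ◁ fst X B) ≫ a) ((T ◁ snd X B) ≫ b)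

/-- The subset `Z` of `X` is invariant under the action of `T`: the action maps `T × Z` into `Z`.
For a torus `T` and a closed subset `Z` this is the same as invariance of `Z` with its reduced scheme
structure, because `T × Z` is reduced. -/
def IsInvariant (act : T ⊗ X ⟶ X) (Z : Set X.left) : Prop :=
  ∀ p : (T ⊗ X).left, (snd T X).left p ∈ Z → act.left p ∈ Z

variable (k) in
/-- The affine space `𝔸^(r m)` with coordinates `x_(i,j)`, for `i < r` and `j < m`. -/
abbrev affineSpace (r m : ℕ) : Over (Spec (.of k)) :=
  affineOver k (MvPolynomial (Fin r × Fin m) k)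

variable (k) in
/-- The representation of `T_Q` on `𝔸^(r m)` in which `T_Q` acts on the coordinates `x_(i,j)` through
the `i`-th coordinate character of a basis of `Q`. -/
def affineSpaceAct {r : ℕ} (b : Module.Basis (Fin r) ℤ Q) (m : ℕ) :
    torus k Q ⊗ affineSpace k r m ⟶ affineSpace k r m :=
  ofCoaction k (MvPolynomial.aeval fun p =>
    (AddMonoidAlgebra.single (b.coord p.1) 1 : TorusRing k Q) ⊗ₜ MvPolynomial.X p)

variable (k) in
/-- The open subset `(𝔸^m ∖ 0)^r` of `𝔸^(r m)`, on which `T_Q` acts freely; its complement has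
codimension `m` (or is empty). -/
def freeLocus (r m : ℕ) : (affineSpace k r m).left.Opens :=
  ⨅ i : Fin r, ⨆ j : Fin m,
    (PrimeSpectrum.basicOpen (MvPolynomial.X (i, j) : MvPolynomial (Fin r × Fin m) k))

variable (k) in
/-- The open subscheme `U = (𝔸^m ∖ 0)^r` of `𝔸^(r m)`. -/
def freeSpace (r m : ℕ) : Over (Spec (.of k)) :=
  Over.mk ((freeLocus k r m).ι ≫ (affineSpace k r m).hom)

variable (k) in
/-- The open immersion `U → 𝔸^(r m)`. -/
def freeIncl (r m : ℕ) : freeSpace k r m ⟶ affineSpace k r m :=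
  Over.homMk (freeLocus k r m).ι

/-- A subset of `V × U` is invariant under the diagonal action of `T_Q`. -/
def IsInvariantInMixed {V : Over (Spec (.of k))} (act : torus k Q ⊗ V ⟶ V) {r : ℕ}
    (b : Module.Basis (Fin r) ℤ Q) (m : ℕ) (Z : Set (V ⊗ freeSpace k r m).left) : Prop :=
  IsInvariant (diagAct act (affineSpaceAct k b m)) ((V ◁ freeIncl k r m).left '' Z)

/-- A subset of `(V × U) × ℙ¹` is invariant under the action of `T_Q` which is diagonal on `V × U` and
trivial on `ℙ¹`. -/
def IsInvariantInMixedLine {V : Over (Spec (.of k))} (act : torus k Q ⊗ V ⟶ V) {r : ℕ}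
    (b : Module.Basis (Fin r) ℤ Q) (m : ℕ)
    (Z : Set ((V ⊗ freeSpace k r m) ⊗ projLine k).left) : Prop :=
  IsInvariant (diagAct (diagAct act (affineSpaceAct k b m)) (snd (torus k Q) (projLine k)))
    (((V ◁ freeIncl k r m) ▷ projLine k).left '' Z)

variable {V : Over (Spec (.of k))} (act : torus k Q ⊗ V ⟶ V) {r : ℕ}
  (b : Module.Basis (Fin r) ℤ Q) (m : ℕ)

/-- The group of `T_Q`-invariant `l`-dimensional cycles on `V × U`. -/
def invCycles (l : ℤ) : AddSubgroup (AlgebraicCycle (V ⊗ freeSpace k r m).left ℤ) where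
  carrier := {c | ∀ x, c x ≠ 0 → PointHasDim x l ∧ IsInvariantInMixed act b m (closure {x})}
  zero_mem' := fun _ h => absurd rfl h
  add_mem' := by
    intro a b ha hb x hx
    by_cases h : a x = 0
    · refine hb x fun h' => hx ?_
      change a x + b x = 0
      rw [h, h', add_zero]
    · exact ha x h
  neg_mem' := by
    intro a ha x hx
    refine ha x fun h => hx ?_
    change - a x = 0
    rw [h, neg_zero]

/-- The group generated by the differences of the fibres of `T_Q`-invariant `(l+1)`-dimensional
subvarieties of `(V × U) × ℙ¹` dominating `ℙ¹`. -/
def invRatCycles (l : ℤ) : AddSubgroup (AlgebraicCycle (V ⊗ freeSpace k r m).left ℤ) :=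
  AddSubgroup.closure {d | ∃ (K : Over (Spec (.of k)))
    (i : K ⟶ (V ⊗ freeSpace k r m) ⊗ projLine k)
    (c c' : AlgebraicCycle (V ⊗ freeSpace k r m).left ℤ), HasDim K.left (l + 1) ∧
      IsInvariantInMixedLine act b m (Set.range i.left) ∧
      InducesRationalEquivalence i c c' ∧ d = c - c'}

/-- The Chow group of the mixed quotient `(V × U) / T_Q` in degree `l + r m`, where `U = (𝔸^m ∖ 0)^r`
and `T_Q` has rank `r`. For `m` large enough (`m > dim V - r - l` suffices) this is, by definition, the
Chow group `A_l([V/T_Q])` of the quotient stack, whose dimension is `dim V - r`. As `V × U` is a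
`T_Q`-torsor over the mixed quotient, the `d`-dimensional subvarieties of the mixed quotient are the
`T_Q`-invariant `(d + r)`-dimensional subvarieties of `V × U`, and likewise for their products with
`ℙ¹`; the group is described in these terms. -/
abbrev StackChow (l : ℤ) : Type u :=
  invCycles act b m (l + r * m + r) ⧸
    (invRatCycles act b m (l + r * m + r)).addSubgroupOf (invCycles act b m (l + r * m + r))

/-- The `T_Q`-invariant cycles `c` and `c'` on `V × U` define the same class in the group
`A_l([V/T_Q])`, computed with `U = (𝔸^m ∖ 0)^r`. -/
def EqInStackChow (l : ℤ) (c c' : AlgebraicCycle (V ⊗ freeSpace k r m).left ℤ) : Prop :=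
  ∃ (h : c ∈ invCycles act b m (l + r * m + r)) (h' : c' ∈ invCycles act b m (l + r * m + r)),
    (QuotientAddGroup.mk ⟨c, h⟩ : StackChow act b m l) = QuotientAddGroup.mk ⟨c', h'⟩

/-- The cycle on `V × U` which represents the class `[Z/T_Q]` of a `T_Q`-invariant closed subvariety
`Z ⊆ V`. -/
def quotientCycle (r m : ℕ) (Z : Set V.left) : AlgebraicCycle (V ⊗ freeSpace k r m).left ℤ :=
  primeCycle ((fst V (freeSpace k r m)).left ⁻¹' Z)

instance {V W : Over (Spec (.of k))} (f : V ⟶ W) [IsProper f.left] (U : Over (Spec (.of k))) :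
    IsProper (f ▷ U).left := by
  have h : IsProper (pullback.map V.hom U.hom W.hom U.hom f.left (𝟙 _) (𝟙 _)
      (by simp) (by simp)) :=
    MorphismProperty.pullbackMap (P := @IsProper) (i₁ := f.left) (i₂ := 𝟙 U.left)
      inferInstance inferInstance (by simp) (by simp)
  exact h

end Equivariant

section Displacement

variable {N N' : Type u} [AddCommGroup N] [AddCommGroup N']

/-- A vector `v` is generic with respect to a set of cones and a sublattice `L`: for each of the cones
`δ` whose dimension is complementary to that of `L`, the affine space `L_ℝ + v` meets `δ` in at most
one point, which then lies in the relative interior of `δ`. -/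
def IsGeneric (cones : Set (PointedCone ℝ (RealSpace N))) (L : Submodule ℤ N) (v : N) : Prop :=
  ∀ δ ∈ cones, Module.finrank ℤ (coneLattice δ) + Module.finrank ℤ L = Module.finrank ℤ N →
    {x | x ∈ δ ∧ x - toReal N v ∈ realSpan L}.Subsingleton ∧
      {x | x ∈ δ ∧ x - toReal N v ∈ realSpan L} ⊆ relInterior δ

/-- The cones of the star of `τ'`, in `N / N_τ'`: the fan of the closed stratum `V(τ')`. -/
def Fan.starCones (F : Fan N) (τ' : F.cones) :
    Set (PointedCone ℝ (RealSpace (N ⧸ coneLattice τ'.1))) :=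
  {ω | ∃ δ ∈ F.cones, τ'.1 ≤ δ ∧ ω = δ.map (realMap (coneLattice τ'.1).mkQ)}

/-- The image of `N` in `N' / N_τ'`, for a map of lattices `f : N → N'`. -/
def imageInQuotient (f : N →ₗ[ℤ] N') (σ : PointedCone ℝ (RealSpace N')) :
    Submodule ℤ (N' ⧸ coneLattice σ) :=
  LinearMap.range ((coneLattice σ).mkQ ∘ₗ f)

/-- The vector `v` is generic with respect to the image of `V(τ)` in `V(τ')`: its class in
`N' / N_τ'` is generic with respect to the fan of `V(τ')` and the saturation of the image of `N`, which
is the cocharacter lattice of the torus whose closure in `V(τ')` is the image of `V(τ)`. -/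
def IsGenericVector (F' : Fan N') (f : N →ₗ[ℤ] N') (τ' : F'.cones) (v : N') : Prop :=
  IsGeneric (F'.starCones τ') (saturation (imageInQuotient f τ'.1)) ((coneLattice τ'.1).mkQ v)

/-- The set `Δ^τ(v)` of cones `δ` of the fan of the target which contain `τ'`, have dimension
`dim N' - dim f(N) + dim (f(N) ∩ N_τ')`, and meet the affine space `f(N)_ℝ + v`. -/
def displacementCones (F' : Fan N') (f : N →ₗ[ℤ] N') (τ' : F'.cones) (v : N') : Set F'.cones :=
  {δ | τ'.1 ≤ δ.1 ∧
    Module.finrank ℤ (coneLattice δ.1) + Module.finrank ℤ (LinearMap.range f) =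
      Module.finrank ℤ N' +
        Module.finrank ℤ (LinearMap.range f ⊓ coneLattice τ'.1 : Submodule ℤ N') ∧
    ∃ x ∈ δ.1, x - toReal N' v ∈ realSpan (LinearMap.range f)}

/-- The index `m(δ) = [N' : f(N) + N_δ]` (zero if it is infinite). -/
def displacementIndex (f : N →ₗ[ℤ] N') (δ : PointedCone ℝ (RealSpace N')) : ℕ :=
  (LinearMap.range f ⊔ coneLattice δ).toAddSubgroup.index

/-- The index of the image of `N` in `N' / N_τ'` in its saturation (zero if it is infinite). -/
def saturationIndex (f : N →ₗ[ℤ] N') (σ : PointedCone ℝ (RealSpace N')) : ℕ :=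
  (imageInQuotient f σ).toAddSubgroup.relIndex (saturation (imageInQuotient f σ)).toAddSubgroup

/-- The closed subset `V(δ)` of `V(τ')`, for a cone `δ` containing `τ'`. -/
def Fan.substratum (k : Type u) [Field k] (F : Fan N) (τ' δ : F.cones) :
    Set (F.closedStratum k τ').left :=
  (F.strIncl k τ').left ⁻¹' (F.stratum k δ)

end Displacement

end Toric

end

open Toric

/-!
The pushforward of a stratum under a toric morphism is computed by degenerating its image to a union
of strata.

On tori, the map `f : V_Y(τ) ⟶ V_X(τ')` is dual to a homomorphism of character lattices, which
factors as the surjection from the characters of the torus of `V_X(τ')` onto the dual of `N'`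
(`imageRestrict`), followed by an injection whose cokernel has order `[N' : q(f_N(N(Y)))]` if the
ranks agree. So `f(V_Y(τ))` is the closure of the subtorus of `V_X(τ')` with character lattice the
dual of `N'` (`range_stratumMap`), and the pushforward is this closure times the index, or zero if
the dimension drops (`pushforward_stratumMap`). The degree is that of an extension `k[M] ⊆ k[L]` of
group rings, which is free of rank `[L : M]` (`Atlas.residueDegree_torus`).

For the degeneration, the subtorus is moved by a one-parameter subgroup `v'`, and `K` is the closure
of the graph of this family in `V_X(τ') × ℙ¹`. Closed strata, the spaces `(𝔸^m ∖ 0)^r` and their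
products are covered by charts `Spec k[S]` with a common torus (`Atlas`). In such a chart and over
`𝔸¹`, `K` is the spectrum of the monoid algebra of the image of `S × ℕ` under
`(m, a) ↦ (π m, v' m + a)` (`degMonoid`), and the coordinate of `ℙ¹` is the character `(0, 1)`. The
fibre over one is the closure of the subtorus (`sum_localLength_general`). The fibre over zero
contains the closed orbit of the chart exactly if a positive multiple of `v'` agrees modulo the dual
of `M` with a point in the relative interior of the cone dual to `S` (`Meets`). If then `π` is
injective on the units of `S`, the multiplicity of the fibre at the generic point of the closed
orbit is the index of the image of the units (`sum_localLength_special`): choose a representative of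
each coset of the group generated by the units and `(0, 1)`; the functions on the fibre are a free
module over the group ring of the units, with the representatives as a basis, and the fibre is
reduced to the orbit modulo nilpotents (`localLength_orbitIdeal`). The statements on both fibres are
combined in `Atlas.exists_degeneration`.

What remains is to match `Meets` with the condition `(f_N(N(Y))_ℝ + v) ∩ δ ≠ ∅`. Farkas' lemma turns
the dual monoid of a rational cone back into the cone (`toReal_mem_of_forall`), and for a cone
transverse to `N'` of complementary dimension both conditions say that the projection of `v` along
`N'` lies in the cone, in its relative interior as `v` is generic. Genericity constrains only the
cones whose image has complementary dimension, so `v` is replaced by a vector close to a multiple of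
it, which also avoids the proper subspaces spanned by `N'` and a cone
(`IsGenericVector.exists_direction`). The index of the units at `δ` times `[N' : q(f_N(N(Y)))]` is
`m(δ)` (`IsGenericVector.displacementIndex_eq`), which gives the formula and the divisibility.

A torus which acts through `N(Y)` acts on `V_X(τ')` through a homomorphism to the subtorus, and so
preserves each translate of it; hence `K` is invariant (`Atlas.IsToricAction.isInvariant_degTorus`).
For the quotient stacks the same argument is applied to the product atlas of
`V_X(τ') × (𝔸^m ∖ 0)^r`, with the identity on the second factor (`Atlas.isLimitCycle_prod_finsum`,
`Atlas.prod_torus_whiskerRight`).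
-/

universe v w

namespace Toric

section

/-! ### Farkas' lemma and Gordan's lemma -/

/-- Farkas' lemma for finitely many linear forms over a linearly ordered field: a form which is
nonnegative wherever the given forms are is a nonnegative combination of them. -/
theorem farkas {F V ι : Type*} [Field F] [LinearOrder F] [IsStrictOrderedRing F] [AddCommGroup V]
    [Module F V] (s : Finset ι) (a : ι → Module.Dual F V) (c : Module.Dual F V)
    (h : ∀ x, (∀ i ∈ s, 0 ≤ a i x) → 0 ≤ c x) :
    ∃ l : ι → F, (∀ i, 0 ≤ l i) ∧ c = ∑ i ∈ s, l i • a i := by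
  classical
  induction s using Finset.induction_on generalizing a c with
  | empty =>
    refine ⟨0, fun _ => le_rfl, ?_⟩
    ext x
    have h1 := h x (by simp)
    have h2 := h (-x) (by simp)
    rw [map_neg] at h2
    simp only [Finset.sum_empty, LinearMap.zero_apply]
    linarith
  | insert j s hj ih =>
    by_cases hc : ∀ x, (∀ i ∈ s, 0 ≤ a i x) → 0 ≤ c x
    · obtain ⟨l, hl, rfl⟩ := ih a c hc
      refine ⟨Function.update l j 0, fun i => ?_, ?_⟩
      · by_cases hi : i = j
        · simp [hi]
        · simp [hi, hl i]
      · rw [Finset.sum_insert hj, Function.update_self, zero_smul, zero_add]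
        refine Finset.sum_congr rfl fun i hi => ?_
        rw [Function.update_of_ne (by rintro rfl; exact hj hi)]
    · push Not at hc
      obtain ⟨x₀, hx₀, hcx₀⟩ := hc
      have hneg : a j x₀ < 0 := by
        by_contra! hcon
        refine absurd (h x₀ fun i hi => ?_) (not_le.2 hcx₀)
        rcases Finset.mem_insert.1 hi with rfl | hi
        · exact hcon
        · exact hx₀ i hi
      -- project along `x₀` to the hyperplane where the last form vanishes
      obtain ⟨l, hl, hl'⟩ := ih (fun i => a i - (a i x₀ / a j x₀) • a j)
        (c - (c x₀ / a j x₀) • a j) (by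
          intro x hx
          have h1 := h (x - (a j x / a j x₀) • x₀) (by
            intro i hi
            rcases Finset.mem_insert.1 hi with rfl | hi
            · simp [hneg.ne]
            · have := hx i hi
              simp only [LinearMap.sub_apply, LinearMap.smul_apply, smul_eq_mul] at this
              simp only [map_sub, map_smul, smul_eq_mul]
              calc (0 : F) ≤ _ := this
                _ = _ := by ring)
          simp only [map_sub, map_smul, smul_eq_mul] at h1
          simp only [LinearMap.sub_apply, LinearMap.smul_apply, smul_eq_mul]
          calc (0 : F) ≤ _ := h1
            _ = _ := by ring)
      refine ⟨Function.update l j (c x₀ / a j x₀ - ∑ i ∈ s, l i * (a i x₀ / a j x₀)),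
        fun i => ?_, ?_⟩
      · by_cases hi : i = j
        · subst hi
          rw [Function.update_self, sub_nonneg]
          refine le_trans (Finset.sum_nonpos fun i hi => ?_)
            (div_nonneg_of_nonpos hcx₀.le hneg.le)
          exact mul_nonpos_of_nonneg_of_nonpos (hl i)
            (div_nonpos_of_nonneg_of_nonpos (hx₀ i hi) hneg.le)
        · simp [hi, hl i]
      · have hs : ∑ i ∈ s, Function.update l j
            (c x₀ / a j x₀ - ∑ i ∈ s, l i * (a i x₀ / a j x₀)) i • a i = ∑ i ∈ s, l i • a i :=
          Finset.sum_congr rfl fun i hi => by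
            rw [Function.update_of_ne (by rintro rfl; exact hj hi)]
        rw [Finset.sum_insert hj, Function.update_self, hs]
        have h2 : ∑ i ∈ s, l i • (a i - (a i x₀ / a j x₀) • a j) =
            ∑ i ∈ s, l i • a i - (∑ i ∈ s, l i * (a i x₀ / a j x₀)) • a j := by
          simp only [smul_sub, Finset.sum_sub_distrib, Finset.sum_smul, smul_smul]
        rw [h2, sub_eq_iff_eq_add] at hl'
        ext x
        have := LinearMap.congr_fun hl' x
        simp only [LinearMap.add_apply, LinearMap.sub_apply, LinearMap.smul_apply,
          smul_eq_mul] at this ⊢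
        rw [this]
        ring

lemma neg_mem_of_nsmul_neg_mem {N : Type*} [AddCommGroup N] {T : AddSubmonoid N} {s : N}
    (hs : s ∈ T) {c : ℕ} (hc : 0 < c)
    (h : c • (-s) ∈ T) : -s ∈ T := by
  obtain ⟨d, rfl⟩ := Nat.exists_eq_succ_of_ne_zero hc.ne'
  have : -s = (d + 1) • (-s) + d • s := by
    rw [succ_nsmul, smul_neg]; abel
  rw [this]
  exact add_mem h (nsmul_mem hs d)

section Lattice

variable {N : Type*} [AddCommGroup N] [Module.Free ℤ N] [Module.Finite ℤ N]

lemma exists_nat_smul_int {ι : Type*} (s : Finset ι) (l : ι → ℚ) :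
    ∃ c : ℕ, 0 < c ∧ ∃ m : ι → ℤ, ∀ i ∈ s, (c : ℚ) * l i = m i := by
  classical
  refine ⟨∏ i ∈ s, (l i).den, Finset.prod_pos fun i _ => (l i).pos,
    fun i => (∏ j ∈ s.erase i, (l j).den : ℕ) * (l i).num, fun i hi => ?_⟩
  rw [← Finset.mul_prod_erase s _ hi]
  push_cast
  rw [mul_right_comm, mul_comm ((l i).den : ℚ), Rat.mul_den_eq_num, mul_comm]

/-- Farkas' lemma for lattices. -/
theorem farkas_int {ι : Type*} (s : Finset ι) (a : ι → N) (n : N)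
    (h : ∀ φ : Module.Dual ℤ N, (∀ i ∈ s, 0 ≤ φ (a i)) → 0 ≤ φ n) :
    ∃ c : ℕ, 0 < c ∧ ∃ l : ι → ℕ, c • n = ∑ i ∈ s, l i • a i := by
  classical
  let b := Module.Free.chooseBasis ℤ N
  let V := N →ₗ[ℤ] ℚ
  let ev : N → Module.Dual ℚ V := fun x =>
    { toFun := fun φ => φ x, map_add' := fun _ _ => rfl, map_smul' := fun _ _ => rfl }
  obtain ⟨l, hl, hl'⟩ := farkas s (fun i => ev (a i)) (ev n) (by
    intro φ hφ
    obtain ⟨c, hc, m, hm⟩ := exists_nat_smul_int Finset.univ (fun i => φ (b i))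
    let ψ : Module.Dual ℤ N := b.constr ℤ m
    have hψ : ∀ x, (ψ x : ℚ) = c * φ x := by
      intro x
      have : (Int.castAddHom ℚ).toIntLinearMap ∘ₗ ψ = (c : ℤ) • φ := by
        refine b.ext fun i => ?_
        rw [LinearMap.smul_apply, zsmul_eq_mul, Int.cast_natCast, hm i (Finset.mem_univ i)]
        simp [ψ]
      have := LinearMap.congr_fun this x
      rwa [LinearMap.smul_apply, zsmul_eq_mul, Int.cast_natCast] at this
    have := h ψ (fun i hi => by
      have h1 : (0 : ℚ) ≤ ψ (a i) := by
        rw [hψ]; exact mul_nonneg (Nat.cast_nonneg c) (hφ i hi)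
      exact_mod_cast h1)
    have h2 : (0 : ℚ) ≤ ψ n := by exact_mod_cast this
    rw [hψ] at h2
    exact nonneg_of_mul_nonneg_right h2 (by exact_mod_cast hc))
  obtain ⟨c, hc, m, hm⟩ := exists_nat_smul_int s l
  refine ⟨c, hc, fun i => (m i).toNat, ?_⟩
  apply b.repr.injective
  ext j
  let φ : V := (Int.castAddHom ℚ).toIntLinearMap ∘ₗ b.coord j
  have h1 : φ n = ∑ i ∈ s, l i * φ (a i) := by
    have := LinearMap.congr_fun hl' φ
    simpa [ev] using this
  have h2 : ((c : ℤ) * b.coord j n : ℚ) = ∑ i ∈ s, (m i : ℚ) * (b.coord j (a i) : ℚ) := by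
    change ((c : ℤ) : ℚ) * φ n = ∑ i ∈ s, (m i : ℚ) * φ (a i)
    rw [h1, Finset.mul_sum]
    refine Finset.sum_congr rfl fun i hi => ?_
    rw [← hm i hi, mul_assoc]
    simp
  have h3 : (c : ℤ) * b.coord j n = ∑ i ∈ s, m i * b.coord j (a i) := by exact_mod_cast h2
  have h4 : ∀ i ∈ s, ((m i).toNat : ℤ) = m i := by
    intro i hi
    refine Int.toNat_of_nonneg ?_
    have : (0 : ℚ) ≤ m i := by rw [← hm i hi]; exact mul_nonneg (Nat.cast_nonneg c) (hl i)
    exact_mod_cast this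
  simp only [Module.Basis.coord_apply] at h3
  simp only [map_nsmul, map_sum, Finsupp.coe_smul, Pi.smul_apply, Finsupp.coe_finsetSum,
    Finset.sum_apply, nsmul_eq_mul]
  rw [h3]
  refine Finset.sum_congr rfl fun i hi => ?_
  rw [← h4 i hi]
  simp

/-- A finitely generated submonoid of a lattice has an integral functional which is nonnegative on
it and vanishes only on its units. -/
theorem exists_functional_pos {T : AddSubmonoid N} (hT : T.FG) :
    ∃ Y : Module.Dual ℤ N, ∀ s ∈ T, 0 ≤ Y s ∧ (Y s = 0 → -s ∈ T) := by
  classical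
  obtain ⟨g, rfl⟩ := hT
  set T := AddSubmonoid.closure (g : Set N) with hTdef
  have key : ∀ h : N, ∃ φ : Module.Dual ℤ N, (∀ x ∈ g, 0 ≤ φ x) ∧
      (h ∈ g → -h ∉ T → 0 < φ h) := by
    intro h
    by_cases hh : h ∈ g ∧ -h ∉ T
    · by_contra! hcon
      obtain ⟨c, hc, l, hl⟩ := farkas_int g id (-h) (fun φ hφ => by
        obtain ⟨-, -, h3⟩ := hcon φ hφ
        rw [map_neg]
        linarith)
      refine hh.2 (neg_mem_of_nsmul_neg_mem (AddSubmonoid.subset_closure hh.1) hc ?_)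
      rw [hl]
      exact sum_mem fun i hi => nsmul_mem (AddSubmonoid.subset_closure hi) _
    · exact ⟨0, by simp, fun h1 h2 => absurd ⟨h1, h2⟩ hh⟩
  choose φ hφ hφ' using key
  refine ⟨∑ h ∈ g, φ h, fun s hs => ?_⟩
  induction hs using AddSubmonoid.closure_induction with
  | mem x hx =>
    simp only [LinearMap.coe_sum, Finset.sum_apply]
    refine ⟨Finset.sum_nonneg fun h _ => hφ h x hx, fun h0 => ?_⟩
    by_contra hcon
    exact (hφ' x hx hcon).ne' ((Finset.sum_eq_zero_iff_of_nonneg fun h _ => hφ h x hx).1 h0 x hx)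
  | zero => simp
  | add x y _ _ hx hy =>
    rw [map_add]
    refine ⟨add_nonneg hx.1 hy.1, fun h0 => ?_⟩
    rw [neg_add]
    exact add_mem (hx.2 (by linarith [hx.1, hy.1])) (hy.2 (by linarith [hx.1, hy.1]))

/-- Gordan's lemma. -/
theorem fg_of_nonneg {Λ ι : Type*} [AddCommGroup Λ] [AddGroup.FG Λ] [Finite ι] (f : Λ →+ (ι → ℤ))
    (S : AddSubmonoid Λ) (hS : ∀ x, x ∈ S ↔ 0 ≤ f x) : S.FG := by
  classical
  have : AddMonoid.FG Λ := AddGroup.fg_iff_addMonoid_fg.1 inferInstance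
  obtain ⟨g, hg⟩ := AddMonoid.FG.fg_top (M := Λ)
  let A := (g ⊕ ι → ℕ)
  let p : A →+ Λ := ∑ i : g, (AddMonoidHom.comp (multiplesHom Λ i.1)
    (Pi.evalAddMonoidHom (fun _ => ℕ) (Sum.inl i)) : A →+ Λ)
  let c : A →+ (ι → ℤ) :=
    { toFun := fun a i => (a (Sum.inr i) : ℤ)
      map_zero' := by ext; simp
      map_add' := fun a b => by ext i; exact Nat.cast_add _ _ }
  have hp : ∀ (n : g → ℕ) (m : ι → ℕ), p (Sum.elim n m) = ∑ i, n i • i.1 := by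
    intro n m
    simp only [p, AddMonoidHom.finsetSum_apply]
    rfl
  have hp' : ∀ x : Λ, ∃ n : g → ℕ, ∑ i, n i • i.1 = x := by
    intro x
    have hx : x ∈ AddSubmonoid.closure (g : Set Λ) := by rw [hg]; trivial
    induction hx using AddSubmonoid.closure_induction with
    | mem x hx =>
      exact ⟨Pi.single ⟨x, hx⟩ 1, by
        rw [Finset.sum_eq_single ⟨x, hx⟩]
        · simp
        · intro i _ hi; simp [hi]
        · simp⟩
    | zero => exact ⟨0, by simp⟩
    | add x y _ _ hx hy =>
      obtain ⟨n, rfl⟩ := hx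
      obtain ⟨m, rfl⟩ := hy
      exact ⟨n + m, by simp [add_smul, Finset.sum_add_distrib]⟩
  have hfg : ((f.comp p).eqLocusM c).FG := AddSubmonoid.fg_eqLocusM _ _
  have : S = ((f.comp p).eqLocusM c).map p := by
    ext x
    rw [hS, AddSubmonoid.mem_map]
    constructor
    · intro hx
      obtain ⟨n, hn⟩ := hp' x
      refine ⟨Sum.elim n fun i => (f x i).toNat, ?_, (hp _ _).trans hn⟩
      change f (p _) = c _
      rw [hp, hn]
      ext i
      simp only [AddMonoidHom.coe_mk, ZeroHom.coe_mk, Sum.elim_inr, c]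
      exact (Int.toNat_of_nonneg (hx i)).symm
    · rintro ⟨a, ha, rfl⟩
      change f (p a) = c a at ha
      rw [ha]
      exact fun i => Int.natCast_nonneg _
  rw [this]
  exact hfg.map p

end Lattice

end

section

/-! ### Rational cones and their dual monoids -/

section Cones

variable {N N' : Type u} [AddCommGroup N] [AddCommGroup N']

lemma pairing_toReal (m : Module.Dual ℤ N) (n : N) : pairing m (toReal N n) = m n := by
  change pairing m ((1 : ℝ) ⊗ₜ n) = _
  simp [pairing]

lemma realMap_toReal (f : N →ₗ[ℤ] N') (n : N) : realMap f (toReal N n) = toReal N' (f n) := by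
  change realMap f ((1 : ℝ) ⊗ₜ n) = (1 : ℝ) ⊗ₜ f n
  simp [realMap]

lemma toReal_injective [Module.Free ℤ N] : Function.Injective (toReal N) := by
  rw [injective_iff_map_eq_zero]
  intro n hn
  let b := Module.Free.chooseBasis ℤ N
  apply b.repr.injective
  ext i
  have := pairing_toReal (b.coord i) n
  rw [hn, map_zero] at this
  simpa using this.symm

/-- A cone is rational polyhedral if it is generated by finitely many lattice points. -/
def IsRational (σ : PointedCone ℝ (RealSpace N)) : Prop :=
  ∃ s : Set N, s.Finite ∧ σ = PointedCone.hull ℝ (toReal N '' s)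

lemma IsRational.map {σ : PointedCone ℝ (RealSpace N)} (h : IsRational σ) (f : N →ₗ[ℤ] N') :
    IsRational (σ.map (realMap f)) := by
  obtain ⟨s, hs, rfl⟩ := h
  refine ⟨f '' s, hs.image f, ?_⟩
  change Submodule.map _ (Submodule.span _ _) = Submodule.span _ _
  rw [Submodule.map_span, ← Set.image_comp, ← Set.image_comp]
  congr 2

lemma nonneg_of_mem_hull {s : Set N} (l : RealSpace N →ₗ[ℝ] ℝ)
    (h : ∀ n ∈ s, 0 ≤ l (toReal N n)) {x : RealSpace N}
    (hx : x ∈ PointedCone.hull ℝ (toReal N '' s)) : 0 ≤ l x := by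
  induction hx using Submodule.span_induction with
  | mem y hy => obtain ⟨z, hz, rfl⟩ := hy; exact h z hz
  | zero => simp
  | add y z _ _ hy hz => rw [map_add]; exact add_nonneg hy hz
  | smul c y _ hy =>
    have : c • y = (c : ℝ) • y := rfl
    rw [this, map_smul]
    exact smul_nonneg c.2 hy

lemma mem_dualMonoid_hull {s : Set N} {m : Module.Dual ℤ N} :
    m ∈ dualMonoid (PointedCone.hull ℝ (toReal N '' s)) ↔ ∀ n ∈ s, 0 ≤ m n := by
  constructor
  · intro h n hn
    have := h _ (PointedCone.subset_hull ⟨n, hn, rfl⟩)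
    rw [pairing_toReal] at this
    exact_mod_cast this
  · intro h x hx
    refine nonneg_of_mem_hull _ (fun n hn => ?_) hx
    rw [pairing_toReal]
    exact_mod_cast h n hn

lemma mem_dualMonoid_map {f : N →ₗ[ℤ] N'} {σ : PointedCone ℝ (RealSpace N)}
    {m : Module.Dual ℤ N'} : m ∈ dualMonoid (σ.map (realMap f)) ↔ m ∘ₗ f ∈ dualMonoid σ := by
  constructor
  · intro h x hx
    rw [pairing_comp]
    exact h _ ⟨x, hx, rfl⟩
  · rintro h _ ⟨x, hx, rfl⟩
    have := h x hx
    rw [pairing_comp] at this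
    exact this

lemma pairing_eq_zero {σ : PointedCone ℝ (RealSpace N)} {m : Module.Dual ℤ N}
    (h : m ∈ dualMonoid σ) (h' : -m ∈ dualMonoid σ) {x : RealSpace N} (hx : x ∈ σ) :
    pairing m x = 0 := by
  have h1 := h x hx
  have h2 := h' x hx
  rw [pairing_neg] at h2
  linarith

lemma neg_mem_dualMonoid {σ : PointedCone ℝ (RealSpace N)} {m : Module.Dual ℤ N}
    (h : ∀ x ∈ σ, pairing m x = 0) : -m ∈ dualMonoid σ := by
  intro x hx
  rw [pairing_neg, h x hx, neg_zero]

lemma pairing_eq_zero_of_coneLattice {σ : PointedCone ℝ (RealSpace N)} (hσ : IsRational σ)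
    {m : Module.Dual ℤ N} (h : ∀ n ∈ coneLattice σ, m n = 0) {x : RealSpace N} (hx : x ∈ σ) :
    pairing m x = 0 := by
  obtain ⟨s, hs, rfl⟩ := hσ
  have h0 : ∀ n ∈ s, m n = 0 := fun n hn =>
    h n (Submodule.subset_span (PointedCone.subset_hull ⟨n, hn, rfl⟩))
  refine le_antisymm ?_ (nonneg_of_mem_hull _ (fun n hn => ?_) hx)
  · have := nonneg_of_mem_hull (-pairing m) (fun n hn => ?_) hx
    · simpa using this
    · simp [pairing_toReal, h0 n hn]
  · rw [pairing_toReal, h0 n hn]; simp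

/-- A lattice point lies in the relative interior of a rational cone: functionals in the dual monoid
which vanish there vanish on the cone. -/
def IsInteriorPoint (σ : PointedCone ℝ (RealSpace N)) (y : N) : Prop :=
  ∀ m ∈ dualMonoid σ, 0 ≤ m y ∧ (m y = 0 → -m ∈ dualMonoid σ)

lemma IsRational.exists_isInteriorPoint {σ : PointedCone ℝ (RealSpace N)} (h : IsRational σ) :
    ∃ d, toReal N d ∈ σ ∧ IsInteriorPoint σ d := by
  classical
  obtain ⟨s, hs, rfl⟩ := h
  refine ⟨∑ n ∈ hs.toFinset, n, ?_, fun m hm => ?_⟩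
  · rw [map_sum]
    exact sum_mem fun n hn => PointedCone.subset_hull ⟨n, hs.mem_toFinset.1 hn, rfl⟩
  · rw [mem_dualMonoid_hull] at hm
    rw [map_sum]
    refine ⟨Finset.sum_nonneg fun n hn => hm n (hs.mem_toFinset.1 hn), fun h0 => ?_⟩
    rw [mem_dualMonoid_hull]
    intro n hn
    rw [Finset.sum_eq_zero_iff_of_nonneg fun n hn => hm n (hs.mem_toFinset.1 hn)] at h0
    simp [h0 n (hs.mem_toFinset.2 hn)]

lemma realMap_mkQ_eq_zero {τ : PointedCone ℝ (RealSpace N)} (hτ : IsRational τ)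
    {x : RealSpace N} (hx : x ∈ τ) : realMap (coneLattice τ).mkQ x = 0 := by
  obtain ⟨s, hs, hs'⟩ := hτ
  have hx' : x ∈ PointedCone.hull ℝ (toReal N '' s) := hs' ▸ hx
  induction hx' using Submodule.span_induction with
  | mem z hz =>
    obtain ⟨n, hn, rfl⟩ := hz
    rw [realMap_toReal]
    have : (coneLattice τ).mkQ n = 0 := by
      rw [Submodule.mkQ_apply, Submodule.Quotient.mk_eq_zero]
      exact Submodule.subset_span hx
    rw [this, map_zero]
  | zero => simp
  | add a b ha hb iha ihb =>
    rw [map_add, iha (hs' ▸ ha), ihb (hs' ▸ hb), add_zero]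
  | smul c y hy ih =>
    have : c • y = (c : ℝ) • y := rfl
    rw [this, map_smul, ih (hs' ▸ hy), smul_zero]

variable [Module.Free ℤ N] [Module.Finite ℤ N]

/-- Gordan's lemma for the dual monoid of a rational cone. -/
lemma dualMonoid_fg {σ : PointedCone ℝ (RealSpace N)} (h : IsRational σ) :
    (dualMonoid σ).FG := by
  obtain ⟨s, hs, rfl⟩ := h
  have : Finite s := hs
  have : AddGroup.FG (Module.Dual ℤ N) :=
    Module.Finite.iff_addGroup_fg.1 inferInstance
  refine fg_of_nonneg (ι := s)
    { toFun := fun m n => m n.1, map_zero' := rfl, map_add' := fun _ _ => rfl } _ fun m => ?_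
  rw [mem_dualMonoid_hull]
  exact ⟨fun h n => h n.1 n.2, fun h n hn => h ⟨n, hn⟩⟩

/-- A rational cone is the dual of its dual monoid. -/
lemma toReal_mem_of_forall {σ : PointedCone ℝ (RealSpace N)} (h : IsRational σ) {n : N}
    (hn : ∀ m ∈ dualMonoid σ, 0 ≤ m n) : toReal N n ∈ σ := by
  classical
  obtain ⟨s, hs, rfl⟩ := h
  obtain ⟨c, hc, l, hl⟩ := farkas_int hs.toFinset (id : N → N) n (fun φ hφ => hn φ
    (mem_dualMonoid_hull.2 fun n hn => hφ n (hs.mem_toFinset.2 hn)))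
  have h1 : (c : ℝ) • toReal N n ∈ PointedCone.hull ℝ (toReal N '' s) := by
    rw [Nat.cast_smul_eq_nsmul, ← map_nsmul, hl, map_sum]
    refine sum_mem fun i hi => ?_
    rw [map_nsmul]
    have h0 : toReal N i ∈ PointedCone.hull ℝ (toReal N '' s) :=
      PointedCone.subset_hull ⟨i, hs.mem_toFinset.1 hi, rfl⟩
    exact nsmul_mem h0 (l i)
  have hc' : (0 : ℝ) < c := by exact_mod_cast hc
  have h2 := PointedCone.smul_mem _ (inv_nonneg.2 hc'.le) h1
  rwa [smul_smul, inv_mul_cancel₀ hc'.ne', one_smul] at h2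

lemma IsInteriorPoint.toReal_mem {σ : PointedCone ℝ (RealSpace N)} (h : IsRational σ) {n : N}
    (hn : IsInteriorPoint σ n) : toReal N n ∈ σ :=
  toReal_mem_of_forall h fun m hm => (hn m hm).1

lemma exists_add_nsmul_mem_of_isInteriorPoint {σ : PointedCone ℝ (RealSpace N)}
    (h : IsRational σ) {d n : N} (hd : IsInteriorPoint σ d)
    (hn : ∀ m ∈ dualMonoid σ, -m ∈ dualMonoid σ → m n = 0) :
    ∃ C : ℕ, toReal N (n + C • d) ∈ σ := by
  obtain ⟨g, hg⟩ := dualMonoid_fg h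
  refine ⟨∑ m ∈ g, (m n).natAbs, toReal_mem_of_forall h fun m hm => ?_⟩
  rw [← hg] at hm
  induction hm using AddSubmonoid.closure_induction with
  | mem m hm =>
    have hmσ : m ∈ dualMonoid σ := by rw [← hg]; exact AddSubmonoid.subset_closure hm
    rw [map_add, map_nsmul, nsmul_eq_mul]
    rcases (hd m hmσ).1.eq_or_lt with h0 | h0
    · rw [hn m hmσ ((hd m hmσ).2 h0.symm), ← h0]; simp
    · have h1 : (m n).natAbs ≤ ∑ m ∈ g, (m n).natAbs :=
        Finset.single_le_sum (f := fun m : Module.Dual ℤ N => (m n).natAbs)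
          (fun _ _ => Nat.zero_le _) hm
      have h2 : ((m n).natAbs : ℤ) ≤ ((∑ m ∈ g, (m n).natAbs : ℕ) : ℤ) := by exact_mod_cast h1
      have h3 : -(m n) ≤ ((m n).natAbs : ℤ) := by omega
      nlinarith
  | zero => simp
  | add a b _ _ ha hb => rw [LinearMap.add_apply]; exact add_nonneg ha hb

/-- The lattice of a rational cone is cut out by the functionals vanishing on the cone. In
particular it is saturated. -/
lemma mem_coneLattice_iff {σ : PointedCone ℝ (RealSpace N)} (h : IsRational σ) {n : N} :
    n ∈ coneLattice σ ↔ ∀ m ∈ dualMonoid σ, -m ∈ dualMonoid σ → m n = 0 := by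
  constructor
  · intro hn m hm hm'
    induction hn using Submodule.span_induction with
    | mem x hx =>
      have := pairing_eq_zero hm hm' hx
      rw [pairing_toReal] at this
      exact_mod_cast this
    | zero => simp
    | add x y _ _ hx hy => rw [map_add, hx, hy, add_zero]
    | smul c x _ hx => rw [map_smul, hx, smul_zero]
  · intro hn
    obtain ⟨d, hd, hd'⟩ := h.exists_isInteriorPoint
    obtain ⟨C, hC⟩ := exists_add_nsmul_mem_of_isInteriorPoint h hd' hn
    have : n = (n + C • d) - C • d := by abel
    rw [this]
    have h0 : d ∈ coneLattice σ := Submodule.subset_span hd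
    exact sub_mem (Submodule.subset_span hC) (nsmul_mem h0 C)

lemma exists_sub_of_mem_coneLattice {σ : PointedCone ℝ (RealSpace N)} (h : IsRational σ) {n : N}
    (hn : n ∈ coneLattice σ) : ∃ a b, toReal N a ∈ σ ∧ toReal N b ∈ σ ∧ n = a - b := by
  obtain ⟨d, hd, hd'⟩ := h.exists_isInteriorPoint
  obtain ⟨C, hC⟩ := exists_add_nsmul_mem_of_isInteriorPoint h hd' ((mem_coneLattice_iff h).1 hn)
  refine ⟨n + C • d, C • d, hC, ?_, by abel⟩
  rw [map_nsmul]
  exact nsmul_mem hd _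

lemma free_quotient_of_saturated {A : Type*} [AddCommGroup A] [Module.Finite ℤ A]
    {D : Submodule ℤ A} (h : ∀ (c : ℤ) (x : A), c ≠ 0 → c • x ∈ D → x ∈ D) :
    Module.Free ℤ (A ⧸ D) := by
  have : Module.IsTorsionFree ℤ (A ⧸ D) := by
    rw [Module.isTorsionFree_iff_smul_eq_zero]
    intro c x hx
    obtain ⟨x, rfl⟩ := D.mkQ_surjective x
    by_cases hc : c = 0
    · exact Or.inl hc
    · right
      rw [← map_smul, Submodule.mkQ_apply, Submodule.Quotient.mk_eq_zero] at hx
      rw [Submodule.mkQ_apply, Submodule.Quotient.mk_eq_zero]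
      exact h c x hc hx
  infer_instance

lemma coneLattice_saturated {σ : PointedCone ℝ (RealSpace N)} (h : IsRational σ) {c : ℤ} {n : N}
    (hc : c ≠ 0) (hn : c • n ∈ coneLattice σ) : n ∈ coneLattice σ := by
  rw [mem_coneLattice_iff h] at hn ⊢
  intro m hm hm'
  have := hn m hm hm'
  rw [map_smul, smul_eq_mul] at this
  exact (mul_eq_zero.1 this).resolve_left hc

lemma free_quotient_coneLattice {σ : PointedCone ℝ (RealSpace N)} (h : IsRational σ) :
    Module.Free ℤ (N ⧸ coneLattice σ) :=
  free_quotient_of_saturated fun _ _ => coneLattice_saturated h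

/-- The dual monoid of a strongly convex rational cone generates the dual lattice. -/
lemma closure_dualMonoid {σ : PointedCone ℝ (RealSpace N)} (h : IsRational σ)
    (hσ : ∀ x ∈ σ, -x ∈ σ → x = 0) :
    AddSubgroup.closure (dualMonoid σ : Set (Module.Dual ℤ N)) = ⊤ := by
  classical
  obtain ⟨s, hs, rfl⟩ := h
  obtain ⟨Y, hY⟩ := exists_functional_pos (T := AddSubmonoid.closure s)
    ⟨hs.toFinset, by rw [hs.coe_toFinset]⟩
  have hmem : ∀ n ∈ AddSubmonoid.closure s,
      toReal N n ∈ PointedCone.hull ℝ (toReal N '' s) := by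
    intro n hn
    induction hn using AddSubmonoid.closure_induction with
    | mem n hn => exact PointedCone.subset_hull ⟨n, hn, rfl⟩
    | zero => simp
    | add a b _ _ ha hb => rw [map_add]; exact add_mem ha hb
  have hpos : ∀ n ∈ s, n ≠ 0 → 0 < Y n := by
    intro n hn hn0
    have h1 := hY n (AddSubmonoid.subset_closure hn)
    refine h1.1.lt_of_ne fun h0 => hn0 ?_
    have h2 := hmem _ (h1.2 h0.symm)
    rw [map_neg] at h2
    refine toReal_injective ?_
    rw [map_zero]
    exact hσ _ (PointedCone.subset_hull ⟨n, hn, rfl⟩) h2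
  have hYm : Y ∈ dualMonoid (PointedCone.hull ℝ (toReal N '' s)) :=
    mem_dualMonoid_hull.2 fun n hn => (hY n (AddSubmonoid.subset_closure hn)).1
  rw [eq_top_iff]
  intro m _
  have hm : m + (∑ n ∈ hs.toFinset, (m n).natAbs) • Y ∈
      dualMonoid (PointedCone.hull ℝ (toReal N '' s)) := by
    refine mem_dualMonoid_hull.2 fun n hn => ?_
    rw [LinearMap.add_apply, LinearMap.smul_apply, nsmul_eq_mul]
    by_cases hn0 : n = 0
    · simp [hn0]
    have h1 : (m n).natAbs ≤ ∑ n ∈ hs.toFinset, (m n).natAbs :=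
      Finset.single_le_sum (f := fun n => (m n).natAbs)
        (fun _ _ => Nat.zero_le _) (hs.mem_toFinset.2 hn)
    have h2 : ((m n).natAbs : ℤ) ≤ ((∑ n ∈ hs.toFinset, (m n).natAbs : ℕ) : ℤ) := by
      exact_mod_cast h1
    have h3 : -(m n) ≤ ((m n).natAbs : ℤ) := by omega
    have := hpos n hn hn0
    nlinarith
  have : m = (m + (∑ n ∈ hs.toFinset, (m n).natAbs) • Y) -
      (∑ n ∈ hs.toFinset, (m n).natAbs) • Y := by abel
  rw [this]
  exact sub_mem (AddSubgroup.subset_closure hm)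
    (nsmul_mem (AddSubgroup.subset_closure hYm) _)

/-- A functional which vanishes on the lattice of a cone factors through the quotient. -/
lemma exists_comp_mkQ {A : Type*} [AddCommGroup A] {D : Submodule ℤ A} (m : Module.Dual ℤ A)
    (h : ∀ n ∈ D, m n = 0) : ∃ m' : Module.Dual ℤ (A ⧸ D), m' ∘ₗ D.mkQ = m :=
  ⟨D.liftQ m h, D.liftQ_mkQ m h⟩

/-- The image of a strongly convex cone in the quotient by the lattice of a face is strongly
convex. -/
lemma stronglyConvex_map {τ σ : PointedCone ℝ (RealSpace N)} (hτ : IsRational τ)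
    (hface : IsFace τ σ) :
    ∀ x ∈ σ.map (realMap (coneLattice τ).mkQ), -x ∈ σ.map (realMap (coneLattice τ).mkQ) →
      x = 0 := by
  obtain ⟨m₀, hm₀, hτm⟩ := hface
  rintro _ ⟨x, hx, rfl⟩ ⟨y, hy, hxy⟩
  have hm₀τ : ∀ z ∈ τ, pairing m₀ z = 0 := fun z hz => ((hτm z).1 hz).2
  have h1 : ∀ n ∈ coneLattice τ, m₀ n = 0 := fun n hn =>
    (mem_coneLattice_iff hτ).1 hn m₀ (fun z hz => (hm₀τ z hz).ge) (neg_mem_dualMonoid hm₀τ)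
  obtain ⟨m', rfl⟩ := exists_comp_mkQ m₀ h1
  have h2 : pairing (m' ∘ₗ (coneLattice τ).mkQ) x + pairing (m' ∘ₗ (coneLattice τ).mkQ) y = 0 := by
    rw [pairing_comp, pairing_comp]
    have hxy' : realMap (coneLattice τ).mkQ y = - realMap (coneLattice τ).mkQ x := hxy
    rw [hxy', map_neg, add_neg_cancel]
  have hx0 : pairing (m' ∘ₗ (coneLattice τ).mkQ) x = 0 := by
    linarith [hm₀ x hx, hm₀ y hy]
  have hxτ : x ∈ τ := (hτm x).2 ⟨hx, hx0⟩
  exact realMap_mkQ_eq_zero hτ hxτ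

end Cones

end

section

/-! ### Lattice indices and small perturbations -/

section Index

variable {A B : Type*} [AddCommGroup A] [AddCommGroup B] [Module.Free ℤ A] [Module.Finite ℤ A]
  [Module.Free ℤ B] [Module.Finite ℤ B]

/-- An injective map of lattices of the same rank and its dual have images of the same index: both
indices are the absolute value of the determinant. -/
lemma index_range_dualMap (φ : A →ₗ[ℤ] B) (hφ : Function.Injective φ)
    (h : Module.finrank ℤ A = Module.finrank ℤ B) :
    (LinearMap.range φ.dualMap).toAddSubgroup.index = (LinearMap.range φ).toAddSubgroup.index := by
  classical
  let a := Module.finBasisOfFinrankEq ℤ A h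
  let b := Module.finBasis ℤ B
  have hfin : Finite (B ⧸ LinearMap.range φ) := by
    rw [Submodule.finiteQuotient_iff, LinearMap.finrank_range_of_inj hφ, h]
  have hinj : Function.Injective φ.dualMap := by
    rw [injective_iff_map_eq_zero]
    intro m hm
    ext x
    have h1 := (LinearMap.range φ).toAddSubgroup.nsmul_index_mem x
    obtain ⟨y, hy⟩ := h1
    have h2 : m (φ y) = 0 := LinearMap.congr_fun hm y
    have h3 : φ y = (LinearMap.range φ).toAddSubgroup.index • x := hy
    rw [h3, map_nsmul, smul_eq_zero] at h2
    refine h2.resolve_left ?_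
    exact AddSubgroup.index_ne_zero_iff_finite.2 hfin
  let a' : Module.Basis _ ℤ (LinearMap.range φ).toAddSubgroup :=
    a.map (LinearEquiv.ofInjective φ hφ)
  let b' : Module.Basis _ ℤ (LinearMap.range φ.dualMap).toAddSubgroup :=
    b.dualBasis.map (LinearEquiv.ofInjective φ.dualMap hinj)
  rw [AddSubgroup.index_eq_natAbs_det b _ a', AddSubgroup.index_eq_natAbs_det a.dualBasis _ b',
    Module.Basis.det_apply, Module.Basis.det_apply, ← Matrix.det_transpose]
  congr 2
  ext i j
  simp only [Matrix.transpose_apply, Module.Basis.toMatrix_apply]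
  rw [Module.Basis.dualBasis_repr]
  change (φ.dualMap (b.dualBasis i)) (a j) = b.repr (φ (a j)) i
  rw [LinearMap.dualMap_apply, Module.Basis.dualBasis_apply]

end Index

section Transverse

variable {A : Type*} [AddCommGroup A] [Module.Free ℤ A] [Module.Finite ℤ A]

/-- Up to a positive factor `c`, there is a projection of a lattice onto one of two transverse
sublattices along the other one. -/
lemma exists_projection {D E : Submodule ℤ A} (hDE : Disjoint D E)
    (hr : Module.finrank ℤ D + Module.finrank ℤ E = Module.finrank ℤ A) :
    ∃ (c : ℕ) (ρ : A →ₗ[ℤ] A), 0 < c ∧ (∀ x, ρ x ∈ D) ∧ (∀ x, c • x - ρ x ∈ E) ∧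
      (∀ x ∈ D, ρ x = c • x) ∧ ∀ x ∈ E, ρ x = 0 := by
  let j : D × E →ₗ[ℤ] A := LinearMap.coprod D.subtype E.subtype
  have hj : Function.Injective j := by
    rw [injective_iff_map_eq_zero]
    rintro ⟨d, e⟩ h
    have h1 : (d : A) + e = 0 := h
    have h2 : (d : A) = -e := eq_neg_of_add_eq_zero_left h1
    have h3 : (d : A) ∈ E := h2 ▸ neg_mem e.2
    have h4 := Submodule.disjoint_def.1 hDE d d.2 h3
    rw [h4, zero_add] at h1
    ext <;> simp [h4, h1]
  have hfin : Finite (A ⧸ LinearMap.range j) := by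
    rw [Submodule.finiteQuotient_iff, LinearMap.finrank_range_of_inj hj, Module.finrank_prod, hr]
  let c := (LinearMap.range j).toAddSubgroup.index
  have hc : c ≠ 0 := AddSubgroup.index_ne_zero_iff_finite.2 hfin
  let θ : A →ₗ[ℤ] LinearMap.range j := LinearMap.codRestrict _ ((c : ℤ) • LinearMap.id) fun x => by
    have := (LinearMap.range j).toAddSubgroup.nsmul_index_mem x
    simpa using this
  let e := LinearEquiv.ofInjective j hj
  have he : ∀ x, j (e.symm (θ x)) = c • x := by
    intro x
    have : (e (e.symm (θ x)) : A) = c • x := by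
      rw [LinearEquiv.apply_symm_apply]
      simp [θ]
    exact this
  have he' : ∀ x p, j p = c • x → e.symm (θ x) = p := by
    intro x p hp
    apply hj
    rw [he, hp]
  refine ⟨c, D.subtype ∘ₗ LinearMap.fst ℤ D E ∘ₗ e.symm.toLinearMap ∘ₗ θ, Nat.pos_of_ne_zero hc,
    fun x => (e.symm (θ x)).1.2, fun x => ?_, fun x hx => ?_, fun x hx => ?_⟩
  · rw [← he x]
    have : j (e.symm (θ x)) - (e.symm (θ x)).1 = (e.symm (θ x)).2 := by
      change ((e.symm (θ x)).1 : A) + (e.symm (θ x)).2 - _ = _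
      abel
    change j (e.symm (θ x)) - (e.symm (θ x)).1 ∈ E
    rw [this]
    exact (e.symm (θ x)).2.2
  · have := he' x (c • ⟨x, hx⟩, 0) (by simp [j])
    change ((e.symm (θ x)).1 : A) = _
    rw [this]
    simp
  · have := he' x (0, c • ⟨x, hx⟩) (by simp [j])
    change ((e.symm (θ x)).1 : A) = _
    rw [this]
    simp

/-- The index of the sum of two transverse sublattices, computed in the dual of the second one. -/
lemma index_sup_eq {D E : Submodule ℤ A} (hDE : Disjoint D E) [Module.Free ℤ (A ⧸ D)]
    (hr : Module.finrank ℤ D + Module.finrank ℤ E = Module.finrank ℤ A) :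
    (LinearMap.range (E.subtype.dualMap ∘ₗ D.mkQ.dualMap)).toAddSubgroup.index =
      (D ⊔ E).toAddSubgroup.index := by
  have hinj : Function.Injective (D.mkQ ∘ₗ E.subtype) := by
    rw [injective_iff_map_eq_zero]
    intro e he
    rw [LinearMap.comp_apply, Submodule.mkQ_apply, Submodule.Quotient.mk_eq_zero] at he
    exact Subtype.ext (Submodule.disjoint_def.1 hDE _ he e.2)
  have h1 := index_range_dualMap (D.mkQ ∘ₗ E.subtype) hinj (by
    have := Submodule.finrank_quotient_add_finrank D
    omega)
  rw [LinearMap.dualMap_comp_dualMap, h1, ← AddSubgroup.index_comap_of_surjective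
    (LinearMap.range (D.mkQ ∘ₗ E.subtype)).toAddSubgroup (f := D.mkQ.toAddMonoidHom)
    D.mkQ_surjective]
  congr 1
  change (Submodule.comap D.mkQ (LinearMap.range (D.mkQ ∘ₗ E.subtype))).toAddSubgroup = _
  rw [LinearMap.range_comp, Submodule.range_subtype, Submodule.comap_map_mkQ]

lemma disjoint_of_index_ne_zero {D E : Submodule ℤ A} [Module.Free ℤ (A ⧸ D)]
    (hinj : ∀ g : Module.Dual ℤ (A ⧸ D), E.subtype.dualMap (D.mkQ.dualMap g) = 0 → g = 0)
    (hfin : (LinearMap.range (E.subtype.dualMap ∘ₗ D.mkQ.dualMap)).toAddSubgroup.index ≠ 0) :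
    Disjoint D E ∧ Module.finrank ℤ D + Module.finrank ℤ E = Module.finrank ℤ A := by
  constructor
  · rw [Submodule.disjoint_def]
    intro x hx hxE
    have h1 : ∀ m : Module.Dual ℤ E, m ⟨x, hxE⟩ = 0 := by
      intro m
      obtain ⟨g, hg⟩ := (LinearMap.range (E.subtype.dualMap ∘ₗ
        D.mkQ.dualMap)).toAddSubgroup.nsmul_index_mem m
      have h2 := LinearMap.congr_fun hg ⟨x, hxE⟩
      have h3 : (E.subtype.dualMap ∘ₗ D.mkQ.dualMap) g ⟨x, hxE⟩ = g (D.mkQ x) := rfl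
      change (E.subtype.dualMap ∘ₗ D.mkQ.dualMap) g ⟨x, hxE⟩ = _ at h2
      rw [h3, Submodule.mkQ_apply, (Submodule.Quotient.mk_eq_zero D).2 hx, map_zero,
        LinearMap.smul_apply] at h2
      exact (smul_eq_zero.1 h2.symm).resolve_left hfin
    have := (Module.forall_dual_apply_eq_zero_iff ℤ (⟨x, hxE⟩ : E)).1 h1
    exact congrArg Subtype.val this
  · have h1 : Function.Injective (E.subtype.dualMap ∘ₗ D.mkQ.dualMap) := by
      rw [injective_iff_map_eq_zero]
      exact hinj
    have h2 : Finite (Module.Dual ℤ E ⧸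
        LinearMap.range (E.subtype.dualMap ∘ₗ D.mkQ.dualMap)) :=
      AddSubgroup.index_ne_zero_iff_finite.1 hfin
    rw [Submodule.finiteQuotient_iff, LinearMap.finrank_range_of_inj h1,
      Module.finrank_linearMap_self, Module.finrank_linearMap_self] at h2
    have := Submodule.finrank_quotient_add_finrank D
    omega

end Transverse

section Saturation

variable {A : Type*} [AddCommGroup A]

lemma mem_saturation {P : Submodule ℤ A} {x : A} :
    x ∈ saturation P ↔ ∃ c : ℤ, c ≠ 0 ∧ c • x ∈ P := by
  rw [saturation, Submodule.mem_comap, Submodule.mem_torsion_iff]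
  constructor
  · rintro ⟨c, hc⟩
    refine ⟨c, nonZeroDivisors.coe_ne_zero c, ?_⟩
    rwa [← Submodule.Quotient.mk_eq_zero]
  · rintro ⟨c, hc, h⟩
    refine ⟨⟨c, mem_nonZeroDivisors_of_ne_zero hc⟩, ?_⟩
    exact (Submodule.Quotient.mk_eq_zero _).2 h

lemma le_saturation (P : Submodule ℤ A) : P ≤ saturation P := fun x hx =>
  mem_saturation.2 ⟨1, one_ne_zero, by rwa [one_smul]⟩

lemma finite_saturation_quotient [Module.Finite ℤ A] (P : Submodule ℤ A) :
    P.toAddSubgroup.relIndex (saturation P).toAddSubgroup ≠ 0 := by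
  have hfin : Finite (saturation P ⧸ P.submoduleOf (saturation P)) := by
    have htor : Module.IsTorsion ℤ (saturation P ⧸ P.submoduleOf (saturation P)) := by
      intro x
      obtain ⟨x, rfl⟩ := Submodule.mkQ_surjective _ x
      obtain ⟨c, hc, h⟩ := mem_saturation.1 x.2
      exact ⟨⟨c, mem_nonZeroDivisors_of_ne_zero hc⟩, (Submodule.Quotient.mk_eq_zero _).2 h⟩
    exact Module.finite_of_fg_torsion _ htor
  exact AddSubgroup.index_ne_zero_iff_finite.2 hfin

lemma finrank_saturation [Module.Free ℤ A] [Module.Finite ℤ A] (P : Submodule ℤ A) :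
    Module.finrank ℤ (saturation P) = Module.finrank ℤ P := by
  have h : Finite (saturation P ⧸ P.submoduleOf (saturation P)) :=
    AddSubgroup.index_ne_zero_iff_finite.1 (finite_saturation_quotient P)
  rw [Submodule.finiteQuotient_iff] at h
  rw [← h]
  exact (Submodule.submoduleOfEquivOfLe (le_saturation P)).finrank_eq

lemma realSpan_saturation {A : Type u} [AddCommGroup A] (P : Submodule ℤ A) :
    realSpan (saturation P) = realSpan P := by
  apply le_antisymm
  · refine Submodule.span_le.2 ?_
    rintro _ ⟨x, hx, rfl⟩
    obtain ⟨c, hc, h⟩ := mem_saturation.1 hx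
    have h1 : toReal A (c • x) ∈ realSpan P := Submodule.subset_span ⟨_, h, rfl⟩
    have hc' : (c : ℝ) ≠ 0 := by exact_mod_cast hc
    rw [map_smul, ← Int.cast_smul_eq_zsmul ℝ] at h1
    have h2 := Submodule.smul_mem _ (c : ℝ)⁻¹ h1
    rwa [smul_smul, inv_mul_cancel₀ hc', one_smul] at h2
  · exact Submodule.span_mono (Set.image_mono (le_saturation P))

end Saturation

/-- The units of a submonoid of an abelian group, as a subgroup. -/
def unitGroup {L : Type*} [AddCommGroup L] (S : AddSubmonoid L) : AddSubgroup L where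
  carrier := {m | m ∈ S ∧ -m ∈ S}
  zero_mem' := by simp
  add_mem' := by
    rintro a b ⟨ha, ha'⟩ ⟨hb, hb'⟩
    refine ⟨add_mem ha hb, ?_⟩
    rw [neg_add]
    exact add_mem ha' hb'
  neg_mem' := by
    rintro a ⟨ha, ha'⟩
    exact ⟨ha', by simpa using ha⟩

lemma mem_unitGroup {L : Type*} [AddCommGroup L] {S : AddSubmonoid L} {m : L} :
    m ∈ unitGroup S ↔ m ∈ S ∧ -m ∈ S := Iff.rfl

/-- For a submonoid `S` of a lattice `L` and a map `π : L → M`, the relative interior of the cone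
dual to `S` meets the ray of `v` modulo the dual of `M`. -/
def Meets {L M : Type*} [AddCommGroup L] [AddCommGroup M] (S : AddSubmonoid L) (π : L →ₗ[ℤ] M)
    (v : Module.Dual ℤ L) : Prop :=
  ∃ Y : M × ℤ →ₗ[ℤ] ℤ, 0 < Y (0, 1) ∧
    ∀ m ∈ S, 0 ≤ Y (π m, v m) ∧ (Y (π m, v m) = 0 → -m ∈ S)

lemma eventually_ne_zero {a b : ℤ} (h : a ≠ 0 ∨ b ≠ 0) :
    ∀ᶠ C : ℕ in Filter.atTop, (C : ℤ) * a + b ≠ 0 := by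
  by_cases ha : a = 0
  · exact Filter.Eventually.of_forall fun _ => by simpa [ha] using h
  · filter_upwards [Filter.eventually_gt_atTop b.natAbs] with C hC h0
    have h1 : (C : ℤ) * a = -b := by omega
    have h2 := congrArg Int.natAbs h1
    rw [Int.natAbs_mul, Int.natAbs_neg, Int.natAbs_natCast] at h2
    have h3 : 0 < a.natAbs := Int.natAbs_pos.2 ha
    nlinarith

/-- A point where none of finitely many nonzero functionals vanishes. -/
lemma exists_forall_ne_zero {A : Type*} [AddCommGroup A] (s : Finset (Module.Dual ℤ A))
    (hs : ∀ g ∈ s, g ≠ 0) :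
    ∃ w : A, ∀ g ∈ s, g w ≠ 0 := by
  classical
  induction s using Finset.induction_on with
  | empty => exact ⟨0, by simp⟩
  | insert g s hg ih =>
    obtain ⟨w, hw⟩ := ih fun g hg => hs g (Finset.mem_insert_of_mem hg)
    obtain ⟨u, hu⟩ : ∃ u, g u ≠ 0 := by
      by_contra! hcon
      exact hs g (Finset.mem_insert_self g s) (LinearMap.ext hcon)
    have h1 : ∀ h ∈ insert g s, ∀ᶠ C : ℕ in Filter.atTop, (C : ℤ) * h w + h u ≠ 0 := by
      intro h hh
      refine eventually_ne_zero ?_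
      rcases Finset.mem_insert.1 hh with rfl | hh
      · exact Or.inr hu
      · exact Or.inl (hw h hh)
    obtain ⟨C, hC⟩ := ((Filter.eventually_all_finset _).2 h1).exists
    exact ⟨C • w + u, fun h hh => by simpa using hC h hh⟩

section Generic

variable {A : Type u} [AddCommGroup A] [Module.Free ℤ A] [Module.Finite ℤ A]

lemma IsInteriorPoint.mem_coneLattice {ω : PointedCone ℝ (RealSpace A)} (h : IsRational ω) {y : A}
    (hy : IsInteriorPoint ω y) : y ∈ coneLattice ω := by
  rw [mem_coneLattice_iff h]
  intro m hm hm'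
  have h1 := (hy m hm).1
  have h2 := (hy _ hm').1
  rw [LinearMap.neg_apply] at h2
  omega

lemma meets_iff {ω : PointedCone ℝ (RealSpace A)} {E : Submodule ℤ A} {v : A} :
    Meets (dualMonoid ω) E.subtype.dualMap (Module.Dual.eval ℤ A v) ↔
      ∃ c : ℕ, 0 < c ∧ ∃ n ∈ E, IsInteriorPoint ω (c • v + n) := by
  constructor
  · rintro ⟨Y, hY, h⟩
    obtain ⟨n, hn⟩ := (Module.evalEquiv ℤ E).surjective (Y ∘ₗ LinearMap.inl ℤ _ _)
    refine ⟨(Y (0, 1)).toNat, by omega, n, n.2, ?_⟩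
    have key : ∀ m : Module.Dual ℤ A, m ((Y (0, 1)).toNat • v + n) =
        Y (E.subtype.dualMap m, m v) := by
      intro m
      have h1 : m n = Y (E.subtype.dualMap m, 0) := by
        have := LinearMap.congr_fun hn (E.subtype.dualMap m)
        exact this
      have h2 : ((E.subtype.dualMap m, m v) : Module.Dual ℤ E × ℤ) =
          (E.subtype.dualMap m, 0) + m v • (0, 1) := by simp
      rw [h2, map_add Y, map_smul Y, ← h1, map_add, map_nsmul, nsmul_eq_mul,
        Int.toNat_of_nonneg hY.le, smul_eq_mul]
      ring
    intro m hm
    rw [key]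
    exact h m hm
  · rintro ⟨c, hc, n, hn, h⟩
    refine ⟨LinearMap.coprod (Module.Dual.eval ℤ E ⟨n, hn⟩) ((c : ℤ) • LinearMap.id), ?_, ?_⟩
    · simpa using hc
    · intro m hm
      have := h m hm
      have h1 : (LinearMap.coprod (Module.Dual.eval ℤ E ⟨n, hn⟩) ((c : ℤ) • LinearMap.id))
          (E.subtype.dualMap m, Module.Dual.eval ℤ A v m) = m (c • v + n) := by
        simp [add_comm]
      rw [h1]
      exact this

lemma meets_iff_projection {ω : PointedCone ℝ (RealSpace A)} (hω : IsRational ω)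
    {E : Submodule ℤ A} {c : ℕ} (hc : 0 < c) {ρ : A →ₗ[ℤ] A}
    (h₂ : ∀ x, c • x - ρ x ∈ E) (h₃ : ∀ x ∈ coneLattice ω, ρ x = c • x) (h₄ : ∀ x ∈ E, ρ x = 0)
    {v : A} :
    Meets (dualMonoid ω) E.subtype.dualMap (Module.Dual.eval ℤ A v) ↔
      IsInteriorPoint ω (ρ v) := by
  rw [meets_iff]
  constructor
  · rintro ⟨c', hc', n, hn, h⟩
    have h1 := h₃ _ (h.mem_coneLattice hω)
    rw [map_add, map_nsmul, h₄ n hn, add_zero] at h1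
    intro m hm
    have h2 := h m hm
    have h3 : (c' : ℤ) * m (ρ v) = c * m (c' • v + n) := by
      have := congrArg m h1
      rwa [map_nsmul, map_nsmul, nsmul_eq_mul, nsmul_eq_mul] at this
    have hc'' : (0 : ℤ) < c' := by exact_mod_cast hc'
    have hc''' : (0 : ℤ) < c := by exact_mod_cast hc
    refine ⟨?_, fun h0 => h2.2 ?_⟩
    · refine nonneg_of_mul_nonneg_right ?_ hc''
      rw [h3]
      exact mul_nonneg hc'''.le h2.1
    · rw [h0, mul_zero] at h3
      exact (mul_eq_zero.1 h3.symm).resolve_left hc'''.ne'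
  · intro h
    refine ⟨c, hc, -(c • v - ρ v), neg_mem (h₂ v), ?_⟩
    have : c • v + -(c • v - ρ v) = ρ v := by abel
    rwa [this]

lemma eventually_pos {a : ℤ} (b : ℤ) (h : 0 < a) :
    ∀ᶠ C : ℕ in Filter.atTop, 0 < (C : ℤ) * a + b := by
  filter_upwards [Filter.eventually_gt_atTop b.natAbs] with C hC
  have h1 : (b.natAbs : ℤ) < C := by exact_mod_cast hC
  have h2 : -b ≤ b.natAbs := by omega
  nlinarith

/-- A sufficiently small perturbation of a point which is not on the relative boundary of a cone. -/
lemma eventually_isInteriorPoint_iff {ω : PointedCone ℝ (RealSpace A)} (hω : IsRational ω)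
    {x y : A} (hx : x ∈ coneLattice ω) (hy : y ∈ coneLattice ω)
    (h : toReal A x ∈ ω → IsInteriorPoint ω x) :
    ∀ᶠ C : ℕ in Filter.atTop, (IsInteriorPoint ω (C • x + y) ↔ toReal A x ∈ ω) := by
  classical
  obtain ⟨g, hg⟩ := dualMonoid_fg hω
  have hgω : ∀ m ∈ g, m ∈ dualMonoid ω := fun m hm => by
    rw [← hg]; exact AddSubmonoid.subset_closure hm
  by_cases hxω : toReal A x ∈ ω
  · have hev : ∀ m ∈ g, ∀ᶠ C : ℕ in Filter.atTop,
        0 ≤ m (C • x + y) ∧ (m (C • x + y) = 0 → -m ∈ dualMonoid ω) := by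
      intro m hm
      have h1 := h hxω m (hgω m hm)
      by_cases hm' : -m ∈ dualMonoid ω
      · have h2 := (mem_coneLattice_iff hω).1 hx m (hgω m hm) hm'
        have h3 := (mem_coneLattice_iff hω).1 hy m (hgω m hm) hm'
        exact Filter.Eventually.of_forall fun C => ⟨by simp [h2, h3], fun _ => hm'⟩
      · have h2 : 0 < m x := h1.1.lt_of_ne fun h0 => hm' (h1.2 h0.symm)
        filter_upwards [eventually_pos (m y) h2] with C hC
        have h3 : m (C • x + y) = C * m x + m y := by simp
        rw [h3]
        exact ⟨hC.le, fun h0 => absurd h0 hC.ne'⟩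
    filter_upwards [(Filter.eventually_all_finset g).2 hev] with C hC
    refine iff_of_true ?_ hxω
    intro m hm
    rw [← hg] at hm
    induction hm using AddSubmonoid.closure_induction with
    | mem m hm => exact hC m hm
    | zero => simp
    | add a b _ _ ha hb =>
      rw [LinearMap.add_apply, neg_add]
      exact ⟨add_nonneg ha.1 hb.1, fun h0 =>
        add_mem (ha.2 (by linarith [ha.1, hb.1])) (hb.2 (by linarith [ha.1, hb.1]))⟩
  · have : ∃ m ∈ dualMonoid ω, m x < 0 := by
      by_contra! hcon
      exact hxω (toReal_mem_of_forall hω hcon)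
    obtain ⟨m, hm, hmx⟩ := this
    filter_upwards [eventually_pos (-m y) (neg_pos.2 hmx)] with C hC
    refine iff_of_false (fun hcon => ?_) hxω
    have h1 := (hcon m hm).1
    rw [map_add, map_nsmul, nsmul_eq_mul] at h1
    linarith

end Generic

end

section

/-! ### Images of cones in quotient lattices -/

section Displacement

variable {N : Type u} [AddCommGroup N]

lemma finrank_range_add_ker {A B : Type*} [AddCommGroup A] [Module.Finite ℤ A] [AddCommGroup B]
    (f : A →ₗ[ℤ] B) : Module.finrank ℤ (LinearMap.range f) + Module.finrank ℤ (LinearMap.ker f) =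
      Module.finrank ℤ A := by
  rw [← f.quotKerEquivRange.finrank_eq]
  exact Submodule.finrank_quotient_add_finrank _

lemma finrank_map_mkQ {A : Type*} [AddCommGroup A] [Module.Finite ℤ A] (S T : Submodule ℤ A) :
    Module.finrank ℤ (T.map S.mkQ) + Module.finrank ℤ (T ⊓ S : Submodule ℤ A) =
      Module.finrank ℤ T := by
  have h1 := finrank_range_add_ker (S.mkQ ∘ₗ T.subtype)
  rw [LinearMap.range_comp, Submodule.range_subtype, LinearMap.ker_comp, Submodule.ker_mkQ] at h1
  rw [← h1]
  congr 1
  have h2 : (T ⊓ S : Submodule ℤ A) = (S.comap T.subtype).map T.subtype := by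
    rw [Submodule.map_comap_subtype]
  rw [h2]
  exact (Submodule.equivMapOfInjective T.subtype T.subtype_injective _).finrank_eq.symm

lemma comap_mkQ_coneLattice_map [Module.Free ℤ N] [Module.Finite ℤ N]
    {τ σ : PointedCone ℝ (RealSpace N)} (hτ : IsRational τ)
    (hσ : IsRational σ) (h : τ ≤ σ) :
    (coneLattice (σ.map (realMap (coneLattice τ).mkQ))).comap (coneLattice τ).mkQ =
      coneLattice σ := by
  have := free_quotient_coneLattice hτ
  ext n
  have key : ((coneLattice τ).mkQ n ∈
      coneLattice (σ.map (realMap (coneLattice τ).mkQ))) ↔ _ :=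
    mem_coneLattice_iff (N := N ⧸ coneLattice τ) (hσ.map (coneLattice τ).mkQ)
  rw [Submodule.mem_comap, mem_coneLattice_iff hσ]
  refine key.trans ?_
  clear key
  constructor
  · intro hn m hm hm'
    obtain ⟨m', rfl⟩ := exists_comp_mkQ (D := coneLattice τ) m fun x hx =>
      (mem_coneLattice_iff hτ).1 hx m (dualMonoid_anti h hm) (dualMonoid_anti h hm')
    have h1 : m' ∈ dualMonoid (σ.map (realMap (coneLattice τ).mkQ)) := mem_dualMonoid_map.2 hm
    have h2 : -m' ∈ dualMonoid (σ.map (realMap (coneLattice τ).mkQ)) :=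
      mem_dualMonoid_map.2 (by rw [LinearMap.neg_comp]; exact hm')
    exact hn m' h1 h2
  · intro hn m hm hm'
    have h1 : m ∘ₗ (coneLattice τ).mkQ ∈ dualMonoid σ := mem_dualMonoid_map.1 hm
    have h2 : -(m ∘ₗ (coneLattice τ).mkQ) ∈ dualMonoid σ := by
      rw [← LinearMap.neg_comp]; exact mem_dualMonoid_map.1 hm'
    exact hn (m ∘ₗ (coneLattice τ).mkQ) h1 h2

lemma coneLattice_map_mkQ [Module.Free ℤ N] [Module.Finite ℤ N] {τ σ : PointedCone ℝ (RealSpace N)}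
    (hτ : IsRational τ)
    (hσ : IsRational σ) (h : τ ≤ σ) :
    coneLattice (σ.map (realMap (coneLattice τ).mkQ)) =
      (coneLattice σ).map (coneLattice τ).mkQ := by
  rw [← comap_mkQ_coneLattice_map hτ hσ h,
    Submodule.map_comap_eq_of_surjective (coneLattice τ).mkQ_surjective]

lemma coneLattice_mono {τ σ : PointedCone ℝ (RealSpace N)} (h : τ ≤ σ) :
    coneLattice τ ≤ coneLattice σ := Submodule.span_mono fun _ hn => h hn

lemma finrank_coneLattice_map [Module.Free ℤ N] [Module.Finite ℤ N]
    {τ σ : PointedCone ℝ (RealSpace N)} (hτ : IsRational τ)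
    (hσ : IsRational σ) (h : τ ≤ σ) :
    Module.finrank ℤ (coneLattice (σ.map (realMap (coneLattice τ).mkQ))) +
      Module.finrank ℤ (coneLattice τ) = Module.finrank ℤ (coneLattice σ) := by
  rw [coneLattice_map_mkQ hτ hσ h, ← finrank_map_mkQ (coneLattice τ) (coneLattice σ),
    inf_eq_right.2 (coneLattice_mono h)]

lemma mem_unitGroup_dualMonoid_iff [Module.Free ℤ N] [Module.Finite ℤ N]
    {ω : PointedCone ℝ (RealSpace N)} (hω : IsRational ω)
    {m : Module.Dual ℤ N} : m ∈ unitGroup (dualMonoid ω) ↔ ∀ n ∈ coneLattice ω, m n = 0 := by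
  constructor
  · rintro ⟨hm, hm'⟩ n hn
    exact (mem_coneLattice_iff hω).1 hn m hm hm'
  · intro h
    have h0 : ∀ x ∈ ω, pairing m x = 0 := fun x hx => pairing_eq_zero_of_coneLattice hω h hx
    exact ⟨fun x hx => (h0 x hx).ge, neg_mem_dualMonoid h0⟩

lemma map_unitGroup_dualMonoid [Module.Free ℤ N] [Module.Finite ℤ N]
    {ω : PointedCone ℝ (RealSpace N)} (hω : IsRational ω)
    (E : Submodule ℤ N) :
    (unitGroup (dualMonoid ω)).map (E.subtype.dualMap : Module.Dual ℤ N →+ Module.Dual ℤ E) =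
      (LinearMap.range (E.subtype.dualMap ∘ₗ (coneLattice ω).mkQ.dualMap)).toAddSubgroup := by
  ext m
  constructor
  · rintro ⟨g, hg, rfl⟩
    obtain ⟨g', rfl⟩ := exists_comp_mkQ g ((mem_unitGroup_dualMonoid_iff hω).1 hg)
    exact ⟨g', rfl⟩
  · rintro ⟨g, rfl⟩
    refine ⟨(coneLattice ω).mkQ.dualMap g, (mem_unitGroup_dualMonoid_iff hω).2 fun n hn => ?_, rfl⟩
    change g ((coneLattice ω).mkQ n) = 0
    rw [Submodule.mkQ_apply, (Submodule.Quotient.mk_eq_zero _).2 hn, map_zero]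

lemma realMap_eq_smul {ω : PointedCone ℝ (RealSpace N)} (hω : IsRational ω) {c : ℕ}
    {ρ : N →ₗ[ℤ] N} (h : ∀ x ∈ coneLattice ω, ρ x = c • x) {x : RealSpace N} (hx : x ∈ ω) :
    realMap ρ x = (c : ℝ) • x := by
  obtain ⟨s, hs, hs'⟩ := hω
  have hx' : x ∈ PointedCone.hull ℝ (toReal N '' s) := hs' ▸ hx
  induction hx' using Submodule.span_induction with
  | mem z hz =>
    obtain ⟨n, hn, rfl⟩ := hz
    rw [realMap_toReal, h n (Submodule.subset_span hx), map_nsmul, Nat.cast_smul_eq_nsmul]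
  | zero => simp
  | add a b ha hb iha ihb =>
    rw [map_add, iha (hs' ▸ ha), ihb (hs' ▸ hb), smul_add]
  | smul r y hy ih =>
    have : r • y = (r : ℝ) • y := rfl
    rw [this, map_smul, ih (hs' ▸ hy), smul_comm]

lemma realMap_eq_zero_of_realSpan {A B : Type u} [AddCommGroup A] [AddCommGroup B]
    {E : Submodule ℤ A} {ρ : A →ₗ[ℤ] B} (h : ∀ x ∈ E, ρ x = 0) {x : RealSpace A}
    (hx : x ∈ realSpan E) : realMap ρ x = 0 := by
  induction hx using Submodule.span_induction with
  | mem z hz =>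
    obtain ⟨n, hn, rfl⟩ := hz
    rw [realMap_toReal, h n hn, map_zero]
  | zero => simp
  | add a b _ _ iha ihb => rw [map_add, iha, ihb, add_zero]
  | smul r y _ ih => rw [map_smul, ih, smul_zero]

/-- The affine space `v + E_ℝ` meets a cone transverse to `E` exactly in the projection of `v`. -/
lemma exists_mem_cone_iff [Module.Free ℤ N] [Module.Finite ℤ N] {ω : PointedCone ℝ (RealSpace N)}
    (hω : IsRational ω)
    {E : Submodule ℤ N} {c : ℕ} (hc : 0 < c) {ρ : N →ₗ[ℤ] N}
    (h₂ : ∀ x, c • x - ρ x ∈ E) (h₃ : ∀ x ∈ coneLattice ω, ρ x = c • x) (h₄ : ∀ x ∈ E, ρ x = 0)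
    {v : N} :
    (∃ x ∈ ω, x - toReal N v ∈ realSpan E) ↔ toReal N (ρ v) ∈ ω := by
  have hc' : (0 : ℝ) < c := by exact_mod_cast hc
  constructor
  · rintro ⟨x, hx, hxv⟩
    have h1 := realMap_eq_zero_of_realSpan h₄ hxv
    rw [map_sub, realMap_eq_smul hω h₃ hx, realMap_toReal, sub_eq_zero] at h1
    rw [← h1]
    exact PointedCone.smul_mem _ hc'.le hx
  · intro h
    refine ⟨(c : ℝ)⁻¹ • toReal N (ρ v), PointedCone.smul_mem _ (inv_nonneg.2 hc'.le) h, ?_⟩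
    have h1 : toReal N (c • v - ρ v) ∈ realSpan E := Submodule.subset_span ⟨_, h₂ v, rfl⟩
    have h2 := Submodule.smul_mem _ (-(c : ℝ)⁻¹) h1
    rw [map_sub, map_nsmul, ← Nat.cast_smul_eq_nsmul ℝ, smul_sub, smul_smul, neg_mul,
      inv_mul_cancel₀ hc'.ne', neg_smul, one_smul, neg_smul, sub_neg_eq_add] at h2
    rwa [add_comm, ← sub_eq_add_neg] at h2

lemma IsInteriorPoint.exists_nsmul_sub_mem [Module.Free ℤ N] [Module.Finite ℤ N]
    {τ : PointedCone ℝ (RealSpace N)} (hτ : IsRational τ)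
    {w : N} (hw : IsInteriorPoint τ w) {u : RealSpace N} (hu : u ∈ realSpan (coneLattice τ)) :
    ∃ C : ℝ, C • toReal N w - u ∈ τ := by
  have hwτ := hw.toReal_mem hτ
  suffices h : (∃ C : ℝ, 0 ≤ C ∧ C • toReal N w - u ∈ τ) ∧ ∃ C : ℝ, 0 ≤ C ∧ C • toReal N w + u ∈ τ by
    obtain ⟨⟨C, -, hC⟩, -⟩ := h
    exact ⟨C, hC⟩
  induction hu using Submodule.span_induction with
  | mem z hz =>
    obtain ⟨n, hn, rfl⟩ := hz
    have hn' := (mem_coneLattice_iff hτ).1 hn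
    have hn'' := (mem_coneLattice_iff hτ).1 (neg_mem hn)
    obtain ⟨C, hC⟩ := exists_add_nsmul_mem_of_isInteriorPoint hτ hw hn'
    obtain ⟨C', hC'⟩ := exists_add_nsmul_mem_of_isInteriorPoint hτ hw hn''
    rw [map_add, map_nsmul, ← Nat.cast_smul_eq_nsmul ℝ, add_comm] at hC hC'
    rw [map_neg, ← sub_eq_add_neg] at hC'
    exact ⟨⟨C', C'.cast_nonneg, hC'⟩, C, C.cast_nonneg, hC⟩
  | zero => exact ⟨⟨0, le_rfl, by simp⟩, 0, le_rfl, by simp⟩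
  | add x y _ _ hx hy =>
    obtain ⟨⟨a, ha0, ha⟩, b, hb0, hb⟩ := hx
    obtain ⟨⟨a', ha0', ha'⟩, b', hb0', hb'⟩ := hy
    refine ⟨⟨a + a', add_nonneg ha0 ha0', ?_⟩, b + b', add_nonneg hb0 hb0', ?_⟩
    · have := add_mem ha ha'
      convert this using 1
      rw [add_smul]; abel
    · have := add_mem hb hb'
      convert this using 1
      rw [add_smul]; abel
  | smul r x _ hx =>
    obtain ⟨⟨a, ha0, ha⟩, b, hb0, hb⟩ := hx
    rcases le_total 0 r with hr | hr
    · refine ⟨⟨r * a, mul_nonneg hr ha0, ?_⟩, r * b, mul_nonneg hr hb0, ?_⟩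
      · rw [mul_smul, ← smul_sub]; exact PointedCone.smul_mem _ hr ha
      · rw [mul_smul, ← smul_add]; exact PointedCone.smul_mem _ hr hb
    · refine ⟨⟨-r * b, mul_nonneg (neg_nonneg.2 hr) hb0, ?_⟩, -r * a,
        mul_nonneg (neg_nonneg.2 hr) ha0, ?_⟩
      · have := PointedCone.smul_mem _ (neg_nonneg.2 hr) hb
        convert this using 1
        rw [smul_add, mul_smul, neg_smul r x, sub_eq_add_neg]
      · have := PointedCone.smul_mem _ (neg_nonneg.2 hr) ha
        convert this using 1
        rw [smul_sub, mul_smul, neg_smul r x, sub_neg_eq_add]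

lemma mem_realSpan_of_realMap_mkQ_eq_zero {A : Type u} [AddCommGroup A] {D : Submodule ℤ A}
    {x : RealSpace A} (h : realMap D.mkQ x = 0) : x ∈ realSpan D := by
  have hex : Function.Exact D.subtype D.mkQ := LinearMap.exact_subtype_mkQ D
  have := (lTensor_exact ℝ hex D.mkQ_surjective) x
  obtain ⟨y, rfl⟩ := this.1 h
  clear this h
  induction y using TensorProduct.induction_on with
  | zero => simp
  | tmul r d =>
    have : LinearMap.lTensor ℝ D.subtype (r ⊗ₜ[ℤ] d) = r • toReal A d := by
      change r ⊗ₜ[ℤ] (d : A) = r • ((1 : ℝ) ⊗ₜ[ℤ] (d : A))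
      rw [TensorProduct.smul_tmul', smul_eq_mul, mul_one]
    rw [this]
    exact Submodule.smul_mem _ _ (Submodule.subset_span ⟨d, d.2, rfl⟩)
  | add a b ha hb => rw [map_add]; exact add_mem ha hb

lemma realSpan_map {A B : Type u} [AddCommGroup A] [AddCommGroup B] (f : A →ₗ[ℤ] B)
    (E : Submodule ℤ A) : realSpan (E.map f) = (realSpan E).map (realMap f) := by
  rw [realSpan, realSpan, Submodule.map_span, ← Set.image_comp, Submodule.map_coe,
    ← Set.image_comp]
  congr 1

variable {N' : Type u} [AddCommGroup N']

/-- The image of the sum of the generators of a cone lies in the relative interior of the smallest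
cone containing the image of the cone. -/
lemma IsSmallestCone.exists_isInteriorPoint {F : Fan N'} {F' : Fan N} {f : N' →ₗ[ℤ] N}
    {τ : F.cones} {τ' : F'.cones} (h : IsSmallestCone f τ τ') :
    ∃ t, IsInteriorPoint τ'.1 (f t) := by
  obtain ⟨d, hd, hd'⟩ := IsRational.exists_isInteriorPoint (F.rational _ τ.2)
  refine ⟨d, fun m hm => ?_⟩
  have hmf : m ∘ₗ f ∈ dualMonoid τ.1 := comp_mem_dualMonoid h.1 hm
  refine ⟨(hd' _ hmf).1, fun h0 => ?_⟩
  have h1 := (hd' _ hmf).2 h0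
  let ρ : PointedCone ℝ (RealSpace N) := τ'.1 ⊓ (LinearMap.ker (pairing m)).restrictScalars _
  have hρ : ∀ x, x ∈ ρ ↔ x ∈ τ'.1 ∧ pairing m x = 0 := fun x => Iff.rfl
  have hρm : ρ ∈ F'.cones := F'.face_mem _ τ'.2 _ ⟨m, hm, hρ⟩
  have : τ'.1 ≤ ρ := h.2 ⟨ρ, hρm⟩ (by
    rintro _ ⟨z, hz, rfl⟩
    refine (hρ _).2 ⟨h.1 ⟨z, hz, rfl⟩, ?_⟩
    have := pairing_eq_zero hmf h1 hz
    rwa [pairing_comp] at this)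
  exact neg_mem_dualMonoid fun x hx => ((hρ x).1 (this hx)).2

lemma imageInQuotient_eq (f : N' →ₗ[ℤ] N) (σ : PointedCone ℝ (RealSpace N)) :
    imageInQuotient f σ = (LinearMap.range f).map (coneLattice σ).mkQ :=
  LinearMap.range_comp _ _

lemma exists_mem_map_iff [Module.Free ℤ N] [Module.Finite ℤ N] {τ σ : PointedCone ℝ (RealSpace N)}
    (hτ : IsRational τ) (h : τ ≤ σ)
    {f : N' →ₗ[ℤ] N} {t : N'} (ht : IsInteriorPoint τ (f t)) {v : N} :
    (∃ x ∈ σ, x - toReal N v ∈ realSpan (LinearMap.range f)) ↔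
      ∃ x ∈ σ.map (realMap (coneLattice τ).mkQ), x - toReal _ ((coneLattice τ).mkQ v) ∈
        realSpan (saturation (imageInQuotient f τ)) := by
  rw [realSpan_saturation, imageInQuotient_eq, realSpan_map]
  constructor
  · rintro ⟨x, hx, hxv⟩
    refine ⟨_, ⟨x, hx, rfl⟩, x - toReal N v, hxv, ?_⟩
    rw [map_sub, realMap_toReal]
    rfl
  · rintro ⟨_, ⟨x, hx, rfl⟩, z, hz, hxz⟩
    have h1 : realMap (coneLattice τ).mkQ (x - toReal N v - z) = 0 := by
      rw [map_sub, map_sub, hxz, realMap_toReal]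
      exact sub_self _
    obtain ⟨C, hC⟩ := ht.exists_nsmul_sub_mem hτ (mem_realSpan_of_realMap_mkQ_eq_zero h1)
    refine ⟨_, add_mem hx (h hC), ?_⟩
    have : x + (C • toReal N (f t) - (x - toReal N v - z)) - toReal N v =
        z + C • toReal N (f t) := by abel
    rw [this]
    exact add_mem hz (Submodule.smul_mem _ _ (Submodule.subset_span ⟨_, ⟨t, rfl⟩, rfl⟩))

lemma isInteriorPoint_of_relInterior {ω : PointedCone ℝ (RealSpace N)} {c : ℝ} (hc : 0 < c)
    {x : RealSpace N} {y : N} (hxy : toReal N y = c • x) (hx : x ∈ relInterior ω) :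
    IsInteriorPoint ω y := by
  intro m hm
  have h1 : (m y : ℝ) = c * pairing m x := by
    rw [← pairing_toReal, hxy, map_smul, smul_eq_mul]
  refine ⟨?_, fun h0 => ?_⟩
  · have : (0 : ℝ) ≤ m y := by rw [h1]; exact mul_nonneg hc.le (hm x hx.1)
    exact_mod_cast this
  · rw [h0, Int.cast_zero] at h1
    have h2 := (mul_eq_zero.1 h1.symm).resolve_left hc.ne'
    refine neg_mem_dualMonoid fun z hz => ?_
    obtain ⟨ε, hε, h3⟩ := hx.2 z hz
    have h4 := hm _ h3
    rw [map_sub, map_smul, h2, smul_eq_mul, zero_sub] at h4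
    have h5 := hm z hz
    nlinarith

lemma disjoint_of_relInterior [Module.Free ℤ N] [Module.Finite ℤ N]
    {ω : PointedCone ℝ (RealSpace N)} (hω : IsRational ω)
    {E : Submodule ℤ N} {v : N}
    (h₁ : {x | x ∈ ω ∧ x - toReal N v ∈ realSpan E}.Subsingleton)
    (h₂ : {x | x ∈ ω ∧ x - toReal N v ∈ realSpan E} ⊆ relInterior ω)
    {x : RealSpace N} (hx : x ∈ ω) (hxv : x - toReal N v ∈ realSpan E) :
    Disjoint (coneLattice ω) E := by
  rw [Submodule.disjoint_def]
  intro d hd hdE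
  obtain ⟨a, b, ha, hb, rfl⟩ := exists_sub_of_mem_coneLattice hω hd
  obtain ⟨ε, hε, h3⟩ := (h₂ ⟨hx, hxv⟩).2 _ hb
  have h4 : x + ε • toReal N (a - b) ∈ ω := by
    have := add_mem h3 (PointedCone.smul_mem _ hε.le ha)
    convert this using 1
    rw [map_sub, smul_sub]; abel
  have h5 : x + ε • toReal N (a - b) - toReal N v ∈ realSpan E := by
    rw [add_sub_right_comm]
    exact add_mem hxv (Submodule.smul_mem _ _ (Submodule.subset_span ⟨_, hdE, rfl⟩))
  have h6 := h₁ ⟨h4, h5⟩ ⟨hx, hxv⟩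
  rw [add_eq_left, smul_eq_zero] at h6
  refine toReal_injective ?_
  rw [map_zero]
  exact h6.resolve_left hε.ne'

end Displacement

end

section

/-! ### Generic vectors -/

section Degeneration

lemma relIndex_sup_sup {A : Type*} [AddCommGroup A] {P E D : AddSubgroup A} (hPE : P ≤ E)
    (hED : Disjoint D E) : (P ⊔ D).relIndex (E ⊔ D) = P.relIndex E := by
  have h1 : E ⊔ D = E ⊔ (P ⊔ D) := by
    rw [← sup_assoc, sup_eq_left.2 hPE]
  have h2 : (P ⊔ D) ⊓ E = P := by
    rw [sup_inf_assoc_of_le D hPE, hED.eq_bot, sup_bot_eq]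
  rw [h1, AddSubgroup.relIndex_sup_right, ← AddSubgroup.inf_relIndex_right, h2]

lemma index_comap_mkQ {A : Type*} [AddCommGroup A] (D : Submodule ℤ A) (P : Submodule ℤ (A ⧸ D)) :
    (P.comap D.mkQ).toAddSubgroup.index = P.toAddSubgroup.index :=
  AddSubgroup.index_comap_of_surjective P.toAddSubgroup (f := D.mkQ.toAddMonoidHom) D.mkQ_surjective

variable {N_X N_Y : Type u} [AddCommGroup N_X] [Module.Free ℤ N_X] [Module.Finite ℤ N_X]
  [AddCommGroup N_Y]

/-- The index `m(δ)` in terms of the images of the lattices in `N / N_τ`. -/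
lemma displacementIndex_eq {τ σ : PointedCone ℝ (RealSpace N_X)} (hτ : IsRational τ)
    (hσ : IsRational σ) (h : τ ≤ σ) (f : N_Y →ₗ[ℤ] N_X)
    (hd : Disjoint (coneLattice (σ.map (realMap (coneLattice τ).mkQ)))
      (saturation (imageInQuotient f τ))) :
    displacementIndex f σ = saturationIndex f τ *
      (coneLattice (σ.map (realMap (coneLattice τ).mkQ)) ⊔
        saturation (imageInQuotient f τ)).toAddSubgroup.index := by
  have h1 : (LinearMap.range f ⊔ coneLattice σ) =
      (imageInQuotient f τ ⊔ coneLattice (σ.map (realMap (coneLattice τ).mkQ))).comap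
        (coneLattice τ).mkQ := by
    rw [imageInQuotient_eq, coneLattice_map_mkQ hτ hσ h, ← Submodule.map_sup,
      Submodule.comap_map_eq, Submodule.ker_mkQ, sup_assoc,
      sup_eq_left.2 (coneLattice_mono h)]
  have h2 : displacementIndex f σ = (imageInQuotient f τ ⊔
      coneLattice (σ.map (realMap (coneLattice τ).mkQ))).toAddSubgroup.index := by
    rw [displacementIndex, h1, index_comap_mkQ]
  have hd' : Disjoint (coneLattice (σ.map (realMap (coneLattice τ).mkQ))).toAddSubgroup
      (saturation (imageInQuotient f τ)).toAddSubgroup := by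
    rw [AddSubgroup.disjoint_def]
    intro x hx hx'
    exact Submodule.disjoint_def.1 hd x hx hx'
  have hle : (imageInQuotient f τ).toAddSubgroup ≤
      (saturation (imageInQuotient f τ)).toAddSubgroup := fun x hx => le_saturation _ hx
  rw [h2, saturationIndex, Submodule.sup_toAddSubgroup, Submodule.sup_toAddSubgroup,
    ← relIndex_sup_sup hle hd', sup_comm (coneLattice _).toAddSubgroup]
  exact (AddSubgroup.relIndex_mul_index (sup_le_sup_right hle _)).symm

/-- The condition on the dimension in the definition of the displacement cones says that the image
of `δ` in `N / N_τ'` has complementary dimension to the image of `N(Y)`. -/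
lemma finrank_complementary_iff {τ σ : PointedCone ℝ (RealSpace N_X)} (hτ : IsRational τ)
    (hσ : IsRational σ) (h : τ ≤ σ) (f : N_Y →ₗ[ℤ] N_X) :
    Module.finrank ℤ (coneLattice (σ.map (realMap (coneLattice τ).mkQ))) +
        Module.finrank ℤ (saturation (imageInQuotient f τ)) =
        Module.finrank ℤ (N_X ⧸ coneLattice τ) ↔
      Module.finrank ℤ (coneLattice σ) + Module.finrank ℤ (LinearMap.range f) =
      Module.finrank ℤ N_X +
        Module.finrank ℤ (LinearMap.range f ⊓ coneLattice τ : Submodule ℤ N_X) := by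
  have := free_quotient_coneLattice hτ
  have h1 := finrank_coneLattice_map hτ hσ h
  have h2 := finrank_saturation (imageInQuotient f τ)
  have h3 := finrank_map_mkQ (coneLattice τ) (LinearMap.range f)
  have h4 := Submodule.finrank_quotient_add_finrank (coneLattice τ)
  rw [← imageInQuotient_eq] at h3
  omega

lemma eq_zero_of_disjoint {A : Type*} [AddCommGroup A] [Module.Free ℤ A] [Module.Finite ℤ A]
    {D E : Submodule ℤ A} (hDE : Disjoint D E)
    (hr : Module.finrank ℤ D + Module.finrank ℤ E = Module.finrank ℤ A) {g : Module.Dual ℤ A}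
    (hD : ∀ x ∈ D, g x = 0) (hE : ∀ x ∈ E, g x = 0) : g = 0 := by
  obtain ⟨c, ρ, hc, h1, h2, -, -⟩ := exists_projection hDE hr
  ext x
  have h3 : g (c • x - ρ x + ρ x) = 0 := by rw [map_add, hD _ (h1 x), hE _ (h2 x), add_zero]
  rw [sub_add_cancel, map_nsmul] at h3
  exact (smul_eq_zero.1 h3).resolve_left hc.ne'

lemma finite_quotient_sup {A : Type*} [AddCommGroup A] [Module.Free ℤ A] [Module.Finite ℤ A]
    {D E : Submodule ℤ A} (hDE : Disjoint D E)
    (hr : Module.finrank ℤ D + Module.finrank ℤ E = Module.finrank ℤ A) :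
    Finite (A ⧸ (D ⊔ E)) := by
  obtain ⟨c, ρ, hc, h1, h2, -, -⟩ := exists_projection hDE hr
  refine Module.finite_of_fg_torsion _ fun x => ?_
  obtain ⟨x, rfl⟩ := (D ⊔ E).mkQ_surjective x
  refine ⟨⟨c, mem_nonZeroDivisors_of_ne_zero (by exact_mod_cast hc.ne')⟩, ?_⟩
  change (c : ℤ) • (D ⊔ E).mkQ x = 0
  rw [← map_smul, Submodule.mkQ_apply, Submodule.Quotient.mk_eq_zero, natCast_zsmul,
    ← sub_add_cancel (c • x) (ρ x)]
  exact add_mem (Submodule.mem_sup_right (h2 x)) (Submodule.mem_sup_left (h1 x))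

lemma Meets.eq_zero {L M : Type*} [AddCommGroup L] [AddCommGroup M] {S : AddSubmonoid L}
    {π : L →ₗ[ℤ] M} {v : Module.Dual ℤ L} (h : Meets S π v) {g : L} (hg : g ∈ unitGroup S)
    (hπ : π g = 0) : v g = 0 := by
  obtain ⟨Y, hY, h⟩ := h
  have h1 := (h g hg.1).1
  have h2 := (h _ hg.2).1
  have h3 : ∀ a : ℤ, Y (0, a) = a * Y (0, 1) := fun a => by
    rw [← smul_eq_mul, ← map_smul]; simp
  rw [hπ, h3] at h1
  rw [map_neg, hπ, neg_zero, map_neg, h3] at h2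
  nlinarith

variable {X : Fan N_X} {Y : Fan N_Y} {f : N_Y →ₗ[ℤ] N_X} {τ : Y.cones} {τ' : X.cones} {v : N_X}

lemma IsGenericVector.disjoint (hv : IsGenericVector X f τ' v) {t : N_Y}
    (ht : IsInteriorPoint τ'.1 (f t)) {δ : X.cones} (hδ : δ ∈ displacementCones X f τ' v) :
    Disjoint (coneLattice (δ.1.map (realMap (coneLattice τ'.1).mkQ)))
      (saturation (imageInQuotient f τ'.1)) := by
  have hr := (finrank_complementary_iff (X.rational _ τ'.2) (X.rational _ δ.2) hδ.1 f).2 hδ.2.1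
  have hg := hv _ ⟨δ.1, δ.2, hδ.1, rfl⟩ hr
  obtain ⟨x, hx, hxv⟩ := (exists_mem_map_iff (X.rational _ τ'.2) hδ.1 ht).1 hδ.2.2
  have := free_quotient_coneLattice (X.rational _ τ'.2)
  exact disjoint_of_relInterior (IsRational.map (X.rational _ δ.2) _) hg.1 hg.2 hx hxv

/-- The lattice index with which a cone `δ` of complementary dimension contributes to the limit of
the degeneration: the index in the dual of `N'` of the restrictions of the characters of the orbit
of `δ`. -/
noncomputable def orbitIndex (f : N_Y →ₗ[ℤ] N_X) (τ δ : PointedCone ℝ (RealSpace N_X)) : ℕ :=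
  ((unitGroup (dualMonoid (δ.map (realMap (coneLattice τ).mkQ)))).map
    ((saturation (imageInQuotient f τ)).subtype.dualMap :
      Module.Dual ℤ (N_X ⧸ coneLattice τ) →+
        Module.Dual ℤ (saturation (imageInQuotient f τ)))).index

lemma IsGenericVector.displacementIndex_eq (hv : IsGenericVector X f τ' v) {t : N_Y}
    (ht : IsInteriorPoint τ'.1 (f t)) {δ : X.cones} (hδ : δ ∈ displacementCones X f τ' v) :
    displacementIndex f δ.1 = saturationIndex f τ'.1 * orbitIndex f τ'.1 δ.1 ∧
      orbitIndex f τ'.1 δ.1 ≠ 0 := by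
  have hτ := X.rational _ τ'.2
  have hσ := X.rational _ δ.2
  have hd := hv.disjoint ht hδ
  have hr := (finrank_complementary_iff hτ hσ hδ.1 f).2 hδ.2.1
  have := free_quotient_coneLattice hτ
  have hω : IsRational (δ.1.map (realMap (coneLattice τ'.1).mkQ)) := IsRational.map hσ _
  have := free_quotient_coneLattice hω
  have h1 : orbitIndex f τ'.1 δ.1 =
      (coneLattice (δ.1.map (realMap (coneLattice τ'.1).mkQ)) ⊔
        saturation (imageInQuotient f τ'.1)).toAddSubgroup.index := by
    rw [orbitIndex, map_unitGroup_dualMonoid hω, index_sup_eq hd hr]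
  refine ⟨by rw [Toric.displacementIndex_eq hτ hσ hδ.1 f hd, h1], ?_⟩
  rw [h1]
  have hfin := finite_quotient_sup hd hr
  exact AddSubgroup.index_ne_zero_iff_finite.2 hfin

/-- A direction in which the orbit closure degenerates to the strata of the displacement cones. The
vector `v` itself need not be such a direction, as it may lie on cones of small dimension which are
not contained in larger cones; it is moved slightly away from these. -/
theorem IsGenericVector.exists_direction (hv : IsGenericVector X f τ' v) {t : N_Y}
    (ht : IsInteriorPoint τ'.1 (f t)) :
    ∃ v' : N_X ⧸ coneLattice τ'.1, ∀ δ : X.cones, τ'.1 ≤ δ.1 →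
      (Meets (dualMonoid (δ.1.map (realMap (coneLattice τ'.1).mkQ)))
          (saturation (imageInQuotient f τ'.1)).subtype.dualMap (Module.Dual.eval ℤ _ v') →
        ∀ g ∈ unitGroup (dualMonoid (δ.1.map (realMap (coneLattice τ'.1).mkQ))),
          (saturation (imageInQuotient f τ'.1)).subtype.dualMap g = 0 → g = 0) ∧
      (δ ∈ displacementCones X f τ' v ↔
        Meets (dualMonoid (δ.1.map (realMap (coneLattice τ'.1).mkQ)))
          (saturation (imageInQuotient f τ'.1)).subtype.dualMap (Module.Dual.eval ℤ _ v') ∧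
        orbitIndex f τ'.1 δ.1 ≠ 0) := by
  classical
  have hτ := X.rational _ τ'.2
  have := free_quotient_coneLattice hτ
  have hfin : Finite X.cones := X.finite.to_subtype
  let := Fintype.ofFinite X.cones
  set E := saturation (imageInQuotient f τ'.1)
  let ω : X.cones → PointedCone ℝ (RealSpace (N_X ⧸ coneLattice τ'.1)) := fun δ =>
    δ.1.map (realMap (coneLattice τ'.1).mkQ)
  have hω : ∀ δ, IsRational (ω δ) := fun δ => IsRational.map (X.rational _ δ.2) _
  have hbad : ∀ δ : X.cones, ∃ g : Module.Dual ℤ (N_X ⧸ coneLattice τ'.1),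
      (∃ g' ∈ unitGroup (dualMonoid (ω δ)), E.subtype.dualMap g' = 0 ∧ g' ≠ 0) →
        g ∈ unitGroup (dualMonoid (ω δ)) ∧ E.subtype.dualMap g = 0 ∧ g ≠ 0 := by
    intro δ
    by_cases h : ∃ g' ∈ unitGroup (dualMonoid (ω δ)), E.subtype.dualMap g' = 0 ∧ g' ≠ 0
    · obtain ⟨g, hg⟩ := h
      exact ⟨g, fun _ => hg⟩
    · exact ⟨0, fun h' => absurd h' h⟩
  choose g hg using hbad
  obtain ⟨w, hw⟩ := exists_forall_ne_zero ((Finset.univ.image g).erase 0)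
    (fun g hg => (Finset.mem_erase.1 hg).1)
  suffices h : ∀ δ : X.cones, ∀ᶠ C : ℕ in Filter.atTop, τ'.1 ≤ δ.1 →
      (Meets (dualMonoid (ω δ)) E.subtype.dualMap
          (Module.Dual.eval ℤ _ (C • (coneLattice τ'.1).mkQ v + w)) →
        ∀ g ∈ unitGroup (dualMonoid (ω δ)), E.subtype.dualMap g = 0 → g = 0) ∧
      (δ ∈ displacementCones X f τ' v ↔ Meets (dualMonoid (ω δ)) E.subtype.dualMap
          (Module.Dual.eval ℤ _ (C • (coneLattice τ'.1).mkQ v + w)) ∧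
        orbitIndex f τ'.1 δ.1 ≠ 0) by
    obtain ⟨C, hC⟩ := (Filter.eventually_all.2 h).exists
    exact ⟨_, hC⟩
  intro δ
  by_cases hle : τ'.1 ≤ δ.1
  swap
  · exact Filter.Eventually.of_forall fun _ h => absurd h hle
  have hσ := X.rational _ δ.2
  by_cases hδ : ∃ g' ∈ unitGroup (dualMonoid (ω δ)), E.subtype.dualMap g' = 0 ∧ g' ≠ 0
  · obtain ⟨h1, h2, h3⟩ := hg δ hδ
    have h4 : g δ w ≠ 0 := hw _ (Finset.mem_erase.2 ⟨h3, Finset.mem_image_of_mem _ (by simp)⟩)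
    filter_upwards [eventually_ne_zero (a := g δ ((coneLattice τ'.1).mkQ v)) (.inr h4)] with C hC _
    have hnot : ¬ Meets (dualMonoid (ω δ)) E.subtype.dualMap
        (Module.Dual.eval ℤ _ (C • (coneLattice τ'.1).mkQ v + w)) := by
      intro hM
      have := hM.eq_zero h1 h2
      rw [Module.Dual.eval_apply, map_add, map_nsmul, nsmul_eq_mul] at this
      exact hC this
    refine ⟨fun h => absurd h hnot, fun h => ?_, fun h => absurd h.1 hnot⟩
    refine absurd (eq_zero_of_disjoint (hv.disjoint ht h)
      ((finrank_complementary_iff hτ hσ hle f).2 h.2.1) (fun x hx => ?_) fun x hx => ?_) h3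
    · exact (mem_unitGroup_dualMonoid_iff (hω δ)).1 h1 x hx
    · exact LinearMap.congr_fun h2 ⟨x, hx⟩
  · push Not at hδ
    by_cases hi : orbitIndex f τ'.1 δ.1 = 0
    · refine Filter.Eventually.of_forall fun C _ => ⟨fun _ => hδ, fun h => ?_, fun h =>
        absurd hi h.2⟩
      exact absurd hi (hv.displacementIndex_eq ht h).2
    have := free_quotient_coneLattice (hω δ)
    have hi' := hi
    rw [orbitIndex, map_unitGroup_dualMonoid (hω δ)] at hi'
    obtain ⟨hdis, hr⟩ := disjoint_of_index_ne_zero (fun g hg => by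
      have h1 := hδ ((coneLattice (ω δ)).mkQ.dualMap g) ((mem_unitGroup_dualMonoid_iff (hω δ)).2
        fun n hn => by
          change g ((coneLattice (ω δ)).mkQ n) = 0
          rw [Submodule.mkQ_apply, (Submodule.Quotient.mk_eq_zero _).2 hn, map_zero]) hg
      refine LinearMap.ext fun x => ?_
      obtain ⟨x, rfl⟩ := (coneLattice (ω δ)).mkQ_surjective x
      exact LinearMap.congr_fun h1 x) hi'
    obtain ⟨c, ρ, hc, h1, h2, h3, h4⟩ := exists_projection hdis hr
    have hgen := hv _ ⟨δ.1, δ.2, hle, rfl⟩ hr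
    have hint : toReal _ (ρ ((coneLattice τ'.1).mkQ v)) ∈ ω δ →
        IsInteriorPoint (ω δ) (ρ ((coneLattice τ'.1).mkQ v)) := by
      intro hx
      obtain ⟨z, hz, hzv⟩ := (exists_mem_cone_iff (hω δ) hc h2 h3 h4).2 hx
      refine isInteriorPoint_of_relInterior (c := (c : ℝ)) (x := z) (by exact_mod_cast hc) ?_
        (hgen.2 ⟨hz, hzv⟩)
      have h5 := realMap_eq_zero_of_realSpan h4 hzv
      rw [map_sub, realMap_eq_smul (hω δ) h3 hz, realMap_toReal, sub_eq_zero] at h5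
      exact h5.symm
    filter_upwards [eventually_isInteriorPoint_iff (hω δ) (h1 ((coneLattice τ'.1).mkQ v))
      (h1 w) hint] with C hC _
    refine ⟨fun _ => hδ, ?_⟩
    rw [meets_iff_projection (hω δ) hc h2 h3 h4, map_add, map_nsmul, hC,
      ← exists_mem_cone_iff (hω δ) hc h2 h3 h4, ← exists_mem_map_iff hτ hle ht]
    constructor
    · intro h
      exact ⟨h.2.2, hi⟩
    · intro h
      exact ⟨hle, (finrank_complementary_iff hτ hσ hle f).1 hr, h.1⟩

end Degeneration

end

section

/-! ### Lengths of local rings -/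

section Length

open IsLocalRing

/-- The length of the local ring of a ring at a prime ideal, as a natural number (zero if it is
infinite). -/
noncomputable def localLength {D : Type*} [CommRing D] (q : Ideal D) [q.IsPrime] : ℕ :=
  (Module.length (Localization.AtPrime q) (Localization.AtPrime q)).toNat

lemma length_eq_of_ringEquiv {A B : Type*} [CommRing A] [CommRing B] (e : A ≃+* B) :
    Module.length A A = Module.length B B := by
  apply WithBot.coe_injective
  rw [Module.coe_length, Module.coe_length]
  exact Order.krullDim_eq_of_orderIso (α := Ideal A) (β := Ideal B) e.symm.idealComapOrderIso

lemma localLength_eq {D B : Type*} [CommRing D] [CommRing B] [Algebra D B] (q : Ideal D) [q.IsPrime]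
    [IsLocalization.AtPrime B q] : localLength q = (Module.length B B).toNat := by
  rw [localLength, length_eq_of_ringEquiv
    (IsLocalization.algEquiv q.primeCompl (Localization.AtPrime q) B).toRingEquiv]

/-- The local ring of a ring which is free over a domain `A` with residue ring `A` modulo nilpotents
has length equal to the rank. -/
lemma localLength_eq_card {A D : Type*} [CommRing A] [IsDomain A] [CommRing D] [Algebra A D]
    {ι : Type*} [Finite ι] (b : Module.Basis ι A D) (P : Ideal D) [P.IsPrime]
    (hnil : ∀ x ∈ P, IsNilpotent x) (hsplit : ∀ d : D, ∃ a : A, d - algebraMap A D a ∈ P) :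
    localLength P = Nat.card ι := by
  have : Nontrivial D := ⟨⟨0, 1, fun h => Ideal.IsPrime.ne_top ‹_›
    ((Ideal.eq_top_iff_one P).2 (h ▸ P.zero_mem))⟩⟩
  have hP : ∀ a : A, algebraMap A D a ∈ P → a = 0 := by
    intro a ha
    obtain ⟨n, hn⟩ := hnil _ ha
    have := Module.Free.of_basis b
    have hinj : Function.Injective (algebraMap A D) := FaithfulSMul.algebraMap_injective A D
    by_contra h
    rw [← map_pow] at hn
    exact pow_ne_zero n h (hinj (hn.trans (map_zero _).symm))
  set M := Algebra.algebraMapSubmonoid D (nonZeroDivisors A) with hM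
  let K := Localization (nonZeroDivisors A)
  let B := Localization M
  let : Field K := inferInstanceAs (Field (FractionRing A))
  have hMP : M ≤ P.primeCompl := by
    rintro _ ⟨a, ha, rfl⟩ h
    exact nonZeroDivisors.ne_zero ha (hP a h)
  have hloc : IsLocalization.AtPrime B P := by
    refine IsLocalization.isLocalization_of_is_exists_mul_mem B M _ hMP fun x => ?_
    obtain ⟨a, ha⟩ := hsplit x
    obtain ⟨n, hn⟩ := hnil _ ha
    have ha0 : a ≠ 0 := by
      rintro rfl
      rw [map_zero, sub_zero] at ha
      exact x.2 ha
    obtain ⟨y, hy⟩ := sub_dvd_pow_sub_pow (algebraMap A D a) (-(x - algebraMap A D a)) n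
    refine ⟨y, a ^ n, mem_nonZeroDivisors_of_ne_zero (pow_ne_zero _ ha0), ?_⟩
    rw [neg_pow, hn, mul_zero, sub_zero, sub_neg_eq_add, add_sub_cancel] at hy
    rw [map_pow, hy, mul_comm]
  rw [localLength_eq (B := B) P]
  have : IsLocalRing B := IsLocalization.AtPrime.isLocalRing B P
  let b' : Module.Basis ι K B := b.localizationLocalization K (nonZeroDivisors A) B
  have : Module.Finite K B := Module.Finite.of_basis b'
  have : Nontrivial K := inferInstance
  have h1 := length_restrictScalars K B B
  have hs : Function.Surjective (algebraMap (ResidueField K) (ResidueField B)) := by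
    intro z
    obtain ⟨z, rfl⟩ := residue_surjective z
    obtain ⟨d, s, rfl⟩ := IsLocalization.exists_mk'_eq M z
    obtain ⟨_, s, hs, rfl⟩ := s
    obtain ⟨a, ha⟩ := hsplit d
    refine ⟨residue K (IsLocalization.mk' K a ⟨s, hs⟩), ?_⟩
    have h2 : algebraMap K B (IsLocalization.mk' K a ⟨s, hs⟩) * algebraMap D B (algebraMap A D s) =
        algebraMap D B (algebraMap A D a) := by
      rw [← IsScalarTower.algebraMap_apply A D B, ← IsScalarTower.algebraMap_apply A D B,
        IsScalarTower.algebraMap_apply A K B, IsScalarTower.algebraMap_apply A K B, ← map_mul]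
      congr 1
      exact IsLocalization.mk'_spec K a ⟨s, hs⟩
    have hsM : algebraMap A D s ∈ M := ⟨s, hs, rfl⟩
    have h3 := IsLocalization.mk'_spec B d ⟨algebraMap A D s, hsM⟩
    have hu : IsUnit (algebraMap D B (algebraMap A D s)) :=
      IsLocalization.map_units B (⟨algebraMap A D s, hsM⟩ : M)
    change residue B (algebraMap K B _) = residue B _
    rw [← sub_eq_zero, ← map_sub, residue_eq_zero_iff]
    rw [← Ideal.mul_unit_mem_iff_mem _ hu, sub_mul, h2, h3, ← map_sub, ← neg_sub, map_neg,
      Ideal.neg_mem_iff]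
    obtain ⟨n, hn⟩ := hnil _ ha
    refine Ideal.IsPrime.mem_of_pow_mem inferInstance n ?_
    rw [← map_pow, hn, map_zero]
    exact zero_mem _
  have h4 : Module.length (ResidueField K) (ResidueField B) = 1 := by
    have h5 : Module.length (ResidueField K) (ResidueField B) = _ :=
      Module.length_eq_of_surjective hs
    rw [h5, Module.length_eq_one]
  rw [h4, mul_one] at h1
  rw [← h1, Module.length_eq_finrank, Module.finrank_eq_nat_card_basis b']
  rfl

lemma isArtinianRing_of_localLength_ne_zero {D : Type*} [CommRing D] (q : Ideal D) [q.IsPrime]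
    (h : localLength q ≠ 0) : IsArtinianRing (Localization.AtPrime q) := by
  rw [isArtinianRing_iff_isFiniteLength, ← Module.length_ne_top_iff]
  intro h'
  exact h (by rw [localLength, h', ENat.toNat_top])

/-- Elements of a prime whose local ring has finite length are nilpotent up to multiplication by an
element outside the prime. -/
lemma exists_mul_pow_eq_zero {D : Type*} [CommRing D] (q : Ideal D) [q.IsPrime]
    (h : localLength q ≠ 0) {x : D} (hx : x ∈ q) : ∃ r ∉ q, ∃ n : ℕ, r * x ^ n = 0 := by
  have := isArtinianRing_of_localLength_ne_zero q h
  have h1 : algebraMap D (Localization.AtPrime q) x ∈ maximalIdeal (Localization.AtPrime q) :=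
    (IsLocalization.AtPrime.to_map_mem_maximal_iff _ q x).2 hx
  have h2 : IsNilpotent (algebraMap D (Localization.AtPrime q) x) := by
    obtain ⟨n, hn⟩ := IsArtinianRing.isNilpotent_jacobson_bot (R := Localization.AtPrime q)
    refine ⟨n, ?_⟩
    rw [jacobson_eq_maximalIdeal _ bot_ne_top] at hn
    have := Ideal.pow_mem_pow h1 n
    rwa [hn] at this
  obtain ⟨n, hn⟩ := h2
  rw [← map_pow, IsLocalization.map_eq_zero_iff q.primeCompl] at hn
  obtain ⟨r, hr⟩ := hn
  exact ⟨r, r.2, n, hr⟩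

/-- A local ring of finite length is the local ring of a minimal prime. -/
lemma le_of_localLength_ne_zero {D : Type*} [CommRing D] (q p : Ideal D) [q.IsPrime] [p.IsPrime]
    (h : localLength q ≠ 0) (hpq : p ≤ q) : q ≤ p := by
  intro x hx
  obtain ⟨r, hr, n, hn⟩ := exists_mul_pow_eq_zero q h hx
  have h1 : r * x ^ n ∈ p := hn ▸ zero_mem p
  exact Ideal.IsPrime.mem_of_pow_mem ‹_› n
    ((Ideal.IsPrime.mem_or_mem ‹_› h1).resolve_left fun h2 => hr (hpq h2))

open Classical in
lemma localLength_of_isDomain {D : Type*} [CommRing D] [IsDomain D] (q : Ideal D) [q.IsPrime] :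
    localLength q = if q = ⊥ then 1 else 0 := by
  split_ifs with h
  · subst h
    have h1 : IsLocalization.AtPrime (FractionRing D) (⊥ : Ideal D) := by
      rw [IsLocalization.AtPrime, Ideal.primeCompl_bot]
      infer_instance
    rw [localLength_eq (B := FractionRing D), Module.length_eq_one]
    rfl
  · by_contra h'
    exact h (le_bot_iff.1 (le_of_localLength_ne_zero q ⊥ h' bot_le))

end Length

end

section

/-! ### Monoid algebras and closed orbits -/

section MonoidAlgebra

variable (k : Type*) [Field k]

/-- The homomorphism of monoid algebras induced by a homomorphism of monoids. -/
noncomputable abbrev charMap {A B : Type*} [AddCommMonoid A] [AddCommMonoid B] (f : A →+ B) :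
    AddMonoidAlgebra k A →ₐ[k] AddMonoidAlgebra k B :=
  AddMonoidAlgebra.mapDomainAlgHom k k f

lemma charMap_single {A B : Type*} [AddCommMonoid A] [AddCommMonoid B] (f : A →+ B) (a : A)
    (c : k) :
    charMap k f (AddMonoidAlgebra.single a c) = AddMonoidAlgebra.single (f a) c := by
  simp

lemma charMap_comp {A B C : Type*} [AddCommMonoid A] [AddCommMonoid B] [AddCommMonoid C]
    (f : A →+ B) (g : B →+ C) (x : AddMonoidAlgebra k A) :
    charMap k g (charMap k f x) = charMap k (g.comp f) x := by
  induction x using AddMonoidAlgebra.induction_linear with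
  | zero => simp only [map_zero]
  | add x y hx hy => simp only [map_add, hx, hy]
  | single a c => simp only [charMap_single, AddMonoidHom.comp_apply]

lemma charMap_injective {A B : Type*} [AddCommMonoid A] [AddCommMonoid B] {f : A →+ B}
    (hf : Function.Injective f) : Function.Injective (charMap k f) :=
  AddMonoidAlgebra.mapDomain_injective hf

lemma charMap_surjective {A B : Type*} [AddCommMonoid A] [AddCommMonoid B] {f : A →+ B}
    (hf : Function.Surjective f) : Function.Surjective (charMap k f) := by
  intro x
  induction x using AddMonoidAlgebra.induction_linear with
  | zero => exact ⟨0, map_zero _⟩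
  | add x y hx hy =>
    obtain ⟨x, rfl⟩ := hx
    obtain ⟨y, rfl⟩ := hy
    exact ⟨x + y, map_add _ _ _⟩
  | single a c =>
    obtain ⟨a, rfl⟩ := hf a
    exact ⟨_, charMap_single k f a c⟩

lemma coeff_charMap {A B : Type*} [AddCommMonoid A] [AddCommMonoid B] {f : A →+ B}
    (hf : Function.Injective f) (x : AddMonoidAlgebra k A) (a : A) :
    (charMap k f x).coeff (f a) = x.coeff a :=
  Finsupp.mapDomain_apply hf _ _

lemma coeff_charMap_of_notMem {A B : Type*} [AddCommMonoid A] [AddCommMonoid B] {f : A →+ B}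
    (x : AddMonoidAlgebra k A) {b : B} (hb : b ∉ Set.range f) :
    (charMap k f x).coeff b = 0 :=
  Finsupp.mapDomain_of_notMem_range _ _ hb

variable {L : Type*} [AddCommGroup L]

instance [Module.Free ℤ L] [Module.Finite ℤ L] : IsDomain (AddMonoidAlgebra k L) := by
  have : AddMonoid.FG L := AddGroup.fg_iff_addMonoid_fg.1 (Module.Finite.iff_addGroup_fg.1 ‹_›)
  have : IsAddTorsionFree L := IsAddTorsionFree.of_isTorsionFree ℤ L
  infer_instance

instance [Module.Free ℤ L] [Module.Finite ℤ L] (S : AddSubmonoid L) :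
    IsDomain (AddMonoidAlgebra k S) :=
  (charMap_injective k (f := S.subtype) Subtype.val_injective).isDomain _

instance [Module.Free ℤ L] [Module.Finite ℤ L] (S : AddSubgroup L) :
    IsDomain (AddMonoidAlgebra k S) :=
  (charMap_injective k (f := S.subtype) Subtype.val_injective).isDomain _

/-- The ideal of the closed torus orbit in `Spec k[S]`, generated by the characters which are not
invertible. -/
noncomputable def nonunitIdeal (S : AddSubmonoid L) : Ideal (AddMonoidAlgebra k S) :=
  Ideal.span (AddMonoidAlgebra.of' k S '' {s | -(s : L) ∉ S})

variable {k} {S : AddSubmonoid L}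

lemma mem_nonunitIdeal {x : AddMonoidAlgebra k S} :
    x ∈ nonunitIdeal k S ↔ ∀ m : S, -(m : L) ∈ S → x.coeff m = 0 := by
  rw [nonunitIdeal, AddMonoidAlgebra.mem_ideal_span_of'_image]
  constructor
  · intro h m hm
    by_contra h0
    obtain ⟨s, hs, d, rfl⟩ := h m (Finsupp.mem_support_iff.2 h0)
    refine hs ?_
    have := add_mem hm d.2
    rwa [AddSubmonoid.coe_add, neg_add, neg_add_cancel_comm] at this
  · intro h m hm
    exact ⟨m, fun h' => Finsupp.mem_support_iff.1 hm (h m h'), 0, (zero_add m).symm⟩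

lemma nonunitIdeal_le {q : Ideal (AddMonoidAlgebra k S)}
    (hq : ∀ s : S, -(s : L) ∉ S → AddMonoidAlgebra.single s 1 ∈ q) : nonunitIdeal k S ≤ q := by
  rw [nonunitIdeal, Ideal.span_le]
  rintro _ ⟨s, hs, rfl⟩
  exact hq s hs

lemma single_mem_nonunitIdeal {s : S} :
    (AddMonoidAlgebra.single s 1 : AddMonoidAlgebra k S) ∈ nonunitIdeal k S ↔ -(s : L) ∉ S := by
  classical
  rw [mem_nonunitIdeal]
  constructor
  · intro h hs
    have := h s hs
    rw [AddMonoidAlgebra.coeff_single, Finsupp.single_eq_same] at this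
    exact one_ne_zero this
  · intro h m hm
    rw [AddMonoidAlgebra.coeff_single, Finsupp.single_eq_of_ne]
    rintro rfl
    exact h hm

variable (S) in
/-- The inclusion of the group of units of a monoid. -/
def unitIncl : unitGroup S →+ S where
  toFun u := ⟨u.1, u.2.1⟩
  map_zero' := rfl
  map_add' _ _ := rfl

lemma unitIncl_injective : Function.Injective (unitIncl S) := fun _ _ h =>
  Subtype.ext (congrArg (fun s : S => (s : L)) h)

variable (k S) in
open Classical in
/-- The restriction of a character to the closed torus orbit of `Spec k[S]`. -/
noncomputable def unitPartChar (s : S) : AddMonoidAlgebra k (unitGroup S) :=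
  if h : -(s : L) ∈ S then AddMonoidAlgebra.single ⟨s, mem_unitGroup.2 ⟨s.2, h⟩⟩ 1 else 0

lemma unitPartChar_of_mem {s : S} (h : -(s : L) ∈ S) :
    unitPartChar k S s = AddMonoidAlgebra.single ⟨s, mem_unitGroup.2 ⟨s.2, h⟩⟩ 1 := dif_pos h

lemma unitPartChar_of_notMem {s : S} (h : -(s : L) ∉ S) : unitPartChar k S s = 0 := dif_neg h

variable (k S) in
/-- The restriction of functions to the closed torus orbit of `Spec k[S]`. -/
noncomputable def unitPart : AddMonoidAlgebra k S →ₐ[k] AddMonoidAlgebra k (unitGroup S) :=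
  AddMonoidAlgebra.lift k _ _
    { toFun := fun s => unitPartChar k S s.toAdd
      map_one' := by
        rw [toAdd_one, unitPartChar_of_mem (by
          rw [ZeroMemClass.coe_zero, neg_zero]; exact zero_mem S)]
        rfl
      map_mul' := fun a b => by
        by_cases ha : -(a.toAdd : L) ∈ S
        · by_cases hb : -(b.toAdd : L) ∈ S
          · rw [unitPartChar_of_mem ha, unitPartChar_of_mem hb, unitPartChar_of_mem (by
              rw [toAdd_mul, AddSubmonoid.coe_add, neg_add]; exact add_mem ha hb),
              AddMonoidAlgebra.single_mul_single, mul_one]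
            rfl
          · rw [unitPartChar_of_notMem hb, mul_zero, unitPartChar_of_notMem]
            intro h
            refine hb ?_
            have := add_mem h a.toAdd.2
            rwa [toAdd_mul, AddSubmonoid.coe_add, neg_add, neg_add_cancel_comm] at this
        · rw [unitPartChar_of_notMem ha, zero_mul, unitPartChar_of_notMem]
          intro h
          refine ha ?_
          have := add_mem h b.toAdd.2
          rwa [toAdd_mul, AddSubmonoid.coe_add, neg_add, neg_add_cancel_right] at this }

lemma unitPart_single (s : S) (c : k) :
    unitPart k S (AddMonoidAlgebra.single s c) = c • unitPartChar k S s :=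
  AddMonoidAlgebra.lift_single _ _ _

lemma unitPart_single_of_mem {s : S} (hs : -(s : L) ∈ S) (c : k) :
    unitPart k S (AddMonoidAlgebra.single s c) =
      AddMonoidAlgebra.single ⟨s, mem_unitGroup.2 ⟨s.2, hs⟩⟩ c := by
  rw [unitPart_single, unitPartChar_of_mem hs, AddMonoidAlgebra.smul_single', mul_one]

lemma unitPart_single_of_notMem {s : S} (hs : -(s : L) ∉ S) (c : k) :
    unitPart k S (AddMonoidAlgebra.single s c) = 0 := by
  rw [unitPart_single, unitPartChar_of_notMem hs, smul_zero]

lemma coeff_unitPart (x : AddMonoidAlgebra k S) (u : unitGroup S) :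
    (unitPart k S x).coeff u = x.coeff (unitIncl S u) := by
  classical
  induction x using AddMonoidAlgebra.induction_linear with
  | zero => simp
  | add x y hx hy => rw [map_add, AddMonoidAlgebra.coeff_add, AddMonoidAlgebra.coeff_add,
      Finsupp.add_apply, Finsupp.add_apply, hx, hy]
  | single s c =>
    by_cases hs : -(s : L) ∈ S
    · rw [unitPart_single_of_mem hs, AddMonoidAlgebra.coeff_single, AddMonoidAlgebra.coeff_single,
        Finsupp.single_apply, Finsupp.single_apply]
      exact if_congr ⟨fun h => Subtype.ext (congrArg (Subtype.val : unitGroup S → L) h),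
        fun h => Subtype.ext (congrArg (Subtype.val : S → L) h)⟩ rfl rfl
    · rw [unitPart_single_of_notMem hs, AddMonoidAlgebra.coeff_single, Finsupp.single_eq_of_ne]
      · rfl
      · intro h
        have h1 : (u : L) = s := congrArg (Subtype.val : S → L) h
        exact hs (h1 ▸ u.2.2)

lemma ker_unitPart : RingHom.ker (unitPart k S) = nonunitIdeal k S := by
  ext x
  rw [RingHom.mem_ker, mem_nonunitIdeal]
  constructor
  · intro h m hm
    have := coeff_unitPart x ⟨m, m.2, hm⟩
    rw [h] at this
    exact this.symm
  · intro h
    ext u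
    rw [coeff_unitPart]
    exact h _ u.2.2

lemma unitPart_charMap (a : AddMonoidAlgebra k (unitGroup S)) :
    unitPart k S (charMap k (unitIncl S) a) = a := by
  ext u
  rw [coeff_unitPart, coeff_charMap k unitIncl_injective]

lemma unitPart_surjective : Function.Surjective (unitPart k S) :=
  fun a => ⟨_, unitPart_charMap a⟩

instance [Module.Free ℤ L] [Module.Finite ℤ L] : (nonunitIdeal k S).IsPrime := by
  rw [← ker_unitPart]
  exact RingHom.ker_isPrime _

/-! ### Cosets of the group generated by the units and an element -/

variable {Λ : Type*} [AddCommGroup Λ] {T : AddSubmonoid Λ}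

/-- The subgroup generated by the units of a monoid and the element `t`. -/
def unitsSup (T : AddSubmonoid Λ) (t : Λ) : AddSubgroup Λ := unitGroup T ⊔ AddSubgroup.zmultiples t

lemma mem_unitsSup {t x : Λ} :
    x ∈ unitsSup T t ↔ ∃ f ∈ unitGroup T, ∃ n : ℤ, f + n • t = x := by
  rw [unitsSup, AddSubgroup.mem_sup]
  constructor
  · rintro ⟨f, hf, _, ⟨n, rfl⟩, h⟩
    exact ⟨f, hf, n, h⟩
  · rintro ⟨f, hf, n, h⟩
    exact ⟨f, hf, _, ⟨n, rfl⟩, h⟩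

/-- If multiples of all noninvertible elements are divisible by `t`, then the units and `t` generate
a subgroup of finite index. -/
lemma index_unitsSup_ne_zero [Module.Free ℤ Λ] [Module.Finite ℤ Λ] (hT : T.FG)
    (hgen : AddSubgroup.closure (T : Set Λ) = ⊤) {t : Λ}
    (ht : t ∈ T) (ht' : -t ∉ T)
    (h : ∀ s ∈ T, -s ∉ T → ∃ n : ℕ, n • s - t ∈ T) : (unitsSup T t).index ≠ 0 := by
  classical
  obtain ⟨Y, hY⟩ := exists_functional_pos hT
  have hYt : 0 < Y t := lt_of_le_of_ne (hY t ht).1 fun h => ht' ((hY t ht).2 h.symm)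
  obtain ⟨g, rfl⟩ := hT
  set T := AddSubmonoid.closure (g : Set Λ)
  have hgT : ∀ s ∈ g, s ∈ T := fun s hs => AddSubmonoid.subset_closure hs
  have hn : ∀ s, ∃ n : ℕ, s ∈ g → -s ∉ T → n • s - t ∈ T := by
    intro s
    by_cases hs : s ∈ g ∧ -s ∉ T
    · obtain ⟨n, hn⟩ := h s (hgT s hs.1) hs.2
      exact ⟨n, fun _ _ => hn⟩
    · exact ⟨0, fun h1 h2 => absurd ⟨h1, h2⟩ hs⟩
  choose n hn using hn
  let G := Λ ⧸ unitsSup T t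
  let p : Λ →+ G := QuotientAddGroup.mk' (unitsSup T t)
  have hp : ∀ x, x ∈ unitsSup T t → p x = 0 := fun x hx =>
    (QuotientAddGroup.eq_zero_iff x).2 hx
  have hpt : p t = 0 := hp t (mem_unitsSup.2 ⟨0, zero_mem _, 1, by simp⟩)
  -- every class of an element of the monoid is represented by a combination of generators with
  -- bounded coefficients
  let O : Set G := Set.range fun c : (∀ s : g, Fin (n s + 1)) => ∑ s : g, (c s : ℕ) • p s
  have hO : ∀ N : ℕ, ∀ x ∈ T, Y x ≤ N → p x ∈ O := by
    intro N
    induction N using Nat.strong_induction_on with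
    | _ N ih =>
      intro x hx hxN
      by_cases hxt : x - t ∈ T
      · have h1 : p x = p (x - t) := by rw [map_sub, hpt, sub_zero]
        rw [h1]
        have h2 := (hY _ hxt).1
        rw [map_sub] at h2
        refine ih (Y (x - t)).toNat ?_ _ hxt (by rw [map_sub]; omega)
        rw [map_sub]
        omega
      · obtain ⟨a, ha⟩ := AddSubmonoid.mem_closure_finset'.1 hx
        refine ⟨fun s => if hs : -(s : Λ) ∈ T then 0 else ⟨a s, ?_⟩, ?_⟩
        · rw [Nat.lt_succ_iff]
          by_contra! hlt
          refine hxt ?_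
          rw [ha, ← Finset.add_sum_erase _ _ (Finset.mem_univ s), ← Nat.sub_add_cancel hlt.le,
            add_smul, add_assoc, add_sub_assoc, add_sub_right_comm]
          refine add_mem (nsmul_mem (hgT s s.2) _) (add_mem (hn s s.2 hs) ?_)
          exact sum_mem fun i _ => nsmul_mem (hgT i i.2) _
        · have h3 := congrArg p ha
          rw [map_sum] at h3
          refine Eq.trans ?_ h3.symm
          refine Finset.sum_congr rfl fun s _ => ?_
          by_cases hs : -(s : Λ) ∈ T
          · have h1 : p s = 0 := hp _ (mem_unitsSup.2 ⟨s, ⟨hgT s s.2, hs⟩, 0, by simp⟩)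
            rw [map_nsmul, h1, smul_zero, smul_zero]
          · dsimp only
            rw [dif_neg hs, map_nsmul]
  have hfinT : (p '' (T : Set Λ)).Finite := (Set.finite_range _).subset (by
    rintro _ ⟨x, hx, rfl⟩
    exact hO (Y x).toNat x hx (by have := (hY x hx).1; omega))
  -- a finite submonoid of a group is a subgroup
  have hneg : ∀ x ∈ T, p (-x) ∈ p '' (T : Set Λ) := by
    intro x hx
    obtain ⟨i, j, hij, h1⟩ : ∃ i j : ℕ, i < j ∧ p (i • x) = p (j • x) := by
      by_contra! hcon
      have hinj : Function.Injective fun i : ℕ => (⟨p (i • x), _, nsmul_mem hx i, rfl⟩ :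
          p '' (T : Set Λ)) := by
        intro i j hij
        have hij' : p (i • x) = p (j • x) := congrArg Subtype.val hij
        rcases lt_trichotomy i j with h2 | h2 | h2
        · exact absurd hij' (hcon i j h2)
        · exact h2
        · exact absurd hij'.symm (hcon j i h2)
      have := hfinT.to_subtype
      exact not_injective_infinite_finite _ hinj
    refine ⟨(j - i - 1) • x, nsmul_mem hx _, ?_⟩
    have h2 : j • x = i • x + ((j - i - 1) • x + x) := by
      rw [← succ_nsmul, ← add_smul]
      congr 1
      omega
    rw [h2, map_add, left_eq_add, map_add] at h1
    rw [map_neg]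
    exact eq_neg_of_add_eq_zero_left h1
  have hall : ∀ x : Λ, p x ∈ p '' (T : Set Λ) := by
    intro x
    have hx : x ∈ AddSubgroup.closure (T : Set Λ) := hgen ▸ AddSubgroup.mem_top x
    induction hx using AddSubgroup.closure_induction with
    | mem x hx => exact ⟨x, hx, rfl⟩
    | zero => exact ⟨0, zero_mem T, rfl⟩
    | add x y _ _ hx hy =>
      obtain ⟨a, ha, ha'⟩ := hx
      obtain ⟨b, hb, hb'⟩ := hy
      exact ⟨a + b, add_mem ha hb, by rw [map_add, map_add, ha', hb']⟩
    | neg x _ hx =>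
      obtain ⟨a, ha, ha'⟩ := hx
      rw [map_neg, ← ha', ← map_neg]
      exact hneg a ha
  rw [AddSubgroup.index_ne_zero_iff_finite]
  have : Finite (p '' (T : Set Λ)) := hfinT.to_subtype
  refine Finite.of_surjective (fun z : p '' (T : Set Λ) => (z.1 : G)) fun z => ?_
  obtain ⟨x, rfl⟩ := QuotientAddGroup.mk'_surjective _ z
  exact ⟨⟨_, hall x⟩, rfl⟩

/-- In a coset of the subgroup generated by the units and `t`, the elements of the monoid are the
translates of a single element by the units and multiples of `t`. -/
lemma exists_representative [Module.Free ℤ Λ] [Module.Finite ℤ Λ] (hT : T.FG)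
    (hgen : AddSubgroup.closure (T : Set Λ) = ⊤) {t : Λ}
    (ht : t ∈ T) (ht' : -t ∉ T) (h : (unitsSup T t).index ≠ 0) (c : Λ ⧸ unitsSup T t) :
    ∃ s : T, ((s : Λ) : Λ ⧸ unitsSup T t) = c ∧ (s : Λ) - t ∉ T ∧
      ∀ x ∈ T, (x : Λ ⧸ unitsSup T t) = c →
        ∃ f ∈ unitGroup T, ∃ n : ℕ, x = s + f + n • t := by
  classical
  obtain ⟨Y, hY⟩ := exists_functional_pos hT
  have hYt : 0 < Y t := lt_of_le_of_ne (hY t ht).1 fun h => ht' ((hY t ht).2 h.symm)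
  have hYu : ∀ f ∈ unitGroup T, Y f = 0 := fun f hf => by
    have h1 := (hY f hf.1).1
    have h2 := (hY _ hf.2).1
    rw [map_neg] at h2
    omega
  have hmemt : t ∈ unitsSup T t := mem_unitsSup.2 ⟨0, zero_mem _, 1, by simp⟩
  -- each coset contains an element of the monoid
  have hne : ∃ N : ℕ, ∃ s ∈ T, (s : Λ ⧸ unitsSup T t) = c ∧ Y s = N := by
    suffices h1 : ∃ s ∈ T, (s : Λ ⧸ unitsSup T t) = c by
      obtain ⟨s, hs, hsc⟩ := h1
      exact ⟨(Y s).toNat, s, hs, hsc, by have := (hY s hs).1; omega⟩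
    obtain ⟨x, rfl⟩ := QuotientAddGroup.mk_surjective c
    have hx : x ∈ AddSubgroup.closure (T : Set Λ) := hgen ▸ AddSubgroup.mem_top x
    induction hx using AddSubgroup.closure_induction with
    | mem x hx => exact ⟨x, hx, rfl⟩
    | zero => exact ⟨0, zero_mem T, rfl⟩
    | add x y _ _ hx hy =>
      obtain ⟨a, ha, ha'⟩ := hx
      obtain ⟨b, hb, hb'⟩ := hy
      exact ⟨a + b, add_mem ha hb, by
        rw [QuotientAddGroup.mk_add, QuotientAddGroup.mk_add, ha', hb']⟩
    | neg x _ hx =>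
      obtain ⟨a, ha, ha'⟩ := hx
      refine ⟨((unitsSup T t).index - 1) • a, nsmul_mem ha _, ?_⟩
      rw [QuotientAddGroup.mk_neg, ← ha']
      refine eq_neg_of_add_eq_zero_left ?_
      rw [← QuotientAddGroup.mk_add, ← succ_nsmul, Nat.sub_add_cancel (Nat.pos_of_ne_zero h),
        QuotientAddGroup.eq_zero_iff]
      exact AddSubgroup.nsmul_index_mem _ a
  obtain ⟨s, hs, hsc, hsN⟩ := Nat.find_spec hne
  have hmin : ∀ x ∈ T, (x : Λ ⧸ unitsSup T t) = c → Y s ≤ Y x := by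
    intro x hx hxc
    have h1 := Nat.find_min' hne ⟨x, hx, hxc, (Int.toNat_of_nonneg (hY x hx).1).symm⟩
    have h2 := (hY x hx).1
    omega
  refine ⟨⟨s, hs⟩, hsc, fun hst => ?_, fun x hx hxc => ?_⟩
  · have h1 := hmin _ hst (by
      rw [QuotientAddGroup.mk_sub, (QuotientAddGroup.eq_zero_iff t).2 hmemt, sub_zero]
      exact hsc)
    rw [map_sub] at h1
    dsimp only at h1
    omega
  · rw [← hsc, eq_comm, QuotientAddGroup.eq] at hxc
    obtain ⟨f, hf, n, hfn⟩ := mem_unitsSup.1 hxc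
    have hx' : x = s + f + n • t := by
      rw [add_assoc, hfn, add_neg_cancel_left]
    have h1 := hmin x hx (by rw [← hsc, eq_comm, QuotientAddGroup.eq]; exact hxc)
    rw [hx', map_add, map_add, hYu f hf, add_zero, map_smul, smul_eq_mul, le_add_iff_nonneg_right]
      at h1
    have h2 : 0 ≤ n := nonneg_of_mul_nonneg_left h1 hYt
    refine ⟨f, hf, n.toNat, ?_⟩
    rw [← natCast_zsmul, Int.toNat_of_nonneg h2]
    exact hx'

end MonoidAlgebra

end

section

/-! ### The local ring of a fibre at the closed orbit -/

section FibreLength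

variable {k : Type*} [Field k] {Λ : Type*} [AddCommGroup Λ] {T : AddSubmonoid Λ}

lemma mem_span_single {t : T} {x : AddMonoidAlgebra k T} :
    x ∈ Ideal.span {AddMonoidAlgebra.single t (1 : k)} ↔
      ∀ m : T, x.coeff m ≠ 0 → (m : Λ) - t ∈ T := by
  have h := AddMonoidAlgebra.mem_ideal_span_of'_image (k := k) (s := {t}) (x := x)
  rw [Set.image_singleton, AddMonoidAlgebra.of'_apply] at h
  rw [h]
  constructor
  · intro h m hm
    obtain ⟨_, rfl, d, rfl⟩ := h m (Finsupp.mem_support_iff.2 hm)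
    rw [AddSubmonoid.coe_add, add_sub_cancel_right]
    exact d.2
  · intro h m hm
    exact ⟨t, rfl, ⟨_, h m (Finsupp.mem_support_iff.1 hm)⟩, Subtype.ext (sub_add_cancel _ _).symm⟩

lemma coeff_mul_single (x : AddMonoidAlgebra k T) (s m : T) (h : (m : Λ) - s ∈ T) :
    (x * AddMonoidAlgebra.single s (1 : k)).coeff m = x.coeff ⟨_, h⟩ := by
  have h1 := coeff_charMap k (f := T.subtype) Subtype.val_injective
    (x * AddMonoidAlgebra.single s (1 : k)) m
  have h2 := coeff_charMap k (f := T.subtype) Subtype.val_injective x ⟨_, h⟩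
  rw [← h1, ← h2, map_mul, charMap_single, AddMonoidAlgebra.coeff_mul_single_apply, mul_one,
    ← sub_eq_add_neg]
  rfl

lemma coeff_charMap_mul_single (a : AddMonoidAlgebra k (unitGroup T)) (s : T) {m : T}
    (u : unitGroup T) (h : (m : Λ) = s + u) :
    (charMap k (unitIncl T) a * AddMonoidAlgebra.single s (1 : k)).coeff m = a.coeff u := by
  have h1 : (m : Λ) - s = u := by rw [h, add_sub_cancel_left]
  rw [coeff_mul_single _ _ _ (h1 ▸ u.2.1), ← coeff_charMap k unitIncl_injective a u]
  congr 1
  exact Subtype.ext h1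

lemma coeff_charMap_mul_single_eq_zero (a : AddMonoidAlgebra k (unitGroup T)) (s m : T)
    (h : (m : Λ) - s ∉ unitGroup T) :
    (charMap k (unitIncl T) a * AddMonoidAlgebra.single s (1 : k)).coeff m = 0 := by
  have h1 := coeff_charMap k (f := T.subtype) Subtype.val_injective
    (charMap k (unitIncl T) a * AddMonoidAlgebra.single s (1 : k)) m
  rw [← h1, map_mul, charMap_single, charMap_comp, AddMonoidAlgebra.coeff_mul_single_apply, mul_one,
    ← sub_eq_add_neg]
  refine coeff_charMap_of_notMem _ _ ?_
  rintro ⟨u, hu⟩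
  exact h (hu ▸ u.2)

variable (t : T)

/-- The ring of functions of the fibre over zero of the function `χ^t` on `Spec k[T]`. -/
abbrev FibreRing (k : Type*) [Field k] {Λ : Type*} [AddCommGroup Λ] {T : AddSubmonoid Λ} (t : T) :
    Type _ :=
  AddMonoidAlgebra k T ⧸ Ideal.span {AddMonoidAlgebra.single t (1 : k)}

lemma span_le_nonunitIdeal (ht : -(t : Λ) ∉ T) :
    Ideal.span {AddMonoidAlgebra.single t (1 : k)} ≤ nonunitIdeal k T := by
  rw [Ideal.span_le, Set.singleton_subset_iff]
  exact single_mem_nonunitIdeal.2 ht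

/-- The ideal of the closed orbit in the fibre. -/
noncomputable def orbitIdeal (k : Type*) [Field k] {Λ : Type*} [AddCommGroup Λ]
    {T : AddSubmonoid Λ} (t : T) : Ideal (FibreRing k t) :=
  (nonunitIdeal k T).map (Ideal.Quotient.mk _)

lemma comap_orbitIdeal [Module.Free ℤ Λ] [Module.Finite ℤ Λ] (ht : -(t : Λ) ∉ T) :
    (orbitIdeal k t).comap (Ideal.Quotient.mk _) = nonunitIdeal k T := by
  rw [orbitIdeal, Ideal.comap_map_of_surjective _ Ideal.Quotient.mk_surjective, ← RingHom.ker_eq_comap_bot,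
    Ideal.mk_ker, sup_eq_left]
  exact span_le_nonunitIdeal t ht

lemma orbitIdeal_isPrime [Module.Free ℤ Λ] [Module.Finite ℤ Λ]
    (ht : -(t : Λ) ∉ T) : (orbitIdeal k t).IsPrime := by
  refine Ideal.map_isPrime_of_surjective Ideal.Quotient.mk_surjective ?_
  rw [Ideal.mk_ker]
  exact span_le_nonunitIdeal t ht

/-- The functions on the fibre are free over the group ring of the units: a basis is given by the
elements of the cosets of `unitsSup T t` from which `t` cannot be subtracted within `T`, and modulo
nilpotents only the unit coset remains. -/
lemma localLength_orbitIdeal [Module.Free ℤ Λ] [Module.Finite ℤ Λ] (hT : T.FG)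
    (hgen : AddSubgroup.closure (T : Set Λ) = ⊤)
    (ht : -(t : Λ) ∉ T) [(orbitIdeal k t).IsPrime] (h : (unitsSup T t).index ≠ 0) :
    localLength (orbitIdeal k t) = (unitsSup T t).index := by
  classical
  let R := AddMonoidAlgebra k T
  let D := FibreRing k t
  let A := AddMonoidAlgebra k (unitGroup T)
  let mk : R →+* D := Ideal.Quotient.mk _
  have hmk : Function.Surjective mk := Ideal.Quotient.mk_surjective
  have hmk0 : ∀ x : R, mk x = 0 ↔ ∀ m : T, x.coeff m ≠ 0 → (m : Λ) - t ∈ T := fun x =>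
    Ideal.Quotient.eq_zero_iff_mem.trans mem_span_single
  let : Algebra A D := (mk.comp (charMap k (unitIncl T)).toRingHom).toAlgebra
  have halg : ∀ a : A, algebraMap A D a = mk (charMap k (unitIncl T) a) := fun _ => rfl
  let ι := Λ ⧸ unitsSup T t
  have : Finite ι := AddSubgroup.index_ne_zero_iff_finite.1 h
  choose s hsc hst hs using exists_representative hT hgen t.2 ht h
  let b : ι → D := fun c => mk (AddMonoidAlgebra.single (s c) 1)
  have hunit : ∀ u ∈ unitGroup T, (u : Λ ⧸ unitsSup T t) = 0 := fun u hu =>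
    (QuotientAddGroup.eq_zero_iff u).2 (mem_unitsSup.2 ⟨u, hu, 0, by simp⟩)
  have hli : LinearIndependent A b := by
    rw [linearIndependent_iff']
    intro S a hsum c hc
    have h1 : mk (∑ i ∈ S, charMap k (unitIncl T) (a i) * AddMonoidAlgebra.single (s i) 1) = 0 := by
      rw [← hsum, map_sum]
      refine Finset.sum_congr rfl fun i _ => ?_
      rw [map_mul, Algebra.smul_def, halg]
    rw [hmk0] at h1
    ext u
    by_contra hau
    have h2 : ((s c : Λ) + u) ∈ T := add_mem (s c).2 u.2.1
    have h3 := h1 ⟨_, h2⟩ (by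
      rw [AddMonoidAlgebra.coeff_sum, Finsupp.finsetSum_apply, Finset.sum_eq_single c,
        coeff_charMap_mul_single _ _ u rfl]
      · exact hau
      · intro i _ hic
        refine coeff_charMap_mul_single_eq_zero _ _ _ fun hu => hic ?_
        have h4 := hunit _ hu
        rw [QuotientAddGroup.mk_sub, QuotientAddGroup.mk_add, hunit u u.2, hsc, hsc, add_zero,
          sub_eq_zero] at h4
        exact h4.symm
      · intro h5
        exact absurd hc h5)
    refine hst c ?_
    have h4 := add_mem h3 u.2.2
    convert h4 using 1
    dsimp only
    abel
  have hspan : ⊤ ≤ Submodule.span A (Set.range b) := by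
    rintro d -
    obtain ⟨x, rfl⟩ := hmk d
    induction x using AddMonoidAlgebra.induction_linear with
    | zero => rw [map_zero]; exact zero_mem _
    | add x y hx hy => rw [map_add]; exact add_mem hx hy
    | single m c =>
      obtain ⟨u, hu, n, hn⟩ := hs _ m m.2 rfl
      set i : ι := ((m : Λ) : Λ ⧸ unitsSup T t)
      have h1 : (AddMonoidAlgebra.single m c : R) = charMap k (unitIncl T)
          (AddMonoidAlgebra.single ⟨u, hu⟩ c) * AddMonoidAlgebra.single (s i) 1 *
            AddMonoidAlgebra.single t 1 ^ n := by
        rw [charMap_single, AddMonoidAlgebra.single_pow, AddMonoidAlgebra.single_mul_single,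
          AddMonoidAlgebra.single_mul_single, one_pow, mul_one, mul_one]
        congr 1
        refine Subtype.ext ?_
        rw [hn, add_comm (s i : Λ)]
        rfl
      have h2 : mk (AddMonoidAlgebra.single t 1) = 0 :=
        Ideal.Quotient.eq_zero_iff_mem.2 (Ideal.mem_span_singleton_self _)
      rw [h1, map_mul, map_mul, map_pow, h2, ← halg, ← Algebra.smul_def]
      rcases n with _ | n
      · rw [pow_zero, mul_one]
        exact Submodule.smul_mem _ _ (Submodule.subset_span ⟨i, rfl⟩)
      · rw [pow_succ, mul_zero, mul_zero]
        exact zero_mem _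
  obtain ⟨Y, hY⟩ := exists_functional_pos hT
  refine localLength_eq_card (Module.Basis.mk hli hspan) _ ?_ ?_
  · have h1 : orbitIdeal k t ≤ nilradical D := by
      rw [orbitIdeal, nonunitIdeal, Ideal.map_span, Ideal.span_le]
      rintro _ ⟨_, ⟨m, hm, rfl⟩, rfl⟩
      refine mem_nilradical.2 ⟨(unitsSup T t).index, ?_⟩
      rw [← map_pow, AddMonoidAlgebra.of'_apply, AddMonoidAlgebra.single_pow]
      refine (hmk0 _).2 fun x hx => ?_
      rw [AddMonoidAlgebra.coeff_single, Finsupp.single_apply] at hx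
      obtain rfl : (unitsSup T t).index • m = x := by
        by_contra h1
        exact hx (if_neg h1)
      obtain ⟨u, hu, n, hn⟩ := mem_unitsSup.1 (AddSubgroup.nsmul_index_mem (unitsSup T t) (m : Λ))
      have h2 : 0 < Y ((unitsSup T t).index • (m : Λ)) := by
        rw [map_nsmul]
        exact smul_pos (Nat.pos_of_ne_zero h) (lt_of_le_of_ne (hY m m.2).1
          fun h => hm ((hY m m.2).2 h.symm))
      have h3 : Y u = 0 := by
        have h3 := (hY u hu.1).1
        have h4 := (hY _ hu.2).1
        rw [map_neg] at h4
        omega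
      have h4 : 0 < n := by
        rw [← hn, map_add, h3, zero_add, map_smul, smul_eq_mul] at h2
        exact pos_of_mul_pos_left h2 (hY t t.2).1
      obtain ⟨n, rfl⟩ := Int.eq_succ_of_zero_lt h4
      have h5 : ((((unitsSup T t).index • m : T) : Λ) - t) = u + n • (t : Λ) := by
        rw [AddSubmonoidClass.coe_nsmul, ← hn, add_smul, one_smul, natCast_zsmul]
        abel
      rw [h5]
      exact add_mem hu.1 (nsmul_mem t.2 n)
    exact fun x hx => h1 hx
  · intro d
    obtain ⟨x, rfl⟩ := hmk d
    refine ⟨unitPart k T x, ?_⟩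
    rw [halg, ← map_sub]
    refine Ideal.mem_map_of_mem _ ?_
    rw [← ker_unitPart, RingHom.mem_ker, map_sub, unitPart_charMap, sub_self]

open Classical in
/-- The multiplicity of the fibre of `χ^t` at a prime which contains all noninvertible characters is
the index of the subgroup generated by the units and `t`, if the prime is the ideal of the closed
orbit; otherwise the local ring has infinite length. -/
theorem localLength_fibre [Module.Free ℤ Λ] [Module.Finite ℤ Λ] (hT : T.FG)
    (hgen : AddSubgroup.closure (T : Set Λ) = ⊤)
    (q : Ideal (FibreRing k t)) [q.IsPrime]
    (hq : nonunitIdeal k T ≤ q.comap (Ideal.Quotient.mk _)) :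
    localLength q = if q.comap (Ideal.Quotient.mk _) = nonunitIdeal k T then
      (unitsSup T t).index else 0 := by
  have ht : -(t : Λ) ∉ T := by
    intro ht
    have h1 : (AddMonoidAlgebra.single t 1 : AddMonoidAlgebra k T) ∈
        q.comap (Ideal.Quotient.mk _) := by
      rw [Ideal.mem_comap, Ideal.Quotient.eq_zero_iff_mem.2 (Ideal.mem_span_singleton_self _)]
      exact zero_mem _
    refine Ideal.IsPrime.ne_top (I := q.comap (Ideal.Quotient.mk _)) inferInstance
      (Ideal.eq_top_of_isUnit_mem _ h1 (IsUnit.of_mul_eq_one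
        (AddMonoidAlgebra.single (⟨-(t : Λ), ht⟩ : T) 1) ?_))
    rw [AddMonoidAlgebra.single_mul_single, mul_one, AddMonoidAlgebra.one_def]
    congr 1
    exact Subtype.ext (add_neg_cancel (t : Λ))
  have hprime := orbitIdeal_isPrime (k := k) t ht
  have hle : orbitIdeal k t ≤ q := Ideal.map_le_iff_le_comap.2 hq
  split_ifs with h
  · obtain rfl : q = orbitIdeal k t := by
      apply Ideal.comap_injective_of_surjective _ Ideal.Quotient.mk_surjective
      rw [h, comap_orbitIdeal t ht]
    by_cases hi : (unitsSup T t).index = 0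
    · rw [hi]
      by_contra hl
      refine index_unitsSup_ne_zero hT hgen t.2 ht (fun s hs hs' => ?_) hi
      have h1 : Ideal.Quotient.mk (Ideal.span {AddMonoidAlgebra.single t (1 : k)})
          (AddMonoidAlgebra.single ⟨s, hs⟩ 1) ∈ orbitIdeal k t :=
        Ideal.mem_map_of_mem _ (single_mem_nonunitIdeal.2 hs')
      obtain ⟨r, hr, n, hn⟩ := exists_mul_pow_eq_zero _ hl h1
      obtain ⟨r, rfl⟩ := Ideal.Quotient.mk_surjective r
      have hr' : r ∉ nonunitIdeal k T := fun h => hr (Ideal.mem_map_of_mem _ h)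
      rw [mem_nonunitIdeal] at hr'
      push Not at hr'
      obtain ⟨u, hu, hru⟩ := hr'
      rw [← map_pow, ← map_mul, Ideal.Quotient.eq_zero_iff_mem, AddMonoidAlgebra.single_pow,
        one_pow, mem_span_single] at hn
      have h2 := hn (u + n • ⟨s, hs⟩) (by
        have h3 : ((u + n • ⟨s, hs⟩ : T) : Λ) - (n • ⟨s, hs⟩ : T) = u := by
          rw [AddSubmonoid.coe_add, add_sub_cancel_right]
        rw [coeff_mul_single _ _ _ (h3 ▸ u.2)]
        convert hru
        )
      refine ⟨n, ?_⟩
      have h3 := add_mem hu h2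
      convert h3 using 1
      rw [AddSubmonoid.coe_add, AddSubmonoidClass.coe_nsmul]
      dsimp only
      abel
    · exact localLength_orbitIdeal t hT hgen ht hi
  · by_contra hl
    refine h ?_
    rw [← comap_orbitIdeal t ht, le_antisymm (le_of_localLength_ne_zero q _ hl hle) hle]

end FibreLength

end

section

/-! ### The ring of the degeneration -/

section DegenerationRing

variable {L M : Type*} [AddCommGroup L] [AddCommGroup M]

/-- The homomorphism of monoids `S × ℕ → M × ℤ` which defines the degeneration of the image of the
torus with character lattice `M` along the one-parameter subgroup `v`: a pair `(m, a)` goes to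
`(π m, v m + a)`. -/
def degHom (S : AddSubmonoid L) (π : L →ₗ[ℤ] M) (v : Module.Dual ℤ L) : S × ℕ →+ M × ℤ where
  toFun x := (π x.1, v x.1 + x.2)
  map_zero' := by simp
  map_add' x y := by
    ext
    · simp
    · simp only [Prod.fst_add, AddSubmonoid.coe_add, map_add, Prod.snd_add, Nat.cast_add]
      ring

/-- The monoid of the characters on the degeneration. -/
def degMonoid (S : AddSubmonoid L) (π : L →ₗ[ℤ] M) (v : Module.Dual ℤ L) : AddSubmonoid (M × ℤ) :=
  AddMonoidHom.mrange (degHom S π v)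

variable {S : AddSubmonoid L} {π : L →ₗ[ℤ] M} {v : Module.Dual ℤ L}

lemma mem_degMonoid {x : M × ℤ} :
    x ∈ degMonoid S π v ↔ ∃ m ∈ S, ∃ a : ℕ, (π m, v m + a) = x := by
  constructor
  · rintro ⟨⟨m, a⟩, rfl⟩
    exact ⟨m, m.2, a, rfl⟩
  · rintro ⟨m, hm, a, rfl⟩
    exact ⟨(⟨m, hm⟩, a), rfl⟩

lemma degMonoid_fg (hS : S.FG) : (degMonoid S π v).FG := by
  have : AddMonoid.FG S := (AddMonoid.fg_iff_addSubmonoid_fg S).2 hS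
  exact (AddMonoid.fg_iff_addSubmonoid_fg _).1 (AddMonoid.fg_range (degHom S π v))

lemma closure_degMonoid (hS : AddSubgroup.closure (S : Set L) = ⊤) (hπ : Function.Surjective π) :
    AddSubgroup.closure (degMonoid S π v : Set (M × ℤ)) = ⊤ := by
  have ht : ((0, 1) : M × ℤ) ∈ AddSubgroup.closure (degMonoid S π v : Set (M × ℤ)) :=
    AddSubgroup.subset_closure (mem_degMonoid.2 ⟨0, zero_mem S, 1, by simp⟩)
  have h1 : ∀ m : L, ((π m, v m) : M × ℤ) ∈ AddSubgroup.closure (degMonoid S π v : Set (M × ℤ)) := by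
    intro m
    have hm : m ∈ AddSubgroup.closure (S : Set L) := hS ▸ AddSubgroup.mem_top m
    induction hm using AddSubgroup.closure_induction with
    | mem x hx => exact AddSubgroup.subset_closure (mem_degMonoid.2 ⟨x, hx, 0, by simp⟩)
    | zero => rw [map_zero, map_zero]; exact zero_mem _
    | add x y _ _ hx hy =>
      have := add_mem hx hy
      rwa [Prod.mk_add_mk, ← map_add, ← map_add] at this
    | neg x _ hx =>
      have := neg_mem hx
      rwa [Prod.neg_mk, ← map_neg, ← map_neg] at this
  rw [eq_top_iff]
  rintro ⟨x, a⟩ -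
  obtain ⟨m, rfl⟩ := hπ x
  have h2 := add_mem (h1 m) (zsmul_mem ht (a - v m))
  rwa [Prod.smul_mk, smul_zero, smul_eq_mul, mul_one, Prod.mk_add_mk, add_zero,
    add_sub_cancel] at h2

variable (S π v)

/-- The parameter of the degeneration. -/
def degParam : degMonoid S π v := ⟨(0, 1), mem_degMonoid.2 ⟨0, zero_mem S, 1, by simp⟩⟩

/-- The restriction of characters to the degeneration. -/
def degRestrict : S →+ degMonoid S π v where
  toFun m := ⟨(π m, v m), mem_degMonoid.2 ⟨m, m.2, 0, by simp⟩⟩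
  map_zero' := by ext <;> simp
  map_add' x y := by ext <;> simp

variable {S π v}

lemma exists_degRestrict (x : degMonoid S π v) :
    ∃ (m : S) (a : ℕ), x = degRestrict S π v m + a • degParam S π v := by
  obtain ⟨m, hm, a, h⟩ := mem_degMonoid.1 x.2
  refine ⟨⟨m, hm⟩, a, Subtype.ext ?_⟩
  rw [← h]
  ext <;> simp [degRestrict, degParam]

lemma neg_degRestrict_mem {m : S} (h : -(m : L) ∈ S) :
    -(degRestrict S π v m : M × ℤ) ∈ degMonoid S π v :=
  mem_degMonoid.2 ⟨_, h, 0, by simp [degRestrict]⟩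

/-- The functional in the definition of `Meets` is nonnegative on the degeneration monoid, and
positive on the parameter. -/
lemma Meets.neg_degParam_notMem (h : Meets S π v) : -(degParam S π v : M × ℤ) ∉ degMonoid S π v := by
  obtain ⟨Y, hY, h⟩ := h
  intro hmem
  obtain ⟨m, hm, a, hma⟩ := mem_degMonoid.1 hmem
  have h1 : Y (π m, v m + a) = Y (π m, v m) + a * Y (0, 1) := by
    rw [← nsmul_eq_mul, ← map_nsmul, ← map_add]
    simp
  have h2 : Y (-(degParam S π v : M × ℤ)) = - Y (0, 1) := map_neg _ _
  have h3 := (h m hm).1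
  rw [hma, h2] at h1
  have : (0 : ℤ) ≤ a * Y (0, 1) := by positivity
  omega

lemma Meets.neg_mem (h : Meets S π v) {m : S}
    (hm : -(degRestrict S π v m : M × ℤ) ∈ degMonoid S π v) : -(m : L) ∈ S := by
  obtain ⟨Y, hY, h⟩ := h
  obtain ⟨m', hm', a, hma⟩ := mem_degMonoid.1 hm
  have h1 : Y (π m', v m' + a) = Y (π m', v m') + a * Y (0, 1) := by
    rw [← nsmul_eq_mul, ← map_nsmul, ← map_add]
    simp
  have h2 : Y (-(degRestrict S π v m : M × ℤ)) = - Y (π m, v m) := map_neg _ _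
  have h3 := (h m' hm').1
  have h4 := (h m m.2).1
  rw [hma, h2] at h1
  have : (0 : ℤ) ≤ a * Y (0, 1) := by positivity
  exact (h m m.2).2 (by omega)

/-- Conversely, if the parameter is not invertible and only invertible characters become invertible
on the degeneration, then the cone meets the affine space. -/
lemma meets_of_notMem (hS : S.FG) (ht : -(degParam S π v : M × ℤ) ∉ degMonoid S π v)
    (h : ∀ m : S, -(degRestrict S π v m : M × ℤ) ∈ degMonoid S π v → -(m : L) ∈ S)
    [Module.Free ℤ M] [Module.Finite ℤ M] : Meets S π v := by
  obtain ⟨Y, hY⟩ := exists_functional_pos (degMonoid_fg (π := π) (v := v) hS)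
  refine ⟨Y, ?_, fun m hm => ?_⟩
  · have h1 := hY _ (degParam S π v).2
    exact lt_of_le_of_ne h1.1 fun h0 => ht (h1.2 h0.symm)
  · have h1 := hY _ (degRestrict S π v ⟨m, hm⟩).2
    exact ⟨h1.1, fun h0 => h ⟨m, hm⟩ (h1.2 h0)⟩

lemma index_unitsSup_degMonoid
    (h : ∀ m : S, -(degRestrict S π v m : M × ℤ) ∈ degMonoid S π v → -(m : L) ∈ S) :
    (unitsSup (degMonoid S π v) (degParam S π v : M × ℤ)).index =
      ((unitGroup S).map (π : L →+ M)).index := by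
  rw [← AddSubgroup.index_comap_of_surjective _ (f := AddMonoidHom.fst M ℤ) Prod.fst_surjective]
  congr 1
  ext x
  rw [unitsSup, AddSubgroup.mem_sup]
  constructor
  · rintro ⟨f, hf, _, ⟨n, rfl⟩, rfl⟩
    obtain ⟨m, a, hma⟩ := exists_degRestrict ⟨f, hf.1⟩
    have hma' : f = degRestrict S π v m + a • (degParam S π v : M × ℤ) := congrArg Subtype.val hma
    have hm : -(degRestrict S π v m : M × ℤ) ∈ degMonoid S π v := by
      have := add_mem hf.2 (nsmul_mem (degParam S π v).2 a)
      rwa [hma', neg_add, neg_add_cancel_right] at this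
    refine ⟨m, ⟨m.2, h m hm⟩, ?_⟩
    rw [hma']
    simp [degRestrict, degParam]
  · rintro ⟨m, hm, hmx⟩
    refine ⟨degRestrict S π v ⟨m, hm.1⟩, ⟨(degRestrict S π v ⟨m, hm.1⟩).2,
      neg_degRestrict_mem (m := ⟨m, hm.1⟩) hm.2⟩, _, ⟨x.2 - v m, rfl⟩, ?_⟩
    ext
    · simpa [degRestrict, degParam] using hmx
    · simp [degRestrict, degParam]

variable (k : Type*) [Field k]

lemma comap_nonunitIdeal_degMonoid
    (h : ∀ m : S, -(degRestrict S π v m : M × ℤ) ∈ degMonoid S π v → -(m : L) ∈ S)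
    (hinj : ∀ g ∈ unitGroup S, π g = 0 → g = 0) :
    (nonunitIdeal k (degMonoid S π v)).comap (charMap k (degRestrict S π v)) =
      nonunitIdeal k S := by
  let j : unitGroup S →+ unitGroup (degMonoid S π v) :=
    { toFun := fun g => ⟨degRestrict S π v (unitIncl S g), mem_unitGroup.2
        ⟨(degRestrict S π v (unitIncl S g)).2, neg_degRestrict_mem (m := unitIncl S g) g.2.2⟩⟩
      map_zero' := by ext <;> simp
      map_add' := fun x y => by ext <;> simp }
  have hj : Function.Injective j := by
    rw [injective_iff_map_eq_zero]
    intro g hg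
    refine Subtype.ext (hinj g g.2 ?_)
    exact congrArg (fun x : unitGroup (degMonoid S π v) => (x : M × ℤ).1) hg
  have hcomm : ∀ x, unitPart k _ (charMap k (degRestrict S π v) x) =
      charMap k j (unitPart k S x) := by
    intro x
    induction x using AddMonoidAlgebra.induction_linear with
    | zero => simp only [map_zero]
    | add x y hx hy => simp only [map_add, hx, hy]
    | single m c =>
      rw [charMap_single]
      by_cases hm : -(m : L) ∈ S
      · rw [unitPart_single_of_mem hm, unitPart_single_of_mem (neg_degRestrict_mem hm),
          charMap_single]
        rfl
      · rw [unitPart_single_of_notMem hm, unitPart_single_of_notMem fun h' => hm (h m h'), map_zero]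
  ext x
  rw [Ideal.mem_comap, ← ker_unitPart, ← ker_unitPart, RingHom.mem_ker, RingHom.mem_ker]
  rw [hcomm, map_eq_zero_iff _ (charMap_injective k hj)]

variable (S π v)

/-- The restriction of functions to the fibre over zero of the degeneration. -/
noncomputable def specialRestrict : AddMonoidAlgebra k S →+* FibreRing k (degParam S π v) :=
  (Ideal.Quotient.mk _).comp (charMap k (degRestrict S π v) : _ →+* _)

variable {S π v}

open Classical in
/-- The multiplicities of the fibre over zero of the degeneration. -/
theorem sum_localLength_special [Module.Free ℤ M] [Module.Finite ℤ M] (hS : S.FG)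
    (hgen : AddSubgroup.closure (S : Set L) = ⊤) (hπ : Function.Surjective π)
    (hinj : Meets S π v → ∀ g ∈ unitGroup S, π g = 0 → g = 0)
    (p : PrimeSpectrum (AddMonoidAlgebra k S)) (hp : nonunitIdeal k S ≤ p.asIdeal) :
    ∑ᶠ q : {q : PrimeSpectrum (FibreRing k (degParam S π v)) //
        PrimeSpectrum.comap (specialRestrict S π v k) q = p}, (localLength q.1.asIdeal : ℤ) =
      if Meets S π v ∧ p.asIdeal = nonunitIdeal k S then
        (((unitGroup S).map (π : L →+ M)).index : ℤ) else 0 := by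
  have hT := degMonoid_fg (π := π) (v := v) hS
  have hgen' := closure_degMonoid (v := v) hgen hπ
  -- the primes of the fibre over `p` contain all noninvertible characters
  have hq : ∀ q : PrimeSpectrum (FibreRing k (degParam S π v)),
      PrimeSpectrum.comap (specialRestrict S π v k) q = p →
      nonunitIdeal k (degMonoid S π v) ≤ q.asIdeal.comap (Ideal.Quotient.mk _) := by
    intro q hqp
    refine nonunitIdeal_le fun s hs => ?_
    obtain ⟨m, a, rfl⟩ := exists_degRestrict s
    have h1 : (AddMonoidAlgebra.single (degRestrict S π v m + a • degParam S π v) 1 :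
        AddMonoidAlgebra k (degMonoid S π v)) =
          charMap k (degRestrict S π v) (AddMonoidAlgebra.single m 1) *
            AddMonoidAlgebra.single (degParam S π v) 1 ^ a := by
      rw [charMap_single, AddMonoidAlgebra.single_pow, AddMonoidAlgebra.single_mul_single, one_pow,
        mul_one]
    rw [h1]
    by_cases hm : -(m : L) ∈ S
    · refine Ideal.mul_mem_left _ _ (Ideal.pow_mem_of_mem _ ?_ a (Nat.pos_of_ne_zero ?_))
      · rw [Ideal.mem_comap, Ideal.Quotient.eq_zero_iff_mem.2 (Ideal.mem_span_singleton_self _)]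
        exact zero_mem _
      · rintro rfl
        rw [zero_smul, add_zero] at hs
        exact hs (neg_degRestrict_mem hm)
    · refine Ideal.mul_mem_right _ _ ?_
      have h2 : AddMonoidAlgebra.single m 1 ∈ p.asIdeal := hp (single_mem_nonunitIdeal.2 hm)
      rw [← hqp] at h2
      exact h2
  -- a character which becomes invertible on a fibre over `p` is invertible
  have hunit : ∀ q : PrimeSpectrum (FibreRing k (degParam S π v)),
      PrimeSpectrum.comap (specialRestrict S π v k) q = p →
      -(degParam S π v : M × ℤ) ∉ degMonoid S π v ∧
        ∀ m : S, -(degRestrict S π v m : M × ℤ) ∈ degMonoid S π v → -(m : L) ∈ S := by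
    intro q hqp
    have hnot : ∀ x : degMonoid S π v, -(x : M × ℤ) ∈ degMonoid S π v →
        AddMonoidAlgebra.single x 1 ∉ q.asIdeal.comap (Ideal.Quotient.mk _) := by
      intro x hx hmem
      refine Ideal.IsPrime.ne_top (I := q.asIdeal.comap (Ideal.Quotient.mk _)) inferInstance
        (Ideal.eq_top_of_isUnit_mem _ hmem (IsUnit.of_mul_eq_one
          (AddMonoidAlgebra.single (⟨-(x : M × ℤ), hx⟩ : degMonoid S π v) 1) ?_))
      rw [AddMonoidAlgebra.single_mul_single, mul_one, AddMonoidAlgebra.one_def]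
      congr 1
      exact Subtype.ext (add_neg_cancel (x : M × ℤ))
    refine ⟨fun h => hnot _ h ?_, fun m hm => ?_⟩
    · rw [Ideal.mem_comap, Ideal.Quotient.eq_zero_iff_mem.2 (Ideal.mem_span_singleton_self _)]
      exact zero_mem _
    · by_contra hm'
      refine hnot _ hm ?_
      have h2 : AddMonoidAlgebra.single m 1 ∈ p.asIdeal := hp (single_mem_nonunitIdeal.2 hm')
      rw [← hqp] at h2
      have h3 : charMap k (degRestrict S π v) (AddMonoidAlgebra.single m 1) ∈
        q.asIdeal.comap (Ideal.Quotient.mk _) := h2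
      rwa [charMap_single] at h3
  have hval : ∀ q : {q : PrimeSpectrum (FibreRing k (degParam S π v)) //
      PrimeSpectrum.comap (specialRestrict S π v k) q = p}, localLength q.1.asIdeal =
        if q.1.asIdeal.comap (Ideal.Quotient.mk _) = nonunitIdeal k (degMonoid S π v) then
          ((unitGroup S).map (π : L →+ M)).index else 0 := by
    intro q
    rw [localLength_fibre (degParam S π v) hT hgen' q.1.asIdeal (hq q.1 q.2),
      index_unitsSup_degMonoid (hunit q.1 q.2).2]
  split_ifs with h
  · obtain ⟨hM, hpn⟩ := h
    have ht := hM.neg_degParam_notMem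
    have hprime := orbitIdeal_isPrime (k := k) _ ht
    have hcomap := comap_orbitIdeal (k := k) _ ht
    let q₀ : {q : PrimeSpectrum (FibreRing k (degParam S π v)) //
        PrimeSpectrum.comap (specialRestrict S π v k) q = p} :=
      ⟨⟨orbitIdeal k _, hprime⟩, by
        ext1
        rw [hpn, ← comap_nonunitIdeal_degMonoid k (fun m => hM.neg_mem) (hinj hM), ← hcomap]
        rfl⟩
    rw [finsum_eq_single _ q₀, hval, if_pos hcomap]
    intro q hqq
    rw [hval, if_neg, Nat.cast_zero]
    intro h
    refine hqq (Subtype.ext (PrimeSpectrum.ext ?_))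
    apply Ideal.comap_injective_of_surjective _ Ideal.Quotient.mk_surjective
    exact h.trans hcomap.symm
  · refine finsum_eq_zero_of_forall_eq_zero fun q => ?_
    rw [hval, if_neg, Nat.cast_zero]
    intro hqn
    have hM := meets_of_notMem hS (hunit q.1 q.2).1 (hunit q.1 q.2).2
    refine h ⟨hM, ?_⟩
    rw [← comap_nonunitIdeal_degMonoid k (fun m => hM.neg_mem) (hinj hM), ← hqn]
    exact congrArg PrimeSpectrum.asIdeal q.2.symm

variable (S π v)

/-- The ring of functions of the fibre over one of the degeneration. -/
abbrev GeneralRing : Type _ := AddMonoidAlgebra k (degMonoid S π v) ⧸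
  Ideal.span {AddMonoidAlgebra.single (degParam S π v) (1 : k) - 1}

/-- The restriction of functions to the fibre over one of the degeneration. -/
noncomputable def generalRestrict : AddMonoidAlgebra k S →+* GeneralRing S π v k :=
  (Ideal.Quotient.mk _).comp (charMap k (degRestrict S π v) : _ →+* _)

/-- The restriction of characters to the torus with character lattice `M`. -/
def degFst : degMonoid S π v →+ M := (AddMonoidHom.fst M ℤ).comp (degMonoid S π v).subtype

variable {S π v}

lemma ker_charMap_degFst : RingHom.ker (charMap k (degFst S π v)) =
    Ideal.span {AddMonoidAlgebra.single (degParam S π v) (1 : k) - 1} := by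
  classical
  set J := Ideal.span {AddMonoidAlgebra.single (degParam S π v) (1 : k) - 1}
  let mk : AddMonoidAlgebra k (degMonoid S π v) →+* GeneralRing S π v k := Ideal.Quotient.mk _
  have ht : mk (AddMonoidAlgebra.single (degParam S π v) 1) = 1 := by
    rw [← sub_eq_zero, ← map_one mk, ← map_sub]
    exact Ideal.Quotient.eq_zero_iff_mem.2 (Ideal.mem_span_singleton_self _)
  have key : ∀ x y : degMonoid S π v, (x : M × ℤ).1 = (y : M × ℤ).1 →
      (x : M × ℤ).2 ≤ (y : M × ℤ).2 →
      mk (AddMonoidAlgebra.single x 1) = mk (AddMonoidAlgebra.single y 1) := by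
    intro x y h1 h2
    have h3 : y = x + ((y : M × ℤ).2 - (x : M × ℤ).2).toNat • degParam S π v := by
      refine Subtype.ext (Prod.ext ?_ ?_)
      · simp [degParam, h1]
      · simp [degParam, h2]
    have h4 : (AddMonoidAlgebra.single y 1 : AddMonoidAlgebra k (degMonoid S π v)) =
        AddMonoidAlgebra.single x 1 * AddMonoidAlgebra.single (degParam S π v) 1 ^
          ((y : M × ℤ).2 - (x : M × ℤ).2).toNat := by
      rw [AddMonoidAlgebra.single_pow, AddMonoidAlgebra.single_mul_single, one_pow, mul_one, ← h3]
    rw [h4, map_mul, map_pow, ht, one_pow, mul_one]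
  have key' : ∀ x y : degMonoid S π v, (x : M × ℤ).1 = (y : M × ℤ).1 →
      mk (AddMonoidAlgebra.single x 1) = mk (AddMonoidAlgebra.single y 1) := fun x y h =>
    (le_total (x : M × ℤ).2 (y : M × ℤ).2).elim (key x y h) fun h' => (key y x h.symm h').symm
  let σ : M → GeneralRing S π v k := fun m =>
    if h : ∃ x : degMonoid S π v, (x : M × ℤ).1 = m then mk (AddMonoidAlgebra.single h.choose 1)
    else 0
  have hσ : ∀ x : degMonoid S π v, σ (x : M × ℤ).1 = mk (AddMonoidAlgebra.single x 1) := by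
    intro x
    have h : ∃ y : degMonoid S π v, (y : M × ℤ).1 = (x : M × ℤ).1 := ⟨x, rfl⟩
    exact (dif_pos h).trans (key' _ _ h.choose_spec)
  have hΨ : ∀ x, Finsupp.linearCombination k σ (charMap k (degFst S π v) x).coeff = mk x := by
    intro x
    induction x using AddMonoidAlgebra.induction_linear with
    | zero => simp
    | add x y hx hy => rw [map_add, map_add, AddMonoidAlgebra.coeff_add, map_add, hx, hy]
    | single m c =>
      rw [charMap_single, AddMonoidAlgebra.coeff_single, Finsupp.linearCombination_single]
      have h1 : σ (degFst S π v m) = mk (AddMonoidAlgebra.single m 1) := hσ m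
      have h2 : (AddMonoidAlgebra.single m c : AddMonoidAlgebra k (degMonoid S π v)) =
          c • AddMonoidAlgebra.single m 1 := by
        rw [AddMonoidAlgebra.smul_single', mul_one]
      rw [h1, h2]
      rfl
  apply le_antisymm
  · intro x hx
    have h1 := hΨ x
    rw [(RingHom.mem_ker).1 hx, AddMonoidAlgebra.coeff_zero, map_zero] at h1
    exact Ideal.Quotient.eq_zero_iff_mem.1 h1.symm
  · rw [Ideal.span_le, Set.singleton_subset_iff]
    change charMap k (degFst S π v) _ = 0
    rw [map_sub, charMap_single, map_one, sub_eq_zero, AddMonoidAlgebra.one_def]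
    rfl

open Classical in
/-- The fibre over one of the degeneration is integral. -/
theorem sum_localLength_general [Module.Free ℤ M] [Module.Finite ℤ M]
    (p : PrimeSpectrum (AddMonoidAlgebra k S)) :
    ∑ᶠ q : {q : PrimeSpectrum (GeneralRing S π v k) //
        PrimeSpectrum.comap (generalRestrict S π v k) q = p}, (localLength q.1.asIdeal : ℤ) =
      if p.asIdeal = RingHom.ker (charMap k ((π : L →+ M).comp S.subtype)) then 1 else 0 := by
  let Φ : GeneralRing S π v k →+* AddMonoidAlgebra k M :=
    Ideal.Quotient.lift _ (charMap k (degFst S π v) : _ →+* _) fun x hx => by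
      rw [← ker_charMap_degFst] at hx
      exact hx
  have hΦ : Function.Injective Φ := by
    rw [injective_iff_map_eq_zero]
    intro x hx
    obtain ⟨x, rfl⟩ := Ideal.Quotient.mk_surjective x
    rw [Ideal.Quotient.eq_zero_iff_mem, ← ker_charMap_degFst]
    exact hx
  have : IsDomain (GeneralRing S π v k) := hΦ.isDomain Φ
  have hbot : (⊥ : Ideal (GeneralRing S π v k)).comap (generalRestrict S π v k) =
      RingHom.ker (charMap k ((π : L →+ M).comp S.subtype)) := by
    ext x
    rw [Ideal.mem_comap, Ideal.mem_bot, ← map_eq_zero_iff Φ hΦ, RingHom.mem_ker]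
    have h1 : Φ (generalRestrict S π v k x) =
        charMap k (degFst S π v) (charMap k (degRestrict S π v) x) := rfl
    rw [h1, charMap_comp]
    rfl
  split_ifs with h
  · rw [finsum_eq_single _ ⟨⟨⊥, Ideal.isPrime_bot⟩, by ext1; rw [h, ← hbot]; rfl⟩,
      localLength_of_isDomain, if_pos rfl, Nat.cast_one]
    intro q hq
    rw [localLength_of_isDomain, if_neg, Nat.cast_zero]
    intro h'
    exact hq (Subtype.ext (PrimeSpectrum.ext h'))
  · refine finsum_eq_zero_of_forall_eq_zero fun q => ?_
    rw [localLength_of_isDomain, if_neg, Nat.cast_zero]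
    intro h'
    refine h ?_
    rw [← hbot, ← h']
    exact congrArg PrimeSpectrum.asIdeal q.2.symm

end DegenerationRing

end

section

/-! ### Dimension and transcendence degree -/

lemma ringKrullDim_eq_of_isIntegral (R S : Type*) [CommRing R] [CommRing S] [IsDomain S]
    [Algebra R S]
    [Algebra.IsIntegral R S] (hinj : Function.Injective (algebraMap R S)) :
    ringKrullDim R = ringKrullDim S := by
  apply le_antisymm
  · refine iSup_le fun l => ?_
    obtain ⟨P, hP, hP'⟩ := Ideal.exists_ideal_over_prime_of_isIntegral_of_isDomain (S := S)
      (RelSeries.head l).asIdeal (by rw [(RingHom.injective_iff_ker_eq_bot _).1 hinj]; exact bot_le)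
    have : P.LiesOver (RelSeries.head l).asIdeal := ⟨hP'.symm⟩
    obtain ⟨m, hm, -⟩ := Ideal.exists_ltSeries_of_hasGoingUp l P
    rw [← hm]
    exact le_iSup (fun p : LTSeries (PrimeSpectrum S) => ((p.length : ℕ) : WithBot ℕ∞)) m
  · refine Order.krullDim_le_of_strictMono (PrimeSpectrum.comap (algebraMap R S)) ?_
    intro p q hpq
    have : p.asIdeal.IsPrime := p.2
    exact Ideal.IsIntegral.comap_lt_comap (R := R) (I := p.asIdeal) (J := q.asIdeal) hpq

variable (k : Type u) [Field k]

lemma trdeg_eq_of_isAlgebraic (A B : Type u) [CommRing A] [CommRing B] [Algebra k A]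
    [Algebra k B] [Algebra A B] [IsScalarTower k A B] [NoZeroDivisors B] [Nontrivial A]
    [FaithfulSMul A B] [Algebra.IsAlgebraic A B] : Algebra.trdeg k A = Algebra.trdeg k B := by
  rw [← trdeg_add_eq k (S := A) (A := B), trdeg_eq_zero (R := A), add_zero]

/-- The Krull dimension of a finitely generated domain over a field is its transcendence degree;
by Noether normalization this reduces to polynomial rings. -/
lemma ringKrullDim_eq_trdeg (A : Type u) [CommRing A] [IsDomain A] [Algebra k A]
    [Algebra.FiniteType k A] : ringKrullDim A = ((Algebra.trdeg k A).toNat : ℕ) := by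
  obtain ⟨s, g, hg, hint⟩ := exists_integral_inj_algHom_of_fg k A
  let := g.toRingHom.toAlgebra
  have : Algebra.IsIntegral (MvPolynomial (Fin s) k) A := ⟨hint⟩
  have : IsScalarTower k (MvPolynomial (Fin s) k) A := .of_algHom g
  have : FaithfulSMul (MvPolynomial (Fin s) k) A :=
    (faithfulSMul_iff_algebraMap_injective _ _).2 hg
  rw [← ringKrullDim_eq_of_isIntegral (MvPolynomial (Fin s) k) A hg,
    MvPolynomial.ringKrullDim_of_isNoetherianRing, ringKrullDim_eq_zero_of_field, zero_add,
    ← trdeg_eq_of_isAlgebraic k (MvPolynomial (Fin s) k) A,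
    MvPolynomial.trdeg_of_isDomain]
  simp

lemma coheight_eq_trdeg {A : Type u} [CommRing A] [Algebra k A]
    [Algebra.FiniteType k A] (p : PrimeSpectrum A) :
    Order.coheight p = ((Algebra.trdeg k (A ⧸ p.asIdeal)).toNat : ℕ) := by
  have h := ringKrullDim_eq_trdeg k (A ⧸ p.asIdeal)
  rw [ringKrullDim_quotient] at h
  have h2 := Order.coheight_eq_krullDim_Ici p
  have h3 : (PrimeSpectrum.zeroLocus (p.asIdeal : Set A)) = Set.Ici p := by
    ext q
    exact Iff.rfl
  rw [h3, ← h2] at h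
  exact_mod_cast h

/-- If the image of `φ : T → L` generates the group `L`, every monomial of `k[L]` is a quotient of
monomials of `k[T]`. -/
lemma isAlgebraic_charMap {T L : Type*} [AddCommMonoid T] [AddCommGroup L] (φ : T →+ L)
    (hφ : AddSubgroup.closure (Set.range φ) = ⊤) [IsDomain (AddMonoidAlgebra k T)]
    [NoZeroDivisors (AddMonoidAlgebra k L)]
    [Algebra (AddMonoidAlgebra k T) (AddMonoidAlgebra k L)]
    (halg : ∀ x, algebraMap (AddMonoidAlgebra k T) (AddMonoidAlgebra k L) x = charMap k φ x) :
    Algebra.IsAlgebraic (AddMonoidAlgebra k T) (AddMonoidAlgebra k L) := by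
  have hsingle : ∀ t : T, IsAlgebraic (AddMonoidAlgebra k T)
      (AddMonoidAlgebra.single (φ t) 1 : AddMonoidAlgebra k L) := by
    intro t
    rw [← charMap_single, ← halg]
    exact isAlgebraic_algebraMap _
  have hinv : ∀ l : L, IsAlgebraic (AddMonoidAlgebra k T)
      (AddMonoidAlgebra.single l 1 : AddMonoidAlgebra k L) := by
    intro l
    have hl : l ∈ AddSubgroup.closure (Set.range φ) := by rw [hφ]; trivial
    induction hl using AddSubgroup.closure_induction with
    | mem x hx => obtain ⟨t, rfl⟩ := hx; exact hsingle t
    | zero => exact isAlgebraic_one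
    | add x y _ _ hx hy =>
      have := hx.mul hy
      rwa [AddMonoidAlgebra.single_mul_single, mul_one] at this
    | neg x _ hx =>
      have h1 : (AddMonoidAlgebra.single x 1 : AddMonoidAlgebra k L) *
          AddMonoidAlgebra.single (-x) 1 = 1 := by
        rw [AddMonoidAlgebra.single_mul_single, add_neg_cancel, mul_one, AddMonoidAlgebra.one_def]
      let inst : Invertible (AddMonoidAlgebra.single x 1 : AddMonoidAlgebra k L) :=
        ⟨AddMonoidAlgebra.single (-x) 1, by rw [mul_comm, h1], h1⟩
      exact hx.invOf
  refine ⟨fun z => ?_⟩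
  induction z using AddMonoidAlgebra.induction_linear with
  | zero => exact isAlgebraic_zero
  | add f g hf hg => exact hf.add hg
  | single l c =>
    have h : (AddMonoidAlgebra.single l c : AddMonoidAlgebra k L) =
        algebraMap (AddMonoidAlgebra k T) _ (AddMonoidAlgebra.single 0 c) *
          AddMonoidAlgebra.single l 1 := by
      rw [halg, charMap_single, AddMonoidAlgebra.single_mul_single, map_zero, zero_add, mul_one]
    rw [h]
    exact (isAlgebraic_algebraMap _).mul (hinv l)

/-- The monoid algebra of a submonoid which generates a lattice has transcendence degree equal to the
rank of the lattice: up to algebraic extensions it is a polynomial ring. -/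
lemma trdeg_addMonoidAlgebra {L : Type u} [AddCommGroup L] [Module.Free ℤ L] [Module.Finite ℤ L]
    (T : AddSubmonoid L) (hT : AddSubgroup.closure (T : Set L) = ⊤) :
    Algebra.trdeg k (AddMonoidAlgebra k T) = Module.finrank ℤ L := by
  classical
  have key : ∀ (T : Type u) [AddCommMonoid T] (φ : T →+ L) (_ : Function.Injective φ)
      (_ : AddSubgroup.closure (Set.range φ) = ⊤) [IsDomain (AddMonoidAlgebra k T)],
      Algebra.trdeg k (AddMonoidAlgebra k T) = Algebra.trdeg k (AddMonoidAlgebra k L) := by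
    intro T _ φ hinj hφ _
    let := (charMap k φ).toRingHom.toAlgebra
    have : IsScalarTower k (AddMonoidAlgebra k T) (AddMonoidAlgebra k L) :=
      .of_algHom (charMap k φ)
    have : FaithfulSMul (AddMonoidAlgebra k T) (AddMonoidAlgebra k L) :=
      (faithfulSMul_iff_algebraMap_injective _ _).2 (charMap_injective k hinj)
    have := isAlgebraic_charMap k φ hφ fun _ => rfl
    exact trdeg_eq_of_isAlgebraic k _ _
  rw [key T T.subtype Subtype.val_injective (by simpa using hT)]
  let b := Module.finBasis ℤ L
  let φ : (ULift.{u} (Fin (Module.finrank ℤ L)) →₀ ℕ) →+ L :=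
    Finsupp.liftAddHom fun i => (multiplesHom L) (b i.down)
  have : IsDomain (AddMonoidAlgebra k (ULift.{u} (Fin (Module.finrank ℤ L)) →₀ ℕ)) :=
    inferInstanceAs (IsDomain (MvPolynomial (ULift.{u} (Fin (Module.finrank ℤ L))) k))
  rw [← key _ φ]
  · refine (MvPolynomial.trdeg_of_isDomain (ι := ULift.{u} (Fin (Module.finrank ℤ L)))
      (S := k)).trans ?_
    simp
  · intro x y hxy
    ext i
    have h : ∀ x, b.repr (φ x) i.down = x i := by
      intro x
      induction x using Finsupp.induction_linear with
      | zero => simp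
      | add f g hf hg => simp [hf, hg]
      | single j c =>
        obtain ⟨j⟩ := j
        obtain ⟨i⟩ := i
        simp [φ, Finsupp.single_apply]
    have := h y
    rw [← hxy, h x] at this
    exact_mod_cast this
  · rw [eq_top_iff]
    intro l _
    rw [← b.sum_repr l]
    refine sum_mem fun i _ => zsmul_mem (AddSubgroup.subset_closure
      (Set.mem_range.2 ⟨Finsupp.single ⟨i⟩ 1, ?_⟩)) _
    simp [φ]

variable {k} in
/-- The transcendence degree over `k` of the residue field of a point of a `k`-scheme. -/
noncomputable def residueTrdeg (X : Over (Spec (.of k))) (x : X.left) : Cardinal.{u} :=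
  @Algebra.trdeg k (X.left.residueField x) _ _
    (Spec.preimage (X.left.fromSpecResidueField x ≫ X.hom)).hom.toAlgebra

variable {k} in
lemma residueTrdeg_chart {X : Over (Spec (.of k))} {A : Type u} [CommRing A] [Algebra k A]
    (j : affineOver k A ⟶ X) [IsOpenImmersion j.left] (p : PrimeSpectrum A) :
    residueTrdeg X (j.left p) = Algebra.trdeg k (A ⧸ p.asIdeal) := by
  let p' : Spec (.of A) := p
  rw [residueTrdeg]
  let := (Spec.preimage (X.left.fromSpecResidueField (j.left p) ≫ X.hom)).hom.toAlgebra
  let e : X.left.residueField (j.left p') ≅ .of p.asIdeal.ResidueField :=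
    asIso (j.left.residueFieldMap p') ≪≫ Scheme.Spec.residueFieldIso (.of A) p'
  have he : Spec.preimage (X.left.fromSpecResidueField (j.left p') ≫ X.hom) ≫ e.hom =
      CommRingCat.ofHom (algebraMap k p.asIdeal.ResidueField) := by
    apply Spec.map_injective
    rw [Spec.map_comp, Spec.map_preimage]
    dsimp only [e, Iso.trans_hom, asIso_hom]
    rw [Spec.map_comp, Category.assoc,
      Scheme.Hom.SpecMap_residueFieldMap_fromSpecResidueField_assoc]
    have h1 : j.left ≫ X.hom = Spec.map (CommRingCat.ofHom (algebraMap k A)) := Over.w j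
    have h2 : (affineOver k A).left.fromSpecResidueField p' = _ :=
      (Scheme.Spec.map_residueFieldIso_inv_eq_fromSpecResidueField (.of A) p').symm
    rw [h2, Category.assoc, h1, ← Spec.map_comp_assoc, Iso.inv_hom_id, Spec.map_id, Category.id_comp,
      ← Spec.map_comp, ← CommRingCat.ofHom_comp, ← IsScalarTower.algebraMap_eq]
  let e' : X.left.residueField (j.left p') ≃ₐ[k] p.asIdeal.ResidueField :=
    AlgEquiv.ofRingEquiv (f := e.commRingCatIsoToRingEquiv) fun r =>
      congrArg (fun g => g.hom r) he
  refine (AlgEquiv.trdeg_eq e').trans ?_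
  have : Algebra.IsAlgebraic (A ⧸ p.asIdeal) p.asIdeal.ResidueField :=
    IsLocalization.isAlgebraic p.asIdeal.ResidueField (nonZeroDivisors (A ⧸ p.asIdeal))
  exact (trdeg_eq_of_isAlgebraic k (A ⧸ p.asIdeal) p.asIdeal.ResidueField).symm

lemma le_iff_specializes {X : Scheme.{u}} {x y : X} : x ≤ y ↔ y ⤳ x := Iff.rfl

variable {k} in
/-- The dimension of the closure of a point of a scheme locally of finite type over a field is the
transcendence degree of its residue field. -/
lemma height_eq_residueTrdeg (X : Over (Spec (.of k))) [LocallyOfFiniteType X.hom] (x : X.left) :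
    Order.height x = ((residueTrdeg X x).toNat : ℕ) := by
  have hchart : ∀ x₀ : X.left, ∃ (A : Type u) (_ : CommRing A) (_ : Algebra k A)
      (j : affineOver k A ⟶ X), Algebra.FiniteType k A ∧ IsOpenImmersion j.left ∧
        x₀ ∈ Set.range j.left := by
    intro x₀
    obtain ⟨R, f, hf, hx, -⟩ := X.left.exists_affine_mem_range_and_range_subset
      (x := x₀) (U := ⊤) trivial
    let := (Spec.preimage (f ≫ X.hom)).hom.toAlgebra
    refine ⟨R, inferInstance, inferInstance, Over.homMk f ?_, ?_, hf, hx⟩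
    · exact (Spec.map_preimage (f ≫ X.hom)).symm
    · have h : LocallyOfFiniteType (Spec.map (Spec.preimage (f ≫ X.hom))) := by
        rw [Spec.map_preimage]
        infer_instance
      exact (HasRingHomProperty.Spec_iff (P := @LocallyOfFiniteType)).1 h
  have hemb : ∀ {A : Type u} [CommRing A] [Algebra k A] (j : affineOver k A ⟶ X)
      [IsOpenImmersion j.left] (p q : PrimeSpectrum A), j.left q ≤ j.left p ↔ p ≤ q := by
    intro A _ _ j _ p q
    rw [le_iff_specializes, PrimeSpectrum.le_iff_specializes]
    exact j.left.isOpenEmbedding.isInducing.specializes_iff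
  apply le_antisymm
  · refine Order.height_le fun l hl => ?_
    obtain ⟨A, _, _, j, _, hj, hx₀⟩ := hchart l.head
    have hmem : ∀ i, ∃ p : PrimeSpectrum A, j.left p = l i := fun i =>
      Specializes.mem_open (s := Set.range j.left) (le_iff_specializes.1 (LTSeries.head_le l i))
        j.left.isOpenEmbedding.isOpen_range hx₀
    choose p hp using hmem
    have hlt : ∀ a b, a < b → p b < p a := by
      intro a b hab
      have := l.strictMono hab
      rw [← hp, ← hp, lt_iff_le_not_ge, hemb, hemb] at this
      rwa [lt_iff_le_not_ge]
    let l' : LTSeries (PrimeSpectrum A) :=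
      LTSeries.mk l.length (fun i => p i.rev) fun a b hab => hlt _ _ (Fin.rev_lt_rev.2 hab)
    have hlast : x = j.left (p (Fin.last _)) := by rw [hp]; exact hl.symm
    rw [hlast, residueTrdeg_chart, ← coheight_eq_trdeg]
    refine Order.length_le_coheight (p := l') ?_
    change _ ≤ p (Fin.rev 0)
    rw [Fin.rev_zero]
  · obtain ⟨A, _, _, j, _, hj, p, rfl⟩ := hchart x
    have h1 : residueTrdeg X (j.left p) = _ := residueTrdeg_chart j p
    rw [h1]
    refine (coheight_eq_trdeg k (A := A) p).symm.trans_le ?_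
    let F : (PrimeSpectrum A)ᵒᵈ → X.left := fun q => j.left (OrderDual.ofDual q)
    have hF : StrictMono F := by
      intro a b hab
      rw [lt_iff_le_not_ge] at hab ⊢
      exact ⟨(hemb j _ _).2 hab.1, fun h => hab.2 ((hemb j _ _).1 h)⟩
    exact Order.height_le_height_apply_of_strictMono F hF (OrderDual.toDual p)

lemma topologicalKrullDim_eq_height {X : Scheme.{u}} {ξ : X} (hξ : IsGenericPoint ξ Set.univ) :
    topologicalKrullDim X = Order.height ξ := by
  let : OrderTop X := { top := ξ, le_top := fun x => hξ.specializes trivial }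
  exact (Order.krullDim_eq_of_orderIso (β := X) (irreducibleSetEquivPoints (α := X))).trans
    (Order.height_top_eq_krullDim (α := X)).symm

end

section

/-! ### Pullback squares of schemes -/

lemma isPullback_of_exists_lift {C : Type*} [Category C] {P X Y Z : C} {p : P ⟶ X} {q : P ⟶ Y}
    {f : X ⟶ Z} {g : Y ⟶ Z} (hw : p ≫ f = q ≫ g)
    (huniq : ∀ {T : C} (a b : T ⟶ P), a ≫ p = b ≫ p → a ≫ q = b ≫ q → a = b)
    (hex : ∀ {T : C} (x : T ⟶ X) (y : T ⟶ Y), x ≫ f = y ≫ g → ∃ l, l ≫ p = x ∧ l ≫ q = y) :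
    IsPullback p q f g := by
  have hex' : ∀ s : PullbackCone f g, ∃ l : s.pt ⟶ P, l ≫ p = s.fst ∧ l ≫ q = s.snd :=
    fun s => hex _ _ s.condition
  choose l hl using hex'
  exact ⟨⟨hw⟩, ⟨PullbackCone.IsLimit.mk _ l
    (fun s => (hl s).1) (fun s => (hl s).2)
    (fun s m h1 h2 => huniq _ _ (h1.trans (hl s).1.symm) (h2.trans (hl s).2.symm))⟩⟩

/-- A reduced closed subscheme `K ⊆ X` meets an open subscheme `U` in the reduced closed subscheme of
`U` with the same underlying set. -/
lemma exists_isPullback_of_range_eq {K X U S : Scheme.{u}} (c : K ⟶ X) [IsClosedImmersion c]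
    [IsReduced K] (j : U ⟶ X) [IsOpenImmersion j] (t : S ⟶ U) [IsClosedImmersion t] [IsReduced S]
    (h : Set.range t = j ⁻¹' Set.range c) : ∃ u : S ⟶ K, IsPullback u t c j := by
  have : IsReduced (pullback c j) := isReduced_of_isOpenImmersion (pullback.fst c j)
  have hs : Surjective (pullback.fst (pullback.snd c j) t) := by
    refine ⟨fun x => ?_⟩
    have : pullback.snd c j x ∈ Set.range t := by
      rw [h]
      exact ⟨pullback.fst c j x, by
        rw [← Scheme.Hom.comp_apply, ← Scheme.Hom.comp_apply, pullback.condition]⟩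
    obtain ⟨y, hy⟩ := this
    obtain ⟨z, hz, -⟩ := Scheme.Pullback.exists_preimage_pullback x y hy.symm
    exact ⟨z, hz⟩
  have hs' : Surjective (pullback.snd (pullback.snd c j) t) := by
    refine ⟨fun y => ?_⟩
    have : t y ∈ j ⁻¹' Set.range c := h ▸ ⟨y, rfl⟩
    obtain ⟨z, hz⟩ := this
    obtain ⟨x, -, hx⟩ := Scheme.Pullback.exists_preimage_pullback z (t y) hz
    obtain ⟨w, -, hw⟩ := Scheme.Pullback.exists_preimage_pullback x y hx
    exact ⟨w, hw⟩
  have := isIso_of_isClosedImmersion_of_surjective (pullback.fst (pullback.snd c j) t)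
  have := isIso_of_isClosedImmersion_of_surjective (pullback.snd (pullback.snd c j) t)
  let e : S ≅ pullback c j :=
    (asIso (pullback.snd (pullback.snd c j) t)).symm ≪≫ asIso (pullback.fst (pullback.snd c j) t)
  have he : e.hom ≫ pullback.snd c j = t := by
    simp only [e, Iso.trans_hom, Iso.symm_hom, asIso_inv, asIso_hom, Category.assoc]
    rw [pullback.condition, IsIso.inv_hom_id_assoc]
  refine ⟨e.hom ≫ pullback.fst c j, IsPullback.of_iso_pullback ⟨?_⟩ e rfl he⟩
  rw [Category.assoc, pullback.condition, reassoc_of% he]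

/-- The multiplicities of the points of `Y` over a point of an affine open subscheme `Spec B ⊆ Z` are
computed on the preimage `Spec D` of that subscheme. -/
lemma finsum_stalk_length {Y Z : Scheme.{u}} {D B : CommRingCat.{u}} {w : Spec D ⟶ Y}
    {g : Spec D ⟶ Spec B} {F : Y ⟶ Z} {c : Spec B ⟶ Z} [IsOpenImmersion c]
    (h : IsPullback w g F c) (p : Spec B) :
    ∑ᶠ z : {z // F z = c p},
      ((Module.length (Y.presheaf.stalk z.1) (Y.presheaf.stalk z.1)).toNat : ℤ) =
    ∑ᶠ q : {q : PrimeSpectrum D // g q = p}, (localLength q.1.asIdeal : ℤ) := by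
  have : IsOpenImmersion w := MorphismProperty.of_isPullback h.flip inferInstance
  have hw : ∀ q, F (w q) = c (g q) := fun q => by
    rw [← Scheme.Hom.comp_apply, ← Scheme.Hom.comp_apply, h.w]
  let e : {q : PrimeSpectrum D // g q = p} → {z // F z = c p} :=
    fun q => ⟨w q.1, (hw q.1).trans (congrArg c q.2)⟩
  have he : Function.Bijective e := by
    constructor
    · intro a b hab
      exact Subtype.ext (w.isOpenEmbedding.injective (congrArg Subtype.val hab))
    · rintro ⟨z, hz⟩
      obtain ⟨y, hy, hy'⟩ := Scheme.Pullback.exists_preimage_pullback z p hz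
      have h1 : w (h.isoPullback.inv y) = z := by
        rw [← Scheme.Hom.comp_apply, h.isoPullback_inv_fst, hy]
      have h2 : g (h.isoPullback.inv y) = p := by
        rw [← Scheme.Hom.comp_apply, h.isoPullback_inv_snd, hy']
      exact ⟨⟨_, h2⟩, Subtype.ext h1⟩
  refine (finsum_eq_of_bijective e he fun q => ?_).symm
  congr 1
  rw [localLength]
  congr 1
  let q' : Spec D := q.1
  exact length_eq_of_ringEquiv ((Spec.stalkIso D q').symm.commRingCatIsoToRingEquiv.trans (asIso (w.stalkMap q')).symm.commRingCatIsoToRingEquiv)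

variable (k : Type u) [Field k]

/-! ### Affine schemes over a field -/

variable {k} in
/-- The morphism `Spec B → Spec A` of a homomorphism of `k`-algebras. -/
noncomputable def specOver {A B : Type u} [CommRing A] [Algebra k A] [CommRing B] [Algebra k B]
    (f : A →ₐ[k] B) : affineOver k B ⟶ affineOver k A :=
  Over.homMk (Spec.map (CommRingCat.ofHom f.toRingHom)) (by
    change Spec.map _ ≫ Spec.map _ = Spec.map _
    rw [← Spec.map_comp]
    congr 1
    apply CommRingCat.hom_ext
    exact f.comp_algebraMap)

variable {k} in
lemma specOver_comp {A B C : Type u} [CommRing A] [Algebra k A] [CommRing B] [Algebra k B]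
    [CommRing C] [Algebra k C] (f : A →ₐ[k] B) (g : B →ₐ[k] C) :
    specOver g ≫ specOver f = specOver (g.comp f) := by
  ext1
  exact (Spec.map_comp _ _).symm

/-- The morphism `Spec k[B] → Spec k[A]` given by a homomorphism of monoids `A → B`. -/
noncomputable abbrev charOver {A B : Type u} [AddCommMonoid A] [AddCommMonoid B] (φ : A →+ B) :
    affineOver k (AddMonoidAlgebra k B) ⟶ affineOver k (AddMonoidAlgebra k A) :=
  specOver (charMap k φ)

lemma charOver_comp {A B C : Type u} [AddCommMonoid A] [AddCommMonoid B] [AddCommMonoid C]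
    (φ : A →+ B) (ψ : B →+ C) : charOver k ψ ≫ charOver k φ = charOver k (ψ.comp φ) := by
  rw [charOver, charOver, specOver_comp]
  congr 1
  exact AlgHom.ext (charMap_comp k φ ψ)

variable {k} in
lemma lift_specOver_left {A B C : Type u} [CommRing A] [Algebra k A] [CommRing B] [Algebra k B]
    [CommRing C] [Algebra k C] (f : A →ₐ[k] C) (g : B →ₐ[k] C) :
    (lift (specOver f) (specOver g)).left =
      Spec.map (CommRingCat.ofHom (Algebra.TensorProduct.productMap f g).toRingHom) ≫
        (pullbackSpecIso k A B).inv := by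
  apply pullback.hom_ext
  · refine (congrArg Over.Hom.left (lift_fst (specOver f) (specOver g))).trans ?_
    rw [Category.assoc]
    refine Eq.trans ?_ (congrArg (Spec.map (CommRingCat.ofHom
      (Algebra.TensorProduct.productMap f g).toRingHom) ≫ ·) (pullbackSpecIso_inv_fst k A B)).symm
    rw [← Spec.map_comp]
    change Spec.map _ = Spec.map _
    congr 1
    apply CommRingCat.hom_ext
    refine RingHom.ext fun x => ?_
    change f x = Algebra.TensorProduct.productMap f g (x ⊗ₜ 1)
    simp
  · refine (congrArg Over.Hom.left (lift_snd (specOver f) (specOver g))).trans ?_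
    rw [Category.assoc]
    refine Eq.trans ?_ (congrArg (Spec.map (CommRingCat.ofHom
      (Algebra.TensorProduct.productMap f g).toRingHom) ≫ ·) (pullbackSpecIso_inv_snd k A B)).symm
    refine Eq.trans ?_ (Spec.map_comp _ _)
    change Spec.map _ = Spec.map _
    congr 1
    apply CommRingCat.hom_ext
    refine RingHom.ext fun x => ?_
    change g x = Algebra.TensorProduct.productMap f g (1 ⊗ₜ x)
    simp

variable {k} in
/-- `Spec C` is the product of `Spec A` and `Spec B` if `C` is the tensor product of `A` and `B`. -/
lemma isIso_lift_specOver {A B C : Type u} [CommRing A] [Algebra k A] [CommRing B] [Algebra k B]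
    [CommRing C] [Algebra k C] (f : A →ₐ[k] C) (g : B →ₐ[k] C)
    (h : Function.Bijective (Algebra.TensorProduct.productMap f g)) :
    IsIso (lift (specOver f) (specOver g)) := by
  let e : A ⊗[k] B ≃+* C := RingEquiv.ofBijective (Algebra.TensorProduct.productMap f g) h
  have h1 : (lift (specOver f) (specOver g)).left = Spec.map e.toCommRingCatIso.hom ≫
      (pullbackSpecIso k A B).inv := lift_specOver_left f g
  have : IsIso ((Over.forget _).map (lift (specOver f) (specOver g))) := by
    change IsIso (lift (specOver f) (specOver g)).left
    rw [h1]
    infer_instance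
  exact isIso_of_reflects_iso (lift (specOver f) (specOver g)) (Over.forget _)

lemma bijective_productMap_charMap (A B : Type*) [AddCommMonoid A] [AddCommMonoid B] :
    Function.Bijective (Algebra.TensorProduct.productMap (charMap k (AddMonoidHom.inl A B))
      (charMap k (AddMonoidHom.inr A B))) := by
  have hE : ∀ x, Algebra.TensorProduct.productMap (charMap k (AddMonoidHom.inl A B))
      (charMap k (AddMonoidHom.inr A B)) x = AddMonoidAlgebra.tensorEquiv k x := by
    intro x
    induction x using TensorProduct.induction_on with
    | zero => rw [map_zero, map_zero]
    | add x y hx hy => rw [map_add, map_add, hx, hy]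
    | tmul x y =>
      induction x using AddMonoidAlgebra.induction_linear with
      | zero => simp
      | add f g hf hg => rw [TensorProduct.add_tmul, map_add, map_add, hf, hg]
      | single a c =>
        induction y using AddMonoidAlgebra.induction_linear with
        | zero => simp
        | add f g hf hg => rw [TensorProduct.tmul_add, map_add, map_add, hf, hg]
        | single b d =>
          rw [AddMonoidAlgebra.tensorEquiv_single_tmul_single]
          simp only [Algebra.TensorProduct.productMap_apply_tmul, charMap_single,
            AddMonoidAlgebra.single_mul_single, AddMonoidHom.inl_apply, AddMonoidHom.inr_apply,
            Prod.mk_add_mk, add_zero, zero_add]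
  rw [show (Algebra.TensorProduct.productMap (charMap k (AddMonoidHom.inl A B))
      (charMap k (AddMonoidHom.inr A B)) : _ → _) = AddMonoidAlgebra.tensorEquiv k from funext hE]
  exact (AddMonoidAlgebra.tensorEquiv k).bijective

end

section

/-! ### Fibres over points of the affine line -/

section Fibre

variable {k : Type u} [Field k]

/-- Evaluation of polynomials at `ε`. -/
noncomputable def evalAt (ε : k) : AddMonoidAlgebra k ℕ →ₐ[k] k :=
  AddMonoidAlgebra.lift k k ℕ ((powersHom k ε).comp (AddMonoidHom.toMultiplicative (.id ℕ)))

lemma evalAt_single (ε : k) (n : ℕ)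
    (c : k) : evalAt ε (AddMonoidAlgebra.single n c) = c * ε ^ n := by
  simp [evalAt, AddMonoidAlgebra.lift_single]

/-- The rational point `ε` of the affine line. -/
noncomputable def linePoint (ε : k) :
    𝟙_ (Over (Spec (.of k))) ⟶ affineOver k (AddMonoidAlgebra k ℕ) :=
  Over.homMk (Spec.map (CommRingCat.ofHom (evalAt ε).toRingHom)) (by
    change Spec.map _ ≫ Spec.map _ = 𝟙 _
    rw [← Spec.map_comp, ← Spec.map_id]
    congr 1
    apply CommRingCat.hom_ext
    exact (evalAt ε).comp_algebraMap)

/-- The fibre over `ε` of a morphism `Spec R → 𝔸¹`. -/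
lemma isPullback_linePoint {R D : Type u} [CommRing R] [Algebra k R] [CommRing D] [Algebra k D]
    (ψ : AddMonoidAlgebra k ℕ →ₐ[k] R) (ε : k) (δ : R →ₐ[k] D) (hδ : Function.Surjective δ)
    (hker : RingHom.ker δ = Ideal.span {ψ (AddMonoidAlgebra.single 1 1) - algebraMap k R ε}) :
    IsPullback (specOver δ).left (Spec.map (CommRingCat.ofHom (algebraMap k D)))
      (specOver ψ).left (linePoint ε).left := by
  refine isPullback_SpecMap_of_isPushout _ _ _ _ ?_
  have hψ : ∀ n c, ψ (AddMonoidAlgebra.single n c) =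
      algebraMap k R c * ψ (AddMonoidAlgebra.single 1 1) ^ n := by
    intro n c
    rw [← map_pow, AddMonoidAlgebra.single_pow, one_pow, nsmul_one, ← Algebra.smul_def,
      ← map_smul, AddMonoidAlgebra.smul_single, smul_eq_mul, mul_one]
    rfl
  have hT : δ (ψ (AddMonoidAlgebra.single 1 1)) = algebraMap k D ε := by
    have : ψ (AddMonoidAlgebra.single 1 1) - algebraMap k R ε ∈ RingHom.ker δ := by
      rw [hker]; exact Ideal.mem_span_singleton_self _
    rw [RingHom.mem_ker, map_sub, AlgHom.commutes, sub_eq_zero] at this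
    exact this
  have hw : ∀ x, δ (ψ x) = algebraMap k D (evalAt ε x) := by
    intro x
    induction x using AddMonoidAlgebra.induction_linear with
    | zero => simp
    | add f g hf hg => simp only [map_add, hf, hg]
    | single n c =>
      rw [hψ, map_mul, map_pow, hT, AlgHom.commutes, evalAt_single, map_mul, map_pow]
  have hs : ∀ s : PushoutCocone (CommRingCat.ofHom ψ.toRingHom)
      (CommRingCat.ofHom (evalAt ε).toRingHom), RingHom.ker δ.toRingHom ≤ RingHom.ker s.inl.hom := by
    intro s
    change RingHom.ker δ ≤ _
    rw [hker, Ideal.span_singleton_le_iff_mem, RingHom.mem_ker, map_sub, sub_eq_zero]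
    have hc := congrArg (fun g => g.hom (AddMonoidAlgebra.single 1 1)) s.condition
    have hc' := congrArg (fun g => g.hom (AddMonoidAlgebra.single 0 ε)) s.condition
    change s.inl.hom (ψ _) = s.inr.hom (evalAt ε _) at hc hc'
    rw [evalAt_single, pow_one, one_mul] at hc
    rw [evalAt_single, pow_zero, mul_one, hψ, pow_zero, mul_one] at hc'
    rw [hc, hc']
  refine ⟨⟨CommRingCat.hom_ext (RingHom.ext hw)⟩, ⟨PushoutCocone.IsColimit.mk _
    (fun s => CommRingCat.ofHom ((RingHom.liftOfSurjective δ.toRingHom hδ) ⟨s.inl.hom, hs s⟩))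
    (fun s => ?_) (fun s => ?_) (fun s m h1 _ => ?_)⟩⟩
  · apply CommRingCat.hom_ext
    exact RingHom.ext fun x => RingHom.liftOfRightInverse_comp_apply δ.toRingHom _
      (Function.rightInverse_surjInv hδ) ⟨s.inl.hom, hs s⟩ x
  · apply CommRingCat.hom_ext
    refine RingHom.ext fun c => ?_
    have hc' := congrArg (fun g => g.hom (AddMonoidAlgebra.single 0 c)) s.condition
    change s.inl.hom (ψ _) = s.inr.hom (evalAt ε _) at hc'
    rw [evalAt_single, pow_zero, mul_one, hψ, pow_zero, mul_one] at hc'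
    refine Eq.trans ?_ hc'
    have : algebraMap k D c = δ (algebraMap k R c) := (δ.commutes c).symm
    change RingHom.liftOfSurjective _ _ _ (algebraMap k D c) = _
    rw [this]
    exact RingHom.liftOfRightInverse_comp_apply δ.toRingHom _
      (Function.rightInverse_surjInv hδ) ⟨s.inl.hom, hs s⟩ _
  · apply CommRingCat.hom_ext
    refine RingHom.ext fun d => ?_
    obtain ⟨x, rfl⟩ := hδ d
    refine (congrArg (fun g => g.hom x) h1).trans ?_
    exact (RingHom.liftOfRightInverse_comp_apply δ.toRingHom _
      (Function.rightInverse_surjInv hδ) ⟨s.inl.hom, hs s⟩ x).symm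

/-- On the preimage of a chart `Spec B` of `V`, the fibre of `K ⊆ V × ℙ¹` over a point `ε` of a chart
`𝔸¹` of `ℙ¹` is the fibre over `ε` of the part `Spec R` of `K` in `Spec B × 𝔸¹`. -/
lemma exists_isPullback_fiberMap {K V : Over (Spec (.of k))} (i : K ⟶ V ⊗ projLine k)
    {B R D : Type u} [CommRing B] [Algebra k B] [CommRing R] [Algebra k R] [CommRing D]
    [Algebra k D] (c : affineOver k B ⟶ V) (l : affineOver k (AddMonoidAlgebra k ℕ) ⟶ projLine k)
    [IsOpenImmersion c.left] [IsOpenImmersion l.left]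
    (u : affineOver k R ⟶ K) (β : B →ₐ[k] R) (ψ : AddMonoidAlgebra k ℕ →ₐ[k] R)
    (hRED : IsPullback u.left (lift (specOver β) (specOver ψ)).left i.left (c ⊗ₘ l).left)
    [Mono u.left]
    (ε : k) (δ : R →ₐ[k] D) (hδ : Function.Surjective δ)
    (hker : RingHom.ker δ = Ideal.span {ψ (AddMonoidAlgebra.single 1 1) - algebraMap k R ε}) :
    ∃ w : (affineOver k D).left ⟶ fiberAt i (linePoint ε ≫ l),
      IsPullback w (specOver (δ.comp β)).left (fiberMap i (linePoint ε ≫ l)) c.left := by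
  have hP := isPullback_linePoint ψ ε δ hδ hker
  have hu : u ≫ i = lift (specOver β) (specOver ψ) ≫ (c ⊗ₘ l) := Over.OverMorphism.ext hRED.w
  have h1 : u ≫ i ≫ snd _ _ = specOver ψ ≫ l := by
    rw [reassoc_of% hu, tensorHom_snd, lift_snd_assoc]
  have h2 : u ≫ i ≫ fst _ _ = specOver β ≫ c := by
    rw [reassoc_of% hu, tensorHom_fst, lift_fst_assoc]
  have h1' : u.left ≫ (i ≫ snd _ _).left = (specOver ψ).left ≫ l.left := congrArg Over.Hom.left h1
  have h2' : u.left ≫ (i ≫ fst _ _).left = (specOver β).left ≫ c.left := congrArg Over.Hom.left h2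
  have hc : (specOver (δ.comp β)).left = (specOver δ).left ≫ (specOver β).left := by
    rw [← specOver_comp]; rfl
  let w : (affineOver k D).left ⟶ fiberAt i (linePoint ε ≫ l) :=
    pullback.lift ((specOver δ).left ≫ u.left) (Spec.map (CommRingCat.ofHom (algebraMap k D))) (by
      rw [Category.assoc, h1', ← Category.assoc, hP.w, Category.assoc]
      rfl)
  have hw1 : w ≫ pullback.fst _ _ = (specOver δ).left ≫ u.left := pullback.lift_fst _ _ _
  have hmono : Mono (specOver δ).left := by
    have : IsClosedImmersion (specOver δ).left := IsClosedImmersion.spec_of_surjective _ hδ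
    infer_instance
  refine ⟨w, isPullback_of_exists_lift ?_ ?_ ?_⟩
  · rw [fiberMap, ← Category.assoc, hw1, Category.assoc, h2', hc, Category.assoc]
  · intro T a b hab _
    have : a ≫ w ≫ pullback.fst _ _ = b ≫ w ≫ pullback.fst _ _ := by
      rw [← Category.assoc, hab, Category.assoc]
    rw [hw1, ← Category.assoc, ← Category.assoc, cancel_mono, cancel_mono] at this
    exact this
  · intro T x y hxy
    have hx : x ≫ pullback.fst _ _ ≫ (i ≫ fst _ _).left = y ≫ c.left := hxy
    have h3 : x ≫ pullback.fst _ _ ≫ K.hom = y ≫ (affineOver k B).hom := by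
      rw [← Over.w c, ← Category.assoc y, ← hx, Category.assoc, Category.assoc, Over.w]
    have h4 : x ≫ pullback.snd _ _ = y ≫ (affineOver k B).hom := by
      rw [← h3, ← Over.w (i ≫ snd _ _), pullback.condition_assoc, Over.w]
      exact (congrArg (x ≫ ·) (Category.comp_id _)).symm
    let T' : Over (Spec (.of k)) := Over.mk (y ≫ (affineOver k B).hom)
    let x' : T' ⟶ K := Over.homMk (x ≫ pullback.fst _ _) (by rw [Category.assoc]; exact h3)
    let y' : T' ⟶ affineOver k B := Over.homMk y rfl
    have h5 : (toUnit T').left = x ≫ pullback.snd _ _ :=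
      ((Category.comp_id _).symm.trans (Over.w (toUnit T'))).trans h4.symm
    have hα : x' ≫ i = lift y' (toUnit T' ≫ linePoint ε) ≫ (c ⊗ₘ l) := by
      apply CartesianMonoidalCategory.hom_ext
      · rw [Category.assoc, Category.assoc, tensorHom_fst, lift_fst_assoc]
        ext1
        exact (Category.assoc _ _ _).trans hx
      · rw [Category.assoc, Category.assoc, tensorHom_snd, lift_snd_assoc]
        ext1
        change (x ≫ pullback.fst _ _) ≫ (i ≫ snd _ _).left =
          ((toUnit T').left ≫ (linePoint ε).left) ≫ l.left
        rw [h5, Category.assoc, pullback.condition, Category.assoc, Category.assoc]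
        rfl
    have hα' : (x ≫ pullback.fst _ _) ≫ i.left =
        (lift y' (toUnit T' ≫ linePoint ε)).left ≫ (c ⊗ₘ l).left := congrArg Over.Hom.left hα
    let γ : T ⟶ (affineOver k R).left := hRED.lift _ _ hα'
    have hγ₁ : γ ≫ u.left = x ≫ pullback.fst _ _ := hRED.lift_fst _ _ _
    have hγ₂ : γ ≫ (lift (specOver β) (specOver ψ)).left = _ := hRED.lift_snd _ _ hα'
    have hβ : γ ≫ (specOver β).left = y := by
      have e1 := congrArg Over.Hom.left (lift_fst (specOver β) (specOver ψ))
      have e2 := congrArg Over.Hom.left (lift_fst y' (toUnit T' ≫ linePoint ε))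
      rw [← e1, Over.comp_left, ← Category.assoc, hγ₂]
      exact e2
    have hψ : γ ≫ (specOver ψ).left = (toUnit T').left ≫ (linePoint ε).left := by
      have e1 := congrArg Over.Hom.left (lift_snd (specOver β) (specOver ψ))
      have e2 := congrArg Over.Hom.left (lift_snd y' (toUnit T' ≫ linePoint ε))
      rw [← e1, Over.comp_left, ← Category.assoc, hγ₂]
      exact e2
    have e1 : hP.lift _ _ hψ ≫ (specOver δ).left = γ := hP.lift_fst _ _ _
    refine ⟨hP.lift _ _ hψ, ?_, ?_⟩
    · apply pullback.hom_ext
      · rw [Category.assoc, hw1, ← Category.assoc, e1, hγ₁]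
      · rw [Category.assoc, ← h5]
        exact (congrArg _ (pullback.lift_snd _ _ _)).trans (hP.lift_snd _ _ _)
    · rw [hc, ← Category.assoc, e1, hβ]

end Fibre

/-! ### A chart of the projective line -/

section Line

variable (k : Type u) [Field k]

attribute [local instance] MvPolynomial.gradedAlgebra

/-- The substitution `X₀ = t`, `X₁ = 1`. -/
noncomputable def dehomogenize : MvPolynomial (Fin 2) k →ₐ[k] AddMonoidAlgebra k ℕ :=
  MvPolynomial.aeval ![AddMonoidAlgebra.single 1 1, 1]

lemma dehomogenize_monomial (d : Fin 2 →₀ ℕ) (c : k) :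
    dehomogenize k (MvPolynomial.monomial d c) = AddMonoidAlgebra.single (d 0) c := by
  rw [dehomogenize, MvPolynomial.aeval_monomial, Finsupp.prod_fintype _ _ (by simp)]
  simp only [Fin.prod_univ_two, Matrix.cons_val_zero, Matrix.cons_val_one,
    one_pow, mul_one, AddMonoidAlgebra.single_pow, nsmul_one]
  rw [← Algebra.smul_def, AddMonoidAlgebra.smul_single, smul_eq_mul, mul_one]
  rfl

lemma eq_zero_of_dehomogenize_eq_zero {n : ℕ} {x : MvPolynomial (Fin 2) k}
    (hx : x ∈ MvPolynomial.homogeneousSubmodule (Fin 2) k n)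
    (h : dehomogenize k x = 0) : x = 0 := by
  classical
  have hx' : x.IsHomogeneous n := hx
  ext d
  rw [MvPolynomial.coeff_zero]
  by_contra hd
  have h1 : (dehomogenize k x).coeff (d 0) = MvPolynomial.coeff d x := by
    conv_lhs => rw [x.as_sum]
    rw [map_sum, AddMonoidAlgebra.coeff_sum, Finsupp.finsetSum_apply]
    rw [Finset.sum_eq_single d]
    · rw [dehomogenize_monomial, AddMonoidAlgebra.coeff_single, Finsupp.single_eq_same]
    · intro d' hd' hne
      rw [dehomogenize_monomial, AddMonoidAlgebra.coeff_single, Finsupp.single_apply, if_neg]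
      intro h0
      refine hne ?_
      have e1 := hx' hd
      have e2 := hx' (MvPolynomial.mem_support_iff.1 hd')
      rw [Finsupp.weight_apply, Finsupp.sum_fintype _ _ (by simp)] at e1 e2
      simp at e1 e2
      ext j
      fin_cases j
      · exact h0
      · change d' 1 = d 1
        omega
    · intro h0
      exact absurd (MvPolynomial.mem_support_iff.2 hd) h0
  rw [h] at h1
  exact hd h1.symm

lemma X_one_mem : (MvPolynomial.X 1 : MvPolynomial (Fin 2) k) ∈
    MvPolynomial.homogeneousSubmodule (Fin 2) k 1 := MvPolynomial.isHomogeneous_X k 1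

/-- The isomorphism of the degree zero part of `k[X₀, X₁, X₁⁻¹]` with `k[t]`, where
`t = X₀ / X₁`. -/
noncomputable def awayToLine : HomogeneousLocalization.Away
    (MvPolynomial.homogeneousSubmodule (Fin 2) k) (MvPolynomial.X 1) →+* AddMonoidAlgebra k ℕ :=
  (IsLocalization.Away.lift (S := Localization.Away (MvPolynomial.X 1 : MvPolynomial (Fin 2) k))
    (MvPolynomial.X 1) (g := (dehomogenize k).toRingHom) (by
      change IsUnit (dehomogenize k _)
      simp [dehomogenize])).comp (algebraMap _ _)

lemma awayToLine_mk (n : ℕ) (x : MvPolynomial (Fin 2) k)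
    (hx : x ∈ MvPolynomial.homogeneousSubmodule (Fin 2) k (n • 1)) :
    awayToLine k (.mk _ (X_one_mem k) n x hx) = dehomogenize k x := by
  have hu : IsUnit ((dehomogenize k).toRingHom (MvPolynomial.X 1)) := by
    change IsUnit (dehomogenize k _)
    simp [dehomogenize]
  have h1 : (HomogeneousLocalization.val (HomogeneousLocalization.Away.mk _ (X_one_mem k) n x hx) :
      Localization.Away (MvPolynomial.X 1 : MvPolynomial (Fin 2) k)) *
        algebraMap (MvPolynomial (Fin 2) k) _ (MvPolynomial.X 1 ^ n) =
          algebraMap (MvPolynomial (Fin 2) k) _ x := by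
    rw [HomogeneousLocalization.Away.val_mk, ← Localization.mk_one_eq_algebraMap,
      ← Localization.mk_one_eq_algebraMap, Localization.mk_mul, Localization.mk_eq_mk_iff,
      Localization.r_iff_exists]
    exact ⟨1, by simp [mul_comm]⟩
  have h2 := congrArg (IsLocalization.Away.lift (S := Localization.Away
    (MvPolynomial.X 1 : MvPolynomial (Fin 2) k)) (MvPolynomial.X 1) hu) h1
  rw [map_mul, IsLocalization.Away.lift_eq, IsLocalization.Away.lift_eq, map_pow] at h2
  have h3 : (dehomogenize k).toRingHom (MvPolynomial.X 1) = 1 := by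
    change dehomogenize k _ = 1
    simp [dehomogenize]
  rw [h3, one_pow, mul_one] at h2
  exact h2

lemma awayToLine_bijective : Function.Bijective (awayToLine k) := by
  constructor
  · rw [injective_iff_map_eq_zero]
    intro z hz
    obtain ⟨n, x, hx, rfl⟩ := HomogeneousLocalization.Away.mk_surjective _ (X_one_mem k) z
    rw [awayToLine_mk] at hz
    have := eq_zero_of_dehomogenize_eq_zero k hx hz
    subst this
    apply HomogeneousLocalization.val_injective
    simp [HomogeneousLocalization.Away.val_mk, Localization.mk_zero]
  · intro y
    induction y using AddMonoidAlgebra.induction_linear with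
    | zero => exact ⟨0, map_zero _⟩
    | add f g hf hg =>
      obtain ⟨a, rfl⟩ := hf
      obtain ⟨b, rfl⟩ := hg
      exact ⟨a + b, map_add _ _ _⟩
    | single n c =>
      have hmem : MvPolynomial.monomial (Finsupp.single 0 n) c ∈
          MvPolynomial.homogeneousSubmodule (Fin 2) k (n • 1) :=
        MvPolynomial.isHomogeneous_monomial c (by simp [Finsupp.degree_single])
      refine ⟨.mk _ (X_one_mem k) n _ hmem, ?_⟩
      rw [awayToLine_mk, dehomogenize_monomial, Finsupp.single_eq_same]

/-- The morphism of schemes underlying `lineChart`. -/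
noncomputable def lineChartHom : Spec (.of (AddMonoidAlgebra k ℕ)) ⟶
    Proj (MvPolynomial.homogeneousSubmodule (Fin 2) k) :=
  Spec.map (CommRingCat.ofHom (awayToLine k)) ≫ Proj.awayι _ _ (X_one_mem k) one_pos

instance : IsOpenImmersion (lineChartHom k) := by
  have : IsIso (CommRingCat.ofHom (awayToLine k)) :=
    (RingEquiv.ofBijective _ (awayToLine_bijective k)).toCommRingCatIso.isIso_hom
  rw [lineChartHom]
  infer_instance

lemma lineChartHom_comp : lineChartHom k ≫
    Proj.toSpecZero (MvPolynomial.homogeneousSubmodule (Fin 2) k) ≫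
    Spec.map (CommRingCat.ofHom (algebraMap k (MvPolynomial.homogeneousSubmodule (Fin 2) k 0))) =
      Spec.map (CommRingCat.ofHom (algebraMap k (AddMonoidAlgebra k ℕ))) := by
  rw [lineChartHom, Category.assoc, Proj.awayι_toSpecZero_assoc, ← Spec.map_comp, ← Spec.map_comp]
  congr 1
  apply CommRingCat.hom_ext
  refine RingHom.ext fun c => ?_
  have hmem : MvPolynomial.C c ∈ MvPolynomial.homogeneousSubmodule (Fin 2) k (0 • 1) :=
    MvPolynomial.isHomogeneous_C _ c
  have h := awayToLine_mk k 0 (MvPolynomial.C c) hmem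
  have h' : dehomogenize k (MvPolynomial.C c) = AddMonoidAlgebra.single 0 c :=
    dehomogenize_monomial k 0 c
  refine Eq.trans ?_ (h.trans h')
  change awayToLine k _ = awayToLine k _
  congr 1

/-- The chart `𝔸¹ → ℙ¹` with coordinate `X₀ / X₁`. -/
noncomputable def lineChart : affineOver k (AddMonoidAlgebra k ℕ) ⟶ projLine k :=
  Over.homMk (lineChartHom k) (lineChartHom_comp k)

instance : IsOpenImmersion (lineChart k).left :=
  inferInstanceAs (IsOpenImmersion (lineChartHom k))

instance : LocallyOfFiniteType (projLine k).hom := by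
  let 𝒜 := MvPolynomial.homogeneousSubmodule (Fin 2) k
  have : IsScalarTower k (𝒜 0) (MvPolynomial (Fin 2) k) :=
    ⟨fun a b c => smul_mul_assoc a b.1 c⟩
  have : Algebra.FiniteType (𝒜 0) (MvPolynomial (Fin 2) k) :=
    Algebra.FiniteType.of_restrictScalars_finiteType k (𝒜 0) _
  have : Algebra.FiniteType k (𝒜 0) :=
    Algebra.FiniteType.of_surjective ((Algebra.ofId k (𝒜 0))) (by
      rintro ⟨x, hx⟩
      refine ⟨MvPolynomial.coeff 0 x, Subtype.ext ?_⟩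
      exact (MvPolynomial.totalDegree_eq_zero_iff_eq_C.1
        ((MvPolynomial.totalDegree_zero_iff_isHomogeneous _).2 hx)).symm)
  have : LocallyOfFiniteType (Spec.map (CommRingCat.ofHom (algebraMap k (𝒜 0)))) :=
    (HasRingHomProperty.Spec_iff (P := @LocallyOfFiniteType)).2
      (RingHom.finiteType_algebraMap.2 this)
  exact inferInstanceAs (LocallyOfFiniteType (Proj.toSpecZero 𝒜 ≫
    Spec.map (CommRingCat.ofHom (algebraMap k (𝒜 0)))))

instance : IsDominant (lineChart k).left := by
  let 𝒜 := MvPolynomial.homogeneousSubmodule (Fin 2) k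
  -- the zero ideal is the generic point of the projective line
  let ξ : ProjectiveSpectrum 𝒜 := ⟨⊥, Ideal.isPrime_bot, fun h => by
    have h1 : (MvPolynomial.X 1 : MvPolynomial (Fin 2) k) ∈
        (HomogeneousIdeal.irrelevant 𝒜) :=
      HomogeneousIdeal.mem_irrelevant_of_mem 𝒜 one_pos (X_one_mem k)
    exact MvPolynomial.X_ne_zero _ (h h1)⟩
  have hξ : ξ ∈ Set.range (lineChartHom k) := by
    have h1 : ξ ∈ (Proj.awayι 𝒜 _ (X_one_mem k) one_pos).opensRange := by
      rw [Proj.opensRange_awayι]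
      exact fun h => MvPolynomial.X_ne_zero _ h
    obtain ⟨y, hy⟩ := h1
    have : IsIso (CommRingCat.ofHom (awayToLine k)) :=
      (RingEquiv.ofBijective _ (awayToLine_bijective k)).toCommRingCatIso.isIso_hom
    obtain ⟨z, rfl⟩ := (Spec.map (CommRingCat.ofHom (awayToLine k))).surjective y
    exact ⟨z, by rw [lineChartHom, Scheme.Hom.comp_apply]; exact hy⟩
  refine ⟨fun x => closure_mono (Set.singleton_subset_iff.2 hξ) ?_⟩
  exact (ProjectiveSpectrum.le_iff_mem_closure 𝒜 ξ x).1 (bot_le (α := Ideal _))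

end Line

end

section

variable {k : Type u} [Field k]

/-! ### Morphisms from reduced schemes and invariant subsets -/

/-- A morphism from a reduced scheme factors through a closed subscheme which contains its image. -/
lemma exists_lift_of_range_subset {K X W : Scheme.{u}} (c : K ⟶ X) [IsClosedImmersion c]
    (f : W ⟶ X) [IsReduced W] (h : Set.range f ⊆ Set.range c) : ∃ g : W ⟶ K, g ≫ c = f := by
  have hs : Surjective (pullback.fst f c) := by
    refine ⟨fun x => ?_⟩
    obtain ⟨y, hy⟩ := h ⟨x, rfl⟩
    obtain ⟨z, hz, -⟩ := Scheme.Pullback.exists_preimage_pullback x y hy.symm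
    exact ⟨z, hz⟩
  have := isIso_of_isClosedImmersion_of_surjective (pullback.fst f c)
  exact ⟨inv (pullback.fst f c) ≫ pullback.snd f c, by
    rw [Category.assoc, ← pullback.condition, IsIso.inv_hom_id_assoc]⟩

lemma isReduced_of_exists_chart {Z : Scheme.{u}} (h : ∀ x : Z, ∃ (W : Scheme.{u}) (c : W ⟶ Z),
    IsReduced W ∧ IsOpenImmersion c ∧ x ∈ Set.range c) : IsReduced Z := by
  have : ∀ x : Z, _root_.IsReduced (Z.presheaf.stalk x) := by
    intro x
    obtain ⟨W, c, _, _, y, rfl⟩ := h x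
    exact isReduced_of_injective (c.stalkMap y).hom
      ((asIso (c.stalkMap y)).commRingCatIsoToRingEquiv.injective)
  exact isReduced_of_isReduced_stalk Z

section Tensor

variable {X Y Z W T : Over (Spec (.of k))}

lemma exists_tensorHom_eq (f : X ⟶ Z) (g : Y ⟶ W) (p : (Z ⊗ W).left) (x : X.left) (y : Y.left)
    (hx : (fst Z W).left p = f.left x) (hy : (snd Z W).left p = g.left y) :
    ∃ q, (f ⊗ₘ g).left q = p := by
  have h := Scheme.Pullback.range_map X.hom Y.hom Z.hom W.hom f.left g.left (𝟙 _)
    (by simp) (by simp)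
  have hp : p ∈ Set.range (f ⊗ₘ g).left := by
    refine h ▸ ?_
    exact ⟨⟨x, hx.symm⟩, ⟨y, hy.symm⟩⟩
  exact hp

lemma exists_whiskerLeft_eq (g : Y ⟶ W) (p : (T ⊗ W).left) (y : Y.left)
    (hy : (snd T W).left p = g.left y) : ∃ q, (T ◁ g).left q = p := by
  rw [← id_tensorHom]
  exact exists_tensorHom_eq (𝟙 T) g p _ y rfl hy

instance (f : X ⟶ Z) (g : Y ⟶ W) [IsOpenImmersion f.left] [IsOpenImmersion g.left] :
    IsOpenImmersion (f ⊗ₘ g).left := by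
  have h : IsOpenImmersion (pullback.map X.hom Y.hom Z.hom W.hom f.left g.left (𝟙 _)
      (by simp) (by simp)) :=
    MorphismProperty.pullbackMap (P := @IsOpenImmersion) (i₁ := f.left) (i₂ := g.left)
      inferInstance inferInstance (by simp) (by simp)
  exact h

instance (g : Y ⟶ W) [IsOpenImmersion g.left] : IsOpenImmersion (T ◁ g).left := by
  rw [← id_tensorHom]
  have : IsOpenImmersion (𝟙 T : T ⟶ T).left := inferInstanceAs (IsOpenImmersion (𝟙 T.left))
  infer_instance

instance (g : Y ⟶ W) [IsOpenImmersion g.left] : IsOpenImmersion (g ▷ T).left := by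
  rw [← tensorHom_id]
  have : IsOpenImmersion (𝟙 T : T ⟶ T).left := inferInstanceAs (IsOpenImmersion (𝟙 T.left))
  infer_instance

lemma isOpenMap_snd [UniversallyOpen T.hom] : IsOpenMap (snd T X).left :=
  (pullback.snd T.hom X.hom).isOpenMap

lemma isOpenMap_fst [UniversallyOpen T.hom] : IsOpenMap (fst X T).left :=
  (pullback.fst X.hom T.hom).isOpenMap

lemma isInvariant_range {act : T ⊗ X ⟶ X} {g : Y ⟶ X} {a : T ⊗ Y ⟶ Y}
    (h : (T ◁ g) ≫ act = a ≫ g) : IsInvariant act (Set.range g.left) := by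
  rintro p ⟨y, hy⟩
  obtain ⟨q, rfl⟩ := exists_whiskerLeft_eq g p y hy.symm
  refine ⟨a.left q, ?_⟩
  rw [← Scheme.Hom.comp_apply, ← Scheme.Hom.comp_apply, ← Over.comp_left, ← Over.comp_left, h]

lemma IsInvariant.closure [UniversallyOpen T.hom] {act : T ⊗ X ⟶ X} {Z : Set X.left}
    (h : IsInvariant act Z) : IsInvariant act (closure Z) := by
  intro p hp
  have h1 : p ∈ _root_.closure ((snd T X).left ⁻¹' Z) := by
    rw [← isOpenMap_snd.preimage_closure_eq_closure_preimage (snd T X).left.continuous]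
    exact hp
  have h2 := image_closure_subset_closure_image act.left.continuous ⟨p, h1, rfl⟩
  refine closure_mono ?_ h2
  rintro _ ⟨q, hq, rfl⟩
  exact h q hq

end Tensor

lemma universallyOpen_affineOver (A : Type u) [CommRing A] [Algebra k A] [Algebra.FiniteType k A] :
    UniversallyOpen (affineOver k A).hom := by
  have h1 : Flat (Spec.map (CommRingCat.ofHom (algebraMap k A))) :=
    (HasRingHomProperty.Spec_iff (P := @Flat)).2
      (RingHom.flat_algebraMap_iff.2 inferInstance)
  have h2 : LocallyOfFinitePresentation (Spec.map (CommRingCat.ofHom (algebraMap k A))) :=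
    (HasRingHomProperty.Spec_iff (P := @LocallyOfFinitePresentation)).2
      (RingHom.finitePresentation_algebraMap.2
        (Algebra.FinitePresentation.of_finiteType.1 inferInstance))
  exact inferInstanceAs (UniversallyOpen (Spec.map (CommRingCat.ofHom (algebraMap k A))))

instance {X : Scheme.{u}} (Z : TopologicalSpace.Closeds X) :
    IsReduced (Scheme.IdealSheafData.vanishingIdeal Z).subscheme := by
  let I := Scheme.IdealSheafData.vanishingIdeal Z
  have hrad : ∀ U : X.affineOpens, _root_.IsReduced (Γ(X, U.1) ⧸ I.ideal U) := by
    intro U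
    rw [← Ideal.isRadical_iff_quotient_reduced, Scheme.IdealSheafData.vanishingIdeal_ideal]
    exact PrimeSpectrum.isRadical_vanishingIdeal _
  refine isReduced_of_exists_chart fun x => ?_
  obtain ⟨y, hy⟩ := I.subschemeCover.openCover.covers x
  refine ⟨_, I.subschemeCover.openCover.f (I.subschemeCover.openCover.idx x), ?_, inferInstance,
    y, hy⟩
  have := hrad (I.subschemeCover.openCover.idx x)
  exact inferInstanceAs (IsReduced (Spec (.of (Γ(X, (I.subschemeCover.openCover.idx x).1) ⧸
      I.ideal (I.subschemeCover.openCover.idx x)))))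

/-! ### Toric atlases -/

section ProdSub

variable {L L' : Type u} [AddCommGroup L] [AddCommGroup L']

/-- The inclusion of the first factor in a product of submonoids. -/
def inlSub (S : AddSubmonoid L) (S' : AddSubmonoid L') : S →+ S.prod S' where
  toFun s := ⟨(s, 0), s.2, zero_mem S'⟩
  map_zero' := rfl
  map_add' x y := by ext <;> simp

/-- The inclusion of the second factor in a product of submonoids. -/
def inrSub (S : AddSubmonoid L) (S' : AddSubmonoid L') : S' →+ S.prod S' where
  toFun s := ⟨(0, s), zero_mem S, s.2⟩
  map_zero' := rfl
  map_add' x y := by ext <;> simp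

lemma nonunitIdeal_le_comap_inlSub {S : AddSubmonoid L} {S' : AddSubmonoid L'}
    {p : Ideal (AddMonoidAlgebra k (S.prod S'))} (hp : nonunitIdeal k (S.prod S') ≤ p) :
    nonunitIdeal k S ≤ p.comap (charMap k (inlSub S S')) := by
  refine nonunitIdeal_le fun s hs => hp ?_
  rw [charMap_single]
  exact single_mem_nonunitIdeal.2 fun h => hs h.1

lemma nonunitIdeal_le_comap_inrSub {S : AddSubmonoid L} {S' : AddSubmonoid L'}
    {p : Ideal (AddMonoidAlgebra k (S.prod S'))} (hp : nonunitIdeal k (S.prod S') ≤ p) :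
    nonunitIdeal k S' ≤ p.comap (charMap k (inrSub S S')) := by
  refine nonunitIdeal_le fun s hs => hp ?_
  rw [charMap_single]
  exact single_mem_nonunitIdeal.2 fun h => hs h.2

lemma isIso_lift_charOver {A B C : Type u} [AddCommMonoid A] [AddCommMonoid B] [AddCommMonoid C]
    (φ : A →+ C) (ψ : B →+ C) (h : Function.Bijective (φ.coprod ψ)) :
    IsIso (lift (charOver k φ) (charOver k ψ)) := by
  refine isIso_lift_specOver _ _ ?_
  have h1 : Algebra.TensorProduct.productMap (charMap k φ) (charMap k ψ) =
      (charMap k (φ.coprod ψ)).comp (Algebra.TensorProduct.productMap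
        (charMap k (AddMonoidHom.inl A B)) (charMap k (AddMonoidHom.inr A B))) := by
    refine Algebra.TensorProduct.ext' fun x y => ?_
    rw [AlgHom.comp_apply, Algebra.TensorProduct.productMap_apply_tmul,
      Algebra.TensorProduct.productMap_apply_tmul, map_mul, charMap_comp, charMap_comp]
    simp
  rw [h1]
  have h2 : Function.Bijective (charMap k (φ.coprod ψ)) :=
    ⟨charMap_injective k h.1, charMap_surjective k h.2⟩
  exact h2.comp (bijective_productMap_charMap k A B)

lemma isIso_lift_inlSub (S : AddSubmonoid L) (S' : AddSubmonoid L') :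
    IsIso (lift (charOver k (inlSub S S')) (charOver k (inrSub S S'))) := by
  refine isIso_lift_charOver _ _ ⟨fun x y h => ?_, fun x => ?_⟩
  · have h1 := congrArg (fun z : S.prod S' => (z : L × L')) h
    simp only [AddMonoidHom.coprod_apply, inlSub, inrSub, AddMonoidHom.coe_mk, ZeroHom.coe_mk,
      AddSubmonoid.coe_add, Prod.mk_add_mk, add_zero, zero_add, Prod.mk.injEq] at h1
    exact Prod.ext (Subtype.ext h1.1) (Subtype.ext h1.2)
  · refine ⟨(⟨x.1.1, x.2.1⟩, ⟨x.1.2, x.2.2⟩), Subtype.ext ?_⟩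
    simp [inlSub, inrSub]

lemma isIso_left {A B : Over (Spec (.of k))} (f : A ⟶ B) [IsIso f] : IsIso f.left :=
  inferInstanceAs (IsIso ((Over.forget _).map f))

end ProdSub

/-- A covering of a scheme over `k` by affine toric charts `Spec k[S]` with a common torus
`Spec k[L]`. Each point is required to lie in the closed orbit of some chart. Neither normality of the
charts nor separatedness is needed; in this form the notion covers closed strata of toric varieties,
the spaces `(𝔸^m ∖ 0)^r`, and their products. -/
structure Atlas (k : Type u) [Field k] (L : Type u) [AddCommGroup L]
    (Z : Over (Spec (.of k))) where
  I : Type u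
  S : I → AddSubmonoid L
  chart : ∀ i, affineOver k (AddMonoidAlgebra k (S i)) ⟶ Z
  fg : ∀ i, (S i).FG
  closure_eq : ∀ i, AddSubgroup.closure (S i : Set L) = ⊤
  isOpenImmersion : ∀ i, IsOpenImmersion (chart i).left
  compat : ∀ i j, charOver k (S i).subtype ≫ chart i = charOver k (S j).subtype ≫ chart j
  cover : ∀ x : Z.left, ∃ i, ∃ p : PrimeSpectrum (AddMonoidAlgebra k (S i)),
    (chart i).left p = x ∧ nonunitIdeal k (S i) ≤ p.asIdeal
  eq_of_chart_eq : ∀ i j (p : PrimeSpectrum (AddMonoidAlgebra k (S i)))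
    (q : PrimeSpectrum (AddMonoidAlgebra k (S j))), nonunitIdeal k (S i) ≤ p.asIdeal →
      nonunitIdeal k (S j) ≤ q.asIdeal → (chart i).left p = (chart j).left q → i = j

namespace Atlas

variable {L : Type u} [AddCommGroup L] {Z : Over (Spec (.of k))} (a : Atlas k L Z)

instance (i : a.I) : IsOpenImmersion (a.chart i).left := a.isOpenImmersion i

/-- The open cover given by the charts. -/
noncomputable def openCover : Z.left.OpenCover :=
  Scheme.Cover.mkOfCovers a.I (fun i => (affineOver k (AddMonoidAlgebra k (a.S i))).left)
    (fun i => (a.chart i).left) (fun x => by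
      obtain ⟨i, p, hp, -⟩ := a.cover x
      exact ⟨i, p, hp⟩) fun i => a.isOpenImmersion i

lemma locallyOfFiniteType (a : Atlas k L Z) : LocallyOfFiniteType Z.hom := by
  have hloc := HasRingHomProperty.instIsZariskiLocalAtSource (P := @LocallyOfFiniteType)
  refine IsZariskiLocalAtSource.of_openCover (P := @LocallyOfFiniteType) a.openCover fun i => ?_
  change LocallyOfFiniteType ((a.chart i).left ≫ Z.hom)
  rw [Over.w]
  have : AddMonoid.FG (a.S i) := (AddMonoid.fg_iff_addSubmonoid_fg _).2 (a.fg i)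
  exact (HasRingHomProperty.Spec_iff (P := @LocallyOfFiniteType)).2
    (RingHom.finiteType_algebraMap.2 inferInstance)

/-- The open embedding of the common torus. -/
noncomputable def torus (i : a.I) : affineOver k (AddMonoidAlgebra k L) ⟶ Z :=
  charOver k (a.S i).subtype ≫ a.chart i

lemma torus_eq (i j : a.I) : a.torus i = a.torus j := a.compat i j

lemma isGenericPoint_torus [Module.Free ℤ L] [Module.Finite ℤ L] (i : a.I) :
    IsGenericPoint ((a.chart i).left (⊥ : PrimeSpectrum (AddMonoidAlgebra k (a.S i)))) Set.univ := by
  rw [isGenericPoint_def]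
  refine Set.eq_univ_of_forall fun x => ?_
  obtain ⟨j, p, rfl, -⟩ := a.cover x
  have h1 : ∀ j, (a.torus j).left (⊥ : PrimeSpectrum (AddMonoidAlgebra k L)) =
      (a.chart j).left (⊥ : PrimeSpectrum (AddMonoidAlgebra k (a.S j))) := by
    intro j
    refine congrArg (a.chart j).left (PrimeSpectrum.ext ?_)
    exact (RingHom.injective_iff_ker_eq_bot _).1
      (charMap_injective k (f := (a.S j).subtype) Subtype.val_injective)
  rw [← h1 i, a.torus_eq i j, h1 j]
  rw [← specializes_iff_mem_closure]
  exact Specializes.map ((PrimeSpectrum.le_iff_specializes ⊥ p).1 bot_le) (a.chart j).left.continuous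

section Prod

variable {L' : Type u} [AddCommGroup L'] {Z' : Over (Spec (.of k))} (a' : Atlas k L' Z')

/-- The product of two charts. -/
noncomputable def prodChart (i : a.I × a'.I) :
    affineOver k (AddMonoidAlgebra k ((a.S i.1).prod (a'.S i.2))) ⟶ Z ⊗ Z' :=
  lift (charOver k (inlSub _ _)) (charOver k (inrSub _ _)) ≫ (a.chart i.1 ⊗ₘ a'.chart i.2)

lemma prodChart_fst (i : a.I × a'.I) : a.prodChart a' i ≫ fst Z Z' =
    charOver k (inlSub (a.S i.1) (a'.S i.2)) ≫ a.chart i.1 := by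
  rw [prodChart, lift_map, lift_fst]

lemma prodChart_snd (i : a.I × a'.I) : a.prodChart a' i ≫ snd Z Z' =
    charOver k (inrSub (a.S i.1) (a'.S i.2)) ≫ a'.chart i.2 := by
  rw [prodChart, lift_map, lift_snd]

lemma charOver_prodChart (i : a.I × a'.I) :
    charOver k ((a.S i.1).prod (a'.S i.2)).subtype ≫ a.prodChart a' i =
      lift (charOver k (AddMonoidHom.inl L L') ≫ a.torus i.1)
        (charOver k (AddMonoidHom.inr L L') ≫ a'.torus i.2) := by
  rw [prodChart, lift_map, comp_lift, ← Category.assoc, ← Category.assoc, charOver_comp,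
    charOver_comp, torus, torus, ← Category.assoc, ← Category.assoc, charOver_comp, charOver_comp]
  rfl

lemma eq_of_prodChart_eq (i j : a.I × a'.I)
    (p : PrimeSpectrum (AddMonoidAlgebra k ((a.S i.1).prod (a'.S i.2))))
    (q : PrimeSpectrum (AddMonoidAlgebra k ((a.S j.1).prod (a'.S j.2))))
    (hp : nonunitIdeal k ((a.S i.1).prod (a'.S i.2)) ≤ p.asIdeal)
    (hq : nonunitIdeal k ((a.S j.1).prod (a'.S j.2)) ≤ q.asIdeal)
    (h : (a.prodChart a' i).left p = (a.prodChart a' j).left q) : i = j := by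
  refine Prod.ext ?_ ?_
  · let p₁ : PrimeSpectrum (AddMonoidAlgebra k (a.S i.1)) :=
      ⟨p.asIdeal.comap (charMap k (inlSub _ _)), inferInstance⟩
    let q₁ : PrimeSpectrum (AddMonoidAlgebra k (a.S j.1)) :=
      ⟨q.asIdeal.comap (charMap k (inlSub _ _)), inferInstance⟩
    refine a.eq_of_chart_eq i.1 j.1 p₁ q₁ (nonunitIdeal_le_comap_inlSub hp)
      (nonunitIdeal_le_comap_inlSub hq) ?_
    exact (congrArg (fun g => g.left p) (a.prodChart_fst a' i)).symm.trans
      ((congrArg (fst Z Z').left h).trans (congrArg (fun g => g.left q) (a.prodChart_fst a' j)))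
  · let p₁ : PrimeSpectrum (AddMonoidAlgebra k (a'.S i.2)) :=
      ⟨p.asIdeal.comap (charMap k (inrSub _ _)), inferInstance⟩
    let q₁ : PrimeSpectrum (AddMonoidAlgebra k (a'.S j.2)) :=
      ⟨q.asIdeal.comap (charMap k (inrSub _ _)), inferInstance⟩
    refine a'.eq_of_chart_eq i.2 j.2 p₁ q₁ (nonunitIdeal_le_comap_inrSub hp)
      (nonunitIdeal_le_comap_inrSub hq) ?_
    exact (congrArg (fun g => g.left p) (a.prodChart_snd a' i)).symm.trans
      ((congrArg (snd Z Z').left h).trans (congrArg (fun g => g.left q) (a.prodChart_snd a' j)))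

/-- The product of two toric atlases. -/
noncomputable def prod : Atlas k (L × L') (Z ⊗ Z') where
  I := a.I × a'.I
  S i := (a.S i.1).prod (a'.S i.2)
  chart := a.prodChart a'
  fg i := (a.fg i.1).prod (a'.fg i.2)
  closure_eq i := by
    rw [AddSubmonoid.coe_prod, AddSubgroup.closure_prod (zero_mem _) (zero_mem _), a.closure_eq,
      a'.closure_eq, AddSubgroup.top_prod_top]
  isOpenImmersion i := by
    have := isIso_lift_inlSub (k := k) (a.S i.1) (a'.S i.2)
    have := isIso_left (lift (charOver k (inlSub (a.S i.1) (a'.S i.2)))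
      (charOver k (inrSub (a.S i.1) (a'.S i.2))))
    rw [prodChart, Over.comp_left]
    infer_instance
  compat i j := by
    rw [charOver_prodChart, charOver_prodChart, a.torus_eq i.1 j.1, a'.torus_eq i.2 j.2]
  cover x := by
    obtain ⟨i, p, hp, hp'⟩ := a.cover ((fst Z Z').left x)
    obtain ⟨j, q, hq, hq'⟩ := a'.cover ((snd Z Z').left x)
    obtain ⟨y, hy⟩ := exists_tensorHom_eq (a.chart i) (a'.chart j) x p q hp.symm hq.symm
    have := isIso_lift_inlSub (k := k) (a.S i) (a'.S j)
    let e := lift (charOver k (inlSub (a.S i) (a'.S j))) (charOver k (inrSub (a.S i) (a'.S j)))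
    have := isIso_left e
    have hs : Function.Surjective e.left := e.left.surjective
    obtain ⟨z, hz⟩ := hs y
    let z' : PrimeSpectrum (AddMonoidAlgebra k ((a.S i).prod (a'.S j))) := z
    have h1 : (charOver k (inlSub (a.S i) (a'.S j))).left z = p := by
      apply (a.chart i).left.isOpenEmbedding.injective
      rw [hp, ← hy, ← hz]
      have h : charOver k (inlSub (a.S i) (a'.S j)) ≫ a.chart i =
          e ≫ (a.chart i ⊗ₘ a'.chart j) ≫ fst Z Z' := by simp [e]
      exact congrArg (fun g => g.left z) h
    have h2 : (charOver k (inrSub (a.S i) (a'.S j))).left z = q := by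
      apply (a'.chart j).left.isOpenEmbedding.injective
      rw [hq, ← hy, ← hz]
      have h : charOver k (inrSub (a.S i) (a'.S j)) ≫ a'.chart j =
          e ≫ (a.chart i ⊗ₘ a'.chart j) ≫ snd Z Z' := by simp [e]
      exact congrArg (fun g => g.left z) h
    refine ⟨(i, j), z', (congrArg _ hz).trans hy, nonunitIdeal_le ?_⟩
    rintro ⟨⟨s, t⟩, hs, ht⟩ hst
    have h3 : (AddMonoidAlgebra.single (⟨(s, t), hs, ht⟩ : (a.S i).prod (a'.S j)) 1 :
        AddMonoidAlgebra k ((a.S i).prod (a'.S j))) =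
        charMap k (inlSub _ _) (AddMonoidAlgebra.single ⟨s, hs⟩ 1) *
          charMap k (inrSub _ _) (AddMonoidAlgebra.single ⟨t, ht⟩ 1) := by
      rw [charMap_single, charMap_single, AddMonoidAlgebra.single_mul_single, mul_one]
      congr 1
      exact Subtype.ext (by simp [inlSub, inrSub])
    rw [h3]
    by_cases h : -s ∈ a.S i
    · refine Ideal.mul_mem_left _ _ ?_
      have h4 : (AddMonoidAlgebra.single (⟨t, ht⟩ : a'.S j) 1 : AddMonoidAlgebra k (a'.S j)) ∈
          q.asIdeal := hq' (single_mem_nonunitIdeal.2 fun h' => hst ⟨h, h'⟩)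
      rw [← h2] at h4
      exact h4
    · refine Ideal.mul_mem_right _ _ ?_
      have h4 : (AddMonoidAlgebra.single (⟨s, hs⟩ : a.S i) 1 : AddMonoidAlgebra k (a.S i)) ∈
          p.asIdeal := hp' (single_mem_nonunitIdeal.2 h)
      rw [← h1] at h4
      exact h4
  eq_of_chart_eq := a.eq_of_prodChart_eq a'

lemma prod_torus (i : a.I × a'.I) : (a.prod a').torus i =
    lift (charOver k (AddMonoidHom.inl L L') ≫ a.torus i.1)
      (charOver k (AddMonoidHom.inr L L') ≫ a'.torus i.2)  :=
  a.charOver_prodChart a' i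

end Prod

end Atlas

/-- The generic point of the closure of the image of `Spec B`, for a domain `B`. -/
lemma isGenericPoint_specOver {Z : Over (Spec (.of k))} {A B : Type u} [CommRing A] [Algebra k A]
    [CommRing B] [IsDomain B] [Algebra k B] (f : A →ₐ[k] B) (c : affineOver k A ⟶ Z) :
    IsGenericPoint (c.left (⟨RingHom.ker f, RingHom.ker_isPrime f⟩ : PrimeSpectrum A))
      (closure (Set.range (specOver f ≫ c).left)) := by
  have h1 : IsGenericPoint (⊥ : PrimeSpectrum B) Set.univ := by
    rw [isGenericPoint_def]
    exact Set.eq_univ_of_forall fun x => (PrimeSpectrum.le_iff_mem_closure ⊥ x).1 bot_le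
  have h2 := IsGenericPoint.image h1 (f := (specOver f ≫ c).left)
    (specOver f ≫ c).left.continuous
  have h4 : (specOver f ≫ c).left '' Set.univ = Set.range (specOver f ≫ c).left := Set.image_univ
  replace h2 := h4 ▸ h2
  have h3 : (specOver f ≫ c).left (⊥ : PrimeSpectrum B) =
      c.left (⟨RingHom.ker f, RingHom.ker_isPrime f⟩ : PrimeSpectrum A) := by
    refine congrArg c.left ?_
    exact PrimeSpectrum.ext rfl
  exact h3 ▸ h2

end

section

variable {k : Type u} [Field k]

/-! ### The degeneration of a subtorus closure -/

lemma isDominant_specOver {A B : Type u} [CommRing A] [Algebra k A] [CommRing B] [Algebra k B]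
    {f : A →ₐ[k] B} (hf : Function.Injective f) : IsDominant (specOver f).left := by
  refine ⟨?_⟩
  have h := (PrimeSpectrum.denseRange_comap_iff_ker_le_nilRadical f.toRingHom).2 (by
    rw [(RingHom.injective_iff_ker_eq_bot _).1 (show Function.Injective f.toRingHom from hf)]
    exact bot_le)
  exact h

lemma linePoint_injective {ε ε' : k}
    (h : (linePoint ε ≫ lineChart k) = linePoint ε' ≫ lineChart k) :
    ε = ε' := by
  have h1 : (linePoint ε).left ≫ (lineChart k).left = (linePoint ε').left ≫ (lineChart k).left :=
    congrArg Over.Hom.left h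
  have h2 : (linePoint ε).left = (linePoint ε').left := (cancel_mono (lineChart k).left).1 h1
  have h3 := congrArg (fun g => g.hom (AddMonoidAlgebra.single 1 1)) (Spec.map_injective h2)
  change evalAt ε _ = evalAt ε' _ at h3
  simpa only [evalAt_single, one_mul, pow_one] using h3

/-- The reduced closed subscheme with a given underlying set, over `k`. -/
noncomputable def reducedOver {W : Over (Spec (.of k))} (C : TopologicalSpace.Closeds W.left) :
    Over (Spec (.of k)) :=
  Over.mk ((Scheme.IdealSheafData.vanishingIdeal C).subschemeι ≫ W.hom)

/-- The closed immersion of a reduced closed subscheme, over `k`. -/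
noncomputable def reducedIncl {W : Over (Spec (.of k))} (C : TopologicalSpace.Closeds W.left) :
    reducedOver C ⟶ W :=
  Over.homMk (Scheme.IdealSheafData.vanishingIdeal C).subschemeι

section Reduced

variable {W : Over (Spec (.of k))} (C : TopologicalSpace.Closeds W.left)

instance : IsClosedImmersion (reducedIncl C).left :=
  inferInstanceAs (IsClosedImmersion (Scheme.IdealSheafData.vanishingIdeal C).subschemeι)

instance : IsReduced (reducedOver C).left :=
  inferInstanceAs (IsReduced (Scheme.IdealSheafData.vanishingIdeal C).subscheme)

lemma range_reducedIncl : Set.range (reducedIncl C).left = C :=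
  (Scheme.IdealSheafData.range_subschemeι _).trans
    (Scheme.IdealSheafData.coe_support_vanishingIdeal C)

end Reduced

lemma isGenericPoint_of_map {X Y : Scheme.{u}} (f : X ⟶ Y) [IsClosedImmersion f] {x : X} {Z : Set Y}
    (h : IsGenericPoint (f x) Z) : IsGenericPoint x (f ⁻¹' Z) := by
  rw [isGenericPoint_def, f.isClosedEmbedding.isInducing.closure_eq_preimage_closure_image,
    Set.image_singleton, h.def]

/-- The trace on an affine open subscheme of the closure of a torus orbit. -/
lemma exists_isPullback_reducedIncl {W : Over (Spec (.of k))} {R D : Type u} [CommRing R]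
    [Algebra k R]
    [CommRing D] [Algebra k D] [_root_.IsReduced R] {f : R →ₐ[k] D} (hf : Function.Injective f)
    {U : Over (Spec (.of k))} (t : affineOver k R ⟶ U) [IsClosedImmersion t.left]
    (j : U ⟶ W) [IsOpenImmersion j.left] (C : TopologicalSpace.Closeds W.left)
    (hC : (C : Set W.left) = closure (Set.range (specOver f ≫ t ≫ j).left)) :
    ∃ u : affineOver k R ⟶ reducedOver C, IsPullback u.left t.left (reducedIncl C).left j.left := by
  have : IsReduced (affineOver k R).left := inferInstanceAs (IsReduced (Spec (.of R)))
  have hdom := isDominant_specOver hf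
  obtain ⟨u, hu⟩ := exists_isPullback_of_range_eq (reducedIncl C).left j.left t.left (by
    rw [range_reducedIncl, hC, Over.comp_left, Over.comp_left, ← Category.assoc]
    have h1 : Set.range (((specOver f).left ≫ t.left) ≫ j.left) =
        j.left '' Set.range ((specOver f).left ≫ t.left) := by
      rw [Scheme.Hom.comp_base, TopCat.coe_comp, Set.range_comp]
    have h2 : Set.range ((specOver f).left ≫ t.left) = t.left '' Set.range (specOver f).left := by
      rw [Scheme.Hom.comp_base, TopCat.coe_comp, Set.range_comp]
    rw [h1, j.left.isOpenEmbedding.isOpenMap.preimage_closure_eq_closure_preimage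
      j.left.continuous, Set.preimage_image_eq _ j.left.isOpenEmbedding.injective, h2,
      t.left.isClosedEmbedding.closure_image_eq, (specOver f).left.denseRange.closure_range,
      Set.image_univ])
  refine ⟨Over.homMk u ?_, hu⟩
  have h1 := hu.w
  change u ≫ (reducedIncl C).left ≫ W.hom = _
  rw [← Category.assoc, h1, Category.assoc, Over.w, Over.w]

section DegTorus

variable {L M : Type u} [AddCommGroup L] [AddCommGroup M] {Z : Over (Spec (.of k))}

/-- The powers of the parameter of the degeneration. -/
def degPow (S : AddSubmonoid L) (π : L →ₗ[ℤ] M) (v : Module.Dual ℤ L) : ℕ →+ degMonoid S π v :=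
  multiplesHom _ (degParam S π v)

lemma degPow_apply (S : AddSubmonoid L) (π : L →ₗ[ℤ] M) (v : Module.Dual ℤ L) (n : ℕ) :
    (degPow S π v n : M × ℤ) = (0, (n : ℤ)) := by
  simp [degPow, degParam]

variable (k) in
/-- The part of the degeneration in `Spec k[S] × 𝔸¹`. -/
noncomputable def degIncl (S : AddSubmonoid L) (π : L →ₗ[ℤ] M) (v : Module.Dual ℤ L) :
    affineOver k (AddMonoidAlgebra k (degMonoid S π v)) ⟶
      affineOver k (AddMonoidAlgebra k S) ⊗ affineOver k (AddMonoidAlgebra k ℕ) :=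
  lift (specOver (charMap k (degRestrict S π v))) (specOver (charMap k (degPow S π v)))

instance (S : AddSubmonoid L) (π : L →ₗ[ℤ] M) (v : Module.Dual ℤ L) :
    IsClosedImmersion (degIncl k S π v).left := by
  let e := lift (specOver (charMap k (AddMonoidHom.inl S ℕ)))
    (specOver (charMap k (AddMonoidHom.inr S ℕ)))
  have : IsIso e := isIso_lift_specOver _ _ (bijective_productMap_charMap k S ℕ)
  have := isIso_left e
  let γ : S × ℕ →+ degMonoid S π v := (degHom S π v).mrangeRestrict
  have hγ : Function.Surjective γ := (degHom S π v).mrangeRestrict_surjective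
  have h1 : degIncl k S π v = specOver (charMap k γ) ≫ e := by
    rw [comp_lift, specOver_comp, specOver_comp, degIncl]
    have e1 : γ.comp (AddMonoidHom.inl S ℕ) = degRestrict S π v := by
      refine AddMonoidHom.ext fun x => Subtype.ext ?_
      change (π x, v x + ((0 : ℕ) : ℤ)) = (π x, v x)
      simp
    have e2 : γ.comp (AddMonoidHom.inr S ℕ) = degPow S π v := by
      refine AddMonoidHom.ext fun n => Subtype.ext ?_
      rw [degPow_apply]
      change (π (0 : S), v (0 : S) + (n : ℤ)) = (0, (n : ℤ))
      simp
    congr 2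
    · refine AlgHom.ext fun x => ?_
      rw [AlgHom.comp_apply, charMap_comp, e1]
    · refine AlgHom.ext fun x => ?_
      rw [AlgHom.comp_apply, charMap_comp, e2]
  have : IsClosedImmersion (specOver (charMap k γ)).left :=
    IsClosedImmersion.spec_of_surjective _ (charMap_surjective k hγ)
  rw [h1, Over.comp_left]
  infer_instance

/-- The restriction of characters of `L × ℤ` to the torus which is degenerated. -/
def torusRestrict (π : L →ₗ[ℤ] M) (v : Module.Dual ℤ L) : L →+ M × ℤ :=
  ((π : L →+ M).prod (v : L →+ ℤ))

/-- The graph of the one-parameter family of translates of the image of the torus `Spec k[M]`, as a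
torus in `Z × ℙ¹`. -/
noncomputable def Atlas.degTorus (a : Atlas k L Z) (i : a.I) (π : L →ₗ[ℤ] M) (v : Module.Dual ℤ L) :
    affineOver k (AddMonoidAlgebra k (M × ℤ)) ⟶ Z ⊗ projLine k :=
  lift (charOver k (torusRestrict π v) ≫ a.torus i)
    (specOver (charMap k ((AddMonoidHom.inr M ℤ).comp (Nat.castAddMonoidHom ℤ))) ≫ lineChart k)

lemma Atlas.degTorus_eq (a : Atlas k L Z) (i j : a.I) (π : L →ₗ[ℤ] M) (v : Module.Dual ℤ L) :
    a.degTorus i π v = specOver (charMap k (degMonoid (a.S j) π v).subtype) ≫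
      degIncl k (a.S j) π v ≫ (a.chart j ⊗ₘ lineChart k) := by
  have e1 : (charMap k (degMonoid (a.S j) π v).subtype).comp (charMap k (degRestrict (a.S j) π v)) =
      (charMap k (torusRestrict π v)).comp (charMap k (a.S j).subtype) := by
    refine AlgHom.ext fun x => ?_
    rw [AlgHom.comp_apply, AlgHom.comp_apply, charMap_comp, charMap_comp]
    rfl
  have e2 : (charMap k (degMonoid (a.S j) π v).subtype).comp (charMap k (degPow (a.S j) π v)) =
      charMap k ((AddMonoidHom.inr M ℤ).comp (Nat.castAddMonoidHom ℤ)) := by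
    refine AlgHom.ext fun x => ?_
    rw [AlgHom.comp_apply, charMap_comp]
    congr 2
    refine AddMonoidHom.ext fun n => ?_
    exact degPow_apply _ _ _ n
  rw [degIncl, lift_map, comp_lift, ← Category.assoc, ← Category.assoc, specOver_comp, specOver_comp,
    degTorus, a.torus_eq i j, torus, ← Category.assoc, specOver_comp, e1, e2]

open Classical in
/-- The closure of the graph of a one-parameter family of translates of a subtorus: its fibre over one
is the closure of the subtorus, and its fibre over zero is the union of the closed orbits which the
family meets, with the lattice indices as multiplicities. -/
theorem Atlas.exists_degeneration [Module.Free ℤ L] [Module.Finite ℤ L] [Module.Free ℤ M]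
    [Module.Finite ℤ M] (a : Atlas k L Z) (i₀ : a.I) (π : L →ₗ[ℤ] M) (hπ : Function.Surjective π)
    (v : Module.Dual ℤ L)
    (hinj : ∀ i, Meets (a.S i) π v → ∀ g ∈ unitGroup (a.S i), π g = 0 → g = 0) :
    ∃ (K : Over (Spec (.of k))) (ι : K ⟶ Z ⊗ projLine k), IsIntegral K.left ∧
      IsClosedImmersion ι.left ∧ IsDominant (ι ≫ snd Z (projLine k)).left ∧
      HasDim K.left (Module.finrank ℤ M + 1) ∧
      Set.range ι.left = closure (Set.range (a.degTorus i₀ π v).left) ∧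
      ∃ s t : 𝟙_ (Over (Spec (.of k))) ⟶ projLine k, s ≠ t ∧
        (∀ x, primeCycle (closure (Set.range (charOver k (π : L →+ M) ≫ a.torus i₀).left)) x =
          fiberMultiplicity ι s x) ∧
        ∀ (i : a.I) (p : PrimeSpectrum (AddMonoidAlgebra k (a.S i))),
          nonunitIdeal k (a.S i) ≤ p.asIdeal → fiberMultiplicity ι t ((a.chart i).left p) =
            if Meets (a.S i) π v ∧ p.asIdeal = nonunitIdeal k (a.S i) then
              (((unitGroup (a.S i)).map (π : L →+ M)).index : ℤ) else 0 := by
  let C : TopologicalSpace.Closeds (Z ⊗ projLine k).left :=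
    TopologicalSpace.Closeds.closure (Set.range (a.degTorus i₀ π v).left)
  have hC : ∀ i, (C : Set (Z ⊗ projLine k).left) = closure (Set.range
      (specOver (charMap k (degMonoid (a.S i) π v).subtype) ≫
        degIncl k (a.S i) π v ≫ (a.chart i ⊗ₘ lineChart k)).left) := by
    intro i
    rw [← a.degTorus_eq i₀]
    rfl
  have hred : ∀ i, ∃ u : affineOver k (AddMonoidAlgebra k (degMonoid (a.S i) π v)) ⟶ reducedOver C,
      IsPullback u.left (degIncl k (a.S i) π v).left (reducedIncl C).left
        (a.chart i ⊗ₘ lineChart k).left := fun i =>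
    exists_isPullback_reducedIncl (charMap_injective k Subtype.val_injective) _ _ C (hC i)
  choose u hu using hred
  have hopen : ∀ i, IsOpenImmersion (u i).left := fun i =>
    MorphismProperty.of_isPullback (P := @IsOpenImmersion) (hu i).flip inferInstance
  have hgen : IsGenericPoint ((u i₀).left
      (⊥ : PrimeSpectrum (AddMonoidAlgebra k (degMonoid (a.S i₀) π v)))) Set.univ := by
    have h1 := isGenericPoint_specOver (charMap k (degMonoid (a.S i₀) π v).subtype)
      (degIncl k (a.S i₀) π v ≫ (a.chart i₀ ⊗ₘ lineChart k))
    rw [← hC i₀] at h1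
    have h2 : (reducedIncl C).left ((u i₀).left
        (⊥ : PrimeSpectrum (AddMonoidAlgebra k (degMonoid (a.S i₀) π v)))) =
        (degIncl k (a.S i₀) π v ≫ (a.chart i₀ ⊗ₘ lineChart k)).left
          (⟨RingHom.ker (charMap k (degMonoid (a.S i₀) π v).subtype),
            RingHom.ker_isPrime _⟩ : PrimeSpectrum (AddMonoidAlgebra k (degMonoid (a.S i₀) π v))) := by
      refine (congrArg (fun g => g (⊥ : PrimeSpectrum _)) (hu i₀).w).trans ?_
      refine congrArg (degIncl k (a.S i₀) π v ≫ (a.chart i₀ ⊗ₘ lineChart k)).left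
        (PrimeSpectrum.ext ?_)
      exact ((RingHom.injective_iff_ker_eq_bot _).1
        (charMap_injective k (f := (degMonoid (a.S i₀) π v).subtype) Subtype.val_injective)).symm
    rw [← h2] at h1
    have h3 := isGenericPoint_of_map (reducedIncl C).left h1
    rwa [← range_reducedIncl, Set.preimage_range] at h3
  have hgen' := closure_degMonoid (S := a.S i₀) (v := v) (a.closure_eq i₀) hπ
  have hfin : LocallyOfFiniteType (reducedOver C).hom := by
    have := a.locallyOfFiniteType
    have : LocallyOfFiniteType (Z ⊗ projLine k).hom :=
      inferInstanceAs (LocallyOfFiniteType (pullback.fst Z.hom (projLine k).hom ≫ Z.hom))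
    exact inferInstanceAs (LocallyOfFiniteType ((reducedIncl C).left ≫ (Z ⊗ projLine k).hom))
  have hpow : ∀ i, u i ≫ reducedIncl C ≫ snd Z (projLine k) =
      specOver (charMap k (degPow (a.S i) π v)) ≫ lineChart k := by
    intro i
    have h1 : u i ≫ reducedIncl C = degIncl k (a.S i) π v ≫ (a.chart i ⊗ₘ lineChart k) :=
      Over.OverMorphism.ext (hu i).w
    rw [reassoc_of% h1, tensorHom_snd, degIncl, lift_snd_assoc]
  have hψ : ∀ i, charMap k (degPow (a.S i) π v) (AddMonoidAlgebra.single 1 1) =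
      AddMonoidAlgebra.single (degParam (a.S i) π v) 1 := by
    intro i
    rw [charMap_single]
    congr 1
    simp [degPow]
  refine ⟨reducedOver C, reducedIncl C, ?_, inferInstance, ?_, ?_, range_reducedIncl C,
    linePoint 1 ≫ lineChart k, linePoint 0 ≫ lineChart k,
    fun h => one_ne_zero (linePoint_injective h), ?_, ?_⟩
  · have : IrreducibleSpace (reducedOver C).left :=
      (irreducibleSpace_def _).2 (hgen.isIrreducible)
    exact isIntegral_of_irreducibleSpace_of_isReduced _
  · have h1 : IsDominant (specOver (charMap k (degPow (a.S i₀) π v))).left :=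
      isDominant_specOver (charMap_injective k fun m n h => by
        have := congrArg (fun z : degMonoid (a.S i₀) π v => (z : M × ℤ)) h
        simpa only [degPow_apply, Prod.mk.injEq, true_and, Nat.cast_inj] using this)
    have h2 : IsDominant ((u i₀).left ≫ (reducedIncl C ≫ snd Z (projLine k)).left) := by
      have h3 : (u i₀).left ≫ (reducedIncl C ≫ snd Z (projLine k)).left =
        (specOver (charMap k (degPow (a.S i₀) π v))).left ≫ (lineChart k).left :=
        congrArg Over.Hom.left (hpow i₀)
      rw [h3]
      infer_instance
    exact IsDominant.of_comp (u i₀).left _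
  · refine ⟨Module.finrank ℤ (M × ℤ), ?_, by simp⟩
    rw [topologicalKrullDim_eq_height hgen, height_eq_residueTrdeg, residueTrdeg_chart]
    have h1 : Algebra.trdeg k (AddMonoidAlgebra k (degMonoid (a.S i₀) π v) ⧸
        (⊥ : Ideal (AddMonoidAlgebra k (degMonoid (a.S i₀) π v)))) =
        Module.finrank ℤ (M × ℤ) := by
      rw [← trdeg_addMonoidAlgebra k _ hgen']
      exact (AlgEquiv.quotientBot k (AddMonoidAlgebra k (degMonoid (a.S i₀) π v))).trdeg_eq
    have h2 : (Algebra.trdeg k (AddMonoidAlgebra k (degMonoid (a.S i₀) π v) ⧸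
        (⊥ : PrimeSpectrum (AddMonoidAlgebra k (degMonoid (a.S i₀) π v))).asIdeal)).toNat =
        Module.finrank ℤ (M × ℤ) := by
      exact (congrArg Cardinal.toNat h1).trans (Cardinal.toNat_natCast _)
    rw [h2]
    rfl
  · intro x
    obtain ⟨i, p, rfl, -⟩ := a.cover x
    let δ : AddMonoidAlgebra k (degMonoid (a.S i) π v) →ₐ[k] GeneralRing (a.S i) π v k :=
      Ideal.Quotient.mkₐ k _
    obtain ⟨w, hw⟩ := exists_isPullback_fiberMap (reducedIncl C) (a.chart i) (lineChart k) (u i)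
      (charMap k (degRestrict (a.S i) π v)) (charMap k (degPow (a.S i) π v)) (hu i) 1 δ
      (Ideal.Quotient.mkₐ_surjective k _)
      (by rw [hψ, map_one]; exact Ideal.Quotient.mkₐ_ker k _)
    have h1 := finsum_stalk_length hw p
    have h2 := sum_localLength_general k (π := π) (v := v) p
    refine Eq.trans ?_ ((h1.trans h2).symm)
    have h3 := isGenericPoint_specOver (charMap k ((π : L →+ M).comp (a.S i).subtype)) (a.chart i)
    have h4 : specOver (charMap k ((π : L →+ M).comp (a.S i).subtype)) ≫ a.chart i =
        charOver k (π : L →+ M) ≫ a.torus i₀ := by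
      rw [a.torus_eq i₀ i, torus, ← Category.assoc, charOver_comp]
    rw [h4] at h3
    change (if _ then _ else _) = _
    refine if_congr ?_ rfl rfl
    constructor
    · intro h
      have h5 := (a.chart i).left.isOpenEmbedding.injective (h.eq h3)
      exact congrArg PrimeSpectrum.asIdeal h5
    · intro h
      have h5 : p = ⟨_, RingHom.ker_isPrime _⟩ := PrimeSpectrum.ext h
      rw [h5]
      exact h3
  · intro i p hp
    let δ : AddMonoidAlgebra k (degMonoid (a.S i) π v) →ₐ[k] FibreRing k (degParam (a.S i) π v) :=
      Ideal.Quotient.mkₐ k _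
    obtain ⟨w, hw⟩ := exists_isPullback_fiberMap (reducedIncl C) (a.chart i) (lineChart k) (u i)
      (charMap k (degRestrict (a.S i) π v)) (charMap k (degPow (a.S i) π v)) (hu i) 0 δ
      (Ideal.Quotient.mkₐ_surjective k _)
      (by rw [hψ, map_zero, sub_zero]; exact Ideal.Quotient.mkₐ_ker k _)
    exact (finsum_stalk_length hw p).trans
      (sum_localLength_special k (a.fg i) (a.closure_eq i) hπ (hinj i) p hp)

end DegTorus

end

section

/-! ### The space `(𝔸^m ∖ 0)^r` -/

/-- The extension of a monoid of characters by the negative of one of them is a localization of the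
monoid algebra. -/
lemma isLocalization_charMap (k : Type*) [Field k] {A B : Type*} [AddCommMonoid A] [AddCommMonoid B]
    {φ : A →+ B} (hφ : Function.Injective φ) (s : A) (t : B) (hst : φ s + t = 0)
    (hB : ∀ b, ∃ (n : ℕ) (a : A), b + n • φ s = φ a) :
    @IsLocalization.Away _ _ (AddMonoidAlgebra.single s (1 : k)) (AddMonoidAlgebra k B) _
      (charMap k φ).toRingHom.toAlgebra := by
  let := (charMap k φ).toRingHom.toAlgebra
  have hinj := charMap_injective k hφ
  have hu : charMap k φ (AddMonoidAlgebra.single s 1) * AddMonoidAlgebra.single t 1 = 1 := by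
    rw [charMap_single, AddMonoidAlgebra.single_mul_single, hst, mul_one, AddMonoidAlgebra.one_def]
  have hsurj : ∀ z : AddMonoidAlgebra k B, ∃ (n : ℕ) (y : AddMonoidAlgebra k A),
      z * charMap k φ (AddMonoidAlgebra.single s 1 ^ n) = charMap k φ y := by
    intro z
    induction z using AddMonoidAlgebra.induction_linear with
    | zero => exact ⟨0, 0, by simp⟩
    | add f g hf hg =>
      obtain ⟨n, y, hy⟩ := hf
      obtain ⟨n', y', hy'⟩ := hg
      refine ⟨n + n', y * AddMonoidAlgebra.single s 1 ^ n' +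
        y' * AddMonoidAlgebra.single s 1 ^ n, ?_⟩
      rw [map_add, map_mul, map_mul, ← hy, ← hy', pow_add, map_mul]
      ring
    | single b c =>
      obtain ⟨n, a, hn⟩ := hB b
      refine ⟨n, AddMonoidAlgebra.single a c, ?_⟩
      rw [AddMonoidAlgebra.single_pow, one_pow, charMap_single, charMap_single,
        AddMonoidAlgebra.single_mul_single, mul_one, map_nsmul, hn]
  refine ⟨?_, ?_, ?_⟩
  · rintro ⟨_, n, rfl⟩
    change IsUnit (charMap k φ (_ ^ n))
    rw [map_pow]
    exact (IsUnit.of_mul_eq_one _ hu).pow n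
  · intro z
    obtain ⟨n, y, hy⟩ := hsurj z
    exact ⟨⟨y, ⟨_, n, rfl⟩⟩, hy⟩
  · intro x y hxy
    exact ⟨1, by rw [hinj hxy]⟩

/-- The lattice of the characters of the torus in `𝔸^(r m)`. -/
abbrev Coord (r m : ℕ) : Type u := ULift.{u} (Fin r × Fin m) → ℤ

variable {r m : ℕ}

/-- The monoid of the characters which are regular on the open subset of `𝔸^(r m)` where the
coordinates outside `J` do not vanish. -/
def coordMonoid (J : Set (ULift.{u} (Fin r × Fin m))) : AddSubmonoid (Coord.{u} r m) where
  carrier := {x | ∀ p ∈ J, 0 ≤ x p}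
  zero_mem' := fun _ _ => le_rfl
  add_mem' hx hy p hp := add_nonneg (hx p hp) (hy p hp)

variable (J : Set (ULift.{u} (Fin r × Fin m)))

lemma single_mem_coordMonoid (p : ULift.{u} (Fin r × Fin m)) :
    (Pi.single p 1 : Coord r m) ∈ coordMonoid J := by
  intro q _
  by_cases h : q = p
  · subst h; simp
  · simp [h]

lemma neg_single_mem_coordMonoid {p : ULift.{u} (Fin r × Fin m)} (hp : p ∉ J) :
    -(Pi.single p 1 : Coord r m) ∈ coordMonoid J := by
  intro q hq
  have h : q ≠ p := by rintro rfl; exact hp hq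
  simp [h]

lemma sum_smul_single (x : Coord.{u} r m) : ∑ p, x p • (Pi.single p 1 : Coord r m) = x := by
  ext q
  simp [Finset.sum_apply, Pi.single_apply]

lemma coordMonoid_fg : (coordMonoid J).FG := by
  classical
  rw [AddSubmonoid.fg_iff]
  let s : Set (Coord.{u} r m) := (Set.range fun p => Pi.single p 1) ∪
    (fun p => -(Pi.single p 1 : Coord r m)) '' Jᶜ
  refine ⟨s, le_antisymm ?_ ?_, (Set.finite_range _).union ((Set.toFinite _).image _)⟩
  · rw [AddSubmonoid.closure_le]
    rintro _ (⟨p, rfl⟩ | ⟨p, hp, rfl⟩)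
    · exact single_mem_coordMonoid J p
    · exact neg_single_mem_coordMonoid J hp
  · intro x hx
    rw [← sum_smul_single x]
    refine AddSubmonoid.sum_mem _ fun p _ => ?_
    rcases le_or_gt 0 (x p) with h | h
    · rw [← Int.toNat_of_nonneg h, natCast_zsmul]
      have h0 : (Pi.single p 1 : Coord r m) ∈ s := Or.inl ⟨p, rfl⟩
      exact AddSubmonoid.nsmul_mem _ (AddSubmonoid.subset_closure h0) _
    · have hp : p ∉ J := fun hp => absurd (hx p hp) (not_le.2 h)
      have h1 : x p • (Pi.single p 1 : Coord r m) = (-x p).toNat • -(Pi.single p 1 : Coord r m) := by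
        rw [← natCast_zsmul, Int.toNat_of_nonneg (by omega), neg_smul_neg]
      rw [h1]
      have h0 : -(Pi.single p 1 : Coord r m) ∈ s := Or.inr ⟨p, hp, rfl⟩
      exact AddSubmonoid.nsmul_mem _ (AddSubmonoid.subset_closure h0) _

lemma closure_coordMonoid : AddSubgroup.closure (coordMonoid J : Set (Coord.{u} r m)) = ⊤ := by
  refine eq_top_iff.2 fun x _ => ?_
  rw [← sum_smul_single x]
  exact sum_mem fun p _ => zsmul_mem (AddSubgroup.subset_closure (single_mem_coordMonoid J p)) _

/-- The exponent vectors of monomials are characters. -/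
def coordIncl : (Fin r × Fin m →₀ ℕ) →+ coordMonoid J where
  toFun d := ⟨fun p => d p.down, fun _ _ => Nat.cast_nonneg _⟩
  map_zero' := by ext; simp
  map_add' x y := by ext; simp

lemma coordIncl_injective : Function.Injective (coordIncl J) := by
  intro x y h
  ext p
  have := congrFun (congrArg (fun z : coordMonoid J => (z : Coord r m)) h) ⟨p⟩
  exact Nat.cast_injective this

lemma coordIncl_single (p : Fin r × Fin m) :
    (coordIncl J (Finsupp.single p 1) : Coord r m) = Pi.single ⟨p⟩ 1 := by
  classical
  ext q
  change ((Finsupp.single p 1 q.down : ℕ) : ℤ) = _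
  rw [Finsupp.single_apply, Pi.single_apply]
  by_cases h : p = q.down
  · subst h; simp
  · have h' : q ≠ ⟨p⟩ := fun h' => h (by rw [h'])
    simp [h, h']

variable (k : Type u) [Field k]

/-- The restriction of polynomials to the open subset of `𝔸^(r m)` where the coordinates outside `J`
do not vanish. -/
noncomputable def coordRestrict :
    MvPolynomial (Fin r × Fin m) k →ₐ[k] AddMonoidAlgebra k (coordMonoid J) :=
  charMap k (coordIncl J)

lemma coordRestrict_X (p : Fin r × Fin m) : coordRestrict J k (MvPolynomial.X p) =
    AddMonoidAlgebra.single ⟨_, single_mem_coordMonoid J ⟨p⟩⟩ 1 := by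
  refine (charMap_single k (coordIncl J) (Finsupp.single p 1) 1).trans ?_
  congr 1
  exact Subtype.ext (coordIncl_single J p)

open Classical in
/-- The exponent vector of the product of the coordinates outside `J`. -/
noncomputable def coordProd : Fin r × Fin m →₀ ℕ :=
  Finsupp.equivFunOnFinite.symm fun p => if ULift.up p ∈ J then 0 else 1

lemma isLocalization_coordRestrict : @IsLocalization.Away _ _
    (MvPolynomial.monomial (coordProd J) (1 : k)) (AddMonoidAlgebra k (coordMonoid J)) _
      (coordRestrict J k).toRingHom.toAlgebra := by
  classical
  have hv : ∀ p : ULift.{u} (Fin r × Fin m),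
      (coordIncl J (coordProd J) : Coord.{u} r m) p = if p ∈ J then 0 else 1 := by
    intro p
    change ((coordProd J p.down : ℕ) : ℤ) = _
    simp only [coordProd, Finsupp.equivFunOnFinite_symm_apply_apply]
    split_ifs <;> simp
  refine isLocalization_charMap k (coordIncl_injective J) (coordProd J)
    ⟨-(coordIncl J (coordProd J) : Coord.{u} r m), fun p hp => ?_⟩ ?_ ?_
  · rw [Pi.neg_apply, hv, if_pos hp, neg_zero]
  · exact Subtype.ext (add_neg_cancel _)
  · intro b
    let n : ℕ := ∑ p, (b.1 p).natAbs
    have hn : ∀ p, 0 ≤ (b.1 + n • (coordIncl J (coordProd J) : Coord.{u} r m)) p := by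
      intro p
      rw [Pi.add_apply, Pi.smul_apply, hv]
      by_cases hp : p ∈ J
      · rw [if_pos hp, smul_zero, add_zero]
        exact b.2 p hp
      · rw [if_neg hp]
        have h1 : (b.1 p).natAbs ≤ n :=
          Finset.single_le_sum (f := fun p => (b.1 p).natAbs) (fun _ _ => Nat.zero_le _)
            (Finset.mem_univ p)
        simp only [nsmul_eq_mul, mul_one]
        omega
    refine ⟨n, Finsupp.equivFunOnFinite.symm fun p =>
      ((b.1 + n • (coordIncl J (coordProd J) : Coord.{u} r m)) ⟨p⟩).toNat, Subtype.ext ?_⟩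
    ext p
    exact (Int.toNat_of_nonneg (hn p)).symm

instance : IsOpenImmersion (specOver (coordRestrict J k)).left := by
  let := (coordRestrict J k).toRingHom.toAlgebra
  have := isLocalization_coordRestrict J k
  exact IsOpenImmersion.of_isLocalization (MvPolynomial.monomial (coordProd J) (1 : k))

lemma mem_freeLocus {y : PrimeSpectrum (MvPolynomial (Fin r × Fin m) k)} :
    y ∈ freeLocus k r m ↔ ∀ i, ∃ j, MvPolynomial.X (i, j) ∉ y.asIdeal := by
  let y' : (affineSpace k r m).left := y
  have h1 : y' ∈ (freeLocus k r m : Set (affineSpace k r m).left) ↔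
      ∀ i, ∃ j, MvPolynomial.X (i, j) ∉ y.asIdeal := by
    rw [freeLocus, TopologicalSpace.Opens.coe_iInf, Set.mem_iInter]
    refine forall_congr' fun i => ?_
    exact TopologicalSpace.Opens.mem_iSup
  exact h1

/-- The open subset of `𝔸^(r m)` where the coordinates outside `J` do not vanish. -/
lemma mem_range_coordRestrict {y : PrimeSpectrum (MvPolynomial (Fin r × Fin m) k)} :
    y ∈ Set.range (PrimeSpectrum.comap (coordRestrict J k).toRingHom) ↔
      ∀ p, ULift.up p ∉ J → MvPolynomial.X p ∉ y.asIdeal := by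
  classical
  let := (coordRestrict J k).toRingHom.toAlgebra
  have := isLocalization_coordRestrict J k
  have h1 := PrimeSpectrum.localization_away_comap_range (AddMonoidAlgebra k (coordMonoid J))
    (MvPolynomial.monomial (coordProd J) (1 : k))
  have h2 : y ∈ Set.range (PrimeSpectrum.comap (coordRestrict J k).toRingHom) ↔
      MvPolynomial.monomial (coordProd J) (1 : k) ∉ y.asIdeal := Set.ext_iff.1 h1 y
  rw [h2, MvPolynomial.monomial_eq, MvPolynomial.C_1, one_mul, Finsupp.prod_fintype _ _ (by simp),
    y.2.prod_mem_iff]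
  simp only [Finset.mem_univ, true_and, not_exists]
  refine forall_congr' fun p => ?_
  by_cases hp : ULift.up p ∈ J
  · simp [coordProd, hp, y.2.one_notMem]
  · simp [coordProd, hp]

lemma specOver_coordRestrict_mem_freeLocus (hJ : ∀ i, ∃ j, ULift.up (i, j) ∉ J)
    (q : (affineOver k (AddMonoidAlgebra k (coordMonoid J))).left) :
    (specOver (coordRestrict J k)).left q ∈ freeLocus k r m := by
  refine (mem_freeLocus k).2 fun i => ?_
  obtain ⟨j, hj⟩ := hJ i
  exact ⟨j, (mem_range_coordRestrict J k).1 ⟨q, rfl⟩ _ hj⟩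

instance : IsOpenImmersion (freeIncl k r m).left :=
  inferInstanceAs (IsOpenImmersion (Scheme.Opens.ι (freeLocus k r m)))

instance : Mono (freeIncl k r m) := by
  have : Mono ((Over.forget _).map (freeIncl k r m)) :=
    inferInstanceAs (Mono (freeIncl k r m).left)
  exact (Over.forget _).mono_of_mono_map this

lemma range_freeIncl : Set.range (freeIncl k r m).left = freeLocus k r m :=
  Scheme.Opens.range_ι _

/-- The chart of `(𝔸^m ∖ 0)^r` on which the coordinates outside `J` do not vanish. -/
noncomputable def freeChart (hJ : ∀ i, ∃ j, ULift.up (i, j) ∉ J) :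
    affineOver k (AddMonoidAlgebra k (coordMonoid J)) ⟶ freeSpace k r m :=
  Over.homMk (IsOpenImmersion.lift (freeIncl k r m).left (specOver (coordRestrict J k)).left (by
    rw [range_freeIncl]
    rintro _ ⟨q, rfl⟩
    exact specOver_coordRestrict_mem_freeLocus J k hJ q)) (by
    rw [← Over.w (freeIncl k r m), IsOpenImmersion.lift_fac_assoc, Over.w])

lemma freeChart_freeIncl (hJ : ∀ i, ∃ j, ULift.up (i, j) ∉ J) :
    freeChart J k hJ ≫ freeIncl k r m = specOver (coordRestrict J k) := by
  ext1
  exact IsOpenImmersion.lift_fac _ _ _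

lemma freeChart_eq_iff {hJ : ∀ i, ∃ j, ULift.up (i, j) ∉ J} {A : Type u} [CommRing A] [Algebra k A]
    {f : affineOver k A ⟶ _} {g : affineOver k A ⟶ freeSpace k r m} :
    f ≫ freeChart J k hJ = g ↔ f ≫ specOver (coordRestrict J k) = g ≫ freeIncl k r m := by
  rw [← cancel_mono (freeIncl k r m), Category.assoc, freeChart_freeIncl]

lemma coordRestrict_X_mem_iff {p : PrimeSpectrum (AddMonoidAlgebra k (coordMonoid J))}
    (hp : nonunitIdeal k (coordMonoid J) ≤ p.asIdeal) (x : Fin r × Fin m) :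
    coordRestrict J k (MvPolynomial.X x) ∈ p.asIdeal ↔ ULift.up x ∈ J := by
  constructor
  · intro h
    by_contra hx
    exact (mem_range_coordRestrict J k).1 ⟨p, rfl⟩ x hx h
  · intro h
    refine hp ?_
    rw [coordRestrict_X]
    refine single_mem_nonunitIdeal.2 fun h' => ?_
    have := h' _ h
    simp at this

/-- The toric atlas of `(𝔸^m ∖ 0)^r`. -/
noncomputable def freeAtlas (r m : ℕ) : Atlas k (Coord.{u} r m) (freeSpace k r m) where
  I := {J : Set (ULift.{u} (Fin r × Fin m)) // ∀ i, ∃ j, ULift.up (i, j) ∉ J}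
  S J := coordMonoid J.1
  chart J := freeChart J.1 k J.2
  fg J := coordMonoid_fg J.1
  closure_eq J := closure_coordMonoid J.1
  isOpenImmersion J := by
    have h : IsOpenImmersion ((freeChart J.1 k J.2).left ≫ (freeIncl k r m).left) := by
      have h1 : (freeChart J.1 k J.2).left ≫ (freeIncl k r m).left = _ :=
        congrArg Over.Hom.left (freeChart_freeIncl J.1 k J.2)
      rw [h1]
      infer_instance
    exact IsOpenImmersion.of_comp _ (freeIncl k r m).left
  compat J J' := by
    rw [freeChart_eq_iff, Category.assoc, freeChart_freeIncl, specOver_comp, specOver_comp]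
    congr 1
    refine AlgHom.ext fun x => ?_
    exact (charMap_comp k _ _ _).trans
      (charMap_comp k (coordIncl J'.1) (coordMonoid J'.1).subtype x).symm
  cover x := by
    let y : PrimeSpectrum (MvPolynomial (Fin r × Fin m) k) := (freeIncl k r m).left x
    have hy : ∀ i, ∃ j, MvPolynomial.X (i, j) ∉ y.asIdeal := (mem_freeLocus k).1 x.2
    let J : Set (ULift.{u} (Fin r × Fin m)) := {p | MvPolynomial.X p.down ∈ y.asIdeal}
    obtain ⟨q, hq⟩ := (mem_range_coordRestrict J k (y := y)).2 fun p hp => hp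
    refine ⟨⟨J, hy⟩, q, ?_, nonunitIdeal_le fun s hs => ?_⟩
    · apply (freeIncl k r m).left.isOpenEmbedding.injective
      exact (congrArg (fun g => g.left q) (freeChart_freeIncl J k hy)).trans hq
    · have h1 : ∃ p ∈ J, 0 < s.1 p := by
        by_contra! h
        refine hs fun p hp => ?_
        have := h p hp
        rw [Pi.neg_apply]
        omega
      obtain ⟨p, hp, hsp⟩ := h1
      have h2 : s.1 - Pi.single p 1 ∈ coordMonoid J := by
        intro p' hp'
        by_cases h : p' = p
        · subst h
          simp only [Pi.sub_apply, Pi.single_eq_same]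
          omega
        · simpa [h] using s.2 p' hp'
      have h3 : AddMonoidAlgebra.single s (1 : k) = coordRestrict J k (MvPolynomial.X p.down) *
          AddMonoidAlgebra.single ⟨_, h2⟩ 1 := by
        rw [coordRestrict_X, AddMonoidAlgebra.single_mul_single, mul_one]
        congr 1
        exact Subtype.ext (add_sub_cancel _ _).symm
      rw [h3]
      refine Ideal.mul_mem_right _ _ ?_
      have h4 : MvPolynomial.X p.down ∈ y.asIdeal := hp
      rw [← hq] at h4
      exact h4
  eq_of_chart_eq J J' p q hp hq h := by
    have h1 : (specOver (coordRestrict J.1 k)).left p = (specOver (coordRestrict J'.1 k)).left q :=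
      (congrArg (fun g => g.left p) (freeChart_freeIncl J.1 k J.2)).symm.trans
        ((congrArg (freeIncl k r m).left h).trans
          (congrArg (fun g => g.left q) (freeChart_freeIncl J'.1 k J'.2)))
    refine Subtype.ext (Set.ext fun x => ?_)
    rw [← x.up_down, ← coordRestrict_X_mem_iff J.1 k hp, ← coordRestrict_X_mem_iff J'.1 k hq]
    have h2 := congrArg (fun z : PrimeSpectrum (MvPolynomial (Fin r × Fin m) k) =>
      MvPolynomial.X x.down ∈ z.asIdeal) h1
    exact iff_of_eq h2

end

section

/-! ### The atlas of a closed stratum -/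

lemma algHom_ext_single {k A R : Type*} [Field k] [AddMonoid A] [Semiring R] [Algebra k R]
    {f g : AddMonoidAlgebra k A →ₐ[k] R}
    (h : ∀ a, f (AddMonoidAlgebra.single a 1) = g (AddMonoidAlgebra.single a 1)) : f = g :=
  AddMonoidAlgebra.algHom_ext h (Subsingleton.elim _ _)

section FaceRestrict

variable {N : Type u} [AddCommGroup N] (k : Type u) [Field k]

/-- The monoid of characters on the chart of the closed stratum of `τ` which is given by the cone
`σ`. -/
abbrev starMonoid (τ σ : PointedCone ℝ (RealSpace N)) :
    AddSubmonoid (Module.Dual ℤ (N ⧸ coneLattice τ)) :=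
  dualMonoid (σ.map (realMap (coneLattice τ).mkQ))

variable {τ σ : PointedCone ℝ (RealSpace N)}

lemma vanishes_of_add (h : τ ≤ σ) {m m' : Module.Dual ℤ N} (hm : m ∈ dualMonoid σ)
    (hm' : m' ∈ dualMonoid σ) (h0 : ∀ n ∈ coneLattice τ, (m + m') n = 0) :
    ∀ n ∈ coneLattice τ, m n = 0 := by
  intro n hn
  induction hn using Submodule.span_induction with
  | mem x hx =>
    have h1 := hm _ (h hx)
    have h2 := hm' _ (h hx)
    rw [pairing_toReal] at h1 h2
    have h3 := h0 x (Submodule.subset_span hx)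
    rw [LinearMap.add_apply] at h3
    have h1' : 0 ≤ m x := by exact_mod_cast h1
    have h2' : 0 ≤ m' x := by exact_mod_cast h2
    omega
  | zero => exact map_zero m
  | add x y _ _ hx hy => rw [map_add, hx, hy, add_zero]
  | smul c x _ hx => rw [map_smul, hx, smul_zero]

lemma exists_starMonoid {m : dualMonoid σ} (h : ∀ n ∈ coneLattice τ, m.1 n = 0) :
    ∃ m' : starMonoid τ σ, m'.1 ∘ₗ (coneLattice τ).mkQ = m.1 := by
  obtain ⟨m', hm'⟩ := exists_comp_mkQ m.1 h
  exact ⟨⟨m', mem_dualMonoid_map.2 (hm' ▸ m.2)⟩, hm'⟩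

open Classical in
variable (τ) in
/-- The restriction of a character to the closed stratum of `τ`: it is zero unless the character is
trivial on `τ`. -/
noncomputable def faceRestrictChar (m : dualMonoid σ) : AddMonoidAlgebra k (starMonoid τ σ) :=
  if h : ∀ n ∈ coneLattice τ, m.1 n = 0 then
    AddMonoidAlgebra.single (exists_starMonoid h).choose 1
  else 0

lemma faceRestrictChar_of {m : dualMonoid σ} {m' : starMonoid τ σ}
    (h : m'.1 ∘ₗ (coneLattice τ).mkQ = m.1) :
    faceRestrictChar k τ m = AddMonoidAlgebra.single m' 1 := by
  have h0 : ∀ n ∈ coneLattice τ, m.1 n = 0 := by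
    intro n hn
    rw [← h, LinearMap.comp_apply, Submodule.mkQ_apply, (Submodule.Quotient.mk_eq_zero _).2 hn,
      map_zero]
  rw [faceRestrictChar, dif_pos h0]
  congr 1
  refine Subtype.ext ?_
  rw [← LinearMap.cancel_right (Submodule.mkQ_surjective (coneLattice τ)), h,
    (exists_starMonoid h0).choose_spec]

lemma faceRestrictChar_of_not {m : dualMonoid σ} (h : ¬ ∀ n ∈ coneLattice τ, m.1 n = 0) :
    faceRestrictChar k τ m = 0 := dif_neg h

variable (τ σ) in
/-- The characters on a closed stratum are those characters on the ambient affine toric variety which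
are trivial on `τ`. -/
def starIncl : starMonoid τ σ →+ dualMonoid σ where
  toFun m := ⟨m.1 ∘ₗ (coneLattice τ).mkQ, mem_dualMonoid_map.1 m.2⟩
  map_zero' := rfl
  map_add' _ _ := rfl

/-- The restriction of functions from the affine toric variety `U_σ` to the closed stratum of `τ`. -/
noncomputable def faceRestrict (h : τ ≤ σ) :
    ConeRing k σ →ₐ[k] AddMonoidAlgebra k (starMonoid τ σ) :=
  AddMonoidAlgebra.lift k _ _
    { toFun := fun m => faceRestrictChar k τ m.toAdd
      map_one' := faceRestrictChar_of k (m' := 0) rfl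
      map_mul' := fun a b => by
        by_cases ha : ∀ n ∈ coneLattice τ, a.toAdd.1 n = 0
        · by_cases hb : ∀ n ∈ coneLattice τ, b.toAdd.1 n = 0
          · obtain ⟨a', ha'⟩ := exists_starMonoid ha
            obtain ⟨b', hb'⟩ := exists_starMonoid hb
            rw [faceRestrictChar_of k ha', faceRestrictChar_of k hb',
              AddMonoidAlgebra.single_mul_single, mul_one]
            refine faceRestrictChar_of k ?_
            rw [toAdd_mul, AddMemClass.coe_add, AddMemClass.coe_add, LinearMap.add_comp, ha', hb']
          · rw [faceRestrictChar_of_not k hb, mul_zero]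
            refine faceRestrictChar_of_not k fun h0 => hb (vanishes_of_add h b.toAdd.2 a.toAdd.2 ?_)
            rw [add_comm]
            exact h0
        · rw [faceRestrictChar_of_not k ha, zero_mul]
          exact faceRestrictChar_of_not k fun h0 => ha (vanishes_of_add h a.toAdd.2 b.toAdd.2 h0) }

lemma faceRestrict_single (h : τ ≤ σ) (m : dualMonoid σ) :
    faceRestrict k h (AddMonoidAlgebra.single m 1) = faceRestrictChar k τ m := by
  simp [faceRestrict, AddMonoidAlgebra.lift_single]

lemma faceRestrict_starIncl (h : τ ≤ σ) (x : AddMonoidAlgebra k (starMonoid τ σ)) :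
    faceRestrict k h (charMap k (starIncl τ σ) x) = x := by
  have h1 : (faceRestrict k h).comp (charMap k (starIncl τ σ)) = AlgHom.id k _ := by
    refine algHom_ext_single fun m => ?_
    rw [AlgHom.comp_apply, charMap_single, faceRestrict_single]
    exact faceRestrictChar_of k rfl
  exact DFunLike.congr_fun h1 x

lemma faceRestrict_surjective (h : τ ≤ σ) : Function.Surjective (faceRestrict k h) :=
  fun x => ⟨_, faceRestrict_starIncl k h x⟩

lemma ker_faceRestrict (h : τ ≤ σ) : RingHom.ker (faceRestrict k h) =
    Ideal.span {z | ∃ m : dualMonoid σ, (¬ ∀ n ∈ coneLattice τ, m.1 n = 0) ∧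
      z = AddMonoidAlgebra.single m 1} := by
  set I := Ideal.span {z : ConeRing k σ | ∃ m : dualMonoid σ,
    (¬ ∀ n ∈ coneLattice τ, m.1 n = 0) ∧ z = AddMonoidAlgebra.single m 1}
  apply le_antisymm
  · have key : ∀ x, x - charMap k (starIncl τ σ) (faceRestrict k h x) ∈ I := by
      intro x
      induction x using AddMonoidAlgebra.induction_linear with
      | zero => simp
      | add f g hf hg =>
        rw [map_add, map_add, add_sub_add_comm]
        exact add_mem hf hg
      | single m c =>
        have h1 : (AddMonoidAlgebra.single m c : ConeRing k σ) = c • AddMonoidAlgebra.single m 1 := by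
          simp
        rw [h1, map_smul, map_smul, ← smul_sub]
        refine Submodule.smul_of_tower_mem I c ?_
        rw [faceRestrict_single]
        by_cases hm : ∀ n ∈ coneLattice τ, m.1 n = 0
        · obtain ⟨m', hm'⟩ := exists_starMonoid hm
          rw [faceRestrictChar_of k hm', charMap_single]
          have h2 : starIncl τ σ m' = m := Subtype.ext hm'
          rw [h2, sub_self]
          exact zero_mem _
        · rw [faceRestrictChar_of_not k hm, map_zero, sub_zero]
          exact Ideal.subset_span ⟨m, hm, rfl⟩
    intro x hx
    have := key x
    rwa [(RingHom.mem_ker).1 hx, map_zero, sub_zero] at this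
  · rw [Ideal.span_le]
    rintro _ ⟨m, hm, rfl⟩
    rw [SetLike.mem_coe, RingHom.mem_ker, faceRestrict_single, faceRestrictChar_of_not k hm]

lemma faceRestrict_coneRingMap (h : τ ≤ σ) {σ' : PointedCone ℝ (RealSpace N)} (h' : σ ≤ σ')
    (x : ConeRing k σ') :
    charMap k (starMonoid τ σ).subtype (faceRestrict k h (coneRingMap k h' x)) =
      charMap k (starMonoid τ σ').subtype (faceRestrict k (h.trans h') x) := by
  have h1 : ((charMap k (starMonoid τ σ).subtype).comp (faceRestrict k h)).comp (coneRingMap k h') =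
      (charMap k (starMonoid τ σ').subtype).comp (faceRestrict k (h.trans h')) := by
    refine algHom_ext_single fun m => ?_
    rw [AlgHom.comp_apply, AlgHom.comp_apply, AlgHom.comp_apply, coneRingMap_single,
      faceRestrict_single, faceRestrict_single]
    by_cases hm : ∀ n ∈ coneLattice τ, m.1 n = 0
    · obtain ⟨m', hm'⟩ := exists_starMonoid hm
      rw [faceRestrictChar_of k hm', charMap_single]
      obtain ⟨m'', hm''⟩ := exists_starMonoid (τ := τ)
        (m := AddSubmonoid.inclusion (dualMonoid_anti h') m) hm
      rw [faceRestrictChar_of k hm'', charMap_single]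
      congr 1
      change m''.1 = m'.1
      rw [← LinearMap.cancel_right (Submodule.mkQ_surjective (coneLattice τ)), hm', hm'']
      rfl
    · rw [faceRestrictChar_of_not k hm, faceRestrictChar_of_not k (by exact hm), map_zero, map_zero]
  exact DFunLike.congr_fun h1 x

lemma nonunitIdeal_le_comap_faceRestrict (h : τ ≤ σ)
    {p : Ideal (AddMonoidAlgebra k (starMonoid τ σ))} (hp : nonunitIdeal k (starMonoid τ σ) ≤ p) :
    nonunitIdeal k (dualMonoid σ) ≤ p.comap (faceRestrict k h) := by
  refine nonunitIdeal_le fun m hm => ?_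
  rw [Ideal.mem_comap, faceRestrict_single]
  by_cases h0 : ∀ n ∈ coneLattice τ, m.1 n = 0
  · obtain ⟨m', hm'⟩ := exists_starMonoid h0
    rw [faceRestrictChar_of k hm']
    refine hp (single_mem_nonunitIdeal.2 fun h1 => hm ?_)
    have h2 := mem_dualMonoid_map.1 h1
    rwa [LinearMap.neg_comp, hm'] at h2
  · rw [faceRestrictChar_of_not k h0]
    exact zero_mem _

lemma coeff_faceRestrict (h : τ ≤ σ) (x : ConeRing k σ) (m : starMonoid τ σ) :
    (faceRestrict k h x).coeff m = x.coeff (starIncl τ σ m) := by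
  classical
  induction x using AddMonoidAlgebra.induction_linear with
  | zero => simp
  | add f g hf hg => rw [map_add, AddMonoidAlgebra.coeff_add, AddMonoidAlgebra.coeff_add,
      Finsupp.add_apply, Finsupp.add_apply, hf, hg]
  | single a c =>
    have h1 : (AddMonoidAlgebra.single a c : ConeRing k σ) = c • AddMonoidAlgebra.single a 1 := by
      simp
    rw [h1, map_smul, faceRestrict_single, AddMonoidAlgebra.coeff_smul, AddMonoidAlgebra.coeff_smul,
      Finsupp.smul_apply, Finsupp.smul_apply, AddMonoidAlgebra.coeff_single]
    congr 1
    by_cases ha : ∀ n ∈ coneLattice τ, a.1 n = 0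
    · obtain ⟨a', ha'⟩ := exists_starMonoid ha
      have h2 : starIncl τ σ a' = a := Subtype.ext ha'
      rw [faceRestrictChar_of k ha', AddMonoidAlgebra.coeff_single, Finsupp.single_apply,
        Finsupp.single_apply]
      refine if_congr ⟨fun h => by rw [← h2, h], fun h => Subtype.ext ?_⟩ rfl rfl
      rw [← LinearMap.cancel_right (Submodule.mkQ_surjective (coneLattice τ)), ha', h]
      rfl
    · rw [faceRestrictChar_of_not k ha, AddMonoidAlgebra.coeff_zero, Finsupp.zero_apply,
        Finsupp.single_apply, if_neg]
      rintro rfl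
      refine ha fun n hn => ?_
      change m.1 ((coneLattice τ).mkQ n) = 0
      rw [Submodule.mkQ_apply, (Submodule.Quotient.mk_eq_zero _).2 hn, map_zero]

/-- The closed orbit of a chart of a closed stratum is the closed orbit of the ambient chart. -/
lemma comap_faceRestrict_nonunitIdeal (h : τ ≤ σ) :
    (nonunitIdeal k (starMonoid τ σ)).comap (faceRestrict k h) = nonunitIdeal k (dualMonoid σ) := by
  refine le_antisymm (fun x hx => ?_) (nonunitIdeal_le_comap_faceRestrict k h le_rfl)
  rw [mem_nonunitIdeal]
  intro m hm
  have h0 : ∀ n ∈ coneLattice τ, m.1 n = 0 := by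
    intro n hn
    induction hn using Submodule.span_induction with
    | mem x hx =>
      have h1 := pairing_eq_zero m.2 hm (h hx)
      rw [pairing_toReal] at h1
      exact_mod_cast h1
    | zero => exact map_zero _
    | add x y _ _ hx hy => rw [map_add, hx, hy, add_zero]
    | smul c x _ hx => rw [map_smul, hx, smul_zero]
  obtain ⟨m', hm'⟩ := exists_starMonoid h0
  have h2 : starIncl τ σ m' = m := Subtype.ext hm'
  rw [← h2, ← coeff_faceRestrict k h]
  refine mem_nonunitIdeal.1 hx m' (mem_dualMonoid_map.2 ?_)
  rw [LinearMap.neg_comp, hm']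
  exact hm

lemma nonunitIdeal_dualMonoid (hσ : IsRational σ) :
    nonunitIdeal k (dualMonoid σ) = RingHom.ker (faceRestrict k (le_refl σ)) := by
  have h0 : nonunitIdeal k (starMonoid σ σ) = ⊥ := by
    rw [eq_bot_iff]
    refine nonunitIdeal_le fun m hm => absurd ?_ hm
    rw [mem_dualMonoid_map, LinearMap.neg_comp]
    refine neg_mem_dualMonoid fun x hx => ?_
    rw [pairing_comp, realMap_mkQ_eq_zero hσ hx, map_zero]
  rw [← comap_faceRestrict_nonunitIdeal k (le_refl σ), h0]
  exact Ideal.ext fun x => by rw [Ideal.mem_comap, Ideal.mem_bot, RingHom.mem_ker]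

end FaceRestrict

section StratumAtlas

variable {N : Type u} [AddCommGroup N] (k : Type u) [Field k] (F : Fan N)

variable {k F} in
lemma not_vanishes_iff {τ : F.cones} {m : Module.Dual ℤ N} :
    (∃ x ∈ τ.1, pairing m x ≠ 0) ↔ ¬ ∀ n ∈ coneLattice τ.1, m n = 0 := by
  constructor
  · rintro ⟨x, hx, h⟩ h0
    exact h (pairing_eq_zero_of_coneLattice (F.rational _ τ.2) h0 hx)
  · intro h
    by_contra! h0
    refine h fun n hn => ?_
    induction hn using Submodule.span_induction with
    | mem x hx =>
      have := h0 _ hx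
      rw [pairing_toReal] at this
      exact_mod_cast this
    | zero => exact map_zero m
    | add x y _ _ hx hy => rw [map_add, hx, hy, add_zero]
    | smul c x _ hx => rw [map_smul, hx, smul_zero]

/-- For a proper face of a cone of the fan there is a character which does not vanish on the
corresponding open subset, but which is not invertible. -/
lemma Fan.exists_char_of_le {σ ρ : F.cones} (h : ρ.1 ≤ σ.1) (hne : ρ ≠ σ) :
    ∃ m : dualMonoid σ.1, -m.1 ∉ dualMonoid σ.1 ∧ ∀ z : affineToric k ρ.1,
      (AddMonoidAlgebra.single m 1 : ConeRing k σ.1) ∉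
        (show PrimeSpectrum (ConeRing k σ.1) from faceMap k h z).asIdeal := by
  have h' : ρ ≤ σ := h
  obtain ⟨m, hm, hρ⟩ := F.chart_face h'
  refine ⟨⟨m, hm⟩, fun hm' => hne (le_antisymm h' ?_), fun z => ?_⟩
  · intro x hx
    exact (hρ x).2 ⟨hx, pairing_eq_zero hm hm' hx⟩
  · exact (F.mem_range_chart k (homOfLE h') hm hρ _).1 ⟨z, rfl⟩

lemma Fan.exists_orbit (y : (F.variety k).left) : ∃ (σ : F.cones)
    (q : PrimeSpectrum (ConeRing k σ.1)), F.ι k σ q = y ∧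
      nonunitIdeal k (dualMonoid σ.1) ≤ q.asIdeal := by
  have : Finite F.cones := F.finite
  obtain ⟨σ₀, q₀, h₀⟩ : ∃ (σ : F.cones) (q : affineToric k σ.1), F.ι k σ q = y :=
    ⟨(F.cover k).idx y, (F.cover k).covers y⟩
  obtain ⟨σ, ⟨q, hq⟩, hmin⟩ := (Set.toFinite {σ : F.cones | y ∈ Set.range (F.ι k σ)}).exists_minimal
    ⟨σ₀, q₀, h₀⟩
  refine ⟨σ, q, hq, nonunitIdeal_le fun m hm => ?_⟩
  by_contra hmq
  let ρ : PointedCone ℝ (RealSpace N) := σ.1 ⊓ (LinearMap.ker (pairing m.1)).restrictScalars _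
  have hρ : ∀ x, x ∈ ρ ↔ x ∈ σ.1 ∧ pairing m.1 x = 0 := fun x => Iff.rfl
  let ρ' : F.cones := ⟨ρ, F.face_mem _ σ.2 _ ⟨m.1, m.2, hρ⟩⟩
  have hle : ρ' ≤ σ := show ρ ≤ σ.1 from inf_le_left
  obtain ⟨z, hz⟩ := (F.mem_range_chart k (homOfLE hle) m.2 hρ q).2 hmq
  have h1 : σ ≤ ρ' := hmin ⟨z, (congrArg (fun g => g z) (F.faceMap_ι k hle)).symm.trans
    ((congrArg (F.ι k σ) hz).trans hq)⟩ hle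
  exact hm (neg_mem_dualMonoid fun x hx => ((hρ x).1 (h1 hx)).2)

variable {F}

lemma Fan.eq_of_ι_eq {σ σ' : F.cones} {q : PrimeSpectrum (ConeRing k σ.1)}
    {q' : PrimeSpectrum (ConeRing k σ'.1)} (hq : nonunitIdeal k (dualMonoid σ.1) ≤ q.asIdeal)
    (hq' : nonunitIdeal k (dualMonoid σ'.1) ≤ q'.asIdeal)
    (h : F.ι k σ q = F.ι k σ' q') : σ = σ' := by
  obtain ⟨l, fi, fj, y, hi, hj⟩ := (Scheme.IsLocallyDirected.ι_eq_ι_iff (F.chart k)).1 h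
  have h1 : l = σ := by
    by_contra hne
    obtain ⟨m, hm, hm'⟩ := F.exists_char_of_le k (leOfHom fi) hne
    refine hm' y ?_
    have : (faceMap k (leOfHom fi) y : affineToric k σ.1) = q := hi
    rw [this]
    exact hq (single_mem_nonunitIdeal.2 hm)
  have h2 : l = σ' := by
    by_contra hne
    obtain ⟨m, hm, hm'⟩ := F.exists_char_of_le k (leOfHom fj) hne
    refine hm' y ?_
    have : (faceMap k (leOfHom fj) y : affineToric k σ'.1) = q' := hj
    rw [this]
    exact hq' (single_mem_nonunitIdeal.2 hm)
  exact h1.symm.trans h2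

lemma Fan.le_of_mem_stratum {τ σ : F.cones} {q : affineToric k σ.1}
    (h : F.ι k σ q ∈ F.stratum k τ) : τ ≤ σ := by
  have h1 : F.ι k σ q ∈ closure (F.ι k τ '' PrimeSpectrum.zeroLocus
    {z : ConeRing k τ.1 | ∃ m : dualMonoid τ.1, (∃ x ∈ τ.1, pairing m.1 x ≠ 0) ∧
      z = AddMonoidAlgebra.single m 1}) := h
  obtain ⟨_, ⟨w, rfl⟩, z, hz, hzw⟩ := mem_closure_iff.1 h1 _ (F.ι k σ).isOpenEmbedding.isOpen_range
    ⟨q, rfl⟩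
  obtain ⟨l, fi, fj, y, hi, hj⟩ := (Scheme.IsLocallyDirected.ι_eq_ι_iff (F.chart k)).1 hzw
  have h2 : l = τ := by
    by_contra hne
    obtain ⟨m, hm, hm'⟩ := F.exists_char_of_le k (leOfHom fi) hne
    refine hm' y ?_
    have : (faceMap k (leOfHom fi) y : affineToric k τ.1) = z := hi
    rw [this]
    refine hz ⟨m, ?_, rfl⟩
    by_contra! h0
    exact hm (neg_mem_dualMonoid h0)
  exact h2 ▸ leOfHom fj

lemma closure_range_comp {X Y Z : Scheme.{u}} (f : X ⟶ Y) [IsDominant f] (g : Y ⟶ Z) :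
    closure (Set.range (f ≫ g)) = closure (Set.range g) := by
  have h : Set.range (f ≫ g) = g '' Set.range f := by
    rw [Scheme.Hom.comp_base, TopCat.coe_comp, Set.range_comp]
  rw [h]
  exact subset_antisymm (closure_mono (Set.image_subset_range _ _))
    (closure_minimal (g.continuous.range_subset_closure_image_dense f.denseRange) isClosed_closure)

variable (F)

/-- The torus of a closed stratum as a locally closed subscheme of the toric variety, in the chart of
a cone `σ ⊇ τ`. -/
lemma Fan.stratumTorus_eq {τ σ : F.cones} (h : τ.1 ≤ σ.1) :
    charOver k (starMonoid τ.1 σ.1).subtype ≫ specOver (faceRestrict k h) ≫ F.ιOver k σ =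
      charOver k (starMonoid τ.1 τ.1).subtype ≫ specOver (faceRestrict k le_rfl) ≫ F.ιOver k τ := by
  have h1 : specOver (coneRingMap k h) = faceOver k h := rfl
  rw [← F.faceOver_ιOver k h, ← h1, ← Category.assoc, ← Category.assoc, ← Category.assoc,
    specOver_comp, specOver_comp, specOver_comp]
  congr 2
  exact AlgHom.ext fun x => (faceRestrict_coneRingMap k le_rfl h x).symm

lemma Fan.stratum_eq_closure {τ σ : F.cones} (h : τ.1 ≤ σ.1) :
    (F.stratum k τ : Set (F.variety k).left) = closure (Set.range
      (charOver k (starMonoid τ.1 σ.1).subtype ≫ specOver (faceRestrict k h) ≫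
        F.ιOver k σ).left) := by
  have hdom : IsDominant (charOver k (starMonoid τ.1 τ.1).subtype).left :=
    isDominant_specOver (charMap_injective k Subtype.val_injective)
  rw [F.stratumTorus_eq k h, Over.comp_left, closure_range_comp, Over.comp_left]
  have h1 : Set.range (specOver (faceRestrict k (le_refl τ.1))).left = PrimeSpectrum.zeroLocus
      {z : ConeRing k τ.1 | ∃ m : dualMonoid τ.1, (∃ x ∈ τ.1, pairing m.1 x ≠ 0) ∧
        z = AddMonoidAlgebra.single m 1} := by
    refine (range_comap_of_surjective _ _ (faceRestrict_surjective k le_rfl)).trans ?_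
    have h2 := ker_faceRestrict k (le_refl τ.1)
    have h3 : RingHom.ker (faceRestrict k (le_refl τ.1)).toRingHom = _ := h2
    rw [h3, PrimeSpectrum.zeroLocus_span]
    simp only [not_vanishes_iff]
  have h2 : Set.range ((specOver (faceRestrict k (le_refl τ.1))).left ≫ (F.ιOver k τ).left) =
      (F.ι k τ) '' Set.range (specOver (faceRestrict k (le_refl τ.1))).left := by
    rw [Scheme.Hom.comp_base, TopCat.coe_comp, Set.range_comp]
    rfl
  rw [h2, h1]
  rfl

instance (σ : F.cones) : IsOpenImmersion (F.ιOver k σ).left :=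
  inferInstanceAs (IsOpenImmersion (F.ι k σ))

variable [Module.Free ℤ N] [Module.Finite ℤ N]

lemma Fan.exists_stratumChart {τ σ : F.cones} (h : τ.1 ≤ σ.1) :
    ∃ u : affineOver k (AddMonoidAlgebra k (starMonoid τ.1 σ.1)) ⟶ F.closedStratum k τ,
      IsPullback u.left (specOver (faceRestrict k h)).left (F.strIncl k τ).left
        (F.ιOver k σ).left := by
  have := free_quotient_coneLattice (F.rational _ τ.2)
  have : IsClosedImmersion (specOver (faceRestrict k h)).left :=
    IsClosedImmersion.spec_of_surjective _ (faceRestrict_surjective k h)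
  exact exists_isPullback_reducedIncl (charMap_injective k Subtype.val_injective) _ _
    (F.stratum k τ) (F.stratum_eq_closure k h)

/-- The chart of the closed stratum of `τ` which is given by a cone `σ ⊇ τ`. -/
noncomputable def Fan.stratumChart {τ σ : F.cones} (h : τ.1 ≤ σ.1) :
    affineOver k (AddMonoidAlgebra k (starMonoid τ.1 σ.1)) ⟶ F.closedStratum k τ :=
  (F.exists_stratumChart k h).choose

lemma Fan.isPullback_stratumChart {τ σ : F.cones} (h : τ.1 ≤ σ.1) :
    IsPullback (F.stratumChart k h).left (specOver (faceRestrict k h)).left (F.strIncl k τ).left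
      (F.ιOver k σ).left :=
  (F.exists_stratumChart k h).choose_spec

lemma Fan.stratumChart_strIncl {τ σ : F.cones} (h : τ.1 ≤ σ.1) :
    F.stratumChart k h ≫ F.strIncl k τ = specOver (faceRestrict k h) ≫ F.ιOver k σ :=
  Over.OverMorphism.ext (F.isPullback_stratumChart k h).w

instance (τ : F.cones) : Mono (F.strIncl k τ) := by
  have : Mono ((Over.forget _).map (F.strIncl k τ)) :=
    inferInstanceAs (Mono (F.strIncl k τ).left)
  exact (Over.forget _).mono_of_mono_map this

/-- The toric atlas of a closed stratum. -/
noncomputable def Fan.stratumAtlas (τ : F.cones) :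
    Atlas k (Module.Dual ℤ (N ⧸ coneLattice τ.1)) (F.closedStratum k τ) where
  I := {σ : F.cones // τ.1 ≤ σ.1}
  S σ := starMonoid τ.1 σ.1.1
  chart σ := F.stratumChart k σ.2
  fg σ := by
    have := free_quotient_coneLattice (F.rational _ τ.2)
    exact dualMonoid_fg (IsRational.map (F.rational _ σ.1.2) _)
  closure_eq σ := by
    have := free_quotient_coneLattice (F.rational _ τ.2)
    exact closure_dualMonoid (IsRational.map (F.rational _ σ.1.2) _)
      (stronglyConvex_map (F.rational _ τ.2) (F.chart_face (show τ ≤ σ.1 from σ.2)))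
  isOpenImmersion σ :=
    MorphismProperty.of_isPullback (P := @IsOpenImmersion) (F.isPullback_stratumChart k σ.2).flip
      inferInstance
  compat σ σ' := by
    rw [← cancel_mono (F.strIncl k τ), Category.assoc, Category.assoc, F.stratumChart_strIncl k σ.2,
      F.stratumChart_strIncl k σ'.2, F.stratumTorus_eq k σ.2, F.stratumTorus_eq k σ'.2]
  cover x := by
    obtain ⟨σ, q, hq, hq'⟩ := F.exists_orbit k ((F.strIncl k τ).left x)
    have h : τ.1 ≤ σ.1 := Fan.le_of_mem_stratum k (τ := τ) (σ := σ) (q := q) (by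
      rw [hq, ← SetLike.mem_coe, ← range_reducedIncl (F.stratum k τ)]
      exact ⟨x, rfl⟩)
    obtain ⟨z, hz, -⟩ := Scheme.Pullback.exists_preimage_pullback (f := (F.strIncl k τ).left)
      (g := (F.ιOver k σ).left) x q hq.symm
    have hP := F.isPullback_stratumChart k h
    let p : PrimeSpectrum (AddMonoidAlgebra k (starMonoid τ.1 σ.1)) := hP.isoPullback.inv z
    have hp : (F.stratumChart k h).left p = x :=
      (congrArg (fun g => g z) hP.isoPullback_inv_fst).trans hz
    have hpq : (specOver (faceRestrict k h)).left p = q := by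
      apply (F.ι k σ).isOpenEmbedding.injective
      rw [hq, ← hp]
      exact (congrArg (fun g => g p) hP.w).symm
    refine ⟨⟨σ, h⟩, p, hp, nonunitIdeal_le fun m hm => ?_⟩
    have h1 : (AddMonoidAlgebra.single (starIncl τ.1 σ.1 m) 1 : ConeRing k σ.1) ∈ q.asIdeal := by
      refine hq' (single_mem_nonunitIdeal.2 fun h' => hm ?_)
      refine mem_dualMonoid_map.2 ?_
      rw [LinearMap.neg_comp]
      exact h'
    rw [← hpq] at h1
    have h2 : faceRestrict k h (AddMonoidAlgebra.single (starIncl τ.1 σ.1 m) 1) ∈ p.asIdeal := h1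
    rwa [faceRestrict_single, faceRestrictChar_of k (m' := m) rfl] at h2
  eq_of_chart_eq σ σ' p p' hp hp' h := by
    let q : PrimeSpectrum (ConeRing k σ.1.1) :=
      ⟨p.asIdeal.comap (faceRestrict k σ.2), inferInstance⟩
    let q' : PrimeSpectrum (ConeRing k σ'.1.1) :=
      ⟨p'.asIdeal.comap (faceRestrict k σ'.2), inferInstance⟩
    refine Subtype.ext (Fan.eq_of_ι_eq k (q := q) (q' := q')
      (nonunitIdeal_le_comap_faceRestrict k _ hp) (nonunitIdeal_le_comap_faceRestrict k _ hp') ?_)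
    exact (congrArg (fun g => g.left p) (F.stratumChart_strIncl k σ.2)).symm.trans
      ((congrArg (F.strIncl k τ).left h).trans
        (congrArg (fun g => g.left p') (F.stratumChart_strIncl k σ'.2)))

/-- The generic point of a stratum in a larger closed stratum is the generic point of the closed orbit
in the corresponding chart. -/
lemma Fan.isGenericPoint_substratum {τ δ : F.cones} (h : τ.1 ≤ δ.1)
    (p : PrimeSpectrum (AddMonoidAlgebra k (starMonoid τ.1 δ.1)))
    (hp : p.asIdeal = nonunitIdeal k (starMonoid τ.1 δ.1)) :
    IsGenericPoint ((F.stratumChart k h).left p) (F.substratum k τ δ) := by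
  have := free_quotient_coneLattice (F.rational _ δ.2)
  refine isGenericPoint_of_map (F.strIncl k τ).left ?_
  have h1 := isGenericPoint_specOver ((charMap k (starMonoid δ.1 δ.1).subtype).comp
    (faceRestrict k le_rfl)) (F.ιOver k δ)
  have h2 : specOver ((charMap k (starMonoid δ.1 δ.1).subtype).comp (faceRestrict k le_rfl)) ≫
      F.ιOver k δ = charOver k (starMonoid δ.1 δ.1).subtype ≫ specOver (faceRestrict k le_rfl) ≫
        F.ιOver k δ := by
    rw [← specOver_comp, Category.assoc]
  rw [h2, ← F.stratum_eq_closure k (le_refl δ.1)] at h1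
  have h3 : (F.strIncl k τ).left ((F.stratumChart k h).left p) = (F.ιOver k δ).left
      (⟨RingHom.ker ((charMap k (starMonoid δ.1 δ.1).subtype).comp (faceRestrict k le_rfl)),
        RingHom.ker_isPrime _⟩ : PrimeSpectrum (ConeRing k δ.1)) := by
    refine (congrArg (fun g => g.left p) (F.stratumChart_strIncl k h)).trans ?_
    refine congrArg (F.ιOver k δ).left (PrimeSpectrum.ext ?_)
    change p.asIdeal.comap (faceRestrict k h) = _
    rw [hp, comap_faceRestrict_nonunitIdeal k h,
      nonunitIdeal_dualMonoid k (F.rational _ δ.2)]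
    ext x
    rw [RingHom.mem_ker, RingHom.mem_ker, AlgHom.comp_apply,
      map_eq_zero_iff _ (charMap_injective k Subtype.val_injective)]
  rw [h3]
  exact h1

end StratumAtlas

end

section

/-! ### Torus actions -/

section Coaction

variable (k : Type u) [Field k]

variable {k} in
lemma lift_ofCoaction {A B C : Type u} [CommRing A] [Algebra k A] [CommRing B] [Algebra k B]
    [CommRing C] [Algebra k C] (f : A →ₐ[k] C) (g : B →ₐ[k] C) (c : B →ₐ[k] A ⊗[k] B) :
    lift (specOver f) (specOver g) ≫ ofCoaction k c =
      specOver ((Algebra.TensorProduct.productMap f g).comp c) := by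
  ext1
  rw [Over.comp_left, lift_specOver_left]
  change (_ ≫ _) ≫ (pullbackSpecIso k A B).hom ≫ Spec.map _ = Spec.map _
  rw [Category.assoc, Iso.inv_hom_id_assoc, ← Spec.map_comp]
  rfl

variable {A B C D : Type u} [AddCommMonoid A] [AddCommMonoid B] [AddCommMonoid C] [AddCommMonoid D]

/-- The coaction `χ^m ↦ χ^(φ m) ⊗ χ^m`. -/
noncomputable def charCoaction (φ : A →+ D) :
    AddMonoidAlgebra k A →ₐ[k] AddMonoidAlgebra k D ⊗[k] AddMonoidAlgebra k A :=
  AddMonoidAlgebra.lift k _ _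
    { toFun := fun m => AddMonoidAlgebra.single (φ m.toAdd) 1 ⊗ₜ AddMonoidAlgebra.single m.toAdd 1
      map_one' := by
        rw [toAdd_one, map_zero, ← AddMonoidAlgebra.one_def, ← AddMonoidAlgebra.one_def,
          Algebra.TensorProduct.one_def]
      map_mul' := fun a b => by
        rw [toAdd_mul, map_add, Algebra.TensorProduct.tmul_mul_tmul,
          AddMonoidAlgebra.single_mul_single, AddMonoidAlgebra.single_mul_single, mul_one] }

lemma charCoaction_single (φ : A →+ D) (m : A) : charCoaction k φ (AddMonoidAlgebra.single m 1) =
    AddMonoidAlgebra.single (φ m) 1 ⊗ₜ AddMonoidAlgebra.single m 1 := by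
  simp [charCoaction, AddMonoidAlgebra.lift_single]

/-- The action of `Spec k[D]` on `Spec k[A]` given by a homomorphism `A → D`. -/
noncomputable def charAct (φ : A →+ D) :
    affineOver k (AddMonoidAlgebra k D) ⊗ affineOver k (AddMonoidAlgebra k A) ⟶
      affineOver k (AddMonoidAlgebra k A) :=
  ofCoaction k (charCoaction k φ)

lemma lift_charAct (α : D →+ B) (β : A →+ B) (φ : A →+ D) :
    lift (charOver k α) (charOver k β) ≫ charAct k φ = charOver k (α.comp φ + β) := by
  rw [charAct, lift_ofCoaction]
  congr 1
  refine algHom_ext_single fun m => ?_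
  rw [AlgHom.comp_apply, charCoaction_single, Algebra.TensorProduct.productMap_apply_tmul,
    charMap_single, charMap_single, charMap_single, AddMonoidAlgebra.single_mul_single, mul_one]
  rfl

instance isIso_lift_inl_inr : IsIso (lift (charOver k (AddMonoidHom.inl A B))
    (charOver k (AddMonoidHom.inr A B))) :=
  isIso_lift_specOver _ _ (bijective_productMap_charMap k A B)

lemma whiskerLeft_ofCoaction {R : Type u} [CommRing R] [Algebra k R]
    {c : R →ₐ[k] AddMonoidAlgebra k D ⊗[k] R} {ρ : R →ₐ[k] AddMonoidAlgebra k A} {φ : A →+ D}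
    (h : (Algebra.TensorProduct.productMap (charMap k (AddMonoidHom.inl D A))
        ((charMap k (AddMonoidHom.inr D A)).comp ρ)).comp c =
      (charMap k ((AddMonoidHom.inl D A).comp φ + AddMonoidHom.inr D A)).comp ρ) :
    (affineOver k (AddMonoidAlgebra k D) ◁ specOver ρ) ≫ ofCoaction k c =
      charAct k φ ≫ specOver ρ := by
  rw [← cancel_epi (lift (charOver k (AddMonoidHom.inl D A)) (charOver k (AddMonoidHom.inr D A))),
    ← Category.assoc, ← Category.assoc, lift_whiskerLeft, lift_charAct, specOver_comp,
    specOver_comp, lift_ofCoaction, h]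

lemma whiskerLeft_charAct {μ : A →+ B} {φ : A →+ D} {ψ : B →+ D} (h : φ = ψ.comp μ) :
    (affineOver k (AddMonoidAlgebra k D) ◁ charOver k μ) ≫ charAct k φ =
      charAct k ψ ≫ charOver k μ := by
  rw [← cancel_epi (lift (charOver k (AddMonoidHom.inl D B)) (charOver k (AddMonoidHom.inr D B))),
    ← Category.assoc, ← Category.assoc, lift_whiskerLeft, lift_charAct, charOver_comp,
    charOver_comp, lift_charAct, h]
  rfl

lemma charAct_specOver {R : Type u} [CommRing R] [Algebra k R] {ρ : R →ₐ[k] AddMonoidAlgebra k A}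
    {φ : A →+ D} (h : (charMap k ((AddMonoidHom.inl D A).comp φ + AddMonoidHom.inr D A)).comp ρ =
      (charMap k (AddMonoidHom.inr D A)).comp ρ) :
    charAct k φ ≫ specOver ρ = snd _ _ ≫ specOver ρ := by
  rw [← cancel_epi (lift (charOver k (AddMonoidHom.inl D A)) (charOver k (AddMonoidHom.inr D A))),
    ← Category.assoc, ← Category.assoc, lift_charAct, lift_snd, specOver_comp, specOver_comp, h]

section Torus

variable {Q : Type u} [AddCommGroup Q]

lemma torusMul_eq : torusMul k Q = charAct k (AddMonoidHom.id (Module.Dual ℤ Q)) := by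
  rw [torusMul, charAct]
  congr 1
  refine algHom_ext_single fun m => ?_
  rw [charCoaction_single]
  simp

lemma toUnit_torusOne : toUnit (affineOver k (AddMonoidAlgebra k A)) ≫ torusOne k Q =
    charOver k (0 : Module.Dual ℤ Q →+ A) := by
  ext1
  have h1 : (toUnit (affineOver k (AddMonoidAlgebra k A))).left =
    Spec.map (CommRingCat.ofHom (algebraMap k (AddMonoidAlgebra k A))) := rfl
  rw [Over.comp_left, h1]
  refine (Spec.map_comp _ _).symm.trans ?_
  change Spec.map _ = Spec.map _
  congr 1
  apply CommRingCat.hom_ext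
  have h2 : (Algebra.ofId k (AddMonoidAlgebra k A)).comp
      (Bialgebra.counitAlgHom k (TorusRing k Q)) = charMap k (0 : Module.Dual ℤ Q →+ A) := by
    refine algHom_ext_single fun m => ?_
    rw [charMap_single]
    simp
  exact congrArg AlgHom.toRingHom h2

lemma torusOne_charAct (φ : A →+ Module.Dual ℤ Q) :
    (torusOne k Q ▷ affineOver k (AddMonoidAlgebra k A)) ≫ charAct k φ = snd _ _ := by
  rw [← cancel_epi (λ_ (affineOver k (AddMonoidAlgebra k A))).inv, ← Category.assoc]
  have h1 : (λ_ (affineOver k (AddMonoidAlgebra k A))).inv = lift (toUnit _) (𝟙 _) := by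
    rw [← cancel_mono (λ_ _).hom]
    simp
  have h2 : 𝟙 (affineOver k (AddMonoidAlgebra k A)) = charOver k (AddMonoidHom.id A) := by
    ext1
    refine (Spec.map_id _).symm.trans ?_
    change Spec.map _ = Spec.map _
    congr 1
    apply CommRingCat.hom_ext
    have h2 : AlgHom.id k _ = charMap k (AddMonoidHom.id A) :=
      algHom_ext_single fun m => by rw [charMap_single]; rfl
    exact congrArg AlgHom.toRingHom h2
  rw [h1, lift_whiskerRight, toUnit_torusOne, lift_snd, h2, lift_charAct, AddMonoidHom.zero_comp,
    zero_add]

lemma torusMul_charAct (φ : A →+ Module.Dual ℤ Q) :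
    (torusMul k Q ▷ affineOver k (AddMonoidAlgebra k A)) ≫ charAct k φ =
      (α_ _ _ _).hom ≫ (torus k Q ◁ charAct k φ) ≫ charAct k φ := by
  let D := Module.Dual ℤ Q
  let w := lift (charOver k (AddMonoidHom.inl D D)) (charOver k (AddMonoidHom.inr D D))
  let i := AddMonoidHom.inl (D × D) A
  have hg : lift (charOver k i) (charOver k (AddMonoidHom.inr (D × D) A)) ≫ (w ▷ _) =
      lift (lift (charOver k (i.comp (AddMonoidHom.inl D D)))
        (charOver k (i.comp (AddMonoidHom.inr D D)))) (charOver k (AddMonoidHom.inr (D × D) A)) := by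
    rw [lift_whiskerRight, comp_lift, charOver_comp, charOver_comp]
  rw [← cancel_epi (w ▷ affineOver k (AddMonoidAlgebra k A)),
    ← cancel_epi (lift (charOver k i) (charOver k (AddMonoidHom.inr (D × D) A))),
    ← Category.assoc, ← Category.assoc _ (w ▷ _), hg, ← Category.assoc, ← Category.assoc,
    ← Category.assoc, lift_whiskerRight, lift_lift_associator_hom, lift_whiskerLeft, torusMul_eq,
    lift_charAct, lift_charAct, lift_charAct, lift_charAct, AddMonoidHom.comp_id]
  congr 1
  exact DFunLike.ext _ _ fun a => by simp [add_assoc]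

end Torus

end Coaction

section ToricAction

variable {k : Type u} [Field k] {L D : Type u} [AddCommGroup L] [AddCommGroup D]
  {Z : Over (Spec (.of k))}

lemma Atlas.hom_ext_whisker (a : Atlas k L Z) {W Y : Over (Spec (.of k))} {f g : W ⊗ Z ⟶ Y}
    (h : ∀ i, (W ◁ a.chart i) ≫ f = (W ◁ a.chart i) ≫ g) : f = g := by
  ext1
  refine Scheme.Cover.hom_ext (Scheme.Cover.mkOfCovers a.I
    (fun i => (W ⊗ affineOver k (AddMonoidAlgebra k (a.S i))).left)
    (fun i => (W ◁ a.chart i).left) (fun x => ?_) fun i => inferInstance) _ _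
      fun i => congrArg Over.Hom.left (h i)
  obtain ⟨i, p, hp, -⟩ := a.cover ((snd W Z).left x)
  exact ⟨i, exists_whiskerLeft_eq (a.chart i) x p hp.symm⟩

/-- The torus `Spec k[D]` acts on `Z` through its torus `Spec k[L]`, by the homomorphism `φ` on
characters. -/
def Atlas.IsToricAction (a : Atlas k L Z) (act : affineOver k (AddMonoidAlgebra k D) ⊗ Z ⟶ Z)
    (φ : L →+ D) : Prop :=
  ∀ i, (affineOver k (AddMonoidAlgebra k D) ◁ a.chart i) ≫ act =
    charAct k (φ.comp (a.S i).subtype) ≫ a.chart i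

variable {a : Atlas k L Z} {act : affineOver k (AddMonoidAlgebra k D) ⊗ Z ⟶ Z} {φ : L →+ D}

lemma Atlas.IsToricAction.whiskerLeft_torus (h : a.IsToricAction act φ) (i : a.I) :
    (affineOver k (AddMonoidAlgebra k D) ◁ a.torus i) ≫ act = charAct k φ ≫ a.torus i := by
  rw [Atlas.torus, whiskerLeft_comp, Category.assoc, h i, ← Category.assoc, ← Category.assoc,
    whiskerLeft_charAct k rfl]

lemma Atlas.IsToricAction.isAction {Q : Type u} [AddCommGroup Q] {act : Toric.torus k Q ⊗ Z ⟶ Z}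
    {φ : L →+ Module.Dual ℤ Q} (h : a.IsToricAction act φ) : IsAction act where
  one_act := by
    refine a.hom_ext_whisker fun i => ?_
    rw [whisker_exchange_assoc, h i, ← Category.assoc, torusOne_charAct, whiskerLeft_snd]
  mul_act := by
    refine a.hom_ext_whisker fun i => ?_
    rw [whisker_exchange_assoc, h i, ← Category.assoc, torusMul_charAct,
      associator_naturality_right_assoc, ← whiskerLeft_comp_assoc, h i, whiskerLeft_comp_assoc, h i]
    simp only [Category.assoc]

lemma diagAct_comp {T X B X' B' : Over (Spec (.of k))} {b : T ⊗ X ⟶ X} {c : T ⊗ B ⟶ B}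
    {b' : T ⊗ X' ⟶ X'} {c' : T ⊗ B' ⟶ B'} {f : X ⟶ X'} {g : B ⟶ B'}
    (hf : b ≫ f = (T ◁ f) ≫ b') (hg : c ≫ g = (T ◁ g) ≫ c') :
    diagAct b c ≫ (f ⊗ₘ g) = (T ◁ (f ⊗ₘ g)) ≫ diagAct b' c' := by
  rw [diagAct, diagAct, lift_map, comp_lift, Category.assoc, Category.assoc, hf, hg,
    ← whiskerLeft_comp_assoc, ← whiskerLeft_comp_assoc, ← whiskerLeft_comp_assoc,
    ← whiskerLeft_comp_assoc, tensorHom_fst, tensorHom_snd]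

lemma diagAct_fst {T X B : Over (Spec (.of k))} (b : T ⊗ X ⟶ X) (c : T ⊗ B ⟶ B) :
    diagAct b c ≫ fst X B = (T ◁ fst X B) ≫ b := by
  rw [diagAct, lift_fst]

lemma Atlas.IsToricAction.prod {L' : Type u} [AddCommGroup L'] {Z' : Over (Spec (.of k))}
    {a' : Atlas k L' Z'} {act' : affineOver k (AddMonoidAlgebra k D) ⊗ Z' ⟶ Z'} {φ' : L' →+ D}
    (h : a.IsToricAction act φ) (h' : a'.IsToricAction act' φ') :
    (a.prod a').IsToricAction (diagAct act act') (φ.coprod φ') := by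
  rintro ⟨i, j⟩
  change (_ ◁ a.prodChart a' (i, j)) ≫ lift _ _ =
    charAct k ((φ.coprod φ').comp ((a.S i).prod (a'.S j)).subtype) ≫ a.prodChart a' (i, j)
  rw [comp_lift, ← whiskerLeft_comp_assoc, ← whiskerLeft_comp_assoc, prodChart_fst, prodChart_snd,
    whiskerLeft_comp_assoc, whiskerLeft_comp_assoc, h i, h' j, ← Category.assoc,
    ← Category.assoc (_ ◁ charOver k (inrSub (a.S i) (a'.S j))),
    whiskerLeft_charAct k (ψ := (φ.coprod φ').comp ((a.S i).prod (a'.S j)).subtype),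
    whiskerLeft_charAct k (ψ := (φ.coprod φ').comp ((a.S i).prod (a'.S j)).subtype)]
  · refine CartesianMonoidalCategory.hom_ext _ _ ?_ ?_
    · rw [lift_fst, Category.assoc, Category.assoc, prodChart_fst]
    · rw [lift_snd, Category.assoc, Category.assoc, prodChart_snd]
  · exact DFunLike.ext _ _ fun x => by simp [inrSub]
  · exact DFunLike.ext _ _ fun x => by simp [inlSub]

lemma IsInvariant.image {T X Y : Over (Spec (.of k))} {b : T ⊗ X ⟶ X} {b' : T ⊗ Y ⟶ Y} {g : Y ⟶ X}
    [IsOpenImmersion g.left] (hg : b' ≫ g = (T ◁ g) ≫ b) {C : Set Y.left} (h : IsInvariant b' C) :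
    IsInvariant b (g.left '' C) := by
  rintro p ⟨y, hy, hyp⟩
  obtain ⟨q, rfl⟩ := exists_whiskerLeft_eq g p y hyp.symm
  refine ⟨b'.left q, h q ?_, ?_⟩
  · have h1 : g.left ((snd T Y).left q) = g.left y := by
      rw [hyp, ← Scheme.Hom.comp_apply, ← Scheme.Hom.comp_apply, ← Over.comp_left, ← Over.comp_left,
        whiskerLeft_snd]
    rwa [g.left.isOpenEmbedding.injective h1]
  · rw [← Scheme.Hom.comp_apply, ← Scheme.Hom.comp_apply, ← Over.comp_left, ← Over.comp_left, hg]

/-- An action of a torus restricts to an immersed subscheme with a toric atlas if it does so on the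
charts. -/
lemma Atlas.exists_action (a : Atlas k L Z) {X : Over (Spec (.of k))} (c : Z ⟶ X) [Mono c]
    (b : affineOver k (AddMonoidAlgebra k D) ⊗ X ⟶ X) (φ : L →+ D)
    (hlift : ∀ g : (affineOver k (AddMonoidAlgebra k D) ⊗ Z).left ⟶ X.left,
      Set.range g ⊆ Set.range c.left → ∃ g', g' ≫ c.left = g)
    (h : ∀ i, (affineOver k (AddMonoidAlgebra k D) ◁ (a.chart i ≫ c)) ≫ b =
      charAct k (φ.comp (a.S i).subtype) ≫ a.chart i ≫ c) :
    ∃ act, act ≫ c = (_ ◁ c) ≫ b ∧ a.IsToricAction act φ := by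
  obtain ⟨g, hg⟩ := hlift ((_ ◁ c) ≫ b).left (by
    rintro _ ⟨x, rfl⟩
    obtain ⟨i, p, hp, -⟩ := a.cover ((snd _ Z).left x)
    obtain ⟨q, rfl⟩ := exists_whiskerLeft_eq (a.chart i) x p hp.symm
    refine ⟨(charAct k (φ.comp (a.S i).subtype) ≫ a.chart i).left q, ?_⟩
    have h1 := h i
    rw [whiskerLeft_comp, Category.assoc, ← Category.assoc (charAct _ _)] at h1
    exact (congrArg (fun g => g.left q) h1).symm)
  have hw : g ≫ Z.hom = (affineOver k (AddMonoidAlgebra k D) ⊗ Z).hom := by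
    rw [← Over.w c, ← Category.assoc, hg, Over.w]
  let act : affineOver k (AddMonoidAlgebra k D) ⊗ Z ⟶ Z := Over.homMk g hw
  have hact : act ≫ c = (_ ◁ c) ≫ b := Over.OverMorphism.ext hg
  refine ⟨act, hact, fun i => ?_⟩
  rw [← cancel_mono c, Category.assoc, hact, Category.assoc, ← h i, whiskerLeft_comp, Category.assoc]

section Free

variable [Module.Finite ℤ D]

instance : UniversallyOpen (affineOver k (AddMonoidAlgebra k D)).hom := by
  have : AddMonoid.FG D :=
    AddGroup.fg_iff_addMonoid_fg.1 (Module.Finite.iff_addGroup_fg.1 inferInstance)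
  exact universallyOpen_affineOver _

lemma Atlas.isReduced_tensor [Module.Free ℤ D] [Module.Free ℤ L] [Module.Finite ℤ L]
    (a : Atlas k L Z) :
    IsReduced (affineOver k (AddMonoidAlgebra k D) ⊗ Z).left := by
  refine isReduced_of_exists_chart fun x => ?_
  obtain ⟨i, p, hp, -⟩ := a.cover ((snd _ Z).left x)
  obtain ⟨q, hq⟩ := exists_whiskerLeft_eq (a.chart i) x p hp.symm
  refine ⟨_, (_ ◁ a.chart i).left, ?_, inferInstance, q, hq⟩
  let e := lift (charOver k (AddMonoidHom.inl D (a.S i))) (charOver k (AddMonoidHom.inr D (a.S i)))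
  have he : IsIso e.left := isIso_left e
  have hinj : Function.Injective ((AddMonoidHom.id D).prodMap (a.S i).subtype) :=
    Function.injective_id.prodMap Subtype.val_injective
  have hred : _root_.IsReduced (AddMonoidAlgebra k (D × a.S i)) :=
    isReduced_of_injective (charMap k ((AddMonoidHom.id D).prodMap (a.S i).subtype))
      (charMap_injective k hinj)
  have : IsReduced (affineOver k (AddMonoidAlgebra k (D × a.S i))).left :=
    inferInstanceAs (IsReduced (Spec _))
  exact isReduced_of_isOpenImmersion (inv e.left)

variable {M : Type u} [AddCommGroup M] {π : L →ₗ[ℤ] M} {ψ : M →+ D}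

lemma Atlas.IsToricAction.isInvariant_torus (h : a.IsToricAction act (ψ.comp (π : L →+ M)))
    (i : a.I) : IsInvariant act (closure (Set.range (charOver k (π : L →+ M) ≫ a.torus i).left)) := by
  refine (isInvariant_range (a := charAct k ψ) ?_).closure
  rw [whiskerLeft_comp, Category.assoc, h.whiskerLeft_torus, ← Category.assoc, ← Category.assoc,
    whiskerLeft_charAct k rfl]

/-- A one-parameter family of translates of a subtorus is invariant under each torus which acts
through this subtorus. -/
lemma Atlas.IsToricAction.isInvariant_degTorus (h : a.IsToricAction act (ψ.comp (π : L →+ M)))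
    (i : a.I) (v : Module.Dual ℤ L) : IsInvariant (diagAct act (snd _ (projLine k)))
      (closure (Set.range (a.degTorus i π v).left)) := by
  refine (isInvariant_range (a := charAct k (ψ.comp (AddMonoidHom.fst M ℤ))) ?_).closure
  refine CartesianMonoidalCategory.hom_ext _ _ ?_ ?_
  · rw [Category.assoc, diagAct_fst, ← whiskerLeft_comp_assoc, Category.assoc, Atlas.degTorus,
      lift_fst, whiskerLeft_comp, Category.assoc, h.whiskerLeft_torus, ← Category.assoc, ← Category.assoc,
      whiskerLeft_charAct k (μ := torusRestrict π v) (φ := ψ.comp (π : L →+ M))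
        (ψ := ψ.comp (AddMonoidHom.fst M ℤ)) rfl]
  · rw [Category.assoc, Category.assoc, diagAct, lift_snd, ← whiskerLeft_comp_assoc, Atlas.degTorus,
      lift_snd, whiskerLeft_snd, ← Category.assoc, ← Category.assoc, charAct_specOver]
    refine AlgHom.ext fun x => ?_
    rw [AlgHom.comp_apply, AlgHom.comp_apply, charMap_comp, charMap_comp]
    congr 2
    exact DFunLike.ext _ _ fun n => Prod.ext ((add_zero _).trans (map_zero ψ)) (zero_add _)

end Free

end ToricAction

end

section

/-! ### The actions on closed strata and on `(𝔸^m ∖ 0)^r` -/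

section Stratum

variable {N Q : Type u} [AddCommGroup N] [AddCommGroup Q] (k : Type u) [Field k]

/-- The weights of the action of a torus on a closed stratum. -/
def stratumWeight (j : Q →ₗ[ℤ] N) (τ : PointedCone ℝ (RealSpace N)) :
    Module.Dual ℤ (N ⧸ coneLattice τ) →+ Module.Dual ℤ Q :=
  ((((coneLattice τ).mkQ ∘ₗ j).dualMap :
    Module.Dual ℤ (N ⧸ coneLattice τ) →ₗ[ℤ] Module.Dual ℤ Q) : _ →+ _)

lemma whiskerLeft_faceRestrict_coneAct (j : Q →ₗ[ℤ] N) {τ σ : PointedCone ℝ (RealSpace N)}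
    (h : τ ≤ σ) : (torus k Q ◁ specOver (faceRestrict k h)) ≫ coneAct k j σ =
      charAct k ((stratumWeight j τ).comp (starMonoid τ σ).subtype) ≫
        specOver (faceRestrict k h) := by
  refine whiskerLeft_ofCoaction k (algHom_ext_single fun m => ?_)
  rw [AlgHom.comp_apply, AlgHom.comp_apply, coneCoaction_single, one_smul,
    Algebra.TensorProduct.productMap_apply_tmul, AlgHom.comp_apply, faceRestrict_single,
    charMap_single]
  by_cases hm : ∀ n ∈ coneLattice τ, m.1 n = 0
  · obtain ⟨m', hm'⟩ := exists_starMonoid hm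
    rw [faceRestrictChar_of k hm', charMap_single, charMap_single,
      AddMonoidAlgebra.single_mul_single, mul_one, ← hm']
    rfl
  · rw [faceRestrictChar_of_not k hm, map_zero, map_zero, mul_zero]

variable (F : Fan N) [Module.Free ℤ N] [Module.Finite ℤ N]

lemma Fan.whiskerLeft_torusAct (j : Q →ₗ[ℤ] N) {τ σ : F.cones} (h : τ.1 ≤ σ.1) :
    (torus k Q ◁ (F.stratumChart k h ≫ F.strIncl k τ)) ≫ F.torusAct k j =
      charAct k ((stratumWeight j τ.1).comp (starMonoid τ.1 σ.1).subtype) ≫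
        F.stratumChart k h ≫ F.strIncl k τ := by
  rw [F.stratumChart_strIncl k h, whiskerLeft_comp, Category.assoc, F.torusAct_ιOver k,
    ← Category.assoc, whiskerLeft_faceRestrict_coneAct, Category.assoc]

variable [Module.Free ℤ Q] [Module.Finite ℤ Q]

lemma Fan.exists_stratumAction (j : Q →ₗ[ℤ] N) (τ : F.cones) :
    ∃ act : torus k Q ⊗ F.closedStratum k τ ⟶ F.closedStratum k τ,
      act ≫ F.strIncl k τ = (torus k Q ◁ F.strIncl k τ) ≫ F.torusAct k j ∧
      (F.stratumAtlas k τ).IsToricAction act (stratumWeight j τ.1) := by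
  have := free_quotient_coneLattice (F.rational _ τ.2)
  have hred : IsReduced (torus k Q ⊗ F.closedStratum k τ).left :=
    (F.stratumAtlas k τ).isReduced_tensor
  have hcl : IsClosedImmersion (F.strIncl k τ).left :=
    inferInstanceAs (IsClosedImmersion (reducedIncl (F.stratum k τ)).left)
  have h : ∀ i : (F.stratumAtlas k τ).I,
      (torus k Q ◁ ((F.stratumAtlas k τ).chart i ≫ F.strIncl k τ)) ≫ F.torusAct k j =
        charAct k ((stratumWeight j τ.1).comp ((F.stratumAtlas k τ).S i).subtype) ≫
          (F.stratumAtlas k τ).chart i ≫ F.strIncl k τ :=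
    fun i => F.whiskerLeft_torusAct k j i.2
  exact (F.stratumAtlas k τ).exists_action (F.strIncl k τ) (F.torusAct k j) _
    (fun g hg => exists_lift_of_range_subset _ g hg) h

end Stratum

section StratumMap

variable {N N' Q : Type u} [AddCommGroup N] [AddCommGroup N'] [AddCommGroup Q] (k : Type u)
  [Field k]
  {F : Fan N} {F' : Fan N'} {f : N →ₗ[ℤ] N'} {τ : F.cones} {τ' : F'.cones}

lemma IsSmallestCone.coneLattice_le (h : IsSmallestCone f τ τ') :
    coneLattice τ.1 ≤ (coneLattice τ'.1).comap f := by
  refine Submodule.span_le.2 fun n hn => Submodule.subset_span ?_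
  exact h.1 ⟨_, hn, realMap_toReal f n⟩

/-- The map of the cocharacter lattices of the tori of the closed strata. -/
def IsSmallestCone.latticeMap (h : IsSmallestCone f τ τ') :
    (N ⧸ coneLattice τ.1) →ₗ[ℤ] (N' ⧸ coneLattice τ'.1) :=
  (coneLattice τ.1).mapQ _ f h.coneLattice_le

lemma IsSmallestCone.vanishes (h : IsSmallestCone f τ τ') {m : Module.Dual ℤ N'}
    (hm : m ∈ dualMonoid τ'.1) (h0 : ∀ n ∈ coneLattice τ.1, (m ∘ₗ f) n = 0) :
    ∀ n ∈ coneLattice τ'.1, m n = 0 := by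
  let ρ : PointedCone ℝ (RealSpace N') := τ'.1 ⊓ (LinearMap.ker (pairing m)).restrictScalars _
  have hρ : ∀ x, x ∈ ρ ↔ x ∈ τ'.1 ∧ pairing m x = 0 := fun x => Iff.rfl
  have h1 : τ'.1 ≤ ρ := h.2 ⟨ρ, F'.face_mem _ τ'.2 _ ⟨m, hm, hρ⟩⟩ (by
    rintro _ ⟨z, hz, rfl⟩
    refine (hρ _).2 ⟨h.1 ⟨z, hz, rfl⟩, ?_⟩
    have := pairing_eq_zero_of_coneLattice (F.rational _ τ.2) h0 hz
    rwa [pairing_comp] at this)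
  by_contra hcon
  obtain ⟨x, hx, hx'⟩ := not_vanishes_iff.2 hcon
  exact hx' ((hρ x).1 (h1 hx)).2

lemma ιOver_toricMorphism (hf : IsFanMap F F' f) (h : τ.1.map (realMap f) ≤ τ'.1) :
    F.ιOver k τ ≫ toricMorphism k f hf = specOver (coneRingPull k f h) ≫ F'.ιOver k τ' :=
  Over.OverMorphism.ext (ι_toricMap k f hf τ τ' h)

lemma whiskerLeft_coneRingPull_coneAct (j : Q →ₗ[ℤ] N) {σ : PointedCone ℝ (RealSpace N)}
    {σ' : PointedCone ℝ (RealSpace N')} (h : σ.map (realMap f) ≤ σ') :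
    (torus k Q ◁ specOver (coneRingPull k f h)) ≫ coneAct k (f ∘ₗ j) σ' =
      coneAct k j σ ≫ specOver (coneRingPull k f h) := by
  let φ : dualMonoid σ →+ Module.Dual ℤ Q :=
    (j.dualMap : Module.Dual ℤ N →+ Module.Dual ℤ Q).comp (dualMonoid σ).subtype
  have h1 : coneCoaction k j σ = charCoaction k φ := algHom_ext_single fun m => by
    rw [coneCoaction_single, charCoaction_single, one_smul]
    rfl
  have h2 : coneAct k j σ = charAct k φ := congrArg (ofCoaction k) h1
  rw [h2]
  refine whiskerLeft_ofCoaction k (algHom_ext_single fun m => ?_)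
  rw [AlgHom.comp_apply, AlgHom.comp_apply, coneCoaction_single, one_smul,
    Algebra.TensorProduct.productMap_apply_tmul, AlgHom.comp_apply, coneRingPull_single,
    charMap_single, charMap_single, charMap_single, AddMonoidAlgebra.single_mul_single, mul_one]
  rfl

variable [Module.Free ℤ N] [Module.Finite ℤ N]

/-- The map of closed strata is equivariant. -/
lemma stratumMap_equivariant (hf : IsFanMap F F' f) (h : IsSmallestCone f τ τ') (j : Q →ₗ[ℤ] N)
    {actY : torus k Q ⊗ F.closedStratum k τ ⟶ F.closedStratum k τ}
    {actX : torus k Q ⊗ F'.closedStratum k τ' ⟶ F'.closedStratum k τ'}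
    (hY : actY ≫ F.strIncl k τ = (torus k Q ◁ F.strIncl k τ) ≫ F.torusAct k j)
    (hX : actX ≫ F'.strIncl k τ' = (torus k Q ◁ F'.strIncl k τ') ≫ F'.torusAct k (f ∘ₗ j)) :
    actY ≫ stratumMap k f hf h = (torus k Q ◁ stratumMap k f hf h) ≫ actX := by
  rw [← cancel_mono (F'.strIncl k τ'), Category.assoc, Category.assoc, hX, stratumMap_strIncl,
    ← Category.assoc, hY, Category.assoc, ← whiskerLeft_comp_assoc, stratumMap_strIncl,
    whiskerLeft_comp, Category.assoc]
  refine (F.stratumAtlas k τ).hom_ext_whisker fun i => ?_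
  change (_ ◁ F.stratumChart k i.2) ≫ _ = (_ ◁ F.stratumChart k i.2) ≫ _
  rw [← whiskerLeft_comp_assoc, ← whiskerLeft_comp_assoc, F.stratumChart_strIncl k i.2, whiskerLeft_comp,
    Category.assoc, Category.assoc]
  congr 1
  obtain ⟨σ', hσ', hle⟩ := hf i.1.1 i.1.2
  have h1 := ιOver_toricMorphism k (τ' := ⟨σ', hσ'⟩) hf hle
  rw [← Category.assoc, F.torusAct_ιOver k, Category.assoc, h1, ← whiskerLeft_comp_assoc, h1,
    whiskerLeft_comp, Category.assoc, F'.torusAct_ιOver k, ← Category.assoc, ← Category.assoc,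
    whiskerLeft_coneRingPull_coneAct]

variable [Module.Free ℤ N'] [Module.Finite ℤ N']

/-- The map of closed strata is given by a homomorphism of tori. -/
lemma torus_stratumMap (hf : IsFanMap F F' f) (h : IsSmallestCone f τ τ')
    (i : (F.stratumAtlas k τ).I) (i' : (F'.stratumAtlas k τ').I) :
    (F.stratumAtlas k τ).torus i ≫ stratumMap k f hf h =
      charOver k (h.latticeMap.dualMap : _ →+ _) ≫ (F'.stratumAtlas k τ').torus i' := by
  rw [(F.stratumAtlas k τ).torus_eq i ⟨τ, le_rfl⟩, (F'.stratumAtlas k τ').torus_eq i' ⟨τ', le_rfl⟩,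
    ← cancel_mono (F'.strIncl k τ')]
  change ((charOver k (starMonoid τ.1 τ.1).subtype ≫ F.stratumChart k (le_refl τ.1)) ≫
    stratumMap k f hf h) ≫ F'.strIncl k τ' = (charOver k _ ≫
      charOver k (starMonoid τ'.1 τ'.1).subtype ≫ F'.stratumChart k (le_refl τ'.1)) ≫ F'.strIncl k τ'
  simp only [Category.assoc]
  rw [stratumMap_strIncl, F'.stratumChart_strIncl k (le_refl τ'.1), ← Category.assoc (F.stratumChart k _),
    F.stratumChart_strIncl k (le_refl τ.1), Category.assoc, ιOver_toricMorphism k hf h.1]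
  simp only [← Category.assoc]
  congr 1
  rw [specOver_comp, specOver_comp, specOver_comp, specOver_comp]
  congr 1
  refine algHom_ext_single fun m => ?_
  simp only [AlgHom.comp_apply, coneRingPull_single, faceRestrict_single]
  by_cases hm : ∀ n ∈ coneLattice τ'.1, m.1 n = 0
  · obtain ⟨m', hm'⟩ := exists_starMonoid hm
    have h1 : m'.1 ∘ₗ h.latticeMap ∘ₗ (coneLattice τ.1).mkQ = m.1 ∘ₗ f := by
      rw [IsSmallestCone.latticeMap, Submodule.mapQ_mkQ, ← LinearMap.comp_assoc, hm']
    have h2 : ∀ n ∈ coneLattice τ.1, (dualMonoidMap f h.1 m).1 n = 0 := fun n hn =>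
      hm _ (h.coneLattice_le hn)
    obtain ⟨m'', hm''⟩ := exists_starMonoid h2
    rw [faceRestrictChar_of k hm', faceRestrictChar_of k hm'', charMap_single, charMap_single,
      charMap_single]
    congr 1
    change m''.1 = m'.1 ∘ₗ h.latticeMap
    rw [← LinearMap.cancel_right (Submodule.mkQ_surjective (coneLattice τ.1)), hm'',
      LinearMap.comp_assoc, h1]
    rfl
  · rw [faceRestrictChar_of_not k hm, faceRestrictChar_of_not k (fun h0 => hm (h.vanishes m.2 h0)),
      map_zero, map_zero, map_zero]

end StratumMap

section Free

variable (k : Type u) [Field k] {Q : Type u} [AddCommGroup Q] {r : ℕ} (b : Module.Basis (Fin r) ℤ Q)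
  (m : ℕ)

/-- The weights of the action of a torus on `(𝔸^m ∖ 0)^r`. -/
noncomputable def coordWeight : Coord.{u} r m →+ Module.Dual ℤ Q :=
  ∑ p, (zmultiplesHom _ (b.coord p.down.1)).comp (Pi.evalAddMonoidHom (fun _ => ℤ) p)

lemma coordWeight_single (p : Fin r × Fin m) :
    coordWeight b m (Pi.single ⟨p⟩ 1) = b.coord p.1 := by
  rw [coordWeight, AddMonoidHom.finsetSum_apply, Finset.sum_eq_single ⟨p⟩]
  · simp
  · intro q _ hq
    simp [hq]
  · simp

lemma whiskerLeft_coordRestrict_affineSpaceAct (J : Set (ULift.{u} (Fin r × Fin m))) :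
    (torus k Q ◁ specOver (coordRestrict J k)) ≫ affineSpaceAct k b m =
      charAct k ((coordWeight b m).comp (coordMonoid J).subtype) ≫ specOver (coordRestrict J k) := by
  refine whiskerLeft_ofCoaction k (MvPolynomial.algHom_ext fun p => ?_)
  rw [AlgHom.comp_apply, AlgHom.comp_apply, MvPolynomial.aeval_X,
    Algebra.TensorProduct.productMap_apply_tmul, AlgHom.comp_apply, coordRestrict_X,
    charMap_single, charMap_single, charMap_single, AddMonoidAlgebra.single_mul_single, mul_one,
    ← coordWeight_single b m p]
  rfl

lemma exists_freeAction : ∃ act : torus k Q ⊗ freeSpace k r m ⟶ freeSpace k r m,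
    act ≫ freeIncl k r m = (torus k Q ◁ freeIncl k r m) ≫ affineSpaceAct k b m ∧
      (freeAtlas (k := k) r m).IsToricAction act (coordWeight b m) := by
  refine (freeAtlas (k := k) r m).exists_action (freeIncl k r m) (affineSpaceAct k b m) _
    (fun g hg => ⟨_, IsOpenImmersion.lift_fac (freeIncl k r m).left g hg⟩) fun J => ?_
  change (_ ◁ (freeChart J.1 k J.2 ≫ freeIncl k r m)) ≫ _ =
    _ ≫ freeChart J.1 k J.2 ≫ freeIncl k r m
  rw [freeChart_freeIncl, whiskerLeft_coordRestrict_affineSpaceAct]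
  rfl

end Free

end

section

/-! ### Degrees of homomorphisms of tori -/

section Degree

lemma residueDegree_comp {X Y Z : Scheme.{u}} (f : X ⟶ Y) (g : Y ⟶ Z) (x : X) :
    (f ≫ g).residueDegree x = g.residueDegree (f x) * f.residueDegree x := by
  let := (f.residueFieldMap x).hom.toAlgebra
  let : Algebra (Z.residueField (g (f x))) (Y.residueField (f x)) :=
    (g.residueFieldMap (f x)).hom.toAlgebra
  let : Algebra (Z.residueField (g (f x))) (X.residueField x) :=
    ((f ≫ g).residueFieldMap x).hom.toAlgebra
  have : IsScalarTower (Z.residueField (g (f x))) (Y.residueField (f x)) (X.residueField x) :=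
    .of_algebraMap_eq fun a => congrArg (fun h => CommRingCat.Hom.hom h a) (Scheme.residueFieldMap_comp f g x)
  exact (Module.finrank_mul_finrank (Z.residueField (g (f x))) (Y.residueField (f x))
    (X.residueField x)).symm

lemma residueDegree_of_isPreimmersion {X Y : Scheme.{u}} (f : X ⟶ Y) [IsPreimmersion f] (x : X) :
    f.residueDegree x = 1 := by
  let := (f.residueFieldMap x).hom.toAlgebra
  have hs : Function.Surjective (f.residueFieldMap x).hom := by
    intro z
    obtain ⟨w, rfl⟩ := X.residue_surjective x z
    obtain ⟨w, rfl⟩ := f.stalkMap_surjective x w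
    exact ⟨Y.residue (f x) w, congrArg (fun h => CommRingCat.Hom.hom h w)
      (Scheme.residue_residueFieldMap f x)⟩
  have h1 : Function.Bijective (algebraMap (Y.residueField (f x)) (X.residueField x)) :=
    ⟨RingHom.injective _, hs⟩
  have h2 := (LinearEquiv.ofBijective (Algebra.linearMap (Y.residueField (f x))
    (X.residueField x)) h1).finrank_eq
  rw [Module.finrank_self] at h2
  exact h2.symm

/-- The residue field of the spectrum of a field. -/
lemma bijective_evaluation_spec {E : Type u} [Field E] (y : Spec (.of E)) :
    Function.Bijective ((Scheme.ΓSpecIso (.of E)).inv ≫ (Spec (.of E)).Γevaluation y).hom := by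
  have hy : y.asIdeal.IsPrime := PrimeSpectrum.isPrime (R := E) y
  refine ⟨RingHom.injective _, ?_⟩
  have h1 : (Scheme.ΓSpecIso (.of E)).inv ≫ (Spec (.of E)).Γevaluation y =
      CommRingCat.ofHom (algebraMap E y.asIdeal.ResidueField) ≫
        (Scheme.Spec.residueFieldIso (.of E) y).inv :=
    (Scheme.Spec.algebraMap_residueFieldIso_inv (.of E) y).symm
  rw [h1]
  have : y.asIdeal.IsMaximal := by
    rw [Ideal.eq_bot_of_prime (K := E) (h := hy)]
    exact Ideal.bot_isMaximal
  exact ((Scheme.Spec.residueFieldIso (.of E) y).symm.commRingCatIsoToRingEquiv.surjective).comp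
    y.asIdeal.algebraMap_residueField_surjective

lemma residueDegree_spec_field {E F : Type u} [Field E] [Field F] [Algebra E F] (y : Spec (.of F)) :
    (Spec.map (CommRingCat.ofHom (algebraMap E F))).residueDegree y = Module.finrank E F := by
  let f := Spec.map (CommRingCat.ofHom (algebraMap E F))
  let := (f.residueFieldMap y).hom.toAlgebra
  have h1 : CommRingCat.ofHom (algebraMap E F) ≫
      (Scheme.ΓSpecIso (.of F)).inv ≫ (Spec (.of F)).Γevaluation y =
      ((Scheme.ΓSpecIso (.of E)).inv ≫ (Spec (.of E)).Γevaluation (f y)) ≫ f.residueFieldMap y := by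
    rw [Category.assoc, Scheme.Γevaluation_naturality, ← Category.assoc,
      Scheme.ΓSpecIso_inv_naturality, Category.assoc]
  exact (Algebra.finrank_eq_of_equiv_equiv
    (RingEquiv.ofBijective _ (bijective_evaluation_spec (f y)))
    (RingEquiv.ofBijective _ (bijective_evaluation_spec y))
    (congrArg CommRingCat.Hom.hom h1).symm).symm

variable (k : Type u) [Field k]

section

variable {M L : Type*} [AddCommGroup M] [AddCommGroup L] {κ : M →+ L} (hκ : Function.Injective κ)
  [Algebra (AddMonoidAlgebra k M) (AddMonoidAlgebra k L)]
  (halg : ∀ x, algebraMap (AddMonoidAlgebra k M) (AddMonoidAlgebra k L) x = charMap k κ x)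

/-- The ring `k[L]` is free over `k[M]` for a subgroup `M` of `L`, with representatives of the cosets
as a basis. -/
noncomputable def cosetBasis :
    Module.Basis (L ⧸ κ.range) (AddMonoidAlgebra k M) (AddMonoidAlgebra k L) := by
  refine Module.Basis.mk (v := fun x => AddMonoidAlgebra.single x.out 1) ?_ ?_
  · classical
    have key : ∀ (l : L ⧸ κ.range →₀ AddMonoidAlgebra k M) x m,
        (Finsupp.linearCombination (AddMonoidAlgebra k M)
          (fun x : L ⧸ κ.range => (AddMonoidAlgebra.single x.out 1 : AddMonoidAlgebra k L)) l).coeff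
            (κ m + x.out) = (l x).coeff m := by
      intro l x m
      induction l using Finsupp.induction_linear with
      | zero => simp
      | add f g hf hg => rw [(Finsupp.linearCombination _ _).map_add, AddMonoidAlgebra.coeff_add,
          Finsupp.add_apply, hf, hg, Finsupp.add_apply, AddMonoidAlgebra.coeff_add,
          Finsupp.add_apply]
      | single x' z =>
        rw [Finsupp.linearCombination_single, Algebra.smul_def, halg]
        induction z using AddMonoidAlgebra.induction_linear with
        | zero => simp
        | add f g hf hg => rw [map_add (charMap k κ), add_mul, AddMonoidAlgebra.coeff_add, Finsupp.add_apply, hf,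
            hg, Finsupp.single_add, Finsupp.add_apply, AddMonoidAlgebra.coeff_add,
            Finsupp.add_apply]
        | single m' c =>
          rw [charMap_single, AddMonoidAlgebra.single_mul_single, mul_one,
            AddMonoidAlgebra.coeff_single, Finsupp.single_apply]
          by_cases hx : x' = x
          · subst hx
            rw [Finsupp.single_eq_same, AddMonoidAlgebra.coeff_single, Finsupp.single_apply]
            exact if_congr (by rw [add_left_inj, hκ.eq_iff]) rfl rfl
          · rw [Finsupp.single_eq_of_ne (Ne.symm hx), AddMonoidAlgebra.coeff_zero,
              Finsupp.zero_apply, if_neg]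
            intro h
            refine hx ?_
            have h1 := congrArg (QuotientAddGroup.mk (s := κ.range)) h
            have h2 : ∀ m, (QuotientAddGroup.mk (κ m) : L ⧸ κ.range) = 0 := fun m =>
              (QuotientAddGroup.eq_zero_iff _).2 ⟨m, rfl⟩
            rwa [QuotientAddGroup.mk_add, QuotientAddGroup.mk_add, h2, h2, zero_add, zero_add,
              QuotientAddGroup.out_eq', QuotientAddGroup.out_eq'] at h1
    rw [linearIndependent_iff]
    intro l hl
    ext x m
    rw [← key, hl]
    rfl
  · intro z _
    induction z using AddMonoidAlgebra.induction_linear with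
    | zero => exact zero_mem _
    | add f g hf hg => exact add_mem (hf trivial) (hg trivial)
    | single l c =>
      obtain ⟨m, hm⟩ : l - (QuotientAddGroup.mk l : L ⧸ κ.range).out ∈ κ.range := by
        rw [← QuotientAddGroup.eq_zero_iff, QuotientAddGroup.mk_sub, QuotientAddGroup.out_eq',
          sub_self]
      have h1 : (AddMonoidAlgebra.single l c : AddMonoidAlgebra k L) =
          (AddMonoidAlgebra.single m c : AddMonoidAlgebra k M) •
            AddMonoidAlgebra.single (QuotientAddGroup.mk l : L ⧸ κ.range).out 1 := by
        rw [Algebra.smul_def, halg, charMap_single, AddMonoidAlgebra.single_mul_single, mul_one, hm,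
          sub_add_cancel]
      rw [h1]
      exact Submodule.smul_mem _ _ (Submodule.subset_span ⟨_, rfl⟩)

end

variable {k} {L : Type u} [AddCommGroup L]

/-- A large multiple of the sum of the generators of a monoid moves every element of the generated
group into the monoid. -/
lemma exists_add_nsmul_mem_of_fg {S : AddSubmonoid L} (hfg : S.FG)
    (hS : AddSubgroup.closure (S : Set L) = ⊤) :
    ∃ s : S, ∀ l : L, ∃ n : ℕ, l + n • (s : L) ∈ S := by
  classical
  obtain ⟨G, hG⟩ := hfg
  have hGS : ∀ g ∈ G, g ∈ S := fun g hg => hG ▸ AddSubmonoid.subset_closure hg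
  have hs : ∑ g ∈ G, g ∈ S := sum_mem fun g hg => hGS g hg
  have hadd : ∀ (x y : L), (∃ n : ℕ, x + n • (∑ g ∈ G, g) ∈ S) →
      (∃ n : ℕ, y + n • (∑ g ∈ G, g) ∈ S) → ∃ n : ℕ, x + y + n • (∑ g ∈ G, g) ∈ S := by
    rintro x y ⟨n, hn⟩ ⟨n', hn'⟩
    refine ⟨n + n', ?_⟩
    rw [add_smul, add_add_add_comm]
    exact add_mem hn hn'
  have hneg : ∀ x ∈ S, ∃ n : ℕ, -x + n • (∑ g ∈ G, g) ∈ S := by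
    intro x hx
    rw [← hG] at hx
    induction hx using AddSubmonoid.closure_induction with
    | mem g hg =>
      refine ⟨1, ?_⟩
      rw [one_smul, ← Finset.add_sum_erase G _ hg, neg_add_cancel_left]
      exact sum_mem fun g' hg' => hGS g' (Finset.mem_of_mem_erase hg')
    | zero => exact ⟨0, by rw [neg_zero, zero_add, zero_smul]; exact zero_mem S⟩
    | add x y _ _ hx hy =>
      rw [neg_add]
      exact hadd _ _ hx hy
  refine ⟨⟨_, hs⟩, fun l => ?_⟩
  have hl : l ∈ AddSubgroup.closure (S : Set L) := hS ▸ AddSubgroup.mem_top l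
  induction hl using AddSubgroup.closure_induction'' with
  | mem x hx => exact ⟨0, by rw [zero_smul, add_zero]; exact hx⟩
  | neg_mem x hx => exact hneg x hx
  | zero => exact ⟨0, by rw [zero_smul, add_zero]; exact zero_mem S⟩
  | add x y _ _ hx hy => exact hadd _ _ hx hy

instance Atlas.isOpenImmersion_torus {Z : Over (Spec (.of k))} (a : Atlas k L Z) (i : a.I) :
    IsOpenImmersion (a.torus i).left := by
  obtain ⟨s, hs⟩ := exists_add_nsmul_mem_of_fg (a.fg i) (a.closure_eq i)
  let := (charMap k (a.S i).subtype).toRingHom.toAlgebra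
  have := isLocalization_charMap k (φ := (a.S i).subtype) Subtype.val_injective s (-(s : L))
    (add_neg_cancel _) fun l => (hs l).imp fun n hn => ⟨⟨_, hn⟩, rfl⟩
  have : IsOpenImmersion (charOver k (a.S i).subtype).left :=
    IsOpenImmersion.of_isLocalization (R := AddMonoidAlgebra k (a.S i))
      (S := AddMonoidAlgebra k L) (AddMonoidAlgebra.single s 1)
  rw [Atlas.torus, Over.comp_left]
  infer_instance

variable [Module.Free ℤ L] [Module.Finite ℤ L] {L' M : Type u} [AddCommGroup L'] [AddCommGroup M]
  [Module.Free ℤ M] [Module.Finite ℤ M] {W V : Over (Spec (.of k))}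

/-- The degree of a homomorphism of tori onto its image is the index of the lattices of characters. -/
lemma Atlas.residueDegree_torus (a : Atlas k L W) (b : Atlas k L' V) (i : a.I) (j : b.I) {f : W ⟶ V}
    {π : L' →+ M} {κ : M →+ L} (h : a.torus i ≫ f = charOver k (κ.comp π) ≫ b.torus j)
    (hπ : Function.Surjective π) (hκ : Function.Injective κ) (hfin : κ.range.index ≠ 0) :
    f.left.residueDegree ((a.torus i).left (⊥ : PrimeSpectrum (AddMonoidAlgebra k L))) =
      κ.range.index := by
  let A := AddMonoidAlgebra k M
  let B := AddMonoidAlgebra k L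
  let F := FractionRing B
  let : Algebra A B := (charMap k κ).toRingHom.toAlgebra
  have hAB : Function.Injective (algebraMap A B) := charMap_injective k hκ
  have : FaithfulSMul A B := (faithfulSMul_iff_algebraMap_injective A B).2 hAB
  have : Finite (L ⧸ κ.range) := AddSubgroup.index_ne_zero_iff_finite.1 hfin
  let bas := cosetBasis k hκ (fun _ => rfl)
  have : Module.Finite A B := Module.Finite.of_basis bas
  have : FaithfulSMul A F := (faithfulSMul_iff_algebraMap_injective A F).2 (by
    rw [IsScalarTower.algebraMap_eq A B F]
    exact (IsFractionRing.injective B F).comp hAB)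
  let : Algebra (FractionRing A) F := FractionRing.liftAlgebra A F
  have : IsScalarTower A (FractionRing A) F := FractionRing.isScalarTower_liftAlgebra A F
  have hdeg : Module.finrank (FractionRing A) F = κ.range.index := by
    exact (IsFractionRing.finrank_eq A (FractionRing A) B F).trans (Module.finrank_eq_nat_card_basis bas)
  have := IsPreimmersion.of_isLocalization (S := F) (nonZeroDivisors B)
  have := IsPreimmersion.of_isLocalization (S := FractionRing A) (nonZeroDivisors A)
  have : IsClosedImmersion (charOver k π).left :=
    IsClosedImmersion.spec_of_surjective _ (charMap_surjective k hπ)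
  let s : Spec (.of F) ⟶ W.left := Spec.map (CommRingCat.ofHom (algebraMap B F)) ≫ (a.torus i).left
  let t : Spec (.of (FractionRing A)) ⟶ V.left :=
    Spec.map (CommRingCat.ofHom (algebraMap A (FractionRing A))) ≫
      (charOver k π).left ≫ (b.torus j).left
  have hst : s ≫ f.left = Spec.map (CommRingCat.ofHom (algebraMap (FractionRing A) F)) ≫ t := by
    have h1 : Spec.map (CommRingCat.ofHom (algebraMap (FractionRing A) F)) ≫
        Spec.map (CommRingCat.ofHom (algebraMap A (FractionRing A))) =
        Spec.map (CommRingCat.ofHom (algebraMap B F)) ≫ (charOver k κ).left := by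
      refine (Spec.map_comp _ _).symm.trans (Eq.trans ?_ (Spec.map_comp _ _))
      rw [← CommRingCat.ofHom_comp, ← IsScalarTower.algebraMap_eq A (FractionRing A) F]
      rfl
    have h2 : (a.torus i).left ≫ f.left = (charOver k κ).left ≫ (charOver k π).left ≫
        (b.torus j).left := by
      rw [← Over.comp_left, h, ← charOver_comp, Over.comp_left, Over.comp_left, Category.assoc]
    simp only [s, t]
    rw [Category.assoc, h2, ← Category.assoc, ← h1, Category.assoc]
  let ξ : Spec (.of F) := (⊥ : PrimeSpectrum F)
  have hξ : s ξ = (a.torus i).left (⊥ : PrimeSpectrum (AddMonoidAlgebra k L)) := by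
    refine congrArg (a.torus i).left (PrimeSpectrum.ext ?_)
    exact (RingHom.injective_iff_ker_eq_bot _).1 (IsFractionRing.injective B F)
  have h1 := residueDegree_comp s f.left ξ
  rw [hξ, residueDegree_of_isPreimmersion s, mul_one] at h1
  rw [← h1, hst, residueDegree_comp, residueDegree_of_isPreimmersion t, one_mul,
    residueDegree_spec_field, hdeg]

end Degree

end

section

/-! ### Cycles on schemes with toric atlases -/

section PrimeCycle

variable {X Y : Scheme.{u}}

open Classical in
lemma primeCycle_apply {ξ : X} {Z : Set X} (hξ : IsGenericPoint ξ Z) (x : X) :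
    primeCycle Z x = if x = ξ then 1 else 0 :=
  if_congr ⟨fun h => h.eq hξ, fun h => h ▸ hξ⟩ rfl rfl

open Classical in
lemma pushforward_primeCycle (f : X ⟶ Y) [IsProper f] {ξ : X} {Z : Set X}
    (hξ : IsGenericPoint ξ Z) :
    pushforward f (primeCycle Z) =
      (if Order.height ξ = Order.height (f ξ) then f.residueDegree ξ else 0) •
        primeCycle (closure {f ξ}) := by
  ext y
  change (∑ᶠ x ∈ f ⁻¹' {y}, primeCycle Z x *
    ((if Order.height x = Order.height (f x) then f.residueDegree x else 0 : ℕ) : ℤ)) =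
    (_ : ℕ) • primeCycle (closure {f ξ}) y
  rw [primeCycle_apply (isGenericPoint_closure (x := f ξ)), finsum_mem_def,
    finsum_eq_single _ ξ fun x hx => ?_]
  · rw [Set.indicator_apply, primeCycle_apply hξ, if_pos rfl, one_mul, Set.mem_preimage,
      Set.mem_singleton_iff]
    by_cases hy : y = f ξ
    · rw [if_pos hy.symm, if_pos hy, nsmul_one]
    · rw [if_neg (Ne.symm hy), if_neg hy, smul_zero]
  · rw [Set.indicator_apply, primeCycle_apply hξ, if_neg hx, zero_mul, ite_self]

end PrimeCycle

section Height

variable (k : Type u) [Field k] {Z : Over (Spec (.of k))}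

lemma trdeg_group (G : Type u) [AddCommGroup G] [Module.Free ℤ G] [Module.Finite ℤ G] :
    Algebra.trdeg k (AddMonoidAlgebra k G) = Module.finrank ℤ G := by
  rw [← trdeg_addMonoidAlgebra k (⊤ : AddSubmonoid G) (by simp)]
  exact (AlgEquiv.trdeg_eq (AddMonoidAlgebra.domCongr k k AddSubmonoid.topEquiv)).symm

variable {k} in
lemma height_specOver [LocallyOfFiniteType Z.hom] {A B : Type u} [CommRing A] [Algebra k A]
    [CommRing B] [IsDomain B] [Algebra k B] {f : A →ₐ[k] B} (hf : Function.Surjective f)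
    (c : affineOver k A ⟶ Z) [IsOpenImmersion c.left] {p : PrimeSpectrum A}
    (hp : p.asIdeal = RingHom.ker f) {n : ℕ} (hn : Algebra.trdeg k B = n) :
    Order.height (c.left p) = (n : ℕ∞) := by
  have h1 : Algebra.trdeg k (A ⧸ p.asIdeal) = n := by
    rw [← hn, hp]
    exact (Ideal.quotientKerAlgEquivOfSurjective hf).trdeg_eq
  rw [height_eq_residueTrdeg, residueTrdeg_chart, h1, Cardinal.toNat_natCast]

namespace Atlas

variable {k} {L M : Type u} [AddCommGroup L] [AddCommGroup M] [Module.Free ℤ M] [Module.Finite ℤ M]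
  (a : Atlas k L Z)

lemma height_torus (i : a.I) {π : L →+ M} (hπ : Function.Surjective π)
    {p : PrimeSpectrum (AddMonoidAlgebra k L)} (hp : p.asIdeal = RingHom.ker (charMap k π)) :
    Order.height ((a.torus i).left p) = (Module.finrank ℤ M : ℕ∞) :=
  have := a.locallyOfFiniteType
  height_specOver (charMap_surjective k hπ) (a.torus i) hp (trdeg_group k M)

variable [Module.Free ℤ L] [Module.Finite ℤ L]

lemma isGenericPoint_univ (i : a.I) :
    IsGenericPoint ((a.torus i).left (⊥ : PrimeSpectrum (AddMonoidAlgebra k L))) Set.univ := by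
  have h1 : (a.torus i).left (⊥ : PrimeSpectrum (AddMonoidAlgebra k L)) =
      (a.chart i).left (⊥ : PrimeSpectrum (AddMonoidAlgebra k (a.S i))) := by
    refine congrArg (a.chart i).left (PrimeSpectrum.ext ?_)
    exact (RingHom.injective_iff_ker_eq_bot _).1
      (charMap_injective k (f := (a.S i).subtype) Subtype.val_injective)
  rw [h1]
  exact a.isGenericPoint_torus i

/-- The closed orbit of a chart has the dimension of a lattice in which its characters have finite
index. -/
lemma height_chart (i : a.I) {π : L →+ M} (hinj : ∀ g ∈ unitGroup (a.S i), π g = 0 → g = 0)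
    (hind : ((unitGroup (a.S i)).map π).index ≠ 0)
    {p : PrimeSpectrum (AddMonoidAlgebra k (a.S i))} (hp : p.asIdeal = nonunitIdeal k (a.S i)) :
    Order.height ((a.chart i).left p) = (Module.finrank ℤ M : ℕ∞) := by
  have := a.locallyOfFiniteType
  have hfree : Module.Free ℤ (unitGroup (a.S i)) :=
    inferInstanceAs (Module.Free ℤ (AddSubgroup.toIntSubmodule (unitGroup (a.S i))))
  have hfinite : Module.Finite ℤ (unitGroup (a.S i)) :=
    inferInstanceAs (Module.Finite ℤ (AddSubgroup.toIntSubmodule (unitGroup (a.S i))))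
  refine height_specOver (unitPart_surjective) (a.chart i) (hp.trans ker_unitPart.symm) ?_
  rw [trdeg_group]
  have hmap : Function.Injective (π.comp (unitGroup (a.S i)).subtype) := by
    rw [injective_iff_map_eq_zero]
    exact fun g hg => Subtype.ext (hinj g g.2 hg)
  have : ((unitGroup (a.S i)).map π).FiniteIndex := ⟨hind⟩
  have h1 := AddSubgroup.finrank_eq_of_finiteIndex ((unitGroup (a.S i)).map π)
  have h2 : Module.finrank ℤ (unitGroup (a.S i)) = Module.finrank ℤ ((unitGroup (a.S i)).map π) := by
    have e := (AddMonoidHom.ofInjective hmap).toIntLinearEquiv.finrank_eq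
    rwa [AddMonoidHom.range_comp, AddSubgroup.range_subtype] at e
  rw [h2, h1]

section Pushforward

variable {L' : Type u} [AddCommGroup L']
  {V : Over (Spec (.of k))} (b : Atlas k L' V) {f : Z ⟶ V} {π : L' →+ M} {κ : M →+ L}

lemma isGenericPoint_image (i : a.I) (j : b.I)
    (h : a.torus i ≫ f = charOver k (κ.comp π) ≫ b.torus j) (hκ : Function.Injective κ) :
    IsGenericPoint (f.left ((a.torus i).left (⊥ : PrimeSpectrum (AddMonoidAlgebra k L))))
      (closure (Set.range (charOver k π ≫ b.torus j).left)) := by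
  have h1 := isGenericPoint_specOver (charMap k π) (b.torus j)
  have h2 : f.left ((a.torus i).left (⊥ : PrimeSpectrum (AddMonoidAlgebra k L))) =
      (b.torus j).left (⟨RingHom.ker (charMap k π), RingHom.ker_isPrime _⟩ :
        PrimeSpectrum (AddMonoidAlgebra k L')) := by
    refine (congrArg (fun g => g.left (⊥ : PrimeSpectrum (AddMonoidAlgebra k L))) h).trans
      (congrArg (b.torus j).left (PrimeSpectrum.ext (Ideal.ext fun x => ?_)))
    change charMap k (κ.comp π) x = 0 ↔ charMap k π x = 0
    rw [← charMap_comp]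
    exact map_eq_zero_iff _ (charMap_injective k hκ)
  rwa [h2]

/-- The image of a proper morphism which is a homomorphism of tori on the tori is the closure of the
image torus. -/
lemma range_eq_closure [IsProper f.left] (i : a.I) (j : b.I)
    (h : a.torus i ≫ f = charOver k (κ.comp π) ≫ b.torus j) (hκ : Function.Injective κ) :
    Set.range f.left = closure (Set.range (charOver k π ≫ b.torus j).left) := by
  have h1 := (a.isGenericPoint_univ i).image f.left.continuous
  rw [Set.image_univ, f.left.isClosedMap.isClosed_range.closure_eq] at h1
  exact h1.def.symm.trans (a.isGenericPoint_image b i j h hκ).def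

/-- The pushforward along a proper morphism which is a homomorphism of tori on the tori: its degree is
the index of the characters, and it vanishes if the dimension drops. -/
lemma pushforward_univ [IsProper f.left] (i : a.I) (j : b.I)
    (h : a.torus i ≫ f = charOver k (κ.comp π) ≫ b.torus j)
    (hπ : Function.Surjective π) (hκ : Function.Injective κ)
    (hfin : Module.finrank ℤ M = Module.finrank ℤ L → κ.range.index ≠ 0) :
    pushforward f.left (primeCycle Set.univ) =
      (if Module.finrank ℤ M = Module.finrank ℤ L then κ.range.index else 0) •
        primeCycle (Set.range f.left) := by
  have hgen := a.isGenericPoint_image b i j h hκ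
  rw [pushforward_primeCycle f.left (a.isGenericPoint_univ i), a.range_eq_closure b i j h hκ, hgen.def]
  congr 1
  have h1 : Order.height ((a.torus i).left (⊥ : PrimeSpectrum (AddMonoidAlgebra k L))) =
      (Module.finrank ℤ L : ℕ∞) :=
    a.height_torus i (π := AddMonoidHom.id L) Function.surjective_id
      ((RingHom.injective_iff_ker_eq_bot _).1 (charMap_injective k Function.injective_id)).symm
  have h2 : Order.height (f.left ((a.torus i).left (⊥ : PrimeSpectrum (AddMonoidAlgebra k L)))) =
      (Module.finrank ℤ M : ℕ∞) := by
    rw [(hgen.eq (isGenericPoint_specOver (charMap k π) (b.torus j)))]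
    exact b.height_torus j hπ rfl
  by_cases hr : Module.finrank ℤ M = Module.finrank ℤ L
  · rw [if_pos hr, if_pos (h1.trans (by rw [h2, hr]))]
    exact a.residueDegree_torus b i j h hπ hκ (hfin hr)
  · rw [if_neg hr, if_neg fun h3 => hr ?_]
    exact (Nat.cast_injective (h1.symm.trans (h3.trans h2))).symm

end Pushforward

end Atlas

end Height

end

section

/-! ### Limits of subtori and rational equivalence -/

section Limit

variable {k : Type u} [Field k] {Z : Over (Spec (.of k))} {L M : Type u} [AddCommGroup L]
  [AddCommGroup M]

namespace Atlas

/-- The cycle `d` is the limit of the translates of the closure of the subtorus given by `π` under the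
one-parameter subgroup `v`: its components are the closures of the closed orbits of the charts which
the family meets, with the lattice indices as multiplicities. -/
def IsLimitCycle (a : Atlas k L Z) (π : L →ₗ[ℤ] M) (v : Module.Dual ℤ L)
    (d : AlgebraicCycle Z.left ℤ) : Prop :=
  ∀ (i : a.I) (p : PrimeSpectrum (AddMonoidAlgebra k (a.S i))), nonunitIdeal k (a.S i) ≤ p.asIdeal →
    (Meets (a.S i) π v ∧ p.asIdeal = nonunitIdeal k (a.S i) →
      d ((a.chart i).left p) = (((unitGroup (a.S i)).map (π : L →+ M)).index : ℤ)) ∧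
    (¬ (Meets (a.S i) π v ∧ p.asIdeal = nonunitIdeal k (a.S i)) → d ((a.chart i).left p) = 0)

variable (a : Atlas k L Z) {π : L →ₗ[ℤ] M} {v : Module.Dual ℤ L} {d : AlgebraicCycle Z.left ℤ}

/-- The limit cycle as a sum over the finitely many charts whose closed orbits the family meets with a
nonzero index. -/
lemma isLimitCycle_finsum [Module.Free ℤ L] [Module.Finite ℤ L] {J : Type*} [Finite J] {c : J → a.I}
    (hc : Function.Injective c)
    {C : J → Set Z.left} (hC : ∀ δ, ∀ p : PrimeSpectrum (AddMonoidAlgebra k (a.S (c δ))),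
      p.asIdeal = nonunitIdeal k (a.S (c δ)) → IsGenericPoint ((a.chart (c δ)).left p) (C δ))
    {m : J → ℕ} (hm : ∀ δ, ((unitGroup (a.S (c δ))).map (π : L →+ M)).index = m δ)
    (hmeets : ∀ δ, Meets (a.S (c δ)) π v)
    (hrange : ∀ i, Meets (a.S i) π v → ((unitGroup (a.S i)).map (π : L →+ M)).index ≠ 0 →
      i ∈ Set.range c) :
    a.IsLimitCycle π v (∑ᶠ δ, m δ • primeCycle (C δ)) := by
  classical
  intro i p hp
  let e : AlgebraicCycle Z.left ℤ →+ ℤ :=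
    AddMonoidHom.mk' (fun d => d ((a.chart i).left p)) fun _ _ => rfl
  have he : (∑ᶠ δ, m δ • primeCycle (C δ) : AlgebraicCycle Z.left ℤ) ((a.chart i).left p) =
      ∑ᶠ δ, m δ • primeCycle (C δ) ((a.chart i).left p) :=
    e.map_finsum (Set.toFinite _)
  rw [he]
  let p₀ : ∀ δ, PrimeSpectrum (AddMonoidAlgebra k (a.S (c δ))) := fun δ =>
    ⟨nonunitIdeal k (a.S (c δ)), inferInstance⟩
  have hne : ∀ δ, ¬ (c δ = i ∧ p.asIdeal = nonunitIdeal k (a.S i)) →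
      primeCycle (C δ) ((a.chart i).left p) = 0 := by
    intro δ h
    rw [primeCycle_apply (hC δ (p₀ δ) rfl), if_neg]
    intro h1
    obtain rfl := a.eq_of_chart_eq _ _ p (p₀ δ) hp le_rfl h1
    refine h ⟨rfl, ?_⟩
    have h2 : p = p₀ δ := (a.chart _).left.isOpenEmbedding.injective h1
    rw [h2]
  refine ⟨fun h => ?_, fun h => ?_⟩
  · by_cases hi : i ∈ Set.range c
    · obtain ⟨δ, rfl⟩ := hi
      rw [finsum_eq_single _ δ fun δ' hδ' => by
        rw [hne δ' fun h' => hδ' (hc h'.1), smul_zero], primeCycle_apply (hC δ p h.2), if_pos rfl,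
        hm, nsmul_one]
    · have h0 : ((unitGroup (a.S i)).map (π : L →+ M)).index = 0 := by
        by_contra h0
        exact hi (hrange i h.1 h0)
      rw [h0, Nat.cast_zero]
      refine finsum_eq_zero_of_forall_eq_zero fun δ => ?_
      rw [hne δ fun h' => hi ⟨δ, h'.1⟩, smul_zero]
  · refine finsum_eq_zero_of_forall_eq_zero fun δ => ?_
    rw [hne δ, smul_zero]
    rintro ⟨rfl, h'⟩
    exact h ⟨hmeets δ, h'⟩

variable {a}

lemma IsLimitCycle.exists_chart (hd : a.IsLimitCycle π v d) {x : Z.left} (hx : d x ≠ 0) :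
    ∃ (i : a.I) (p : PrimeSpectrum (AddMonoidAlgebra k (a.S i))), (a.chart i).left p = x ∧
      p.asIdeal = nonunitIdeal k (a.S i) ∧ Meets (a.S i) π v ∧
        ((unitGroup (a.S i)).map (π : L →+ M)).index ≠ 0 := by
  obtain ⟨i, p, rfl, hp⟩ := a.cover x
  by_cases h : Meets (a.S i) π v ∧ p.asIdeal = nonunitIdeal k (a.S i)
  · refine ⟨i, p, rfl, h.2, h.1, fun h0 => hx ?_⟩
    rw [(hd i p hp).1 h, h0, Nat.cast_zero]
  · exact absurd ((hd i p hp).2 h) hx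

/-- The closure of an orbit is invariant. -/
lemma IsLimitCycle.isInvariant [Module.Free ℤ L] [Module.Finite ℤ L] {D : Type u} [AddCommGroup D]
    [Module.Finite ℤ D]
    {act : affineOver k (AddMonoidAlgebra k D) ⊗ Z ⟶ Z} {φ : L →+ D} (hd : a.IsLimitCycle π v d)
    (h : a.IsToricAction act φ) {x : Z.left} (hx : d x ≠ 0) : IsInvariant act (closure {x}) := by
  obtain ⟨i, p, rfl, hp, -⟩ := hd.exists_chart hx
  have h1 := isGenericPoint_specOver (unitPart k (a.S i)) (a.chart i)
  have h2 : p = ⟨RingHom.ker (unitPart k (a.S i)), RingHom.ker_isPrime _⟩ :=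
    PrimeSpectrum.ext (hp.trans ker_unitPart.symm)
  rw [h2, h1.def]
  refine (isInvariant_range (a := charAct k (φ.comp (unitGroup (a.S i)).subtype)) ?_).closure
  rw [whiskerLeft_comp, Category.assoc, h i, ← Category.assoc, ← Category.assoc, charAct,
    whiskerLeft_ofCoaction k (φ := φ.comp (unitGroup (a.S i)).subtype)]
  refine algHom_ext_single fun s => ?_
  rw [AlgHom.comp_apply, charCoaction_single, Algebra.TensorProduct.productMap_apply_tmul,
    AlgHom.comp_apply, AlgHom.comp_apply, charMap_single]
  by_cases hs : -(s : L) ∈ a.S i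
  · rw [unitPart_single_of_mem hs, charMap_single, charMap_single,
      AddMonoidAlgebra.single_mul_single, mul_one]
    rfl
  · rw [unitPart_single_of_notMem hs, map_zero, map_zero, mul_zero]

variable [Module.Free ℤ M] [Module.Finite ℤ M]

lemma IsLimitCycle.pointHasDim [Module.Free ℤ L] [Module.Finite ℤ L] (hd : a.IsLimitCycle π v d)
    (hinj : ∀ i, Meets (a.S i) π v → ∀ g ∈ unitGroup (a.S i), π g = 0 → g = 0)
    {x : Z.left} (hx : d x ≠ 0) : PointHasDim x (Module.finrank ℤ M) := by
  obtain ⟨i, p, rfl, hp, hmeets, hind⟩ := hd.exists_chart hx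
  exact ⟨_, a.height_chart i (π := (π : L →+ M)) (hinj i hmeets) hind hp, rfl⟩

/-- The closure of a subtorus degenerates to its limit cycle. -/
lemma IsLimitCycle.exists_rationalEquivalence [Module.Free ℤ L] [Module.Finite ℤ L]
    (hd : a.IsLimitCycle π v d) (i₀ : a.I)
    (hπ : Function.Surjective π)
    (hinj : ∀ i, Meets (a.S i) π v → ∀ g ∈ unitGroup (a.S i), π g = 0 → g = 0) :
    ∃ (K : Over (Spec (.of k))) (ι : K ⟶ Z ⊗ projLine k),
      HasDim K.left (Module.finrank ℤ M + 1) ∧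
      Set.range ι.left = closure (Set.range (a.degTorus i₀ π v).left) ∧
      InducesRationalEquivalence ι
        (primeCycle (closure (Set.range (charOver k (π : L →+ M) ≫ a.torus i₀).left))) d := by
  obtain ⟨K, ι, h1, h2, h3, h4, h5, s, t, hst, hs, ht⟩ := a.exists_degeneration i₀ π hπ v hinj
  refine ⟨K, ι, h4, h5, h1, h2, h3, s, t, hst, hs, fun x => ?_⟩
  obtain ⟨i, p, rfl, hp⟩ := a.cover x
  rw [ht i p hp]
  split_ifs with h
  · exact (hd i p hp).1 h
  · exact (hd i p hp).2 h

lemma pointHasDim_subtorus (i : a.I) (hπ : Function.Surjective π) {x : Z.left}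
    (hx : primeCycle (closure (Set.range (charOver k (π : L →+ M) ≫ a.torus i).left)) x ≠ 0) :
    PointHasDim x (Module.finrank ℤ M) := by
  classical
  have h1 := isGenericPoint_specOver (charMap k (π : L →+ M)) (a.torus i)
  rw [primeCycle_apply h1] at hx
  have h2 := (ite_ne_right_iff.1 hx).1
  rw [h2]
  exact ⟨_, a.height_torus i (π := (π : L →+ M)) hπ rfl, rfl⟩

/-- The closure of a subtorus is rationally equivalent to its limit cycle. -/
lemma IsLimitCycle.eqInChow [Module.Free ℤ L] [Module.Finite ℤ L] (hd : a.IsLimitCycle π v d)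
    (i : a.I) (hπ : Function.Surjective π)
    (hinj : ∀ i, Meets (a.S i) π v → ∀ g ∈ unitGroup (a.S i), π g = 0 → g = 0) (n : ℕ) :
    EqInChow Z (Module.finrank ℤ M)
      (n • primeCycle (closure (Set.range (charOver k (π : L →+ M) ≫ a.torus i).left))) (n • d) := by
  have hc : primeCycle (closure (Set.range (charOver k (π : L →+ M) ≫ a.torus i).left)) ∈
      cycles Z (Module.finrank ℤ M) := fun x hx => pointHasDim_subtorus i hπ hx
  have hc' : d ∈ cycles Z (Module.finrank ℤ M) := fun x hx => hd.pointHasDim hinj hx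
  refine ⟨nsmul_mem hc n, nsmul_mem hc' n, ?_⟩
  obtain ⟨K, ι, h1, -, h3⟩ := hd.exists_rationalEquivalence i hπ hinj
  refine ((QuotientAddGroup.eq_iff_sub_mem).2 ?_)
  rw [AddSubgroup.mem_addSubgroupOf]
  have h4 : primeCycle (closure (Set.range (charOver k (π : L →+ M) ≫ a.torus i).left)) - d ∈
      ratCycles Z (Module.finrank ℤ M) :=
    AddSubgroup.subset_closure ⟨K, ι, _, _, h1, h3, rfl⟩
  have h5 := nsmul_mem h4 n
  rwa [smul_sub] at h5

end Atlas

open Atlas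

variable {Q : Type u} [AddCommGroup Q] {act : Toric.torus k Q ⊗ Z ⟶ Z}
  {r m : ℕ} {b : Module.Basis (Fin r) ℤ Q} {actU : Toric.torus k Q ⊗ freeSpace k r m ⟶ freeSpace k r m}

lemma isInvariantInMixed_of_isInvariant
    (hU : actU ≫ freeIncl k r m = (Toric.torus k Q ◁ freeIncl k r m) ≫ affineSpaceAct k b m)
    {C : Set (Z ⊗ freeSpace k r m).left} (h : IsInvariant (diagAct act actU) C) :
    IsInvariantInMixed act b m C := by
  refine IsInvariant.image ?_ h
  have h1 := diagAct_comp (b := act) (b' := act) (f := 𝟙 Z) (by simp) hU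
  rwa [id_tensorHom] at h1

lemma isInvariantInMixedLine_of_isInvariant
    (hU : actU ≫ freeIncl k r m = (Toric.torus k Q ◁ freeIncl k r m) ≫ affineSpaceAct k b m)
    {C : Set ((Z ⊗ freeSpace k r m) ⊗ projLine k).left}
    (h : IsInvariant (diagAct (diagAct act actU) (snd (Toric.torus k Q) (projLine k))) C) :
    IsInvariantInMixedLine act b m C := by
  refine IsInvariant.image ?_ h
  have h1 := diagAct_comp (b := act) (b' := act) (f := 𝟙 Z) (by simp) hU
  rw [id_tensorHom] at h1
  have h2 := diagAct_comp (f := Z ◁ freeIncl k r m) (c := snd (Toric.torus k Q) (projLine k))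
    (c' := snd (Toric.torus k Q) (projLine k)) (g := 𝟙 (projLine k)) h1 (by simp)
  rwa [tensorHom_id] at h2

/-- The rational equivalence of the closure of a subtorus with its limit cycle, on a mixed space: the
degeneration is invariant, as the torus acts through the subtorus. -/
lemma Atlas.IsLimitCycle.eqInStackChow [Module.Free ℤ Q] [Module.Finite ℤ Q]
    {L' M' : Type u} [AddCommGroup L'] [AddCommGroup M'] [Module.Free ℤ L'] [Module.Finite ℤ L'] [Module.Free ℤ M'] [Module.Finite ℤ M']
    {a : Atlas k L' (Z ⊗ freeSpace k r m)} {π : L' →ₗ[ℤ] M'} {v : Module.Dual ℤ L'}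
    {d : AlgebraicCycle (Z ⊗ freeSpace k r m).left ℤ} (hd : a.IsLimitCycle π v d)
    (hU : actU ≫ freeIncl k r m = (Toric.torus k Q ◁ freeIncl k r m) ≫ affineSpaceAct k b m)
    {ψ : M' →+ Module.Dual ℤ Q}
    (hact : a.IsToricAction (diagAct act actU) (ψ.comp (π : L' →+ M')))
    (i : a.I) (hπ : Function.Surjective π)
    (hinj : ∀ i, Meets (a.S i) π v → ∀ g ∈ unitGroup (a.S i), π g = 0 → g = 0) (n : ℕ) {l : ℤ}
    (hl : l + r * m + r = Module.finrank ℤ M') :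
    EqInStackChow act b m l
      (n • primeCycle (closure (Set.range (charOver k (π : L' →+ M') ≫ a.torus i).left)))
      (n • d) := by
  classical
  have hc : primeCycle (closure (Set.range (charOver k (π : L' →+ M') ≫ a.torus i).left)) ∈
      invCycles act b m (l + r * m + r) := by
    rw [hl]
    refine fun x hx => ⟨pointHasDim_subtorus i hπ hx, ?_⟩
    have h1 := isGenericPoint_specOver (charMap k (π : L' →+ M')) (a.torus i)
    rw [primeCycle_apply h1] at hx
    rw [(ite_ne_right_iff.1 hx).1, h1.def]
    exact isInvariantInMixed_of_isInvariant hU (hact.isInvariant_torus i)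
  have hc' : d ∈ invCycles act b m (l + r * m + r) := by
    rw [hl]
    exact fun x hx => ⟨hd.pointHasDim hinj hx, isInvariantInMixed_of_isInvariant hU (hd.isInvariant hact hx)⟩
  refine ⟨nsmul_mem hc n, nsmul_mem hc' n, ?_⟩
  obtain ⟨K, ι, h1, h2, h3⟩ := hd.exists_rationalEquivalence i hπ hinj
  refine ((QuotientAddGroup.eq_iff_sub_mem).2 ?_)
  rw [AddSubgroup.mem_addSubgroupOf]
  have h4 : primeCycle (closure (Set.range (charOver k (π : L' →+ M') ≫ a.torus i).left)) - d ∈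
      invRatCycles act b m (l + r * m + r) := by
    refine AddSubgroup.subset_closure ⟨K, ι, _, _, hl ▸ h1, ?_, h3, rfl⟩
    rw [h2]
    exact isInvariantInMixedLine_of_isInvariant hU (hact.isInvariant_degTorus i v)
  have h5 := nsmul_mem h4 n
  rwa [smul_sub] at h5

end Limit

end

section

/-! ### Limits in products -/

section ProdLimit

variable {k : Type u} [Field k] {L L' M C : Type u} [AddCommGroup L] [AddCommGroup L']
  [AddCommGroup M] [AddCommGroup C] {Z Z' W : Over (Spec (.of k))}

lemma unitGroup_prod (S : AddSubmonoid L) (S' : AddSubmonoid C) :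
    unitGroup (S.prod S') = (unitGroup S).prod (unitGroup S') :=
  AddSubgroup.ext fun _ => ⟨fun h => ⟨⟨h.1.1, h.2.1⟩, ⟨h.1.2, h.2.2⟩⟩,
    fun h => ⟨⟨h.1.1, h.2.1⟩, ⟨h.1.2, h.2.2⟩⟩⟩

lemma index_map_unitGroup_prod (S : AddSubmonoid L) (S' : AddSubmonoid C) (π : L →ₗ[ℤ] M) :
    ((unitGroup (S.prod S')).map
      ((π.prodMap (LinearMap.id : C →ₗ[ℤ] C) : L × C →ₗ[ℤ] M × C) : L × C →+ M × C)).index =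
      ((unitGroup S).map (π : L →+ M)).index * (unitGroup S').index := by
  rw [← AddSubgroup.index_prod]
  congr 1
  ext ⟨x, y⟩
  rw [unitGroup_prod, AddSubgroup.mem_prod]
  constructor
  · rintro ⟨⟨s, c⟩, hs, h⟩
    obtain ⟨rfl, rfl⟩ := Prod.mk.inj h
    exact ⟨⟨s, hs.1, rfl⟩, hs.2⟩
  · rintro ⟨⟨s, hs, h⟩, hy⟩
    exact ⟨(s, y), ⟨hs, hy⟩, Prod.ext h rfl⟩

lemma Meets.of_prod {S : AddSubmonoid L} {S' : AddSubmonoid C} {π : L →ₗ[ℤ] M}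
    {v : Module.Dual ℤ L} (h : Meets (S.prod S') (π.prodMap (LinearMap.id : C →ₗ[ℤ] C))
      (v ∘ₗ LinearMap.fst ℤ L C)) : Meets S π v := by
  obtain ⟨Y, h0, hY⟩ := h
  refine ⟨Y ∘ₗ (LinearMap.inl ℤ M C).prodMap LinearMap.id, h0, fun m hm => ?_⟩
  have h1 := hY (m, 0) ⟨hm, zero_mem _⟩
  exact ⟨h1.1, fun h2 => (h1.2 h2).1⟩

lemma Meets.prod {S : AddSubmonoid L} {S' : AddSubmonoid C} {π : L →ₗ[ℤ] M}
    {v : Module.Dual ℤ L} (h : Meets S π v) (hS' : ∀ c, c ∈ S') :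
    Meets (S.prod S') (π.prodMap (LinearMap.id : C →ₗ[ℤ] C)) (v ∘ₗ LinearMap.fst ℤ L C) := by
  obtain ⟨Y, h0, hY⟩ := h
  exact ⟨Y ∘ₗ (LinearMap.fst ℤ M C).prodMap LinearMap.id, h0, fun m hm =>
    ⟨(hY m.1 hm.1).1, fun h2 => ⟨(hY m.1 hm.1).2 h2, hS' _⟩⟩⟩

namespace Atlas

variable (a : Atlas k L Z) (c : Atlas k C W)

/-- If one chart of the second factor is the torus, each chart of the product contains the product of
the torus with the chart of the first factor. -/
lemma exists_prodChart_eq {i : a.I} {j₀ : c.I} (hj : ∀ l, l ∈ c.S j₀) (j : c.I) :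
    ∃ φ : (a.S i).prod (c.S j) →+ (a.S i).prod (c.S j₀), (∀ x, (φ x : L × C) = x) ∧
      charOver k φ ≫ a.prodChart c (i, j) = a.prodChart c (i, j₀) := by
  let ι : c.S j →+ c.S j₀ := (c.S j).subtype.codRestrict (c.S j₀) fun x => hj _
  let τ : C →+ c.S j₀ := (AddMonoidHom.id C).codRestrict (c.S j₀) hj
  let φ : (a.S i).prod (c.S j) →+ (a.S i).prod (c.S j₀) :=
    ((a.S i).prod (c.S j)).subtype.codRestrict ((a.S i).prod (c.S j₀)) fun x => ⟨x.2.1, hj _⟩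
  have h1 : charOver k ι ≫ c.chart j = c.chart j₀ := by
    have h2 := congrArg (charOver k τ ≫ ·) (c.compat j j₀)
    simp only [← Category.assoc, charOver_comp] at h2
    have h3 : τ.comp (c.S j₀).subtype = AddMonoidHom.id _ := rfl
    have h4 : charMap k (AddMonoidHom.id (c.S j₀)) = AlgHom.id k _ :=
      algHom_ext_single fun m => by rw [charMap_single]; rfl
    have h5 : charOver k (AddMonoidHom.id (c.S j₀)) = 𝟙 _ := by
      rw [charOver, h4]
      exact Over.OverMorphism.ext (Spec.map_id _)
    rw [h3, h5, Category.id_comp] at h2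
    exact h2
  refine ⟨φ, fun _ => rfl, CartesianMonoidalCategory.hom_ext _ _ ?_ ?_⟩
  · rw [Category.assoc, prodChart_fst, prodChart_fst, ← Category.assoc, charOver_comp]
    rfl
  · rw [Category.assoc, prodChart_snd, prodChart_snd, ← Category.assoc, charOver_comp]
    change charOver k ((inrSub (a.S i) (c.S j₀)).comp ι) ≫ c.chart j = _
    rw [← charOver_comp, Category.assoc, h1]

/-- The generic point of the product of an orbit closure with the second factor. -/
lemma isGenericPoint_prod [Module.Free ℤ L] [Module.Finite ℤ L] [UniversallyOpen W.hom] {i : a.I}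
    {j₀ : c.I} (hj : ∀ l, l ∈ c.S j₀)
    {A : Set Z.left} (hA : ∀ p : PrimeSpectrum (AddMonoidAlgebra k (a.S i)),
      p.asIdeal = nonunitIdeal k (a.S i) → IsGenericPoint ((a.chart i).left p) A)
    (q : PrimeSpectrum (AddMonoidAlgebra k ((a.S i).prod (c.S j₀))))
    (hq : q.asIdeal = nonunitIdeal k ((a.S i).prod (c.S j₀))) :
    IsGenericPoint ((a.prodChart c (i, j₀)).left q) ((fst Z W).left ⁻¹' A) := by
  let p₀ : PrimeSpectrum (AddMonoidAlgebra k (a.S i)) := ⟨nonunitIdeal k (a.S i), inferInstance⟩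
  have hA := hA p₀ rfl
  have hfst : ∀ j (w : PrimeSpectrum (AddMonoidAlgebra k ((a.S i).prod (c.S j)))),
      (fst Z W).left ((a.prodChart c (i, j)).left w) =
        (a.chart i).left ((charOver k (inlSub (a.S i) (c.S j))).left w) := fun j w =>
    congrArg (fun g => g.left w) (a.prodChart_fst c (i, j))
  rw [isGenericPoint_def]
  refine subset_antisymm (closure_minimal ?_ ?_) fun y hy => ?_
  · have h1 : (a.chart i).left p₀ ⤳
        (a.chart i).left ((charOver k (inlSub (a.S i) (c.S j₀))).left q) :=
      Specializes.map ((PrimeSpectrum.le_iff_specializes p₀ _).1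
        (nonunitIdeal_le_comap_inlSub hq.ge)) (a.chart i).left.continuous
    rw [specializes_iff_mem_closure, hA.def, ← hfst] at h1
    exact Set.singleton_subset_iff.2 h1
  · exact (hA.def ▸ isClosed_closure).preimage (fst Z W).left.continuous
  · rw [mem_closure_iff]
    intro U hU hyU
    -- As the projection is open, `U` meets the fibre of the generic point of `A`.
    obtain ⟨u, huU, hu⟩ : ∃ u ∈ U, (fst Z W).left u = (a.chart i).left p₀ := by
      have h1 : (fst Z W).left y ∈ closure {(a.chart i).left p₀} := hA.def ▸ hy
      obtain ⟨_, ⟨u, huU, hu⟩, h2⟩ := mem_closure_iff.1 h1 _ (isOpenMap_fst U hU) ⟨y, hyU, rfl⟩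
      exact ⟨u, huU, hu.trans h2⟩
    obtain ⟨⟨i', j⟩, w, rfl, hw⟩ := (a.prod c).cover u
    change (fst Z W).left ((a.prodChart c (i', j)).left w) = _ at hu
    have h3 : (fst Z W).left ((a.prodChart c (i', j)).left w) =
        (a.chart i').left ((charOver k (inlSub (a.S i') (c.S j))).left w) :=
      congrArg (fun g => g.left w) (a.prodChart_fst c (i', j))
    obtain rfl := a.eq_of_chart_eq i' i _ p₀ (nonunitIdeal_le_comap_inlSub hw) le_rfl
      (h3.symm.trans hu)
    have h4 : (charOver k (inlSub (a.S i') (c.S j))).left w = p₀ :=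
      (a.chart i').left.isOpenEmbedding.injective (h3.symm.trans hu)
    obtain ⟨φ, hφ, h5⟩ := a.exists_prodChart_eq c (i := i') hj j
    refine ⟨_, Specializes.mem_open ?_ hU huU, rfl⟩
    have h6 : (a.prodChart c (i', j₀)).left q =
        (a.prodChart c (i', j)).left ((charOver k φ).left q) :=
      congrArg (fun g => g.left q) h5.symm
    rw [h6]
    refine Specializes.map ((PrimeSpectrum.le_iff_specializes _ _).1 ?_)
      (a.prodChart c (i', j)).left.continuous
    intro x hx
    replace hx : charMap k φ x ∈ q.asIdeal := hx
    rw [hq, mem_nonunitIdeal] at hx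
    have h7 : x ∈ Ideal.span (AddMonoidAlgebra.of' k _ ''
        {m : (a.S i').prod (c.S j) | -(m : L × C).1 ∉ a.S i'}) := by
      rw [AddMonoidAlgebra.mem_ideal_span_of'_image]
      refine fun m hm => ⟨m, fun h => Finsupp.mem_support_iff.1 hm ?_, 0, (zero_add m).symm⟩
      rw [← hx (φ m) (by rw [hφ]; exact ⟨h, hj _⟩), coeff_charMap]
      exact fun _ _ h' => Subtype.ext (by rw [← hφ, h', hφ])
    refine (Ideal.span_le (I := w.asIdeal)).2 ?_ h7
    rintro _ ⟨⟨⟨s, t⟩, hs, ht⟩, hm, rfl⟩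
    have h8 : (AddMonoidAlgebra.of' k _ (⟨(s, t), hs, ht⟩ : (a.S i').prod (c.S j)) :
        AddMonoidAlgebra k ((a.S i').prod (c.S j))) =
        charMap k (inlSub _ _) (AddMonoidAlgebra.single ⟨s, hs⟩ 1) *
          charMap k (inrSub _ _) (AddMonoidAlgebra.single ⟨t, ht⟩ 1) := by
      rw [charMap_single, charMap_single, AddMonoidAlgebra.single_mul_single, mul_one]
      exact congrArg (AddMonoidAlgebra.single · 1) (Subtype.ext (by simp [inlSub, inrSub]))
    rw [h8]
    refine Ideal.mul_mem_right _ _ ?_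
    have h9 : (AddMonoidAlgebra.single (⟨s, hs⟩ : a.S i') 1 : AddMonoidAlgebra k (a.S i')) ∈
        p₀.asIdeal := single_mem_nonunitIdeal.2 hm
    rw [← h4] at h9
    exact h9

/-- The product of a homomorphism of tori with the identity of `W`, on the tori. -/
lemma prod_torus_whiskerRight (b : Atlas k L' Z') {f : Z ⟶ Z'} {π : L' →ₗ[ℤ] M} {κ : M →+ L}
    {i : a.I} {j : b.I} (h : a.torus i ≫ f = charOver k (κ.comp (π : L' →+ M)) ≫ b.torus j)
    (J : c.I) : (a.prod c).torus (i, J) ≫ (f ▷ W) =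
      charOver k ((κ.prodMap (AddMonoidHom.id C)).comp
        ((π.prodMap (LinearMap.id : C →ₗ[ℤ] C) : L' × C →ₗ[ℤ] M × C) : L' × C →+ M × C)) ≫
        (b.prod c).torus (j, J) := by
  rw [prod_torus, prod_torus]
  refine CartesianMonoidalCategory.hom_ext _ _ ?_ ?_
  · rw [Category.assoc, whiskerRight_fst, lift_fst_assoc, Category.assoc, h, Category.assoc,
      lift_fst, ← Category.assoc, ← Category.assoc, charOver_comp, charOver_comp]
    rfl
  · rw [Category.assoc, whiskerRight_snd, lift_snd, Category.assoc, lift_snd, ← Category.assoc,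
      charOver_comp]
    congr 2
    exact AddMonoidHom.ext fun x => Prod.ext (by simp) rfl

variable {π : L →ₗ[ℤ] M} {v : Module.Dual ℤ L}

lemma eq_zero_of_meets_prod
    (hinj : ∀ i, Meets (a.S i) π v → ∀ g ∈ unitGroup (a.S i), π g = 0 → g = 0)
    (i : (a.prod c).I) (h : Meets ((a.prod c).S i) (π.prodMap (LinearMap.id : C →ₗ[ℤ] C))
      (v ∘ₗ LinearMap.fst ℤ L C)) (g : L × C) (hg : g ∈ unitGroup ((a.prod c).S i))
    (h0 : π.prodMap (LinearMap.id : C →ₗ[ℤ] C) g = 0) : g = 0 :=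
  Prod.ext (hinj i.1 (Meets.of_prod h) g.1 ⟨hg.1.1, hg.2.1⟩ (congrArg Prod.fst h0))
    (Prod.mk.inj (show (π g.1, g.2) = ((0 : M), (0 : C)) from h0)).2

/-- Limit cycles are compatible with the product with a scheme one of whose charts is a torus. -/
lemma isLimitCycle_prod_finsum [Module.Free ℤ L] [Module.Finite ℤ L] [Module.Free ℤ C]
    [Module.Finite ℤ C] [UniversallyOpen W.hom]
    {J : Type*} [Finite J] {ι : J → a.I} (hι : Function.Injective ι) {A : J → Set Z.left}
    (hA : ∀ δ, ∀ p : PrimeSpectrum (AddMonoidAlgebra k (a.S (ι δ))),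
      p.asIdeal = nonunitIdeal k (a.S (ι δ)) → IsGenericPoint ((a.chart (ι δ)).left p) (A δ))
    {m : J → ℕ} (hm : ∀ δ, ((unitGroup (a.S (ι δ))).map (π : L →+ M)).index = m δ)
    (hmeets : ∀ δ, Meets (a.S (ι δ)) π v)
    (hrange : ∀ i, Meets (a.S i) π v → ((unitGroup (a.S i)).map (π : L →+ M)).index ≠ 0 →
      i ∈ Set.range ι) {j₀ : c.I} (hj : ∀ l, l ∈ c.S j₀)
    (hj' : ∀ j, (unitGroup (c.S j)).index ≠ 0 → j = j₀) :
    (a.prod c).IsLimitCycle (π.prodMap (LinearMap.id : C →ₗ[ℤ] C)) (v ∘ₗ LinearMap.fst ℤ L C)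
      (∑ᶠ δ, m δ • primeCycle ((fst Z W).left ⁻¹' A δ)) := by
  have hindex : ∀ i : (a.prod c).I, ((unitGroup ((a.prod c).S i)).map
      ((π.prodMap (LinearMap.id : C →ₗ[ℤ] C) : L × C →ₗ[ℤ] M × C) : L × C →+ M × C)).index =
      ((unitGroup (a.S i.1)).map (π : L →+ M)).index * (unitGroup (c.S i.2)).index := fun i =>
    index_map_unitGroup_prod _ _ _
  have h1 : unitGroup (c.S j₀) = ⊤ := (AddSubgroup.eq_top_iff' _).2 fun x => ⟨hj _, hj _⟩
  refine (a.prod c).isLimitCycle_finsum (c := fun δ => (ι δ, j₀))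
    (fun δ δ' h => hι (congrArg Prod.fst h)) (fun δ p hp => a.isGenericPoint_prod c hj (hA δ) p hp)
    (fun δ => ?_) (fun δ => (hmeets δ).prod hj) fun i h h' => ?_
  · refine (hindex (ι δ, j₀)).trans ?_
    change ((unitGroup (a.S (ι δ))).map (π : L →+ M)).index * (unitGroup (c.S j₀)).index = m δ
    rw [h1, AddSubgroup.index_top, mul_one, hm]
  · replace h' := (hindex i).symm.trans_ne h'
    obtain ⟨δ, hδ⟩ := hrange i.1 (Meets.of_prod h) (left_ne_zero_of_mul h')
    exact ⟨δ, Prod.ext hδ (hj' _ (right_ne_zero_of_mul h')).symm⟩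

end Atlas

end ProdLimit

end

section

/-! ### Duals of maps of lattices, and the torus of `(𝔸^m ∖ 0)^r` -/

section Factorization

variable {A B : Type u} [AddCommGroup A] [Module.Free ℤ A] [Module.Finite ℤ A] [AddCommGroup B]
  [Module.Free ℤ B] [Module.Finite ℤ B]

/-- The dual of a map of lattices factors through the dual of the saturation of the image; if the map
is injective, the second factor has the index of the image in its saturation. -/
lemma exists_dual_factorization (g : A →ₗ[ℤ] B) {P : Submodule ℤ B} (hP : LinearMap.range g = P) :
    ∃ κ : Module.Dual ℤ (saturation P) →+ Module.Dual ℤ A,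
      (g.dualMap : Module.Dual ℤ B →+ Module.Dual ℤ A) =
        κ.comp ((saturation P).subtype.dualMap :
          Module.Dual ℤ B →+ Module.Dual ℤ (saturation P)) ∧
      Function.Injective κ ∧
      (Module.finrank ℤ (Module.Dual ℤ (saturation P)) = Module.finrank ℤ (Module.Dual ℤ A) →
        κ.range.index = P.toAddSubgroup.relIndex (saturation P).toAddSubgroup) := by
  let h : A →ₗ[ℤ] saturation P := g.codRestrict _ fun x => le_saturation P (hP ▸ ⟨x, rfl⟩)
  have hindex : (LinearMap.range h).toAddSubgroup.index =
      P.toAddSubgroup.relIndex (saturation P).toAddSubgroup := by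
    have h1 : (LinearMap.range h).toAddSubgroup =
        P.toAddSubgroup.addSubgroupOf (saturation P).toAddSubgroup := by
      ext x
      rw [AddSubgroup.mem_addSubgroupOf]
      change x ∈ LinearMap.range h ↔ (x : B) ∈ P
      have h2 : (x : B) ∈ P ↔ (x : B) ∈ LinearMap.range g := by rw [hP]
      rw [h2]
      exact ⟨fun ⟨y, hy⟩ => ⟨y, congrArg Subtype.val hy⟩, fun ⟨y, hy⟩ => ⟨y, Subtype.ext hy⟩⟩
    rw [h1]
    rfl
  have hne := finite_saturation_quotient P
  rw [← hindex] at hne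
  have hfin : Finite (saturation P ⧸ LinearMap.range h) := AddSubgroup.index_ne_zero_iff_finite.1 hne
  refine ⟨h.dualMap.toAddMonoidHom, rfl, ?_, fun hr => ?_⟩
  · rw [injective_iff_map_eq_zero]
    intro m hm
    ext x
    obtain ⟨y, hy⟩ := (LinearMap.range h).toAddSubgroup.nsmul_index_mem x
    have h2 : m (h y) = 0 := LinearMap.congr_fun hm y
    rw [hy, map_nsmul, smul_eq_zero] at h2
    exact h2.resolve_left hne
  · rw [Module.finrank_linearMap_self, Module.finrank_linearMap_self] at hr
    have hker : Module.finrank ℤ (LinearMap.ker h) = 0 := by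
      have h1 := finrank_range_add_ker h
      have h2 := (Submodule.finiteQuotient_iff (LinearMap.range h)).1 hfin
      omega
    have hinj : Function.Injective h := by
      rw [← LinearMap.ker_eq_bot]
      exact Submodule.finrank_eq_zero.1 hker
    rw [← hindex, ← index_range_dualMap h hinj hr.symm]
    rfl

end Factorization

section Free

variable {k : Type u} [Field k] {r m : ℕ}

instance : UniversallyOpen (freeSpace k r m).hom := by
  have := universallyOpen_affineOver (k := k) (MvPolynomial (Fin r × Fin m) k)
  exact inferInstanceAs (UniversallyOpen ((freeLocus k r m).ι ≫ (affineSpace k r m).hom))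

lemma finrank_coord : Module.finrank ℤ (Coord.{u} r m) = r * m := by
  simp [Coord]

lemma Atlas.isEmpty {L : Type u} [AddCommGroup L] {Z : Over (Spec (.of k))} (a : Atlas k L Z)
    [IsEmpty a.I] : IsEmpty Z.left :=
  ⟨fun x => isEmptyElim (a.cover x).choose⟩

lemma coordMonoid_empty (x : Coord.{u} r m) : x ∈ coordMonoid (∅ : Set (ULift.{u} (Fin r × Fin m))) :=
  fun _ h => h.elim

/-- Only the torus chart has a closed orbit of full dimension. -/
lemma eq_empty_of_index_ne_zero {J : Set (ULift.{u} (Fin r × Fin m))}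
    (h : (unitGroup (coordMonoid J)).index ≠ 0) : J = ∅ := by
  refine Set.eq_empty_of_forall_notMem fun p hp => h ?_
  have h1 := ((unitGroup (coordMonoid J)).nsmul_index_mem (Pi.single p 1)).2 p hp
  simp at h1
  omega

end Free

end

section

/-! ### The limit of the image of a stratum -/

section Degeneration

variable {N_X N_Y : Type u} [AddCommGroup N_X] [Module.Free ℤ N_X] [Module.Finite ℤ N_X]
  [AddCommGroup N_Y] {X : Fan N_X} {f : N_Y →ₗ[ℤ] N_X} {τ' : X.cones} {v : N_X}

/-- The characters of the torus of the stratum of a cone. -/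
abbrev StratumChar (τ' : X.cones) : Type u := Module.Dual ℤ (N_X ⧸ coneLattice τ'.1)

/-- The characters of the image torus: the dual of the lattice `N'`. -/
abbrev ImageChar (f : N_Y →ₗ[ℤ] N_X) (τ' : X.cones) : Type u :=
  Module.Dual ℤ (saturation (imageInQuotient f τ'.1))

/-- The restriction of characters to the image torus. -/
noncomputable abbrev imageRestrict (f : N_Y →ₗ[ℤ] N_X) (τ' : X.cones) :
    StratumChar τ' →ₗ[ℤ] ImageChar f τ' :=
  (saturation (imageInQuotient f τ'.1)).subtype.dualMap

variable (k : Type u) [Field k]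

/-- The limit of the image of a stratum in the direction of a generic vector is the sum of the strata
of the displacement cones, and the same holds after taking the product with `(𝔸^m ∖ 0)^r`. -/
lemma IsGenericVector.exists_isLimitCycle (hv : IsGenericVector X f τ' v) {t : N_Y}
    (ht : IsInteriorPoint τ'.1 (f t)) :
    ∃ v' : Module.Dual ℤ (StratumChar τ'),
      (∀ i : (X.stratumAtlas k τ').I, Meets ((X.stratumAtlas k τ').S i) (imageRestrict f τ') v' →
        ∀ g ∈ unitGroup ((X.stratumAtlas k τ').S i), imageRestrict f τ' g = 0 → g = 0) ∧
      (X.stratumAtlas k τ').IsLimitCycle (imageRestrict f τ') v'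
        (∑ᶠ δ : displacementCones X f τ' v,
          orbitIndex f τ'.1 δ.1.1 • primeCycle (X.substratum k τ' δ)) ∧
      ∀ (r m : ℕ) (_ : Nonempty (freeAtlas (k := k) r m).I),
        (∀ i : ((X.stratumAtlas k τ').prod (freeAtlas (k := k) r m)).I,
          Meets (((X.stratumAtlas k τ').prod (freeAtlas (k := k) r m)).S i)
            ((imageRestrict f τ').prodMap LinearMap.id) (v' ∘ₗ LinearMap.fst ℤ _ _) →
          ∀ g ∈ unitGroup (((X.stratumAtlas k τ').prod (freeAtlas (k := k) r m)).S i),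
            (imageRestrict f τ').prodMap LinearMap.id g = 0 → g = 0) ∧
        ((X.stratumAtlas k τ').prod (freeAtlas (k := k) r m)).IsLimitCycle
          ((imageRestrict f τ').prodMap LinearMap.id) (v' ∘ₗ LinearMap.fst ℤ _ _)
          (∑ᶠ δ : displacementCones X f τ' v,
            orbitIndex f τ'.1 δ.1.1 • quotientCycle r m (X.substratum k τ' δ)) := by
  have := free_quotient_coneLattice (X.rational _ τ'.2)
  have hfin : Finite X.cones := X.finite.to_subtype
  obtain ⟨w, hw⟩ := hv.exists_direction ht
  let a := X.stratumAtlas k τ'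
  let c : displacementCones X f τ' v → a.I := fun δ => ⟨δ.1, δ.2.1⟩
  have hc : Function.Injective c := fun δ δ' h =>
    Subtype.ext (congrArg (fun i : a.I => i.1) h)
  have hinj : ∀ i : a.I, Meets (a.S i) (imageRestrict f τ') (Module.Dual.eval ℤ _ w) →
      ∀ g ∈ unitGroup (a.S i), imageRestrict f τ' g = 0 → g = 0 := fun i => (hw i.1 i.2).1
  have hmeets : ∀ δ, Meets (a.S (c δ)) (imageRestrict f τ') (Module.Dual.eval ℤ _ w) := fun δ =>
    ((hw δ.1 δ.2.1).2.1 δ.2).1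
  have hrange : ∀ i : a.I, Meets (a.S i) (imageRestrict f τ') (Module.Dual.eval ℤ _ w) →
      ((unitGroup (a.S i)).map (imageRestrict f τ' : StratumChar τ' →+
        ImageChar f τ')).index ≠ 0 → i ∈ Set.range c := by
    intro i h h'
    have hi : i.1 ∈ displacementCones X f τ' v := (hw i.1 i.2).2.2 ⟨h, h'⟩
    exact ⟨⟨i.1, hi⟩, Subtype.ext rfl⟩
  have hC : ∀ δ, ∀ p : PrimeSpectrum (AddMonoidAlgebra k (a.S (c δ))),
      p.asIdeal = nonunitIdeal k (a.S (c δ)) →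
        IsGenericPoint ((a.chart (c δ)).left p) (X.substratum k τ' δ) := fun δ p hp =>
    X.isGenericPoint_substratum k δ.2.1 p hp
  refine ⟨Module.Dual.eval ℤ _ w, hinj,
    a.isLimitCycle_finsum hc hC (fun _ => rfl) hmeets hrange, fun r m hI => ?_⟩
  let J₀ : (freeAtlas (k := k) r m).I := ⟨∅, fun i => (hI.some.2 i).imp fun _ _ h => h⟩
  exact ⟨a.eq_zero_of_meets_prod _ hinj, a.isLimitCycle_prod_finsum _ hc hC (fun _ => rfl) hmeets
    hrange (j₀ := J₀) coordMonoid_empty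
    fun j h => Subtype.ext (eq_empty_of_index_ne_zero h)⟩

/-- The indices `m(δ)` are the multiplicities of the limit cycle times the degree of the stratum over
its image torus. -/
lemma IsGenericVector.finsum_displacementIndex (hv : IsGenericVector X f τ' v) {t : N_Y}
    (ht : IsInteriorPoint τ'.1 (f t)) {G : Type*} [AddCommGroup G] (z : X.cones → G) :
    (∑ᶠ δ ∈ displacementCones X f τ' v, displacementIndex f δ.1 • z δ) =
      saturationIndex f τ'.1 •
        ∑ᶠ δ : displacementCones X f τ' v, orbitIndex f τ'.1 δ.1.1 • z δ := by
  have hfin : Finite X.cones := X.finite.to_subtype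
  rw [← finsum_set_coe_eq_finsum_mem]
  refine Eq.trans (finsum_congr fun δ => ?_)
    ((nsmulAddMonoidHom (α := G) (saturationIndex f τ'.1)).map_finsum (Set.toFinite _)).symm
  rw [(hv.displacementIndex_eq ht δ.2).1, mul_smul]
  rfl

lemma IsGenericVector.finsum_orbitIndex (hv : IsGenericVector X f τ' v) {t : N_Y}
    (ht : IsInteriorPoint τ'.1 (f t)) {G : Type*} [AddCommGroup G] (z : X.cones → G)
    (h0 : saturationIndex f τ'.1 ≠ 0) :
    (∑ᶠ δ ∈ displacementCones X f τ' v,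
      (displacementIndex f δ.1 / saturationIndex f τ'.1) • z δ) =
        ∑ᶠ δ : displacementCones X f τ' v, orbitIndex f τ'.1 δ.1.1 • z δ := by
  rw [← finsum_set_coe_eq_finsum_mem]
  refine finsum_congr fun δ => ?_
  rw [(hv.displacementIndex_eq ht δ.2).1, Nat.mul_div_cancel_left _ (Nat.pos_of_ne_zero h0)]

end Degeneration

end

section

/-! ### The pushforward of a stratum -/

section Surjective

variable {A : Type*} [AddCommGroup A] [Module.Finite ℤ A]

lemma dualMap_subtype_saturation_surjective (P : Submodule ℤ A) :
    Function.Surjective (saturation P).subtype.dualMap := by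
  have : Module.Free ℤ (A ⧸ saturation P) := free_quotient_of_saturated fun n x hn hx => by
    obtain ⟨c, hc, h⟩ := mem_saturation.1 hx
    exact mem_saturation.2 ⟨c * n, mul_ne_zero hc hn, by rwa [mul_smul]⟩
  obtain ⟨s, hs⟩ := Module.projective_lifting_property (saturation P).mkQ LinearMap.id
    (Submodule.mkQ_surjective _)
  intro m
  have h1 : ∀ x, x - s ((saturation P).mkQ x) ∈ saturation P := fun x => by
    rw [← Submodule.Quotient.mk_eq_zero, Submodule.Quotient.mk_sub]
    exact sub_eq_zero.2 (LinearMap.congr_fun hs ((saturation P).mkQ x)).symm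
  refine ⟨m ∘ₗ (LinearMap.id - s ∘ₗ (saturation P).mkQ).codRestrict _ h1, ?_⟩
  ext x
  refine congrArg m (Subtype.ext ?_)
  change (x : A) - s ((saturation P).mkQ x) = x
  rw [(Submodule.mkQ_apply _ _).trans ((Submodule.Quotient.mk_eq_zero _).2 x.2), map_zero, sub_zero]

end Surjective

section Pushforward

variable (k : Type u) [Field k] {N_X N_Y : Type u} [AddCommGroup N_X] [Module.Finite ℤ N_X]
  [AddCommGroup N_Y] {X : Fan N_X} {Y : Fan N_Y} {f : N_Y →ₗ[ℤ] N_X} {τ : Y.cones} {τ' : X.cones}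

lemma saturationIndex_ne_zero : saturationIndex f τ'.1 ≠ 0 :=
  finite_saturation_quotient _

variable [Module.Free ℤ N_X]

lemma imageRestrict_surjective : Function.Surjective (imageRestrict f τ') :=
  have := free_quotient_coneLattice (X.rational _ τ'.2)
  dualMap_subtype_saturation_surjective _

variable [Module.Free ℤ N_Y] [Module.Finite ℤ N_Y]

/-- The homomorphism of tori given by the restriction of a toric morphism to a stratum factors through
the image torus. -/
lemma IsSmallestCone.exists_torus_factorization (hτ : IsSmallestCone f τ τ') (hf : IsFanMap Y X f) :
    ∃ κ : ImageChar f τ' →+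
        StratumChar τ,
      (∀ i j, (Y.stratumAtlas k τ).torus i ≫ stratumMap k f hf hτ =
        charOver k (κ.comp (imageRestrict f τ' : StratumChar τ' →+ ImageChar f τ')) ≫ (X.stratumAtlas k τ').torus j) ∧
      Function.Injective κ ∧
      (Module.finrank ℤ (ImageChar f τ') =
          Module.finrank ℤ (StratumChar τ) →
        κ.range.index = saturationIndex f τ'.1) := by
  have := free_quotient_coneLattice (X.rational _ τ'.2)
  have := free_quotient_coneLattice (Y.rational _ τ.2)
  have hP : LinearMap.range hτ.latticeMap = imageInQuotient f τ'.1 := by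
    rw [imageInQuotient, IsSmallestCone.latticeMap, ← Submodule.mapQ_mkQ (h := hτ.coneLattice_le),
      LinearMap.range_comp_of_range_eq_top _ (Submodule.range_mkQ _)]
  obtain ⟨κ, h1, h2, h3⟩ := exists_dual_factorization hτ.latticeMap hP
  refine ⟨κ, fun i j => ?_, h2, h3⟩
  rw [torus_stratumMap k hf hτ i j, h1]

/-- The ranks of the two tori agree if and only if the map of strata is generically finite. -/
lemma finrank_dual_saturation_eq_iff :
    Module.finrank ℤ (ImageChar f τ') =
        Module.finrank ℤ (StratumChar τ) ↔
      Module.finrank ℤ (imageInQuotient f τ'.1) + Module.finrank ℤ (coneLattice τ.1) =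
        Module.finrank ℤ N_Y := by
  have := free_quotient_coneLattice (X.rational _ τ'.2)
  have := free_quotient_coneLattice (Y.rational _ τ.2)
  have h1 := Submodule.finrank_quotient_add_finrank (coneLattice τ.1)
  rw [Module.finrank_linearMap_self, Module.finrank_linearMap_self, finrank_saturation]
  omega

variable (hf : IsFanMap Y X f) (hτ : IsSmallestCone f τ τ')
  [IsProper (toricMorphism k f hf).left]

/-- The image of a stratum is the closure of the image torus. -/
lemma range_stratumMap (j : (X.stratumAtlas k τ').I) : Set.range (stratumMap k f hf hτ).left =
    closure (Set.range (charOver k (imageRestrict f τ' : StratumChar τ' →+ ImageChar f τ') ≫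
      (X.stratumAtlas k τ').torus j).left) := by
  have := free_quotient_coneLattice (X.rational _ τ'.2)
  have := free_quotient_coneLattice (Y.rational _ τ.2)
  obtain ⟨κ, h1, h2, -⟩ := hτ.exists_torus_factorization k hf
  exact (Y.stratumAtlas k τ).range_eq_closure (X.stratumAtlas k τ') ⟨τ, le_rfl⟩ j (h1 _ _) h2

/-- The degree of a stratum over its image is the index of the lattice in its saturation. -/
lemma pushforward_stratumMap :
    pushforward (stratumMap k f hf hτ).left (primeCycle Set.univ) =
      (if Module.finrank ℤ (imageInQuotient f τ'.1) + Module.finrank ℤ (coneLattice τ.1) =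
        Module.finrank ℤ N_Y then saturationIndex f τ'.1 else 0) •
        primeCycle (Set.range (stratumMap k f hf hτ).left) := by
  have := free_quotient_coneLattice (X.rational _ τ'.2)
  have := free_quotient_coneLattice (Y.rational _ τ.2)
  obtain ⟨κ, h1, h2, h3⟩ := hτ.exists_torus_factorization k hf
  have h4 := (Y.stratumAtlas k τ).pushforward_univ (X.stratumAtlas k τ') ⟨τ, le_rfl⟩ ⟨τ', le_rfl⟩
    (h1 _ _) imageRestrict_surjective h2 fun hr => (h3 hr).trans_ne saturationIndex_ne_zero
  rw [h4]
  congr 1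
  by_cases hr : Module.finrank ℤ (ImageChar f τ') =
        Module.finrank ℤ (StratumChar τ)
  · rw [if_pos hr, if_pos (finrank_dual_saturation_eq_iff.1 hr), h3 hr]
  · rw [if_neg hr, if_neg fun h => hr (finrank_dual_saturation_eq_iff.2 h)]

/-- The product of the map of strata with `(𝔸^m ∖ 0)^r` is given on characters by
the product with the identity, so the degree is the same. -/
lemma pushforward_stratumMap_whiskerRight (r m : ℕ)
    (j : ((X.stratumAtlas k τ').prod (freeAtlas (k := k) r m)).I) :
    pushforward (stratumMap k f hf hτ ▷ freeSpace k r m).left (quotientCycle r m Set.univ) =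
      (if Module.finrank ℤ (imageInQuotient f τ'.1) + Module.finrank ℤ (coneLattice τ.1) =
        Module.finrank ℤ N_Y then saturationIndex f τ'.1 else 0) •
        primeCycle (closure (Set.range (charOver k
          (((imageRestrict f τ').prodMap LinearMap.id :
            StratumChar τ' × Coord.{u} r m →ₗ[ℤ] ImageChar f τ' × Coord.{u} r m) :
              StratumChar τ' × Coord.{u} r m →+ ImageChar f τ' × Coord.{u} r m) ≫
          ((X.stratumAtlas k τ').prod (freeAtlas (k := k) r m)).torus j).left)) := by
  have := free_quotient_coneLattice (X.rational _ τ'.2)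
  have := free_quotient_coneLattice (Y.rational _ τ.2)
  obtain ⟨κ, h1, h2, h3⟩ := hτ.exists_torus_factorization k hf
  let a := Y.stratumAtlas k τ
  let b := X.stratumAtlas k τ'
  let c := freeAtlas (k := k) r m
  have h5 := a.prod_torus_whiskerRight c b (i := ⟨τ, le_rfl⟩) (j := j.1) (h1 ⟨τ, le_rfl⟩ j.1) j.2
  have h6 : Function.Injective (κ.prodMap (AddMonoidHom.id (Coord.{u} r m))) :=
    h2.prodMap Function.injective_id
  have h7 : (κ.prodMap (AddMonoidHom.id (Coord.{u} r m))).range.index = κ.range.index := by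
    rw [AddMonoidHom.range_prodMap, AddSubgroup.index_prod]
    have h9 : (AddMonoidHom.id (Coord.{u} r m)).range = ⊤ :=
      AddMonoidHom.range_eq_top.2 Function.surjective_id
    rw [h9, AddSubgroup.index_top, mul_one]
  have h8 : Function.Surjective ((imageRestrict f τ').prodMap
    (LinearMap.id : Coord.{u} r m →ₗ[ℤ] _)) := imageRestrict_surjective.prodMap Function.surjective_id
  have hr' : Module.finrank ℤ (ImageChar f τ' × Coord.{u} r m) =
      Module.finrank ℤ (StratumChar τ × Coord.{u} r m) ↔
      Module.finrank ℤ (ImageChar f τ') =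
        Module.finrank ℤ (StratumChar τ) := by
    rw [Module.finrank_prod, Module.finrank_prod, add_left_inj]
  have h4 := (a.prod c).pushforward_univ (b.prod c) (⟨τ, le_rfl⟩, j.2) j h5 h8 h6
    fun hr => h7.trans_ne ((h3 (hr'.1 hr)).trans_ne saturationIndex_ne_zero)
  rw [(a.prod c).range_eq_closure (b.prod c) (⟨τ, le_rfl⟩, j.2) j h5 h6] at h4
  rw [quotientCycle, Set.preimage_univ, h4, h7]
  congr 1
  by_cases hr : Module.finrank ℤ (ImageChar f τ') =
        Module.finrank ℤ (StratumChar τ)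
  · rw [if_pos (hr'.2 hr), if_pos (finrank_dual_saturation_eq_iff.1 hr), h3 hr]
  · rw [if_neg (fun h => hr (hr'.1 h)), if_neg fun h => hr (finrank_dual_saturation_eq_iff.2 h)]

end Pushforward

/-- A torus which acts through the lattice `N_Y` acts on a stratum through the image torus. -/
lemma exists_stratumWeight_eq {N_X N_Y Q : Type u} [AddCommGroup N_X] [AddCommGroup N_Y]
    [AddCommGroup Q] {X : Fan N_X} (f : N_Y →ₗ[ℤ] N_X) (τ' : X.cones) (j : Q →ₗ[ℤ] N_Y) :
    ∃ ψ : ImageChar f τ' →+ Module.Dual ℤ Q, stratumWeight (f ∘ₗ j) τ'.1 =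
      ψ.comp (imageRestrict f τ' : StratumChar τ' →+ ImageChar f τ') :=
  ⟨((((coneLattice τ'.1).mkQ ∘ₗ f ∘ₗ j).codRestrict (saturation (imageInQuotient f τ'.1))
    fun x => le_saturation _ ⟨j x, rfl⟩).dualMap : ImageChar f τ' →ₗ[ℤ] Module.Dual ℤ Q), rfl⟩

/-- If there is no point, each two cycles are equivalent. -/
lemma eqInStackChow_of_isEmpty {k : Type u} [Field k] {Q : Type u} [AddCommGroup Q]
    {V : Over (Spec (.of k))} {act : torus k Q ⊗ V ⟶ V} {r m : ℕ} {b : Module.Basis (Fin r) ℤ Q}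
    [h : IsEmpty (V ⊗ freeSpace k r m).left] (l : ℤ)
    (c c' : AlgebraicCycle (V ⊗ freeSpace k r m).left ℤ) : EqInStackChow act b m l c c' := by
  have hc : ∀ d : AlgebraicCycle (V ⊗ freeSpace k r m).left ℤ,
      d ∈ invCycles act b m (l + r * m + r) := fun d x => h.elim x
  obtain rfl : c = c' := by
    ext x
    exact h.elim x
  exact ⟨hc c, hc c, rfl⟩

end

end Toric

theorem proposition3p3 {k : Type u} [Field k] [CharZero k]
    {N_X N_Y : Type u}
    [AddCommGroup N_X] [Module.Free ℤ N_X] [Module.Finite ℤ N_X]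
    [AddCommGroup N_Y] [Module.Free ℤ N_Y] [Module.Finite ℤ N_Y]
    (X : Fan N_X) (Y : Fan N_Y) (f_N : N_Y →ₗ[ℤ] N_X) (hf : IsFanMap Y X f_N)
    [IsProper (toricMorphism k f_N hf).left]
    (τ : Y.cones) (τ' : X.cones) (hτ : IsSmallestCone f_N τ τ')
    (v : N_X) (hv : IsGenericVector X f_N τ' v) :
    -- the indices are finite
    (∀ δ ∈ displacementCones X f_N τ' v, displacementIndex f_N δ.1 ≠ 0) ∧
    -- the formula in the Chow group of the closed stratum
    (Module.finrank ℤ (imageInQuotient f_N τ'.1) + Module.finrank ℤ (coneLattice τ.1) =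
        Module.finrank ℤ N_Y →
      EqInChow (X.closedStratum k τ')
        (Module.finrank ℤ N_Y - Module.finrank ℤ (coneLattice τ.1))
        (pushforward (stratumMap k f_N hf hτ).left (primeCycle Set.univ))
        (∑ᶠ δ ∈ displacementCones X f_N τ' v,
          displacementIndex f_N δ.1 • primeCycle (X.substratum k τ' δ))) ∧
    (Module.finrank ℤ (imageInQuotient f_N τ'.1) + Module.finrank ℤ (coneLattice τ.1) ≠
        Module.finrank ℤ N_Y →
      pushforward (stratumMap k f_N hf hτ).left (primeCycle Set.univ) = 0) ∧
    -- the equivariant version, for the torus of a sublattice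
    ∀ (N_Q : Submodule ℤ N_Y) (r : ℕ) (b : Module.Basis (Fin r) ℤ N_Q),
      ∃ (actY : torus k N_Q ⊗ Y.closedStratum k τ ⟶ Y.closedStratum k τ)
        (actX : torus k N_Q ⊗ X.closedStratum k τ' ⟶ X.closedStratum k τ'),
        IsAction actY ∧ IsAction actX ∧
        actY ≫ Y.strIncl k τ = (torus k N_Q ◁ Y.strIncl k τ) ≫ Y.torusAct k N_Q.subtype ∧
        actX ≫ X.strIncl k τ' =
          (torus k N_Q ◁ X.strIncl k τ') ≫ X.torusAct k (f_N ∘ₗ N_Q.subtype) ∧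
        actY ≫ stratumMap k f_N hf hτ = (torus k N_Q ◁ stratumMap k f_N hf hτ) ≫ actX ∧
        -- the closed substack which induces the rational equivalence
        (saturationIndex f_N τ'.1 ≠ 0 ∧
          (∀ δ ∈ displacementCones X f_N τ' v,
            saturationIndex f_N τ'.1 ∣ displacementIndex f_N δ.1) ∧
          ∃ (K : Over (Spec (.of k))) (i : K ⟶ X.closedStratum k τ' ⊗ projLine k),
            IsInvariant (diagAct actX (snd (torus k N_Q) (projLine k))) (Set.range i.left) ∧
            InducesRationalEquivalence i
              (primeCycle (Set.range (stratumMap k f_N hf hτ).left))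
              (∑ᶠ δ ∈ displacementCones X f_N τ' v,
                (displacementIndex f_N δ.1 / saturationIndex f_N τ'.1) •
                  primeCycle (X.substratum k τ' δ))) ∧
        -- the formula in the Chow group of the quotient stack
        ∀ m : ℕ,
          (Module.finrank ℤ (imageInQuotient f_N τ'.1) + Module.finrank ℤ (coneLattice τ.1) =
              Module.finrank ℤ N_Y →
            EqInStackChow actX b m
              (Module.finrank ℤ N_Y - Module.finrank ℤ (coneLattice τ.1) - r)
              (pushforward (stratumMap k f_N hf hτ ▷ freeSpace k r m).left
                (quotientCycle r m Set.univ))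
              (∑ᶠ δ ∈ displacementCones X f_N τ' v,
                displacementIndex f_N δ.1 • quotientCycle r m (X.substratum k τ' δ))) ∧
          (Module.finrank ℤ (imageInQuotient f_N τ'.1) + Module.finrank ℤ (coneLattice τ.1) ≠
              Module.finrank ℤ N_Y →
            pushforward (stratumMap k f_N hf hτ ▷ freeSpace k r m).left
              (quotientCycle r m Set.univ) = 0) := by
  have := free_quotient_coneLattice (X.rational _ τ'.2)
  have := free_quotient_coneLattice (Y.rational _ τ.2)
  obtain ⟨t, ht⟩ := hτ.exists_isInteriorPoint
  obtain ⟨v', hinj, hlim, hprod⟩ := hv.exists_isLimitCycle k ht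
  let j : (X.stratumAtlas k τ').I := ⟨τ', le_rfl⟩
  have hrange := range_stratumMap k hf hτ j
  have hpush := pushforward_stratumMap k hf hτ
  have hπ : Function.Surjective (imageRestrict f_N τ') := imageRestrict_surjective
  -- In the generically finite case the image has the dimension of the stratum.
  have hdim : Module.finrank ℤ (imageInQuotient f_N τ'.1) + Module.finrank ℤ (coneLattice τ.1) =
      Module.finrank ℤ N_Y → (Module.finrank ℤ (ImageChar f_N τ') : ℤ) =
        Module.finrank ℤ N_Y - Module.finrank ℤ (coneLattice τ.1) := by
    intro hr
    rw [Module.finrank_linearMap_self, finrank_saturation, ← hr, Nat.cast_add, add_sub_cancel_right]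
  refine ⟨fun δ hδ => ?_, fun hr => ?_, fun hr => ?_, fun N_Q r b => ?_⟩
  · rw [(hv.displacementIndex_eq ht hδ).1]
    exact mul_ne_zero saturationIndex_ne_zero (hv.displacementIndex_eq ht hδ).2
  · rw [hpush, if_pos hr, hv.finsum_displacementIndex ht, hrange, ← hdim hr]
    exact hlim.eqInChow j hπ hinj _
  · rw [hpush, if_neg hr, zero_smul]
  obtain ⟨actY, hY, hY'⟩ := Y.exists_stratumAction k N_Q.subtype τ
  obtain ⟨actX, hX, hX'⟩ := X.exists_stratumAction k (f_N ∘ₗ N_Q.subtype) τ'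
  obtain ⟨ψ, hψ⟩ := exists_stratumWeight_eq f_N τ' N_Q.subtype
  rw [hψ] at hX'
  refine ⟨actY, actX, hY'.isAction, hX'.isAction, hY, hX,
    stratumMap_equivariant k hf hτ N_Q.subtype hY hX, ⟨saturationIndex_ne_zero, fun δ hδ => ?_, ?_⟩,
    fun m => ?_⟩
  · exact ⟨_, (hv.displacementIndex_eq ht hδ).1⟩
  · obtain ⟨K, ι, -, h2, h3⟩ := hlim.exists_rationalEquivalence j hπ hinj
    refine ⟨K, ι, ?_, ?_⟩
    · rw [h2]
      exact hX'.isInvariant_degTorus j v'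
    · rw [hv.finsum_orbitIndex ht _ saturationIndex_ne_zero, hrange]
      exact h3
  · rcases isEmpty_or_nonempty (freeAtlas (k := k) r m).I with hI | hI
    · -- Here `m = 0 < r`, so that `(𝔸^m ∖ 0)^r` is empty.
      have : IsEmpty ((X.stratumAtlas k τ').prod (freeAtlas (k := k) r m)).I := ⟨fun i => hI.elim i.2⟩
      have h := ((X.stratumAtlas k τ').prod (freeAtlas (k := k) r m)).isEmpty
      refine ⟨fun _ => eqInStackChow_of_isEmpty _ _ _, fun _ => ?_⟩
      ext x
      exact h.elim x
    obtain ⟨actU, hU, hU'⟩ := exists_freeAction k b m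
    obtain ⟨hinj', hlim'⟩ := hprod r m hI
    have hact := hX'.prod hU'
    have hact' : ((X.stratumAtlas k τ').prod (freeAtlas (k := k) r m)).IsToricAction
        (diagAct actX actU) ((ψ.coprod (coordWeight b m)).comp
          (((imageRestrict f_N τ').prodMap LinearMap.id :
            StratumChar τ' × Coord.{u} r m →ₗ[ℤ] ImageChar f_N τ' × Coord.{u} r m) :
              StratumChar τ' × Coord.{u} r m →+ ImageChar f_N τ' × Coord.{u} r m)) := hact
    have hpush' := pushforward_stratumMap_whiskerRight k hf hτ r m (j, hI.some)
    refine ⟨fun hr => ?_, fun hr => ?_⟩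
    · rw [hpush', if_pos hr, hv.finsum_displacementIndex ht]
      refine hlim'.eqInStackChow hU hact' (j, hI.some) (hπ.prodMap Function.surjective_id) hinj' _ ?_
      rw [Module.finrank_prod, Nat.cast_add, hdim hr, finrank_coord]
      push_cast
      ring
    · rw [hpush', if_neg hr, zero_smul]
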